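/- Let $N$ be a lattice (a free abelian group of finite rank), $M=\operatorname{Hom}(N,\mathbb Z)$, $T=N\otimes\mathbb C^*$, and let $X$ be the normal $T$-toric variety of a finite rational polyhedral fan $\Sigma$ of strongly convex cones in $N_{\mathbb R}$, with its classical topology. For $\sigma\in\Sigma$ let $O_\sigma$ be the corresponding $T$-orbit, $x_\sigma\in O_\sigma$ its distinguished point, $T_\sigma\subset T$ the stabilizer of $x_\sigma$, and $N_\sigma=N/(N\cap\operatorname{Span}\sigma)\cong\pi_1(O_\sigma)$, where $n\in N$ corresponds to the loop $t\mapsto e^{2\pi i t n}\cdot x_\sigma$. Let $\mathcal F\colon X\to X$ be the map extending the squaring homomorphism $T\to T$; it fixes every $x_\sigma$. Sheaves. $LC_u(X)$ is the full subcategory of the category of sheaves $F$ of complex vector spaces on $X$ which are locally constant on each orbit and such that for each $\sigma$ and $x\in\pi_1(O_\sigma)$ the operator $x-1$ on the stalk $F_\sigma$ of $F$ at $x_\sigma$ is locally nilpotent; $LC_{cf}(X)\subset LC_u(X)$ is the full subcategory of those $F$ for which each $F_\sigma^{\pi_1(O_\sigma)}$ is finite-dimensional. An object of $LC_{\mathcal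 F}(X)$ is a pair $(F,\theta)$ with $F\in LC_{cf}(X)$ and $\theta\colon\mathcal F^{-1}F\to F$ an isomorphism such that for each $\sigma$ the induced endomorphism $\theta_\sigma$ of $F_\sigma$ is diagonalizable with eigenvalues of the form $2^{n/2}$, $n\in\mathbb Z$; morphisms are the morphisms of sheaves commuting with $\theta$. For $n\in\mathbb Z$ the twist $\langle n\rangle$ is $(F,\theta)\mapsto(F,2^{n/2}\theta)$. Modules. Put $\mathcal T_\sigma=\operatorname{Sym}(N_\sigma\otimes\mathbb C)$, graded so that $N_\sigma\otimes\mathbb C$ has degree $2$, with maximal homogeneous ideal $\mathfrak m_\sigma$. A co-$\mathcal T$-module $\mathcal M$ consists of a $\mathcal T_\sigma$-module $\mathcal M_\sigma$ for each $\sigma\in\Sigma$ and a $\mathcal T_\tau$-linear map $\mathcal M_\sigma\to\mathcal M_\tau$ whenever $\tau$ is a face of $\sigma$, these maps being compatible with composition. $\text{co-}\mathcal T\text{-Mod}_n$ is the category of co-$\mathcal T$-modules in which every element of every $\mathcal M_\sigma$ is annihilated by a power of $\mathfrak m_\sigma$; $\text{co-}\mathcal T\text{-Mod}_{cf}$ is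 its full subcategory of those $\mathcal M$ for which every $\{m\in\mathcal M_\sigma\mid\mathfrak m_\sigma m=0\}$ is finite-dimensional; $\text{co-}\mathcal T\text{-mod}_{cf}$ is the category of graded co-$\mathcal T$-modules whose underlying co-$\mathcal T$-module lies in $\text{co-}\mathcal T\text{-Mod}_{cf}$, with morphisms of degree zero. The grading shift is $\mathcal M\{n\}_k=\mathcal M_{k+n}$. Theorem. (1) All six categories are abelian; the inclusions of $LC_u(X)$, $LC_{cf}(X)$ into sheaves and of $\text{co-}\mathcal T\text{-Mod}_n$, $\text{co-}\mathcal T\text{-Mod}_{cf}$ into co-$\mathcal T$-modules are exact, and so are the functors forgetting $\theta$ and forgetting the grading. (2) There are equivalences $$LC_u(X)\simeq\text{co-}\mathcal T\text{-Mod}_n,\qquad LC_{cf}(X)\simeq\text{co-}\mathcal T\text{-Mod}_{cf},$$ the second being the restriction of the first, which send $F$ to the co-$\mathcal T$-module with $\mathcal M_\sigma=F_\sigma$, on which the class of $n\in N$ in $N_\sigma$ acts as $\frac1{2\pi i}$ times the logarithm of the monodromy along the loop of $n$, and whose maps $\mathcal M_\sigma\to\mathcal M_\tau$, for $\tau$ a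 face of $\sigma$, are the canonical maps $F_\sigma\to F_\tau$ (continuation of germs along any path from $x_\sigma$ to $x_\tau$ that lies in $T_\sigma\cdot x_\tau$ at positive times). (3) There is an equivalence of abelian categories $$LC_{\mathcal F}(X)\simeq\text{co-}\mathcal T\text{-mod}_{cf},$$ which sends $(F,\theta)$ to the co-$\mathcal T$-module of $F$ just described, with the grading $(\mathcal M_\sigma)_k=\{a\in F_\sigma\mid\theta_\sigma(a)=2^{-k/2}a\}$; it is compatible with the second equivalence in (2) and the functors forgetting $\theta$ and the grading. It induces a triangulated equivalence $$D^b(LC_{\mathcal F}(X))\simeq D^b(\text{co-}\mathcal T\text{-mod}_{cf}).$$ Under both of these equivalences the twist $\langle n\rangle$ corresponds to the grading shift $\{n\}$, for every $n\in\mathbb Z$. -/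

import Mathlib

open CategoryTheory Limits TopologicalSpace Opposite
open scoped TensorProduct

universe v u w₁ w₂

noncomputable section

namespace ToricLC

/-! ### Fans and toric varieties -/

section Toric

variable {N : Type} [AddCommGroup N]

/-- The real-linear extension `N_ℝ → ℝ` of a character `m ∈ M = Hom(N, ℤ)`. -/
def pairing (m : N →ₗ[ℤ] ℤ) : (ℝ ⊗[ℤ] N) →ₗ[ℝ] ℝ :=
  (TensorProduct.AlgebraTensorModule.rid ℤ ℝ ℝ).toLinearMap ∘ₗ m.baseChange ℝ

theorem pairing_tmul (m : N →ₗ[ℤ] ℤ) (r : ℝ) (n : N) :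
    pairing m (r ⊗ₜ n) = r * (m n : ℝ) := by
  simp [pairing, mul_comm]

theorem pairing_zero (x : ℝ ⊗[ℤ] N) : pairing (0 : N →ₗ[ℤ] ℤ) x = 0 := by
  simp [pairing]

theorem pairing_add (m m' : N →ₗ[ℤ] ℤ) (x : ℝ ⊗[ℤ] N) :
    pairing (m + m') x = pairing m x + pairing m' x := by
  simp [pairing, LinearMap.baseChange_add]

variable (N) in
/-- A finite rational polyhedral fan in `N_ℝ = ℝ ⊗ N` (cones are strongly convex). -/
structure Fan where
  cones : Set (PointedCone ℝ (ℝ ⊗[ℤ] N))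
  finite : cones.Finite
  rational : ∀ σ ∈ cones, ∃ S : Set N, S.Finite ∧
    σ = Submodule.span {c : ℝ // 0 ≤ c} ((fun n : N => (1 : ℝ) ⊗ₜ[ℤ] n) '' S)
  salient : ∀ σ ∈ cones, (σ : ConvexCone ℝ (ℝ ⊗[ℤ] N)).Salient
  face_mem : ∀ σ ∈ cones, ∀ τ : PointedCone ℝ (ℝ ⊗[ℤ] N), τ.IsFaceOf σ → τ ∈ cones
  inter_isFaceOf : ∀ σ ∈ cones, ∀ τ ∈ cones, (σ ⊓ τ).IsFaceOf σ

/-- The cones of a fan, ordered by inclusion (equivalently, by the face relation). -/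
abbrev Fan.Cone (Δ : Fan N) : Type := {σ : PointedCone ℝ (ℝ ⊗[ℤ] N) // σ ∈ Δ.cones}

/-- The monoid `σ^∨ ∩ M`. -/
def dualMonoid (σ : PointedCone ℝ (ℝ ⊗[ℤ] N)) : AddSubmonoid (N →ₗ[ℤ] ℤ) where
  carrier := {m | ∀ x ∈ σ, 0 ≤ pairing m x}
  zero_mem' := fun x _ => by simp [pairing_zero]
  add_mem' := fun {m m'} h h' x hx => by
    rw [pairing_add]; exact add_nonneg (h x hx) (h' x hx)

theorem dualMonoid_anti {τ σ : PointedCone ℝ (ℝ ⊗[ℤ] N)} (h : τ ≤ σ) :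
    dualMonoid σ ≤ dualMonoid τ := fun _ hm x hx => hm x (h hx)

/-- The relation `m ∈ σ^⊥`. -/
def IsPerp (σ : PointedCone ℝ (ℝ ⊗[ℤ] N)) (m : N →ₗ[ℤ] ℤ) : Prop := ∀ x ∈ σ, pairing m x = 0

/-- The complex points of the affine toric variety `U_σ = Spec ℂ[σ^∨ ∩ M]`: monoid homomorphisms
from `(σ^∨ ∩ M, +)` to `(ℂ, ·)`. -/
def AffineToric (σ : PointedCone ℝ (ℝ ⊗[ℤ] N)) : Type := Multiplicative (dualMonoid σ) →* ℂ

/-- The value at `x ∈ U_σ` of the monomial function with exponent `m ∈ σ^∨ ∩ M`. -/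
def AffineToric.eval {σ : PointedCone ℝ (ℝ ⊗[ℤ] N)} (x : AffineToric σ) (m : dualMonoid σ) : ℂ :=
  (show Multiplicative (dualMonoid σ) →* ℂ from x) (Multiplicative.ofAdd m)

theorem AffineToric.ext {σ : PointedCone ℝ (ℝ ⊗[ℤ] N)} {x y : AffineToric σ}
    (h : ∀ m, x.eval m = y.eval m) : x = y := MonoidHom.ext fun m => h m.toAdd

/-- Construct a point of `U_σ` from its values on monomials. -/
def AffineToric.mk {σ : PointedCone ℝ (ℝ ⊗[ℤ] N)} (f : dualMonoid σ → ℂ) (h0 : f 0 = 1)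
    (hadd : ∀ m m', f (m + m') = f m * f m') : AffineToric σ :=
  show Multiplicative (dualMonoid σ) →* ℂ from
  { toFun := fun m => f m.toAdd, map_one' := h0, map_mul' := fun m m' => hadd m.toAdd m'.toAdd }

@[simp] theorem AffineToric.eval_mk {σ : PointedCone ℝ (ℝ ⊗[ℤ] N)} (f : dualMonoid σ → ℂ)
    (h0 : f 0 = 1) (hadd : ∀ m m', f (m + m') = f m * f m') (m : dualMonoid σ) :
    (AffineToric.mk f h0 hadd).eval m = f m := rfl

@[simp] theorem AffineToric.eval_zero {σ : PointedCone ℝ (ℝ ⊗[ℤ] N)} (x : AffineToric σ) :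
    x.eval 0 = 1 := MonoidHom.map_one (M := Multiplicative (dualMonoid σ)) (N := ℂ) x

theorem AffineToric.eval_add {σ : PointedCone ℝ (ℝ ⊗[ℤ] N)} (x : AffineToric σ)
    (m m' : dualMonoid σ) : x.eval (m + m') = x.eval m * x.eval m' :=
  MonoidHom.map_mul (M := Multiplicative (dualMonoid σ)) (N := ℂ) x _ _

/-- The classical topology of `U_σ`: the coarsest one making all monomials continuous (as
`σ^∨ ∩ M` is finitely generated, it is the subspace topology of a closed embedding into `ℂ^k`). -/
instance (σ : PointedCone ℝ (ℝ ⊗[ℤ] N)) : TopologicalSpace (AffineToric σ) :=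
  TopologicalSpace.induced (fun x => x.eval) inferInstance

theorem AffineToric.continuous_iff {Y : Type*} [TopologicalSpace Y]
    {σ : PointedCone ℝ (ℝ ⊗[ℤ] N)} {f : Y → AffineToric σ} :
    Continuous f ↔ ∀ m, Continuous fun y => (f y).eval m := by
  rw [continuous_induced_rng, continuous_pi_iff]; rfl

theorem AffineToric.continuous_eval {σ : PointedCone ℝ (ℝ ⊗[ℤ] N)} (m : dualMonoid σ) :
    Continuous fun x : AffineToric σ => x.eval m :=
  AffineToric.continuous_iff.1 continuous_id m

/-- The inclusion `U_τ → U_σ` for `τ ≤ σ`: restriction of homomorphisms to `σ^∨ ∩ M`. -/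
def AffineToric.incl {τ σ : PointedCone ℝ (ℝ ⊗[ℤ] N)} (h : τ ≤ σ) (x : AffineToric τ) :
    AffineToric σ :=
  AffineToric.mk (fun m => x.eval (AddSubmonoid.inclusion (dualMonoid_anti h) m))
    (by simp) (fun m m' => by simp [AffineToric.eval_add])

/-- Two points of affine charts are identified when one is the image of the other under the
inclusion of the chart of a smaller cone. -/
inductive GlueRel (Δ : Fan N) :
    (Σ σ : Δ.Cone, AffineToric σ.1) → (Σ σ : Δ.Cone, AffineToric σ.1) → Prop
  | glue {τ σ : Δ.Cone} (h : τ ≤ σ) (x : AffineToric τ.1) : GlueRel Δ ⟨τ, x⟩ ⟨σ, x.incl h⟩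

/-- The complex points of the toric variety `X` of the fan: the colimit of the charts `U_σ`,
with the classical topology. -/
def Variety (Δ : Fan N) : Type := Quot (GlueRel Δ)

instance (Δ : Fan N) : TopologicalSpace (Variety Δ) :=
  inferInstanceAs (TopologicalSpace (Quot (GlueRel Δ)))

/-- The chart `U_σ → X`. -/
def chart {Δ : Fan N} (σ : Δ.Cone) (x : AffineToric σ.1) : Variety Δ := Quot.mk _ ⟨σ, x⟩

theorem continuous_chart {Δ : Fan N} (σ : Δ.Cone) : Continuous (chart σ) :=
  continuous_quot_mk.comp continuous_sigmaMk

/-- A family of self-maps of the charts compatible with inclusions glues to a self-map of `X`. -/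
def glueMap {Δ : Fan N} (f : ∀ σ : Δ.Cone, AffineToric σ.1 → AffineToric σ.1)
    (hf : ∀ {τ σ : Δ.Cone} (h : τ ≤ σ) (x : AffineToric τ.1),
      f σ (x.incl h) = (f τ x).incl h) : Variety Δ → Variety Δ :=
  Quot.map (fun p => ⟨p.1, f p.1 p.2⟩) (by
    rintro _ _ ⟨h, x⟩
    dsimp only
    rw [hf h x]
    exact GlueRel.glue h _)

theorem continuous_glueMap {Δ : Fan N} (f : ∀ σ : Δ.Cone, AffineToric σ.1 → AffineToric σ.1)
    (hf : ∀ {τ σ : Δ.Cone} (h : τ ≤ σ) (x : AffineToric τ.1),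
      f σ (x.incl h) = (f τ x).incl h) (hc : ∀ σ, Continuous (f σ)) :
    Continuous (glueMap f hf) := by
  refine continuous_quot_lift _ (continuous_quot_mk.comp ?_)
  exact continuous_sigma fun σ => continuous_sigmaMk.comp (hc σ)

variable (N) in
/-- The torus `T = Hom(M, ℂ^*) = N ⊗ ℂ^*`. -/
abbrev Torus : Type := Multiplicative (N →ₗ[ℤ] ℤ) →* ℂˣ

/-- The action of the torus on an affine chart. -/
def AffineToric.act {σ : PointedCone ℝ (ℝ ⊗[ℤ] N)} (t : Torus N) (x : AffineToric σ) :
    AffineToric σ :=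
  AffineToric.mk (fun m => (t (Multiplicative.ofAdd m.1) : ℂ) * x.eval m)
    (by simp) (fun m m' => by
      simp only [AddSubmonoid.coe_add, ofAdd_add, map_mul, Units.val_mul, AffineToric.eval_add]
      ring)

/-- The action of the torus on the toric variety. -/
instance (Δ : Fan N) : MulAction (Torus N) (Variety Δ) where
  smul t := glueMap (fun _ x => x.act t) (fun _ _ => rfl)
  one_smul x := by
    obtain ⟨σ, x⟩ := x
    exact congrArg (chart σ) (AffineToric.ext fun m => by simp [AffineToric.act])
  mul_smul s t x := by
    obtain ⟨σ, x⟩ := x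
    exact congrArg (chart σ) (AffineToric.ext fun m => by simp [AffineToric.act, mul_assoc])

open Classical in
/-- The distinguished point of `U_σ`: the monomial of exponent `m` has value `1` if `m ∈ σ^⊥`
and `0` otherwise. -/
def affinePt (σ : PointedCone ℝ (ℝ ⊗[ℤ] N)) : AffineToric σ :=
  AffineToric.mk (fun m => if IsPerp σ m.1 then 1 else 0)
    (if_pos fun x _ => pairing_zero x) (fun m m' => by
      have key : IsPerp σ (m + m' : dualMonoid σ).1 ↔ IsPerp σ m.1 ∧ IsPerp σ m'.1 := by
        constructor
        · intro h
          have h' : ∀ x ∈ σ, pairing m.1 x + pairing m'.1 x = 0 := fun x hx => by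
            rw [← pairing_add]; exact h x hx
          exact ⟨fun x hx => by linarith [h' x hx, m.2 x hx, m'.2 x hx],
            fun x hx => by linarith [h' x hx, m.2 x hx, m'.2 x hx]⟩
        · rintro ⟨h, h'⟩ x hx
          rw [AddSubmonoid.coe_add, pairing_add, h x hx, h' x hx, add_zero]
      simp only [key]
      by_cases h : IsPerp σ m.1 <;> by_cases h' : IsPerp σ m'.1 <;> simp [h, h'])

/-- The distinguished point of the orbit `O_σ`. -/
def pt {Δ : Fan N} (σ : Δ.Cone) : Variety Δ := chart σ (affinePt σ.1)

/-- The torus orbit `O_σ`. -/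
def torusOrbit {Δ : Fan N} (σ : Δ.Cone) : Set (Variety Δ) := MulAction.orbit (Torus N) (pt σ)

/-- The squaring map on an affine chart. -/
def AffineToric.sq {σ : PointedCone ℝ (ℝ ⊗[ℤ] N)} (x : AffineToric σ) : AffineToric σ :=
  AffineToric.mk (fun m => x.eval m ^ 2) (by simp)
    (fun m m' => by rw [AffineToric.eval_add, mul_pow])

variable (N) in
/-- The lift of Frobenius `X → X`, extending the squaring homomorphism `T → T`. -/
def frob (Δ : Fan N) : C(Variety Δ, Variety Δ) where
  toFun := glueMap (fun _ x => x.sq) (fun _ _ => rfl)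
  continuous_toFun := continuous_glueMap _ _ fun _ =>
    AffineToric.continuous_iff.2 fun m => (AffineToric.continuous_eval m).pow 2

open Classical in
theorem frob_pt {Δ : Fan N} (σ : Δ.Cone) : frob N Δ (pt σ) = pt σ :=
  congrArg (chart σ) (AffineToric.ext fun m => by
    change (if IsPerp σ.1 m.1 then (1 : ℂ) else 0) ^ 2 = if IsPerp σ.1 m.1 then 1 else 0
    split_ifs <;> simp)

/-- The point `exp(2πi z n)` of the torus, for `z ∈ ℂ` and a cocharacter `n ∈ N`. -/
def torusExp (z : ℂ) (n : N) : Torus N where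
  toFun m := Units.mk0 (Complex.exp (2 * Real.pi * Complex.I * z * (m.toAdd n : ℂ)))
    (Complex.exp_ne_zero _)
  map_one' := by ext; simp
  map_mul' m m' := by
    ext
    simp [← Complex.exp_add, mul_add]

/-- The loop `t ↦ exp(2πi t n) · x_σ` in the orbit `O_σ`, representing the class of `n` in
`π₁(O_σ) = N / (N ∩ Span σ)`. -/
def orbitLoop {Δ : Fan N} (σ : Δ.Cone) (n : N) : Path (pt σ) (pt σ) where
  toFun t := torusExp ((t : ℝ) : ℂ) n • pt σ
  continuous_toFun := by
    refine (continuous_chart σ).comp (AffineToric.continuous_iff.2 fun m => ?_)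
    simp only [AffineToric.act, AffineToric.eval_mk, torusExp, MonoidHom.coe_mk, OneHom.coe_mk,
      Units.val_mk0]
    fun_prop
  source' := by
    have h : torusExp (((0 : unitInterval) : ℝ) : ℂ) n = 1 :=
      MonoidHom.ext fun m => Units.ext (by simp [torusExp])
    rw [h]
    exact one_smul (Torus N) (pt σ)
  target' := by
    have h : torusExp (((1 : unitInterval) : ℝ) : ℂ) n = 1 :=
      MonoidHom.ext fun m => Units.ext (by
        change Complex.exp (2 * Real.pi * Complex.I * (((1 : unitInterval) : ℝ) : ℂ) *
          (m.toAdd n : ℂ)) = 1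
        rw [Complex.exp_eq_one_iff]
        exact ⟨m.toAdd n, by push_cast; ring⟩)
    rw [h]
    exact one_smul (Torus N) (pt σ)

end Toric

/-! ### Locally constant sheaves, monodromy -/

section Sheaves

/-- Sheaves of complex vector spaces on a topological space. -/
abbrev Sh (Y : TopCat.{0}) : Type 1 := TopCat.Sheaf (ModuleCat.{0} ℂ) Y

/-- The stalk of a sheaf at a point. -/
abbrev stalk {Y : TopCat.{0}} (F : Sh Y) (y : Y) : ModuleCat.{0} ℂ := F.presheaf.stalk y

/-- The map on stalks induced by a morphism of sheaves. -/
def stalkMap {Y : TopCat.{0}} {F G : Sh Y} (f : F ⟶ G) (y : Y) : stalk F y →ₗ[ℂ] stalk G y :=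
  ((TopCat.Presheaf.stalkFunctor (ModuleCat.{0} ℂ) y).map f.hom).hom

/-- A sheaf on `Y` is locally constant if each point has an open neighbourhood on which it is
isomorphic to a constant sheaf. -/
def IsLocallyConstantSheaf {Y : TopCat.{0}} (F : Sh Y) : Prop :=
  ∀ y : Y, ∃ U : Opens Y, y ∈ U ∧ Sheaf.IsConstant
    (Opens.grothendieckTopology ((Opens.toTopCat Y).obj U))
    ((TopCat.Sheaf.pullback (ModuleCat.{0} ℂ) U.inclusion').obj F)

/-- The restriction of a sheaf to a subspace. -/
def restrictTo {Y : TopCat.{0}} (F : Sh Y) (Z : Set Y) : Sh (TopCat.of Z) :=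
  (TopCat.Sheaf.pullback (ModuleCat.{0} ℂ)
    (TopCat.ofHom ⟨Subtype.val, continuous_subtype_val⟩ : TopCat.of Z ⟶ Y)).obj F

/-- `b` is obtained from `a` by continuation along the path `γ`: there is a continuous lift of `γ`
to the étalé space of the sheaf, from `a` to `b`. -/
def Transports {Y : TopCat.{0}} (F : Sh Y) {x y : Y} (γ : Path x y) (a : stalk F x)
    (b : stalk F y) : Prop :=
  ∃ s : C(unitInterval, F.presheaf.EtaleSpace), (∀ t, (s t).base = γ t) ∧
    s 0 = ⟨x, a⟩ ∧ s 1 = ⟨y, b⟩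

/-- `μ` is the monodromy operator of the sheaf along the loop `γ`. -/
def IsMonodromy {Y : TopCat.{0}} (F : Sh Y) {x : Y} (γ : Path x x)
    (μ : Module.End ℂ (stalk F x)) : Prop :=
  ∀ a, Transports F γ a (μ a)

/-- The invariants of the stalk at `x` under the monodromy of all loops at `x` inside `Z`. -/
def monodromyInvariants {Y : TopCat.{0}} (F : Sh Y) (Z : Set Y) (x : Y) :
    Submodule ℂ (stalk F x) :=
  ⨅ (γ : Path x x) (_ : ∀ t, γ t ∈ Z) (μ : Module.End ℂ (stalk F x)) (_ : IsMonodromy F γ μ),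
    LinearMap.ker (μ - 1)

/-- A linear endomorphism is locally nilpotent if every vector is killed by a power of it. -/
def IsLocallyNilpotent {V : Type*} [AddCommGroup V] [Module ℂ V] (f : Module.End ℂ V) : Prop :=
  ∀ a, ∃ k : ℕ, (f ^ k) a = 0

/-- The logarithm `∑_{k ≥ 1} (-1)^(k+1) (μ - 1)^k / k` of a locally unipotent operator (the sum
is finite on each vector). -/
def unipotentLog {V : Type*} [AddCommGroup V] [Module ℂ V] (μ : Module.End ℂ V) (a : V) : V :=
  ∑ᶠ k : ℕ, ((-1 : ℂ) ^ k / ((k : ℂ) + 1)) • ((μ - 1) ^ (k + 1)) a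

variable {N : Type} [AddCommGroup N] (Δ : Fan N)

/-- The toric variety as a topological space (classical topology). -/
abbrev X : TopCat.{0} := TopCat.of (Variety Δ)

/-- `LC(X)`: sheaves which are locally constant on each torus orbit. -/
def isLC : ObjectProperty (Sh (X Δ)) := fun F =>
  ∀ σ : Δ.Cone, IsLocallyConstantSheaf (restrictTo F (torusOrbit σ : Set (X Δ)))

/-- Unipotent sheaves: for each orbit, the monodromy operators on the stalk at its distinguished
point are locally unipotent. -/
def isLCu : ObjectProperty (Sh (X Δ)) := fun F =>
  isLC Δ F ∧ ∀ (σ : Δ.Cone) (γ : Path (pt σ : X Δ) (pt σ)), (∀ t, γ t ∈ torusOrbit σ) →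
    ∃ μ : Module.End ℂ (stalk F (pt σ : X Δ)), IsMonodromy F γ μ ∧ IsLocallyNilpotent (μ - 1)

/-- Co-finite sheaves: unipotent sheaves with finite-dimensional spaces of monodromy invariants. -/
def isLCcf : ObjectProperty (Sh (X Δ)) := fun F =>
  isLCu Δ F ∧ ∀ σ : Δ.Cone, FiniteDimensional ℂ
    (monodromyInvariants F (torusOrbit σ : Set (X Δ)) (pt σ : X Δ))

/-- The category `LC_u(X)`. -/
abbrev LCu : Type 1 := (isLCu Δ).FullSubcategory

/-- The category `LC_cf(X)`. -/
abbrev LCcf : Type 1 := (isLCcf Δ).FullSubcategory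

/-- The inclusion `LC_cf(X) ⥤ LC_u(X)`. -/
abbrev LCcfToLCu : LCcf Δ ⥤ LCu Δ := ObjectProperty.ιOfLE fun _ h => h.1

/-! ### `F`-sheaves -/

/-- The lift of Frobenius as a morphism of spaces. -/
def frobHom : X Δ ⟶ X Δ := TopCat.ofHom (frob N Δ)

/-- The inverse image functor `𝓕⁻¹` on sheaves. -/
abbrev frobPullback : Sh (X Δ) ⥤ Sh (X Δ) :=
  TopCat.Sheaf.pullback (ModuleCat.{0} ℂ) (frobHom Δ)

instance {Y Y' : TopCat.{0}} (f : Y ⟶ Y') :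
    (TopCat.Sheaf.pushforward (ModuleCat.{0} ℂ) f).Additive where
  map_add {F G a b} := by
    apply Sheaf.hom_ext
    rfl

instance {Y Y' : TopCat.{0}} (f : Y ⟶ Y') :
    (TopCat.Sheaf.pullback (ModuleCat.{0} ℂ) f).Additive :=
  (TopCat.Sheaf.pullbackPushforwardAdjunction (ModuleCat.{0} ℂ) f).left_adjoint_additive

/-- Pairs `(F, θ)` of a sheaf and a morphism `θ : 𝓕⁻¹F ⟶ F`; morphisms are the morphisms of sheaves
commuting with `θ`. -/
abbrev FrobPair : Type 1 := Endofunctor.Algebra (frobPullback Δ)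

variable {Δ} in
/-- The endomorphism `θ_σ` of the stalk `F_σ` at the distinguished point `x_σ = 𝓕(x_σ)` induced by
`θ : 𝓕⁻¹F ⟶ F`, namely `F_σ = F_{𝓕(x_σ)} = (𝓕⁻¹F)_σ ⟶ F_σ`, written through the adjoint
`F ⟶ 𝓕_*F` of `θ`. -/
def stalkTheta {F : Sh (X Δ)} (θ : (frobPullback Δ).obj F ⟶ F) (σ : Δ.Cone) :
    Module.End ℂ (stalk F (pt σ : X Δ)) :=
  (F.presheaf.stalkSpecializes (specializes_of_eq (frob_pt σ) : frobHom Δ (pt σ) ⤳ pt σ) ≫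
    (TopCat.Presheaf.stalkFunctor (ModuleCat.{0} ℂ) (frobHom Δ (pt σ))).map
      ((TopCat.Sheaf.pullbackPushforwardAdjunction (ModuleCat.{0} ℂ) (frobHom Δ)).homEquiv
        F F θ).hom ≫
    F.presheaf.stalkPushforward (ModuleCat.{0} ℂ) (frobHom Δ) (pt σ)).hom

/-- The number `2^(n/2)`. -/
def sqrtTwoPow (n : ℤ) : ℂ := ((Real.sqrt 2 : ℝ) : ℂ) ^ n

/-- `F`-sheaves: co-finite sheaves with an isomorphism `θ : 𝓕⁻¹F ≅ F` such that every `θ_σ` is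
diagonalizable with eigenvalues among the `2^(n/2)`, `n ∈ ℤ`. -/
def isFSheaf : ObjectProperty (FrobPair Δ) := fun A =>
  isLCcf Δ A.a ∧ IsIso A.str ∧
    ∀ σ : Δ.Cone, ⨆ n : ℤ, (stalkTheta A.str σ).eigenspace (sqrtTwoPow n) = ⊤

/-- The category `LC_𝓕(X)`. -/
abbrev LCF : Type 1 := (isFSheaf Δ).FullSubcategory

/-- The functor `LC_𝓕(X) ⥤ LC_cf(X)` forgetting `θ`. -/
abbrev LCFToLCcf : LCF Δ ⥤ LCcf Δ :=
  (isLCcf Δ).lift ((isFSheaf Δ).ι ⋙ Endofunctor.Algebra.forget _) fun A => A.property.1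

end Sheaves

/-! ### The ringed quiver `𝓣` and its co-modules -/

section CoModules

variable {N : Type} [AddCommGroup N]

/-- The sublattice `N ∩ Span σ`. -/
def spanLattice (σ : PointedCone ℝ (ℝ ⊗[ℤ] N)) : Submodule ℤ N :=
  ((Submodule.span ℝ (σ : Set (ℝ ⊗[ℤ] N))).restrictScalars ℤ).comap (TensorProduct.mk ℤ ℝ N 1)

theorem spanLattice_mono {τ σ : PointedCone ℝ (ℝ ⊗[ℤ] N)} (h : τ ≤ σ) :
    spanLattice τ ≤ spanLattice σ := fun _ hn =>
  Submodule.span_mono (show (τ : Set (ℝ ⊗[ℤ] N)) ⊆ σ from h) hn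

/-- The lattice `N_σ = N / (N ∩ Span σ)`. -/
abbrev QuotLattice (σ : PointedCone ℝ (ℝ ⊗[ℤ] N)) : Type := N ⧸ spanLattice σ

/-- The ring `𝓣_σ = Sym(N_σ ⊗ ℂ)`. -/
abbrev TRing (σ : PointedCone ℝ (ℝ ⊗[ℤ] N)) : Type :=
  SymmetricAlgebra ℂ (ℂ ⊗[ℤ] QuotLattice σ)

/-- The class of `n ∈ N` in `N_σ ⊗ ℂ ⊆ 𝓣_σ`. -/
def TRing.of (σ : PointedCone ℝ (ℝ ⊗[ℤ] N)) (n : N) : TRing σ :=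
  SymmetricAlgebra.ι ℂ (ℂ ⊗[ℤ] QuotLattice σ) ((1 : ℂ) ⊗ₜ[ℤ] (Submodule.Quotient.mk n))

/-- The homomorphism `𝓣_τ → 𝓣_σ`, for `τ ≤ σ`, induced by the projection `N_τ → N_σ`. -/
def TRing.map {τ σ : PointedCone ℝ (ℝ ⊗[ℤ] N)} (h : τ ≤ σ) : TRing τ →ₐ[ℂ] TRing σ :=
  SymmetricAlgebra.lift (SymmetricAlgebra.ι ℂ (ℂ ⊗[ℤ] QuotLattice σ) ∘ₗ
    (Submodule.factor (spanLattice_mono h)).baseChange ℂ)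

/-- The homogeneous maximal ideal `𝔪_σ ⊆ 𝓣_σ`, generated by `N_σ ⊗ ℂ`. -/
def TRing.maxIdeal (σ : PointedCone ℝ (ℝ ⊗[ℤ] N)) : Ideal (TRing σ) :=
  Ideal.span (Set.range (SymmetricAlgebra.ι ℂ (ℂ ⊗[ℤ] QuotLattice σ)))

/-- The homogeneous component `Sym^d(N_σ ⊗ ℂ)` of `𝓣_σ`; it is given the degree `2d`, and the
components of odd degree vanish. -/
def TRing.sym (σ : PointedCone ℝ (ℝ ⊗[ℤ] N)) (d : ℕ) : Submodule ℂ (TRing σ) :=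
  LinearMap.range (SymmetricAlgebra.ι ℂ (ℂ ⊗[ℤ] QuotLattice σ)) ^ d

/-- A co-`𝓣`-module: a `𝓣_σ`-module `M_σ` for each cone `σ` and, whenever `τ` is a face of `σ` (that
is, `O_σ` lies in the closure of `O_τ`), a `𝓣_τ`-linear map `M_σ → M_τ`, compatibly. -/
structure CoTMod (Δ : Fan N) where
  obj : Δ.Cone → Type
  [addCommGroup : ∀ σ, AddCommGroup (obj σ)]
  [moduleC : ∀ σ, Module ℂ (obj σ)]
  [moduleT : ∀ σ, Module (TRing σ.1) (obj σ)]
  [tower : ∀ σ, IsScalarTower ℂ (TRing σ.1) (obj σ)]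
  map : ∀ {τ σ : Δ.Cone}, τ ≤ σ → (obj σ →ₗ[ℂ] obj τ)
  map_smul : ∀ {τ σ : Δ.Cone} (h : τ ≤ σ) (a : TRing τ.1) (m : obj σ),
    map h (TRing.map h a • m) = a • map h m
  map_refl : ∀ (σ : Δ.Cone) (m : obj σ), map (le_refl σ) m = m
  map_trans : ∀ {ρ τ σ : Δ.Cone} (h : ρ ≤ τ) (h' : τ ≤ σ) (m : obj σ),
    map h (map h' m) = map (h.trans h') m

attribute [instance] CoTMod.addCommGroup CoTMod.moduleC CoTMod.moduleT CoTMod.tower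

variable {Δ : Fan N}

/-- Morphisms of co-`𝓣`-modules. -/
@[ext]
structure CoTMod.Hom (P Q : CoTMod Δ) where
  app : ∀ σ : Δ.Cone, P.obj σ →ₗ[TRing σ.1] Q.obj σ
  comm : ∀ {τ σ : Δ.Cone} (h : τ ≤ σ) (m : P.obj σ), app τ (P.map h m) = Q.map h (app σ m)

instance : Category (CoTMod Δ) where
  Hom := CoTMod.Hom
  id P := { app := fun _ => LinearMap.id, comm := fun _ _ => rfl }
  comp f g :=
    { app := fun σ => (g.app σ).comp (f.app σ)
      comm := fun h m => by simp [f.comm, g.comm] }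

theorem CoTMod.hom_ext {P Q : CoTMod Δ} {f g : P ⟶ Q} (h : ∀ σ, CoTMod.Hom.app f σ = CoTMod.Hom.app g σ) :
    f = g := CoTMod.Hom.ext (funext h)

namespace CoTMod.Hom

variable {P Q : CoTMod Δ}

instance : Zero (P ⟶ Q) := ⟨{ app := fun _ => 0, comm := fun _ _ => by simp }⟩
instance : Add (P ⟶ Q) :=
  ⟨fun f g => { app := fun σ => Hom.app f σ + Hom.app g σ, comm := fun h m => by simp [Hom.comm] }⟩
instance : Neg (P ⟶ Q) :=
  ⟨fun f => { app := fun σ => - Hom.app f σ, comm := fun h m => by simp [Hom.comm] }⟩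
instance : Sub (P ⟶ Q) :=
  ⟨fun f g => { app := fun σ => Hom.app f σ - Hom.app g σ, comm := fun h m => by simp [Hom.comm] }⟩
instance : SMul ℕ (P ⟶ Q) :=
  ⟨fun k f => { app := fun σ => k • Hom.app f σ, comm := fun h m => by simp [Hom.comm] }⟩
instance : SMul ℤ (P ⟶ Q) :=
  ⟨fun k f => { app := fun σ => k • Hom.app f σ, comm := fun h m => by simp [Hom.comm] }⟩

instance : AddCommGroup (P ⟶ Q) :=
  Function.Injective.addCommGroup (fun f : P ⟶ Q => Hom.app f)
    (fun _ _ h => CoTMod.Hom.ext h) rfl (fun _ _ => rfl) (fun _ => rfl) (fun _ _ => rfl)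
    (fun _ _ => rfl) (fun _ _ => rfl)

end CoTMod.Hom

instance : Preadditive (CoTMod Δ) where
  add_comp _ _ _ f f' g := CoTMod.hom_ext fun σ => LinearMap.comp_add _ _ _
  comp_add _ _ _ f g g' := CoTMod.hom_ext fun σ => LinearMap.add_comp _ _ _

/-- The co-`𝓣`-module is supported at the origin: every element of `M_σ` is annihilated by some
power of `𝔪_σ`. -/
def isSupportedAtOrigin (Δ : Fan N) : ObjectProperty (CoTMod Δ) := fun P =>
  ∀ (σ : Δ.Cone) (m : P.obj σ), ∃ k : ℕ, ∀ a ∈ TRing.maxIdeal σ.1 ^ k, a • m = 0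

/-- The subspace `{m ∈ M_σ | 𝔪_σ m = 0}`. -/
def CoTMod.socle (P : CoTMod Δ) (σ : Δ.Cone) : Submodule ℂ (P.obj σ) where
  carrier := {m | ∀ a ∈ TRing.maxIdeal σ.1, a • m = 0}
  zero_mem' := fun a _ => smul_zero a
  add_mem' := fun h h' a ha => by rw [smul_add, h a ha, h' a ha, add_zero]
  smul_mem' := fun c m h a ha => by rw [smul_comm, h a ha, smul_zero]

/-- Co-finite co-`𝓣`-modules. -/
def isCofinite (Δ : Fan N) : ObjectProperty (CoTMod Δ) := fun P =>
  isSupportedAtOrigin Δ P ∧ ∀ σ : Δ.Cone, FiniteDimensional ℂ (P.socle σ)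

/-- The category `co-𝓣-Mod_n`. -/
abbrev CoTModN (Δ : Fan N) : Type 1 := (isSupportedAtOrigin Δ).FullSubcategory

/-- The category `co-𝓣-Mod_cf`. -/
abbrev CoTModCf (Δ : Fan N) : Type 1 := (isCofinite Δ).FullSubcategory

/-- The inclusion `co-𝓣-Mod_cf ⥤ co-𝓣-Mod_n`. -/
abbrev CoTModCfToN (Δ : Fan N) : CoTModCf Δ ⥤ CoTModN Δ := ObjectProperty.ιOfLE fun _ h => h.1

/-- A graded co-`𝓣`-module: each `M_σ` is a graded `𝓣_σ`-module (where `N_σ ⊗ ℂ` has degree `2`)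
and the maps `M_σ → M_τ` have degree zero. -/
structure GrCoTMod (Δ : Fan N) where
  toCoTMod : CoTMod Δ
  gr : ∀ σ : Δ.Cone, ℤ → Submodule ℂ (toCoTMod.obj σ)
  isInternal : ∀ σ, DirectSum.IsInternal (gr σ)
  smul_mem : ∀ (σ : Δ.Cone) (d : ℕ) (k : ℤ) (a : TRing σ.1) (m : toCoTMod.obj σ),
    a ∈ TRing.sym σ.1 d → m ∈ gr σ k → a • m ∈ gr σ (k + 2 * d)
  map_mem : ∀ {τ σ : Δ.Cone} (h : τ ≤ σ) (k : ℤ) (m : toCoTMod.obj σ),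
    m ∈ gr σ k → toCoTMod.map h m ∈ gr τ k

/-- Morphisms of graded co-`𝓣`-modules: morphisms of degree zero. -/
@[ext]
structure GrCoTMod.Hom (P Q : GrCoTMod Δ) where
  hom : P.toCoTMod ⟶ Q.toCoTMod
  mem : ∀ (σ : Δ.Cone) (k : ℤ) (m : P.toCoTMod.obj σ),
    m ∈ P.gr σ k → CoTMod.Hom.app hom σ m ∈ Q.gr σ k

instance : Category (GrCoTMod Δ) where
  Hom := GrCoTMod.Hom
  id P := { hom := 𝟙 _, mem := fun _ _ _ h => h }
  comp f g := { hom := f.hom ≫ g.hom, mem := fun σ k m h => g.mem σ k _ (f.mem σ k m h) }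

namespace GrCoTMod.Hom

variable {P Q : GrCoTMod Δ}

instance : Zero (P ⟶ Q) := ⟨{ hom := 0, mem := fun σ k _ _ => (Q.gr σ k).zero_mem }⟩
instance : Add (P ⟶ Q) :=
  ⟨fun f g => { hom := Hom.hom f + Hom.hom g, mem := fun σ k m h =>
    (Q.gr σ k).add_mem (Hom.mem f σ k m h) (Hom.mem g σ k m h) }⟩
instance : Neg (P ⟶ Q) :=
  ⟨fun f => { hom := - Hom.hom f, mem := fun σ k m h => (Q.gr σ k).neg_mem (Hom.mem f σ k m h) }⟩
instance : Sub (P ⟶ Q) :=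
  ⟨fun f g => { hom := Hom.hom f - Hom.hom g, mem := fun σ k m h =>
    (Q.gr σ k).sub_mem (Hom.mem f σ k m h) (Hom.mem g σ k m h) }⟩
instance : SMul ℕ (P ⟶ Q) :=
  ⟨fun n f => { hom := n • Hom.hom f, mem := fun σ k m h =>
    (Q.gr σ k).smul_of_tower_mem n (Hom.mem f σ k m h) }⟩
instance : SMul ℤ (P ⟶ Q) :=
  ⟨fun n f => { hom := n • Hom.hom f, mem := fun σ k m h =>
    (Q.gr σ k).smul_of_tower_mem n (Hom.mem f σ k m h) }⟩

instance : AddCommGroup (P ⟶ Q) :=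
  Function.Injective.addCommGroup (fun f : P ⟶ Q => Hom.hom f)
    (fun _ _ h => GrCoTMod.Hom.ext h) rfl (fun _ _ => rfl) (fun _ => rfl) (fun _ _ => rfl)
    (fun _ _ => rfl) (fun _ _ => rfl)

end GrCoTMod.Hom

instance : Preadditive (GrCoTMod Δ) where
  add_comp _ _ _ f f' g := GrCoTMod.Hom.ext (Preadditive.add_comp _ _ _ _ _ _)
  comp_add _ _ _ f g g' := GrCoTMod.Hom.ext (Preadditive.comp_add _ _ _ _ _ _)

/-- Forgetting the grading. -/
def GrCoTMod.forget (Δ : Fan N) : GrCoTMod Δ ⥤ CoTMod Δ where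
  obj P := P.toCoTMod
  map f := GrCoTMod.Hom.hom f

/-- Co-finite graded co-`𝓣`-modules. -/
def isGrCofinite (Δ : Fan N) : ObjectProperty (GrCoTMod Δ) := fun P => isCofinite Δ P.toCoTMod

/-- The category `co-𝓣-mod_cf` of graded co-finite co-`𝓣`-modules. -/
abbrev GrCoTModCf (Δ : Fan N) : Type 1 := (isGrCofinite Δ).FullSubcategory

/-- The functor `co-𝓣-mod_cf ⥤ co-𝓣-Mod_cf` forgetting the grading. -/
abbrev GrCoTModCfToCf (Δ : Fan N) : GrCoTModCf Δ ⥤ CoTModCf Δ :=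
  (isCofinite Δ).lift ((isGrCofinite Δ).ι ⋙ GrCoTMod.forget Δ) fun P => P.property

/-- The graded co-`𝓣`-module `M{n}` with `M{n}_k = M_{k + n}`. -/
def GrCoTMod.shiftObj (n : ℤ) (P : GrCoTMod Δ) : GrCoTMod Δ where
  toCoTMod := P.toCoTMod
  gr σ k := P.gr σ (k + n)
  isInternal σ := by
    have h := (DirectSum.isInternal_submodule_iff_iSupIndep_and_iSup_eq_top _).1 (P.isInternal σ)
    refine (DirectSum.isInternal_submodule_iff_iSupIndep_and_iSup_eq_top _).2
      ⟨h.1.comp (add_left_injective n), ?_⟩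
    rw [← h.2]
    exact (Equiv.addRight n).iSup_comp (g := P.gr σ)
  smul_mem σ d k a m ha hm := by
    have := P.smul_mem σ d (k + n) a m ha hm
    rwa [add_right_comm] at this
  map_mem h k m hm := P.map_mem h (k + n) m hm

/-- The effect of the grading shift on morphisms. -/
def GrCoTMod.shiftMap (n : ℤ) {P Q : GrCoTMod Δ} (f : P ⟶ Q) :
    GrCoTMod.shiftObj n P ⟶ GrCoTMod.shiftObj n Q :=
  GrCoTMod.Hom.mk (P := GrCoTMod.shiftObj n P) (Q := GrCoTMod.shiftObj n Q)
    (GrCoTMod.Hom.hom (P := P) (Q := Q) f)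
    (fun σ k m h => GrCoTMod.Hom.mem (P := P) (Q := Q) f σ (k + n) m h)

/-- The grading shift functor `{n}` on `co-𝓣-mod_cf`. -/
def grShift (Δ : Fan N) (n : ℤ) : GrCoTModCf Δ ⥤ GrCoTModCf Δ :=
  (isGrCofinite Δ).lift
    { obj := fun P => GrCoTMod.shiftObj n P.obj
      map := fun f => GrCoTMod.shiftMap n f.hom
      map_id := fun _ => rfl
      map_comp := fun _ _ => rfl }
    fun P => P.property

instance (n : ℤ) : (grShift Δ n).Additive where
  map_add := rfl

theorem grShift_comp_iso (n k : ℤ) (h : n + k = 0) :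
    Nonempty (grShift Δ n ⋙ grShift Δ k ≅ 𝟭 _) := by
  have key : ∀ j : ℤ, j + k + n = j := fun j => by lia
  refine ⟨NatIso.ofComponents (fun P => (isGrCofinite Δ).isoMk
    { hom := { hom := 𝟙 P.obj.toCoTMod, mem := fun σ j m hm => ?_ }
      inv := { hom := 𝟙 P.obj.toCoTMod, mem := fun σ j m hm => ?_ }
      hom_inv_id := rfl
      inv_hom_id := rfl }) ?_⟩
  · change m ∈ P.obj.gr σ (j + k + n) at hm
    rwa [key] at hm
  · change m ∈ P.obj.gr σ (j + k + n)
    rwa [key]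
  · intros
    apply ObjectProperty.hom_ext
    rfl

instance (n : ℤ) : (grShift Δ n).IsEquivalence := by
  obtain ⟨e⟩ := grShift_comp_iso (Δ := Δ) n (-n) (by lia)
  obtain ⟨e'⟩ := grShift_comp_iso (Δ := Δ) (-n) n (by lia)
  exact (CategoryTheory.Equivalence.mk (grShift Δ n) (grShift Δ (-n)) e.symm e').isEquivalence_functor

end CoModules

/-! ### The twist on `F`-sheaves -/

section Twist

variable {N : Type} [AddCommGroup N]

/-- The multiple `c • f` of a morphism of sheaves of complex vector spaces. -/
def scaleHom {Y : TopCat.{0}} {F G : Sh Y} (c : ℂ) (f : F ⟶ G) : F ⟶ G :=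
  ⟨{ app := fun U => c • f.hom.app U
     naturality := fun U V i => by
      rw [Linear.comp_smul, Linear.smul_comp, f.hom.naturality] }⟩

theorem scaleHom_app {Y : TopCat.{0}} {F G : Sh Y} (c : ℂ) (f : F ⟶ G) (U : (Opens Y)ᵒᵖ) :
    (scaleHom c f).hom.app U = c • f.hom.app U := rfl

theorem scaleHom_comp {Y : TopCat.{0}} {F G H : Sh Y} (c : ℂ) (f : F ⟶ G) (g : G ⟶ H) :
    scaleHom c f ≫ g = scaleHom c (f ≫ g) := by
  apply Sheaf.hom_ext
  ext U : 2
  exact Linear.smul_comp _ _ _ _ _ _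

theorem comp_scaleHom {Y : TopCat.{0}} {F G H : Sh Y} (c : ℂ) (f : F ⟶ G) (g : G ⟶ H) :
    f ≫ scaleHom c g = scaleHom c (f ≫ g) := by
  apply Sheaf.hom_ext
  ext U : 2
  exact Linear.comp_smul _ _ _ _ _ _

theorem scaleHom_scaleHom {Y : TopCat.{0}} {F G : Sh Y} (c d : ℂ) (f : F ⟶ G) :
    scaleHom c (scaleHom d f) = scaleHom (c * d) f := by
  apply Sheaf.hom_ext
  ext U : 2
  exact smul_smul _ _ _

theorem scaleHom_one {Y : TopCat.{0}} {F G : Sh Y} (f : F ⟶ G) : scaleHom 1 f = f := by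
  apply Sheaf.hom_ext
  ext U : 2
  exact one_smul _ _

theorem stalkFunctor_map_eq_smul {Y : TopCat.{0}} {P Q : TopCat.Presheaf (ModuleCat.{0} ℂ) Y}
    (c : ℂ) (f g : P ⟶ Q) (h : ∀ U, g.app U = c • f.app U) (y : Y) :
    (TopCat.Presheaf.stalkFunctor (ModuleCat.{0} ℂ) y).map g =
      c • (TopCat.Presheaf.stalkFunctor (ModuleCat.{0} ℂ) y).map f := by
  refine TopCat.Presheaf.stalk_hom_ext _ fun U hU => ?_
  rw [TopCat.Presheaf.stalkFunctor_map_germ, h, Linear.smul_comp]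
  refine Eq.trans ?_ (Linear.comp_smul _ _ _ _ _ _).symm
  exact congrArg (c • ·) (TopCat.Presheaf.stalkFunctor_map_germ U y hU f).symm

variable {Δ : Fan N}

/-- The pair `(F, c θ)`. -/
abbrev FrobPair.scale (c : ℂ) (A : FrobPair Δ) : FrobPair Δ where
  a := A.a
  str := scaleHom c A.str

theorem stalkTheta_scale (c : ℂ) {F : Sh (X Δ)} (θ : (frobPullback Δ).obj F ⟶ F) (σ : Δ.Cone) :
    stalkTheta (scaleHom c θ) σ = c • stalkTheta θ σ := by
  have h : (TopCat.Sheaf.pullbackPushforwardAdjunction (ModuleCat.{0} ℂ) (frobHom Δ)).homEquiv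
      F F (scaleHom c θ) = scaleHom c
      ((TopCat.Sheaf.pullbackPushforwardAdjunction (ModuleCat.{0} ℂ) (frobHom Δ)).homEquiv
        F F θ) := by
    rw [Adjunction.homEquiv_unit, Adjunction.homEquiv_unit, ← comp_scaleHom]
    rfl
  have h' := stalkFunctor_map_eq_smul c
    ((TopCat.Sheaf.pullbackPushforwardAdjunction (ModuleCat.{0} ℂ) (frobHom Δ)).homEquiv F F θ).hom
    _ (fun U => scaleHom_app c _ U) (frobHom Δ (pt σ))
  ext a
  unfold stalkTheta
  rw [h]
  exact congrArg (fun g => (F.presheaf.stalkPushforward (ModuleCat.{0} ℂ) (frobHom Δ) (pt σ)).hom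
    (ModuleCat.Hom.hom g _)) h' |>.trans (map_smul _ c _)

theorem sqrtTwoPow_add (m n : ℤ) : sqrtTwoPow (m + n) = sqrtTwoPow m * sqrtTwoPow n :=
  zpow_add₀ (by simp) _ _

theorem sqrtTwoPow_zero : sqrtTwoPow 0 = 1 := zpow_zero _

theorem isIso_scaleHom {Y : TopCat.{0}} {F G : Sh Y} (n : ℤ) (f : F ⟶ G) (hf : IsIso f) :
    IsIso (scaleHom (sqrtTwoPow n) f) := by
  refine ⟨scaleHom (sqrtTwoPow (-n)) (inv f), ?_, ?_⟩
  · rw [scaleHom_comp, comp_scaleHom, scaleHom_scaleHom, ← sqrtTwoPow_add, add_neg_cancel,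
      sqrtTwoPow_zero, scaleHom_one, IsIso.hom_inv_id]
  · rw [scaleHom_comp, comp_scaleHom, scaleHom_scaleHom, ← sqrtTwoPow_add, neg_add_cancel,
      sqrtTwoPow_zero, scaleHom_one, IsIso.inv_hom_id]

theorem isFSheaf_scale (n : ℤ) (A : FrobPair Δ) (hA : isFSheaf Δ A) :
    isFSheaf Δ (A.scale (sqrtTwoPow n)) := by
  refine ⟨hA.1, isIso_scaleHom n A.str hA.2.1, fun σ => ?_⟩
  refine eq_top_iff.2 ((hA.2.2 σ).symm.le.trans ?_)
  refine iSup_le fun k => le_iSup_of_le (n + k) fun a ha => ?_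
  rw [Module.End.mem_eigenspace_iff] at ha
  refine Module.End.mem_eigenspace_iff.2 ?_
  rw [stalkTheta_scale, LinearMap.smul_apply, ha, sqrtTwoPow_add, mul_smul]

/-- The effect of the twist on morphisms. -/
def FrobPair.scaleMap (c : ℂ) {A B : FrobPair Δ} (f : A ⟶ B) : A.scale c ⟶ B.scale c :=
  Endofunctor.Algebra.Hom.mk (A₀ := A.scale c) (A₁ := B.scale c) f.f
    ((comp_scaleHom c ((frobPullback Δ).map f.f) B.str).trans
      ((congrArg _ f.h).trans (scaleHom_comp c A.str f.f).symm))

/-- The twist `⟨n⟩ : (F, θ) ↦ (F, 2^(n/2) θ)` on `LC_𝓕(X)`. -/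
def twist (Δ : Fan N) (n : ℤ) : LCF Δ ⥤ LCF Δ :=
  (isFSheaf Δ).lift
    { obj := fun A => A.obj.scale (sqrtTwoPow n)
      map := fun f => FrobPair.scaleMap (sqrtTwoPow n) f.hom
      map_id := fun _ => rfl
      map_comp := fun _ _ => rfl }
    fun A => isFSheaf_scale n A.obj A.property

instance (n : ℤ) : (twist Δ n).Additive where
  map_add := rfl

theorem twist_comp_iso (n k : ℤ) (h : n + k = 0) :
    Nonempty (twist Δ n ⋙ twist Δ k ≅ 𝟭 _) := by
  have key' : ∀ A : FrobPair Δ, ((A.scale (sqrtTwoPow n)).scale (sqrtTwoPow k)).str = A.str :=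
    fun A => by
    change scaleHom _ (scaleHom _ A.str) = A.str
    rw [scaleHom_scaleHom, ← sqrtTwoPow_add, add_comm, h, sqrtTwoPow_zero, scaleHom_one]
  refine ⟨NatIso.ofComponents (fun A => (isFSheaf Δ).isoMk
    (Endofunctor.Algebra.isoMk (A₀ := (A.obj.scale (sqrtTwoPow n)).scale (sqrtTwoPow k))
      (A₁ := A.obj) (Iso.refl A.obj.a) ?_)) ?_⟩
  · refine Eq.trans ?_ ((Category.comp_id _).trans (key' A.obj)).symm
    exact (congrArg (· ≫ A.obj.str) ((frobPullback Δ).map_id A.obj.a)).trans (Category.id_comp _)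
  · intro A B f
    apply ObjectProperty.hom_ext
    apply Endofunctor.Algebra.ext
    exact (Category.comp_id f.hom.f).trans (Category.id_comp f.hom.f).symm

instance (n : ℤ) : (twist Δ n).IsEquivalence := by
  obtain ⟨e⟩ := twist_comp_iso (Δ := Δ) n (-n) (by lia)
  obtain ⟨e'⟩ := twist_comp_iso (Δ := Δ) (-n) n (by lia)
  exact (CategoryTheory.Equivalence.mk (twist Δ n) (twist Δ (-n)) e.symm e').isEquivalence_functor

end Twist

/-! ### Abelian categories and bounded derived categories -/

section Derived

/-- The axioms of an abelian category for a preadditive category. -/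
structure IsAbelianCat (C : Type u) [Category.{v} C] [Preadditive C] : Prop where
  normalMono : IsNormalMonoCategory C
  normalEpi : IsNormalEpiCategory C
  finiteProducts : HasFiniteProducts C
  kernels : HasKernels C
  cokernels : HasCokernels C

/-- The resulting abelian category structure. -/
@[reducible] def IsAbelianCat.abelian {C : Type u} [Category.{v} C] [i : Preadditive C]
    (h : IsAbelianCat C) : Abelian C :=
  { i with
    toIsNormalMonoCategory := h.normalMono
    toIsNormalEpiCategory := h.normalEpi
    has_finite_products := h.finiteProducts
    has_kernels := h.kernels
    has_cokernels := h.cokernels }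

/-- A functor between categories is exact if it preserves finite limits and finite colimits. -/
structure IsExactFunctor {C D : Type*} [Category* C] [Category* D] (G : C ⥤ D) : Prop where
  limits : PreservesFiniteLimits G
  colimits : PreservesFiniteColimits G

variable {A : Type*} [Category* A] [Abelian A] [HasDerivedCategory.{w₁} A]
  {B : Type*} [Category* B] [Abelian B] [HasDerivedCategory.{w₂} B]

theorem bounded_mapDerivedCategory (G : A ⥤ B) [G.Additive] [PreservesFiniteLimits G]
    [PreservesFiniteColimits G] (K : DerivedCategory A)
    (hK : (DerivedCategory.TStructure.t : Triangulated.TStructure (DerivedCategory A)).bounded K) :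
    (DerivedCategory.TStructure.t : Triangulated.TStructure (DerivedCategory B)).bounded
      (G.mapDerivedCategory.obj K) := by
  obtain ⟨⟨a, L, e, hL⟩, ⟨b, L', e', hL'⟩⟩ := hK
  refine ⟨⟨a, (G.mapHomologicalComplex (ComplexShape.up ℤ)).obj L,
    G.mapDerivedCategory.mapIso e ≪≫ G.mapDerivedCategoryFactors.app L, ?_⟩,
    ⟨b, (G.mapHomologicalComplex (ComplexShape.up ℤ)).obj L',
    G.mapDerivedCategory.mapIso e' ≪≫ G.mapDerivedCategoryFactors.app L', ?_⟩⟩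
  · infer_instance
  · infer_instance

/-- The functor `D^b(A) ⥤ D^b(B)` induced by an exact functor `A ⥤ B`. -/
def boundedMap (G : A ⥤ B) [G.Additive] [PreservesFiniteLimits G] [PreservesFiniteColimits G] :
    DerivedCategory.Bounded A ⥤ DerivedCategory.Bounded B :=
  ObjectProperty.lift _ (DerivedCategory.Bounded.ι ⋙ G.mapDerivedCategory)
    fun K => bounded_mapDerivedCategory G K.obj K.property

instance (G : A ⥤ B) [G.Additive] [PreservesFiniteLimits G] [PreservesFiniteColimits G] :
    (boundedMap G).CommShift ℤ := by
  unfold boundedMap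
  infer_instance

end Derived

/-! ### Logarithms of monodromy -/

section Log

variable {N : Type} [AddCommGroup N] {Δ : Fan N}

/-- A path from `x_σ` to `x_τ`, where `τ` is a face of `σ`, which for positive times stays in
`T_σ · x_τ` (`T_σ` the stabilizer of `x_σ`), i.e. in the part lying in `O_τ` of the fibre over `x_σ`
of the canonical projection from the star of `O_σ` to `O_σ`. Continuation along such a path is the
canonical map from the stalk at `x_σ` to the stalk at `x_τ`. -/
def IsExitPath {σ τ : Δ.Cone} (γ : Path (pt σ : X Δ) (pt τ)) : Prop :=
  ∀ s : unitInterval, 0 < s → ∃ t ∈ MulAction.stabilizer (Torus N) (pt σ), γ s = t • pt τ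

/-- Let `U` assign sheaves and `E` assign co-`𝓣`-modules to the objects of a category. This structure
says that `E` is obtained from `U` by taking logarithms of monodromy: `E(A)_σ` is naturally the stalk
of the sheaf `U(A)` at the distinguished point `x_σ`, the element `n ∈ N_σ` acts on it as
`(2πi)⁻¹ log` of the monodromy along the loop `exp(2πi t n) · x_σ`, and the map `E(A)_σ → E(A)_τ`
is the canonical map of stalks. -/
structure LogMonodromy {C : Type u} [Category.{v} C] (U : C ⥤ Sh (X Δ)) (E : C ⥤ CoTMod Δ) where
  iso : ∀ (A : C) (σ : Δ.Cone), (E.obj A).obj σ ≃ₗ[ℂ] stalk (U.obj A) (pt σ : X Δ)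
  naturality : ∀ {A B : C} (f : A ⟶ B) (σ : Δ.Cone) (m : (E.obj A).obj σ),
    iso B σ (CoTMod.Hom.app (E.map f) σ m) = stalkMap (U.map f) (pt σ : X Δ) (iso A σ m)
  log : ∀ (A : C) (σ : Δ.Cone) (n : N) (μ : Module.End ℂ (stalk (U.obj A) (pt σ : X Δ))),
    IsMonodromy (U.obj A) (orbitLoop σ n : Path (pt σ : X Δ) (pt σ)) μ →
    ∀ m : (E.obj A).obj σ, iso A σ (TRing.of σ.1 n • m) =
      (2 * Real.pi * Complex.I : ℂ)⁻¹ • unipotentLog μ (iso A σ m)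
  cospecialization : ∀ (A : C) {τ σ : Δ.Cone} (h : τ ≤ σ) (γ : Path (pt σ : X Δ) (pt τ)),
    IsExitPath γ → ∀ m : (E.obj A).obj σ,
      Transports (U.obj A) γ (iso A σ m) (iso A τ ((E.obj A).map h m))

variable (Δ)

/-- The functor `LC_𝓕(X) ⥤ Sh(X)` forgetting `θ`. -/
abbrev LCFToSh : LCF Δ ⥤ Sh (X Δ) := (isFSheaf Δ).ι ⋙ Endofunctor.Algebra.forget _

/-- The functor `co-𝓣-mod_cf ⥤ co-𝓣-Mod` forgetting the grading. -/
abbrev GrCoTModCfToCoTMod : GrCoTModCf Δ ⥤ CoTMod Δ := (isGrCofinite Δ).ι ⋙ GrCoTMod.forget Δ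

end Log

end ToricLC

end

noncomputable section

namespace ToricLC

/-! ### Rational cones and their faces -/

section Geometry

variable {N : Type} [AddCommGroup N] {Δ : Fan N}

/-! The orbit `O_σ` is the image of the vector space `N ⊗ ℂ` under `w ↦ exp(2πiw) · x_σ` (`param`);
two vectors have the same image exactly when their difference pairs with `σ^⊥` as an element of `N`
does. A sheaf which is locally constant on the orbits becomes constant on these contractible spaces.
On `O_σ` it therefore amounts to a space of flat sections on which `N` acts by translation, through
`N_σ`.

How the strata fit together is read off from the topology of `X` in logarithmic coordinates. A
neighbourhood of `exp(2πiv) · x_σ` meets `O_τ`, for `τ ≤ σ`, in points having a logarithm that is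
close to `v` along `σ^⊥` and has large imaginary part along the exponents of `σ^∨ ∩ τ^⊥` outside
`σ^⊥`; `eventually_nhds_param_iff` says that these conditions, for all faces `τ`, describe the
neighbourhood filter. The sets of such logarithms are convex. Hence the germ of a section at a point
of `O_σ` has exactly one flat continuation to `O_τ`, and this defines the restriction maps of flat
sections.

So a sheaf locally constant on the orbits is the same thing as a functorial system of
representations of the groups `N_σ`. `exists_flatData` extracts the system from the sheaf and
`MonodromyData.sheaf` rebuilds the sheaf from the system. For morphisms this is done by
`exists_flatRel` and `exists_isEtaleFamily`, over any self-map of `X` which multiplies logarithms by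
`k`: the case `k = 1` gives morphisms of sheaves, and `k = 2` gives morphisms covering the lift of
Frobenius.

On vectors killed by a power of the operator, exponential and logarithm are finite sums and inverse
to each other. They exchange commuting locally unipotent operators `T_n` with commuting locally
nilpotent operators `L_n`, that is, with an action of `Sym(N_σ ⊗ ℂ)` for which every vector is
killed by a power of the maximal ideal. Vectors fixed by all `T_n` are those killed by all `L_n`, so
the two finiteness conditions agree.

Since Frobenius doubles logarithms, `θ_σ T_n² = T_n θ_σ`, and taking logarithms `2 θ_σ L_n = L_n
θ_σ`. Thus `L_n` takes the eigenvalue `2^(-k/2)` to `2^(-(k+2)/2)`, and the eigenspaces of `θ_σ`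
form a grading with `N_σ` in degree `2`. Conversely the operators equal to `2^(-k/2)` in degree `k`
satisfy the same relation, and `exists_theta` turns them into `θ`.

Abelianness is proved for modules, where kernels, cokernels and sums are formed cone by cone, and is
carried over along the equivalences. The one delicate point, stability of co-finiteness under
quotients, follows by recognising it as the descending chain condition (`isCofinite_iff`). Exactness
of the functors to sheaves is tested on stalks, each of which is isomorphic to the stalk at the
distinguished point of its orbit. The statement on derived categories is the functoriality of `D^b`
for exact functors. -/

theorem exists_gens (σ : Δ.Cone) : ∃ S : Finset N, σ.1 =
    Submodule.span {c : ℝ // 0 ≤ c} ((fun n : N => (1 : ℝ) ⊗ₜ[ℤ] n) '' (S : Set N)) := by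
  obtain ⟨S, hS, h⟩ := Δ.rational σ.1 σ.2
  exact ⟨hS.toFinset, by simpa using h⟩

/-- A finite set of lattice generators of a cone of the fan. -/
def gens (σ : Δ.Cone) : Finset N := (exists_gens σ).choose

theorem cone_eq_span (σ : Δ.Cone) : σ.1 =
    Submodule.span {c : ℝ // 0 ≤ c} ((fun n : N => (1 : ℝ) ⊗ₜ[ℤ] n) '' (gens σ : Set N)) :=
  (exists_gens σ).choose_spec

theorem gens_mem {σ : Δ.Cone} {s : N} (hs : s ∈ gens σ) : (1 : ℝ) ⊗ₜ[ℤ] s ∈ σ.1 := by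
  rw [cone_eq_span σ]
  exact Submodule.subset_span ⟨s, hs, rfl⟩

theorem cone_induction (σ : Δ.Cone) {P : (ℝ ⊗[ℤ] N) → Prop}
    (h1 : ∀ s ∈ gens σ, P ((1 : ℝ) ⊗ₜ[ℤ] s)) (h0 : P 0) (hadd : ∀ x y, P x → P y → P (x + y))
    (hsmul : ∀ (c : ℝ), 0 ≤ c → ∀ x, P x → P (c • x)) {x : ℝ ⊗[ℤ] N} (hx : x ∈ σ.1) : P x := by
  rw [cone_eq_span σ] at hx
  induction hx using Submodule.span_induction with
  | mem x hx => obtain ⟨s, hs, rfl⟩ := hx; exact h1 s hs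
  | zero => exact h0
  | add x y _ _ hx hy => exact hadd x y hx hy
  | smul c x _ hx => exact hsmul c.1 c.2 x hx

theorem mem_dualMonoid_iff (σ : Δ.Cone) {m : N →ₗ[ℤ] ℤ} :
    m ∈ dualMonoid σ.1 ↔ ∀ s ∈ gens σ, 0 ≤ m s := by
  constructor
  · intro h s hs
    have := h _ (gens_mem hs)
    rw [pairing_tmul, one_mul] at this
    exact_mod_cast this
  · intro h x hx
    refine cone_induction σ (P := fun x => 0 ≤ pairing m x) ?_ ?_ ?_ ?_ hx
    · intro s hs
      rw [pairing_tmul, one_mul]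
      exact_mod_cast h s hs
    · simp
    · intro x y hx hy
      rw [map_add]
      exact add_nonneg hx hy
    · intro c hc x hx
      rw [map_smul]
      exact mul_nonneg hc hx

theorem isPerp_iff (σ : Δ.Cone) {m : N →ₗ[ℤ] ℤ} : IsPerp σ.1 m ↔ ∀ s ∈ gens σ, m s = 0 := by
  constructor
  · intro h s hs
    have := h _ (gens_mem hs)
    rw [pairing_tmul, one_mul] at this
    exact_mod_cast this
  · intro h x hx
    refine cone_induction σ (P := fun x => pairing m x = 0) ?_ ?_ ?_ ?_ hx
    · intro s hs
      rw [pairing_tmul, one_mul]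
      exact_mod_cast h s hs
    · simp
    · intro x y hx hy
      rw [map_add, hx, hy, add_zero]
    · intro c hc x hx
      rw [map_smul, hx, smul_zero]

theorem IsPerp.mem_dualMonoid {σ : PointedCone ℝ (ℝ ⊗[ℤ] N)} {m : N →ₗ[ℤ] ℤ} (h : IsPerp σ m) :
    m ∈ dualMonoid σ := fun x hx => (h x hx).ge

theorem IsPerp.mono {σ τ : PointedCone ℝ (ℝ ⊗[ℤ] N)} (hle : τ ≤ σ) {m : N →ₗ[ℤ] ℤ}
    (h : IsPerp σ m) : IsPerp τ m := fun x hx => h x (hle hx)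

theorem isFaceOf_of_le {τ σ : Δ.Cone} (h : τ ≤ σ) : τ.1.IsFaceOf σ.1 := by
  have := Δ.inter_isFaceOf σ.1 σ.2 τ.1 τ.2
  rwa [inf_eq_right.2 (show τ.1 ≤ σ.1 from h)] at this

/-- The intersection of two cones of the fan. -/
def infCone (σ τ : Δ.Cone) : Δ.Cone :=
  ⟨σ.1 ⊓ τ.1, Δ.face_mem σ.1 σ.2 _ (Δ.inter_isFaceOf σ.1 σ.2 τ.1 τ.2)⟩

theorem infCone_le_left (σ τ : Δ.Cone) : infCone σ τ ≤ σ := inf_le_left (a := σ.1) (b := τ.1)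

theorem infCone_le_right (σ τ : Δ.Cone) : infCone σ τ ≤ τ := inf_le_right (a := σ.1) (b := τ.1)

theorem le_of_gens_mem {σ : Δ.Cone} {τ : PointedCone ℝ (ℝ ⊗[ℤ] N)}
    (h : ∀ s ∈ gens σ, (1 : ℝ) ⊗ₜ[ℤ] s ∈ τ) : σ.1 ≤ τ := fun _ hx =>
  cone_induction σ (P := fun x => x ∈ τ) h τ.zero_mem (fun _ _ => τ.add_mem)
    (fun _ hc _ hx => τ.smul_mem hc hx) hx

theorem isPerp_of_spanLattice {σ : Δ.Cone} {m : N →ₗ[ℤ] ℤ}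
    (h : ∀ n ∈ spanLattice σ.1, m n = 0) : IsPerp σ.1 m :=
  (isPerp_iff σ).2 fun s hs => h s (Submodule.subset_span (gens_mem hs))

theorem IsPerp.apply_eq_zero {σ : PointedCone ℝ (ℝ ⊗[ℤ] N)} {m : N →ₗ[ℤ] ℤ} (h : IsPerp σ m)
    {n : N} (hn : n ∈ spanLattice σ) : m n = 0 := by
  have key : ∀ x ∈ Submodule.span ℝ (σ : Set (ℝ ⊗[ℤ] N)), pairing m x = 0 := fun x hx => by
    induction hx using Submodule.span_induction with
    | mem x hx => exact h x hx
    | zero => simp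
    | add x y _ _ hx hy => rw [map_add, hx, hy, add_zero]
    | smul c x _ hx => rw [map_smul, hx, smul_zero]
  have := key _ hn
  simp only [TensorProduct.mk_apply, pairing_tmul, one_mul] at this
  exact_mod_cast this

theorem exists_sub_of_mem_span {τ : PointedCone ℝ (ℝ ⊗[ℤ] N)} {x : ℝ ⊗[ℤ] N}
    (hx : x ∈ Submodule.span ℝ (τ : Set (ℝ ⊗[ℤ] N))) : ∃ a ∈ τ, ∃ b ∈ τ, x = a - b := by
  induction hx using Submodule.span_induction with
  | mem x hx => exact ⟨x, hx, 0, τ.zero_mem, by simp⟩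
  | zero => exact ⟨0, τ.zero_mem, 0, τ.zero_mem, by simp⟩
  | add x y _ _ hx hy =>
    obtain ⟨a, ha, b, hb, rfl⟩ := hx
    obtain ⟨a', ha', b', hb', rfl⟩ := hy
    exact ⟨a + a', τ.add_mem ha ha', b + b', τ.add_mem hb hb', by abel⟩
  | smul c x _ hx =>
    obtain ⟨a, ha, b, hb, rfl⟩ := hx
    rcases le_total 0 c with hc | hc
    · exact ⟨c • a, τ.smul_mem hc ha, c • b, τ.smul_mem hc hb, smul_sub _ _ _⟩
    · refine ⟨(-c) • b, τ.smul_mem (neg_nonneg.2 hc) hb, (-c) • a,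
        τ.smul_mem (neg_nonneg.2 hc) ha, ?_⟩
      module

/-- The sum of the generators of `σ`, a lattice point in its relative interior. -/
def interiorPoint (σ : Δ.Cone) : N := ∑ s ∈ gens σ, s

theorem interiorPoint_mem (σ : Δ.Cone) : interiorPoint σ ∈ spanLattice σ.1 :=
  Submodule.sum_mem _ fun _ hs => Submodule.subset_span (gens_mem hs)

theorem apply_interiorPoint_pos {σ : Δ.Cone} {m : N →ₗ[ℤ] ℤ} (hm : m ∈ dualMonoid σ.1)
    (h : ¬ IsPerp σ.1 m) : 0 < m (interiorPoint σ) := by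
  have h' := (mem_dualMonoid_iff σ).1 hm
  rw [interiorPoint, map_sum]
  refine lt_of_le_of_ne (Finset.sum_nonneg h') fun h0 => h ((isPerp_iff σ).2 ?_)
  exact (Finset.sum_eq_zero_iff_of_nonneg h').1 h0.symm

/-- `spanLattice σ` is the preimage of a real subspace, hence saturated in `N`. When `N` is finitely
generated this makes `N_σ` free, so it is separated by the characters in `σ^⊥`. -/
instance (σ : PointedCone ℝ (ℝ ⊗[ℤ] N)) : Module.IsTorsionFree ℤ (QuotLattice σ) := by
  refine Module.IsTorsionFree.of_smul_eq_zero fun k x hx => ?_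
  obtain ⟨n, rfl⟩ := Submodule.Quotient.mk_surjective _ x
  by_contra! hcon
  refine hcon.2 ((Submodule.Quotient.mk_eq_zero _).2 ?_)
  rw [← Submodule.Quotient.mk_smul, Submodule.Quotient.mk_eq_zero] at hx
  have h1 : (1 : ℝ) ⊗ₜ[ℤ] n = (k : ℝ)⁻¹ • ((1 : ℝ) ⊗ₜ[ℤ] (k • n)) := by
    rw [TensorProduct.tmul_smul, ← Int.cast_smul_eq_zsmul ℝ, smul_smul,
      inv_mul_cancel₀ (Int.cast_ne_zero.2 hcon.1), one_smul]
  change (1 : ℝ) ⊗ₜ[ℤ] n ∈ Submodule.span ℝ (σ : Set (ℝ ⊗[ℤ] N))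
  rw [h1]
  exact Submodule.smul_mem _ _ hx

variable [Module.Finite ℤ N]

instance (σ : PointedCone ℝ (ℝ ⊗[ℤ] N)) : Module.Free ℤ (QuotLattice σ) := inferInstance

theorem exists_perp_of_notMem_spanLattice {σ : Δ.Cone} {n : N} (hn : n ∉ spanLattice σ.1) :
    ∃ m : N →ₗ[ℤ] ℤ, IsPerp σ.1 m ∧ m n ≠ 0 := by
  have h0 : (Submodule.Quotient.mk n : QuotLattice σ.1) ≠ 0 := fun h =>
    hn ((Submodule.Quotient.mk_eq_zero _).1 h)
  obtain ⟨f, hf⟩ : ∃ f : Module.Dual ℤ (QuotLattice σ.1), f (Submodule.Quotient.mk n) ≠ 0 := by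
    by_contra! h
    exact h0 ((Module.forall_dual_apply_eq_zero_iff ℤ _).1 h)
  refine ⟨f ∘ₗ (spanLattice σ.1).mkQ, isPerp_of_spanLattice fun n hn => ?_, hf⟩
  have : (spanLattice σ.1).mkQ n = 0 := (Submodule.Quotient.mk_eq_zero _).2 hn
  rw [LinearMap.comp_apply, this, map_zero]

theorem mem_spanLattice_iff {σ : Δ.Cone} {n : N} :
    n ∈ spanLattice σ.1 ↔ ∀ m : N →ₗ[ℤ] ℤ, IsPerp σ.1 m → m n = 0 := by
  refine ⟨fun h m hm => hm.apply_eq_zero h, fun h => ?_⟩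
  by_contra hn
  obtain ⟨m, hm, hmn⟩ := exists_perp_of_notMem_spanLattice hn
  exact hmn (h m hm)

/-- Tensoring `N ∩ Span σ → N → N_σ` with `ℝ` keeps it exact. The coordinates of `N_σ` are
characters in `σ^⊥`, so `x` dies in `ℝ ⊗ N_σ` and comes from `ℝ ⊗ (N ∩ Span σ)`. -/
theorem mem_span_of_pairing_eq_zero {σ : Δ.Cone} {x : ℝ ⊗[ℤ] N}
    (h : ∀ m : N →ₗ[ℤ] ℤ, IsPerp σ.1 m → pairing m x = 0) :
    x ∈ Submodule.span ℝ (σ.1 : Set (ℝ ⊗[ℤ] N)) := by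
  let b := Module.Free.chooseBasis ℤ (QuotLattice σ.1)
  have h0 : (spanLattice σ.1).mkQ.lTensor ℝ x = 0 := by
    apply (b.baseChange ℝ).ext_elem
    intro i
    rw [map_zero, Finsupp.zero_apply]
    have hm : IsPerp σ.1 ((b.coord i) ∘ₗ (spanLattice σ.1).mkQ) :=
      isPerp_of_spanLattice fun n hn => by
        have : (spanLattice σ.1).mkQ n = 0 := (Submodule.Quotient.mk_eq_zero _).2 hn
        rw [LinearMap.comp_apply, this, map_zero]
    refine Eq.trans ?_ (h _ hm)
    clear h
    induction x using TensorProduct.induction_on with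
    | zero => simp
    | tmul r n => rw [pairing_tmul]; simp [Algebra.smul_def, mul_comm]
    | add x y hx hy => rw [map_add, map_add, map_add, Finsupp.add_apply, hx, hy]
  have key : ∀ y, (spanLattice σ.1).subtype.lTensor ℝ y ∈
      Submodule.span ℝ (σ.1 : Set (ℝ ⊗[ℤ] N)) := fun y => by
    induction y using TensorProduct.induction_on with
    | zero => simp
    | tmul r n =>
      have : (spanLattice σ.1).subtype.lTensor ℝ (r ⊗ₜ n) = r • ((1 : ℝ) ⊗ₜ[ℤ] (n : N)) := by
        simp [TensorProduct.smul_tmul']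
      rw [this]
      exact Submodule.smul_mem _ _ n.2
    | add x y hx hy =>
      rw [map_add]
      exact Submodule.add_mem _ hx hy
  obtain ⟨y, rfl⟩ := (lTensor_exact ℝ (LinearMap.exact_subtype_mkQ (spanLattice σ.1))
    (Submodule.mkQ_surjective _) x).1 h0
  exact key y

/-- Finitely many strict linear inequalities define an open set, which contains a rational point as
soon as it is nonempty; the inequalities being homogeneous, denominators can be cleared. -/
theorem exists_int_functional {ι : Type*} [Fintype ι] (B : Finset (ι → ℤ)) (a : ι → ℝ)
    (h : ∀ b ∈ B, 0 < ∑ i, a i * (b i : ℝ)) : ∃ k : ι → ℤ, ∀ b ∈ B, 0 < ∑ i, k i * b i := by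
  have hopen : IsOpen {a : ι → ℝ | ∀ b ∈ B, 0 < ∑ i, a i * (b i : ℝ)} := by
    simp only [Set.ofPred_forall]
    exact isOpen_biInter_finset fun b _ => isOpen_lt continuous_const (by fun_prop)
  have hd : DenseRange (fun (q : ι → ℚ) (i : ι) => (q i : ℝ)) :=
    DenseRange.piMap (fun _ => Rat.denseRange_cast)
  obtain ⟨q, hq⟩ := hd.exists_mem_open hopen ⟨a, h⟩
  let D : ℕ := ∏ i, (q i).den
  have hD : 0 < D := Finset.prod_pos fun i _ => (q i).den_pos
  have hk : ∀ i, ∃ k : ℤ, (k : ℝ) = D * (q i : ℝ) := fun i => by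
    obtain ⟨c, hc⟩ : (q i).den ∣ D := Finset.dvd_prod_of_mem (fun i => (q i).den) (Finset.mem_univ i)
    refine ⟨c * (q i).num, ?_⟩
    rw [hc]
    push_cast
    have : ((q i : ℚ) : ℝ) * ((q i).den : ℝ) = (q i).num := by exact_mod_cast Rat.mul_den_eq_num (q i)
    rw [← this]; ring
  choose k hk using hk
  refine ⟨k, fun b hb => ?_⟩
  have h1 : (0 : ℝ) < D * ∑ i, (q i : ℝ) * (b i : ℝ) := mul_pos (by exact_mod_cast hD) (hq b hb)
  have h2 : ((∑ i, k i * b i : ℤ) : ℝ) = D * ∑ i, (q i : ℝ) * (b i : ℝ) := by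
    push_cast
    rw [Finset.mul_sum]
    exact Finset.sum_congr rfl fun i _ => by rw [hk]; ring
  rw [← h2] at h1
  exact_mod_cast h1

/-- In the coordinates of `N_τ`, the convex hull of the generators of `σ` outside `τ` is compact
and, because `τ` is a face, misses the origin. A separating functional exists by Hahn–Banach and can
be made integral by `exists_int_functional`. -/
theorem exists_face_functional {τ σ : Δ.Cone} (h : τ ≤ σ) : ∃ m ∈ dualMonoid σ.1,
    IsPerp τ.1 m ∧ ∀ s ∈ gens σ, (1 : ℝ) ⊗ₜ[ℤ] s ∉ τ.1 → 0 < m s := by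
  classical
  let b := Module.Free.chooseBasis ℤ (QuotLattice τ.1)
  let c : Module.Free.ChooseBasisIndex ℤ (QuotLattice τ.1) → (N →ₗ[ℤ] ℤ) := fun i =>
    (b.coord i) ∘ₗ (spanLattice τ.1).mkQ
  have hc : ∀ i, IsPerp τ.1 (c i) := fun i => isPerp_of_spanLattice fun n hn => by
    have : (spanLattice τ.1).mkQ n = 0 := (Submodule.Quotient.mk_eq_zero _).2 hn
    rw [LinearMap.comp_apply, this, map_zero]
  let Φ : (ℝ ⊗[ℤ] N) →ₗ[ℝ] (Module.Free.ChooseBasisIndex ℤ (QuotLattice τ.1) → ℝ) :=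
    LinearMap.pi fun i => pairing (c i)
  have hΦ : ∀ x, Φ x = 0 → x ∈ Submodule.span ℝ (τ.1 : Set (ℝ ⊗[ℤ] N)) := fun x hx =>
    mem_span_of_pairing_eq_zero fun m hm => by
      have hm' : m = ∑ i, ((spanLattice τ.1).liftQ m fun n hn => hm.apply_eq_zero hn) (b i) • c i := by
        ext n
        have := b.sum_repr (Submodule.Quotient.mk n)
        have h2 := congrArg ((spanLattice τ.1).liftQ m fun n hn => hm.apply_eq_zero hn) this
        rw [map_sum] at h2
        refine Eq.trans h2.symm ?_
        simp [c, mul_comm]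
      have : pairing m x = ∑ i, (((spanLattice τ.1).liftQ m fun n hn => hm.apply_eq_zero hn) (b i) : ℝ) *
          pairing (c i) x := by
        conv_lhs => rw [hm']
        clear hx hm'
        induction x using TensorProduct.induction_on with
        | zero => simp
        | tmul r n =>
          simp only [pairing_tmul, LinearMap.sum_apply, LinearMap.smul_apply]
          push_cast
          rw [Finset.mul_sum]
          exact Finset.sum_congr rfl fun i _ => by simp; ring
        | add x y hx hy =>
          simp only [map_add, mul_add, Finset.sum_add_distrib]
          rw [hx, hy]
      rw [this]
      refine Finset.sum_eq_zero fun i _ => ?_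
      have : pairing (c i) x = 0 := congrFun hx i
      rw [this, mul_zero]
  let B : Finset N := (gens σ).filter fun s => (1 : ℝ) ⊗ₜ[ℤ] s ∉ τ.1
  let B' : Finset (ℝ ⊗[ℤ] N) := B.image fun s => (1 : ℝ) ⊗ₜ[ℤ] s
  have h0 : (0 : Module.Free.ChooseBasisIndex ℤ (QuotLattice τ.1) → ℝ) ∉ Φ '' (convexHull ℝ (B' : Set (ℝ ⊗[ℤ] N))) := by
    -- A convex combination lying in the span of `τ` equals `t₁ - t₂` with both terms in `τ`. Adding
    -- `t₂` gives the element `t₁` of `τ`, written as a positive multiple of one generator `y` plus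
    -- an element of `σ`; the face property puts `y` in `τ`, a contradiction.
    rintro ⟨x, hx, hx0⟩
    obtain ⟨t₁, ht₁, t₂, ht₂, rfl⟩ := exists_sub_of_mem_span (hΦ x hx0)
    obtain ⟨w, hw0, hw1, hw⟩ := Finset.mem_convexHull'.1 hx
    have hB' : ∀ y ∈ B', y ∈ σ.1 ∧ y ∉ τ.1 := fun y hy => by
      obtain ⟨s, hs, rfl⟩ := Finset.mem_image.1 hy
      obtain ⟨hs, hs'⟩ := Finset.mem_filter.1 hs
      exact ⟨gens_mem hs, hs'⟩
    obtain ⟨y, hy, hy0⟩ : ∃ y ∈ B', 0 < w y := by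
      by_contra! hcon
      have : ∑ y ∈ B', w y ≤ 0 := Finset.sum_nonpos hcon
      linarith
    refine (hB' y hy).2 ((isFaceOf_of_le h).mem_of_smul_add_mem (a := w y)
      (y := ∑ z ∈ B'.erase y, w z • z + t₂) (hB' y hy).1 ?_ hy0 ?_)
    · refine σ.1.add_mem (Submodule.sum_mem _ fun z hz => ?_) (h ht₂)
      have hz' := Finset.mem_of_mem_erase hz
      exact σ.1.smul_mem (hw0 z hz') (hB' z hz').1
    · rw [← add_assoc, Finset.add_sum_erase _ (fun z => w z • z) hy, hw, sub_add_cancel]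
      exact ht₁
  rw [LinearMap.image_convexHull] at h0
  have hfin : (Φ '' (B' : Set (ℝ ⊗[ℤ] N))).Finite := (Finset.finite_toSet B').image _
  obtain ⟨f, u, hfu, hf⟩ := geometric_hahn_banach_point_closed (convex_convexHull ℝ _)
    (hfin.isCompact_convexHull (𝕜 := ℝ)).isClosed h0
  rw [map_zero] at hfu
  obtain ⟨k, hk⟩ := exists_int_functional (B.image fun s i => c i s) (fun i => f (Pi.single i 1))
    (fun b hb => by
      obtain ⟨s, hs, rfl⟩ := Finset.mem_image.1 hb
      have h1 := hf (Φ ((1 : ℝ) ⊗ₜ s)) (subset_convexHull ℝ _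
        ⟨_, Finset.mem_coe.2 (Finset.mem_image_of_mem _ hs), rfl⟩)
      have h2 : f (Φ ((1 : ℝ) ⊗ₜ s)) = ∑ i, f (Pi.single i 1) * (c i s : ℝ) := by
        conv_lhs => rw [pi_eq_sum_univ' (Φ ((1 : ℝ) ⊗ₜ s)), map_sum]
        refine Finset.sum_congr rfl fun i _ => ?_
        rw [map_smul]
        have : Φ ((1 : ℝ) ⊗ₜ s) i = (c i s : ℝ) := by
          rw [LinearMap.pi_apply, pairing_tmul, one_mul]
        rw [this, smul_eq_mul, mul_comm]
      rw [← h2]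
      linarith)
  have hperp : IsPerp τ.1 (∑ i, k i • c i) := (isPerp_iff τ).2 fun s hs => by
    rw [LinearMap.sum_apply]
    refine Finset.sum_eq_zero fun i _ => ?_
    rw [LinearMap.smul_apply, (isPerp_iff τ).1 (hc i) s hs, smul_zero]
  have hpos : ∀ s ∈ gens σ, (1 : ℝ) ⊗ₜ[ℤ] s ∉ τ.1 → 0 < (∑ i, k i • c i) s := fun s hs hs' => by
    have := hk _ (Finset.mem_image_of_mem _ (Finset.mem_filter.2 ⟨hs, hs'⟩))
    simpa using this
  refine ⟨_, (mem_dualMonoid_iff σ).2 fun s hs => ?_, hperp, hpos⟩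
  by_cases hs' : (1 : ℝ) ⊗ₜ[ℤ] s ∈ τ.1
  · have := hperp _ hs'
    rw [pairing_tmul, one_mul] at this
    exact (by exact_mod_cast this.ge)
  · exact (hpos s hs hs').le

end Geometry

end ToricLC

end

noncomputable section

namespace ToricLC

/-! ### The topology of the toric variety -/

section Charts

variable {N : Type} [AddCommGroup N] {Δ : Fan N}

/-- The exponent `m ∈ σ^∨ ∩ M` cuts out the face `τ` of `σ`. -/
structure CutsFace (τ σ : Δ.Cone) (m : N →ₗ[ℤ] ℤ) : Prop where
  mem : m ∈ dualMonoid σ.1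
  perp : IsPerp τ.1 m
  pos : ∀ s ∈ gens σ, (1 : ℝ) ⊗ₜ[ℤ] s ∉ τ.1 → 0 < m s

/-- This is what makes the coordinate ring of `U_τ` the localization of that of `U_σ` at the
monomial `m₀`. -/
theorem CutsFace.exists_add_mem {τ σ : Δ.Cone} {m₀ : N →ₗ[ℤ] ℤ} (h : CutsFace τ σ m₀)
    {m : N →ₗ[ℤ] ℤ} (hm : m ∈ dualMonoid τ.1) : ∃ k : ℕ, m + k • m₀ ∈ dualMonoid σ.1 := by
  -- On the generators outside `τ` the integer `m₀ s` is at least `1`, so any multiple that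
  -- dominates every `|m s|` is enough; on those in `τ` nothing needs correcting.
  refine ⟨∑ s ∈ gens σ, (m s).natAbs, (mem_dualMonoid_iff σ).2 fun s hs => ?_⟩
  rw [LinearMap.add_apply, LinearMap.smul_apply]
  by_cases hs' : (1 : ℝ) ⊗ₜ[ℤ] s ∈ τ.1
  · have h1 := hm _ hs'
    have h2 := h.perp _ hs'
    rw [pairing_tmul, one_mul] at h1 h2
    have h1' : 0 ≤ m s := by exact_mod_cast h1
    have h2' : m₀ s = 0 := by exact_mod_cast h2
    simpa [h2'] using h1'
  · have h1 := h.pos s hs hs'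
    have h2 : ((m s).natAbs : ℤ) ≤ ((∑ s ∈ gens σ, (m s).natAbs : ℕ) : ℤ) := by
      exact_mod_cast Finset.single_le_sum (f := fun s => (m s).natAbs) (fun _ _ => Nat.zero_le _) hs
    rw [nsmul_eq_mul]
    have h3 : -((m s).natAbs : ℤ) ≤ m s := by
      rw [Int.natCast_natAbs]
      exact neg_abs_le _
    nlinarith [Int.natCast_nonneg (∑ s ∈ gens σ, (m s).natAbs)]

theorem CutsFace.le_of_perp {τ σ : Δ.Cone} {m₀ : N →ₗ[ℤ] ℤ} (h : CutsFace τ σ m₀)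
    (h0 : IsPerp σ.1 m₀) : σ ≤ τ := le_of_gens_mem fun s hs => by
  by_contra hcon
  exact (h.pos s hs hcon).ne' ((isPerp_iff σ).1 h0 s hs)

theorem exists_cutsFace [Module.Finite ℤ N] {τ σ : Δ.Cone} (h : τ ≤ σ) :
    ∃ m, CutsFace τ σ m := by
  obtain ⟨m, h1, h2, h3⟩ := exists_face_functional h
  exact ⟨m, h1, h2, h3⟩

namespace AffineToric

variable {σ τ : PointedCone ℝ (ℝ ⊗[ℤ] N)}

theorem eval_mk_add (x : AffineToric σ) {m m' : N →ₗ[ℤ] ℤ} (hm : m ∈ dualMonoid σ)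
    (hm' : m' ∈ dualMonoid σ) (h : m + m' ∈ dualMonoid σ) :
    x.eval ⟨m + m', h⟩ = x.eval ⟨m, hm⟩ * x.eval ⟨m', hm'⟩ := x.eval_add ⟨m, hm⟩ ⟨m', hm'⟩

theorem eval_nsmul (x : AffineToric σ) (m : dualMonoid σ) (k : ℕ) :
    x.eval (k • m) = x.eval m ^ k := by
  induction k with
  | zero => simp
  | succ k ih => rw [succ_nsmul, eval_add, ih, pow_succ]

theorem eval_mk_add_nsmul (x : AffineToric σ) {m m' : N →ₗ[ℤ] ℤ} (hm : m ∈ dualMonoid σ)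
    (hm' : m' ∈ dualMonoid σ) (k : ℕ) (h : m + k • m' ∈ dualMonoid σ) :
    x.eval ⟨m + k • m', h⟩ = x.eval ⟨m, hm⟩ * x.eval ⟨m', hm'⟩ ^ k := by
  rw [← eval_nsmul, ← eval_add]
  rfl

theorem eval_ne_zero_of_perp (x : AffineToric σ) {m : N →ₗ[ℤ] ℤ} (hm : IsPerp σ m)
    (h : m ∈ dualMonoid σ) : x.eval ⟨m, h⟩ ≠ 0 := by
  have hneg : -m ∈ dualMonoid σ := fun y hy => by
    have h1 := pairing_add m (-m) y
    rw [add_neg_cancel, pairing_zero, hm y hy, zero_add] at h1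
    exact h1.le
  intro h0
  have h1 := x.eval_mk_add h hneg (by rw [add_neg_cancel]; exact zero_mem _)
  rw [h0, zero_mul] at h1
  have h2 : x.eval ⟨m + -m, by rw [add_neg_cancel]; exact zero_mem _⟩ = x.eval 0 := by
    congr 1
    exact Subtype.ext (add_neg_cancel m)
  rw [h2, eval_zero] at h1
  exact one_ne_zero h1

@[simp] theorem eval_incl (h : τ ≤ σ) (x : AffineToric τ) (m : dualMonoid σ) :
    (x.incl h).eval m = x.eval ⟨m.1, dualMonoid_anti h m.2⟩ := rfl

theorem continuous_incl (h : τ ≤ σ) : Continuous (incl h) :=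
  continuous_iff.2 fun m => continuous_eval (σ := τ) ⟨m.1, dualMonoid_anti h m.2⟩

end AffineToric

variable {τ σ : Δ.Cone} {m₀ : N →ₗ[ℤ] ℤ}

/-- Cross-multiplied form of the independence of `k` of the fraction `x(m + k m₀) / x(m₀)^k`, which
is the value at `m` of the point restricted to `U_τ`. -/
theorem eval_shift (x : AffineToric σ.1) (h0 : m₀ ∈ dualMonoid σ.1) {m : N →ₗ[ℤ] ℤ} {k l : ℕ}
    (hk : m + k • m₀ ∈ dualMonoid σ.1) (hl : m + l • m₀ ∈ dualMonoid σ.1) :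
    x.eval ⟨m + k • m₀, hk⟩ * x.eval ⟨m₀, h0⟩ ^ l =
      x.eval ⟨m + l • m₀, hl⟩ * x.eval ⟨m₀, h0⟩ ^ k := by
  rw [← AffineToric.eval_nsmul, ← AffineToric.eval_nsmul, ← AffineToric.eval_add,
    ← AffineToric.eval_add]
  congr 1
  apply Subtype.ext
  change m + k • m₀ + l • m₀ = m + l • m₀ + k • m₀
  abel

/-- The point of `U_τ` given by a point of `U_σ` at which the exponent cutting out `τ` does not
vanish. -/
def CutsFace.restrict (h : CutsFace τ σ m₀) (x : AffineToric σ.1)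
    (hx : x.eval ⟨m₀, h.mem⟩ ≠ 0) : AffineToric τ.1 :=
  AffineToric.mk (fun m => x.eval ⟨_, (h.exists_add_mem m.2).choose_spec⟩ /
      x.eval ⟨m₀, h.mem⟩ ^ (h.exists_add_mem m.2).choose)
    (by
      rw [div_eq_one_iff_eq (pow_ne_zero _ hx)]
      have := eval_shift x h.mem (l := 0) (h.exists_add_mem (zero_mem _)).choose_spec
        (by rw [zero_nsmul, add_zero]; exact zero_mem _)
      rw [pow_zero, mul_one] at this
      refine this.trans ?_
      have h1 : x.eval ⟨0 + 0 • m₀, by rw [zero_nsmul, add_zero]; exact zero_mem _⟩ = x.eval 0 := by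
        congr 1
        apply Subtype.ext
        simp
      rw [h1, AffineToric.eval_zero, one_mul])
    (fun m m' => by
      rw [div_mul_div_comm, ← pow_add, div_eq_div_iff (pow_ne_zero _ hx) (pow_ne_zero _ hx),
        ← AffineToric.eval_add, ← AffineToric.eval_nsmul, ← AffineToric.eval_nsmul,
        ← AffineToric.eval_add, ← AffineToric.eval_add]
      congr 1
      apply Subtype.ext
      simp only [AddSubmonoid.coe_add, AddSubmonoidClass.coe_nsmul]
      module)

theorem CutsFace.eval_restrict (h : CutsFace τ σ m₀) (x : AffineToric σ.1)
    (hx : x.eval ⟨m₀, h.mem⟩ ≠ 0) (m : dualMonoid τ.1) (k : ℕ)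
    (hk : m.1 + k • m₀ ∈ dualMonoid σ.1) :
    (h.restrict x hx).eval m = x.eval ⟨_, hk⟩ / x.eval ⟨m₀, h.mem⟩ ^ k := by
  refine (div_eq_div_iff (pow_ne_zero _ hx) (pow_ne_zero _ hx)).2 ?_
  exact eval_shift x h.mem _ _

theorem CutsFace.incl_restrict (h : CutsFace τ σ m₀) (hle : τ ≤ σ) (x : AffineToric σ.1)
    (hx : x.eval ⟨m₀, h.mem⟩ ≠ 0) : (h.restrict x hx).incl hle = x := by
  refine AffineToric.ext fun m => ?_
  rw [AffineToric.eval_incl, h.eval_restrict x hx _ 0 (by simp)]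
  simp

theorem CutsFace.eval_incl_ne_zero (h : CutsFace τ σ m₀) (hle : τ ≤ σ) (z : AffineToric τ.1) :
    (z.incl hle).eval ⟨m₀, h.mem⟩ ≠ 0 := z.eval_ne_zero_of_perp h.perp _

theorem CutsFace.restrict_incl (h : CutsFace τ σ m₀) (hle : τ ≤ σ) (z : AffineToric τ.1) :
    h.restrict (z.incl hle) (h.eval_incl_ne_zero hle z) = z := by
  refine AffineToric.ext fun m => ?_
  obtain ⟨k, hk⟩ := h.exists_add_mem m.2
  rw [h.eval_restrict _ _ m k hk, div_eq_iff (pow_ne_zero _ (h.eval_incl_ne_zero hle z))]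
  rw [AffineToric.eval_incl, AffineToric.eval_incl]
  exact z.eval_mk_add_nsmul m.2 (dualMonoid_anti hle h.mem) k _

/-- The inclusion identifies `U_τ` with the open locus where the monomial `m₀` does not vanish; the
inverse `restrict` is continuous there, its coordinates being quotients by powers of that monomial.
-/
theorem CutsFace.isOpenMap_incl (h : CutsFace τ σ m₀) (hle : τ ≤ σ) :
    IsOpenMap (AffineToric.incl (show τ.1 ≤ σ.1 from hle)) := by
  intro W hW
  let S : Set (AffineToric σ.1) := {x | x.eval ⟨m₀, h.mem⟩ ≠ 0}
  have hS : IsOpen S := isOpen_ne.preimage (AffineToric.continuous_eval _)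
  let g : S → AffineToric τ.1 := fun x => h.restrict x.1 x.2
  have hg : Continuous g := by
    refine AffineToric.continuous_iff.2 fun m => ?_
    obtain ⟨k, hk⟩ := h.exists_add_mem m.2
    refine Continuous.congr ?_ fun x => (h.eval_restrict x.1 x.2 m k hk).symm
    exact ((AffineToric.continuous_eval _).comp continuous_subtype_val).div
      (((AffineToric.continuous_eval _).comp continuous_subtype_val).pow k)
      fun x => pow_ne_zero _ x.2
  have : AffineToric.incl (show τ.1 ≤ σ.1 from hle) '' W = Subtype.val '' (g ⁻¹' W) := by
    ext x
    constructor
    · rintro ⟨z, hz, rfl⟩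
      exact ⟨⟨_, h.eval_incl_ne_zero hle z⟩, by
        rw [Set.mem_preimage]; change h.restrict _ _ ∈ W; rwa [h.restrict_incl hle z], rfl⟩
    · rintro ⟨x, hx, rfl⟩
      exact ⟨_, hx, h.incl_restrict hle x.1 x.2⟩
  rw [this]
  exact hS.isOpenMap_subtype_val _ (hW.preimage hg)

theorem chart_incl (hle : τ ≤ σ) (z : AffineToric τ.1) : chart σ (z.incl hle) = chart τ z :=
  (Quot.sound (GlueRel.glue hle z)).symm

/-- Every point of `U_σ` lies in `U_τ` for a face `τ` such that only the exponents in `τ^⊥` do not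
vanish at it. -/
theorem exists_face_of_point (x : AffineToric σ.1) : ∃ (τ : Δ.Cone) (h : τ ≤ σ)
    (z : AffineToric τ.1), z.incl h = x ∧ ∀ m : dualMonoid τ.1, z.eval m ≠ 0 → IsPerp τ.1 m.1 := by
  classical
  let Z : AddSubmonoid (N →ₗ[ℤ] ℤ) :=
    { carrier := {m | ∃ h : m ∈ dualMonoid σ.1, x.eval ⟨m, h⟩ ≠ 0}
      zero_mem' := ⟨zero_mem _, by
        have : x.eval ⟨0, zero_mem _⟩ = 1 := x.eval_zero
        rw [this]; exact one_ne_zero⟩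
      add_mem' := by
        rintro m m' ⟨h, hx⟩ ⟨h', hx'⟩
        refine ⟨add_mem h h', ?_⟩
        rw [x.eval_mk_add h h']
        exact mul_ne_zero hx hx' }
  -- The face orthogonal to all exponents that do not vanish at `x`. It is a face because these
  -- exponents are nonnegative on `σ`.
  let τ' : PointedCone ℝ (ℝ ⊗[ℤ] N) :=
    { carrier := {y | y ∈ σ.1 ∧ ∀ m ∈ Z, pairing m y = 0}
      zero_mem' := ⟨σ.1.zero_mem, fun m _ => map_zero _⟩
      add_mem' := fun {y y'} h h' => ⟨σ.1.add_mem h.1 h'.1, fun m hm => by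
        rw [map_add, h.2 m hm, h'.2 m hm, add_zero]⟩
      smul_mem' := fun c y h => ⟨Submodule.smul_mem _ c h.1, fun m hm => by
        have : pairing m (c • y) = (c : ℝ) • pairing m y := map_smul _ (c : ℝ) y
        rw [this, h.2 m hm, smul_zero]⟩ }
  have hτ' : τ'.IsFaceOf σ.1 := by
    refine ⟨fun y hy => hy.1, fun {y y' a} hy hy' ha h => ⟨hy, fun m hm => ?_⟩⟩
    have h1 := h.2 m hm
    rw [map_add, map_smul, smul_eq_mul] at h1
    have h2 := hm.1 y hy
    have h3 := hm.1 y' hy'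
    have h4 : a * pairing m y = 0 := by nlinarith
    exact (mul_eq_zero.1 h4).resolve_left ha.ne'
  let τ : Δ.Cone := ⟨τ', Δ.face_mem σ.1 σ.2 τ' hτ'⟩
  have hle : τ ≤ σ := fun y hy => hy.1
  -- Every generator outside `τ'` is detected by some nonvanishing exponent. The sum of the chosen
  -- exponents is still nonvanishing at `x`, and it cuts out `τ'`; for the other vectors the choice
  -- is `0`.
  have hf : ∀ s : N, ∃ m ∈ Z, s ∈ gens σ → (1 : ℝ) ⊗ₜ[ℤ] s ∉ τ' → m s ≠ 0 := fun s => by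
    by_cases hs : s ∈ gens σ ∧ (1 : ℝ) ⊗ₜ[ℤ] s ∉ τ'
    · have h1 : ¬ ∀ m ∈ Z, pairing m ((1 : ℝ) ⊗ₜ[ℤ] s) = 0 := fun h => hs.2 ⟨gens_mem hs.1, h⟩
      push Not at h1
      obtain ⟨m, hm, hms⟩ := h1
      refine ⟨m, hm, fun _ _ h0 => hms ?_⟩
      rw [pairing_tmul, h0, Int.cast_zero, mul_zero]
    · exact ⟨0, zero_mem _, fun h1 h2 => (hs ⟨h1, h2⟩).elim⟩
  choose f hfZ hf using hf
  have hm₀Z : ∑ s ∈ gens σ, f s ∈ Z := sum_mem fun s _ => hfZ s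
  have hnn : ∀ s ∈ gens σ, ∀ s', 0 ≤ f s' s := fun s hs s' =>
    (mem_dualMonoid_iff σ).1 (hfZ s').1 s hs
  have hcut : CutsFace τ σ (∑ s ∈ gens σ, f s) := by
    refine ⟨hm₀Z.1, fun y hy => hy.2 _ hm₀Z, fun s hs hs' => ?_⟩
    rw [LinearMap.sum_apply]
    exact Finset.sum_pos' (fun s' _ => hnn s hs s')
      ⟨s, hs, lt_of_le_of_ne (hnn s hs s) (hf s hs hs').symm⟩
  refine ⟨τ, hle, hcut.restrict x hm₀Z.2, hcut.incl_restrict hle x _, fun m hm => ?_⟩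
  obtain ⟨k, hk⟩ := hcut.exists_add_mem m.2
  rw [hcut.eval_restrict x hm₀Z.2 m k hk] at hm
  intro y hy
  have h1 := hy.2 _ (⟨hk, fun h0 => hm (by rw [h0, zero_div])⟩ : _ ∈ Z)
  have h2 : ∀ k : ℕ, pairing (k • ∑ s ∈ gens σ, f s) y = 0 := fun k => by
    induction k with
    | zero => rw [zero_nsmul, pairing_zero]
    | succ k ih => rw [succ_nsmul, pairing_add, ih, hcut.perp y hy, add_zero]
  rwa [pairing_add, h2, add_zero] at h1

variable [Module.Finite ℤ N]

theorem isOpenMap_incl (hle : τ ≤ σ) :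
    IsOpenMap (AffineToric.incl (show τ.1 ≤ σ.1 from hle)) := by
  obtain ⟨m₀, h⟩ := exists_cutsFace hle
  exact h.isOpenMap_incl hle

theorem incl_injective (hle : τ ≤ σ) :
    Function.Injective (AffineToric.incl (show τ.1 ≤ σ.1 from hle)) := by
  obtain ⟨m₀, h⟩ := exists_cutsFace hle
  intro x y hxy
  rw [← h.restrict_incl hle x, ← h.restrict_incl hle y]
  congr 1

/-- Inside `U_σ` one has `U_{τ₁} ∩ U_{τ₂} = U_{τ₁ ∩ τ₂}`, since the sum of exponents cutting out
`τ₁` and `τ₂` cuts out `τ₁ ∩ τ₂`. This is what makes the gluing relation transitive. -/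
theorem exists_incl_infCone {τ₁ τ₂ : Δ.Cone} (h₁ : τ₁ ≤ σ) (h₂ : τ₂ ≤ σ) (x₁ : AffineToric τ₁.1)
    (x₂ : AffineToric τ₂.1) (h : x₁.incl h₁ = x₂.incl h₂) : ∃ w : AffineToric (infCone τ₁ τ₂).1,
      w.incl (infCone_le_left τ₁ τ₂) = x₁ ∧ w.incl (infCone_le_right τ₁ τ₂) = x₂ := by
  obtain ⟨m₁, hm₁⟩ := exists_cutsFace h₁
  obtain ⟨m₂, hm₂⟩ := exists_cutsFace h₂
  have hle : infCone τ₁ τ₂ ≤ σ := (infCone_le_left τ₁ τ₂).trans h₁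
  have hm : CutsFace (infCone τ₁ τ₂) σ (m₁ + m₂) := by
    refine ⟨add_mem hm₁.mem hm₂.mem, fun x hx => ?_, fun s hs hs' => ?_⟩
    · rw [pairing_add, hm₁.perp x hx.1, hm₂.perp x hx.2, add_zero]
    · have h1 := (mem_dualMonoid_iff σ).1 hm₁.mem s hs
      have h2 := (mem_dualMonoid_iff σ).1 hm₂.mem s hs
      rw [LinearMap.add_apply]
      by_cases h3 : (1 : ℝ) ⊗ₜ[ℤ] s ∈ τ₁.1
      · have h4 := hm₂.pos s hs fun h4 => hs' ⟨h3, h4⟩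
        lia
      · have h4 := hm₁.pos s hs h3
        lia
  have hne : (x₁.incl h₁).eval ⟨m₁ + m₂, hm.mem⟩ ≠ 0 := by
    rw [AffineToric.eval_mk_add _ hm₁.mem hm₂.mem]
    refine mul_ne_zero (hm₁.eval_incl_ne_zero h₁ x₁) ?_
    rw [h]
    exact hm₂.eval_incl_ne_zero h₂ x₂
  refine ⟨hm.restrict _ hne, incl_injective h₁ ?_, incl_injective h₂ ?_⟩
  · exact hm.incl_restrict hle _ hne
  · rw [← h]
    exact hm.incl_restrict hle _ hne

/-- Having a common preimage in the chart of a smaller cone is already an equivalence relation: two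
such preimages in the middle chart come from the chart of the intersection. Injectivity and openness
of the charts follow. -/
theorem chart_eq_chart_iff {ρ : Δ.Cone} {x : AffineToric σ.1} {y : AffineToric ρ.1} :
    chart σ x = chart ρ y ↔ ∃ (τ : Δ.Cone) (h₁ : τ ≤ σ) (h₂ : τ ≤ ρ) (z : AffineToric τ.1),
      z.incl h₁ = x ∧ z.incl h₂ = y := by
  constructor
  · intro h
    have key : ∀ p q : Σ σ : Δ.Cone, AffineToric σ.1, Relation.EqvGen (GlueRel Δ) p q →
        ∃ (τ : Δ.Cone) (h₁ : τ ≤ p.1) (h₂ : τ ≤ q.1) (z : AffineToric τ.1),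
          z.incl h₁ = p.2 ∧ z.incl h₂ = q.2 := by
      intro p q hpq
      induction hpq with
      | rel p q h =>
        obtain ⟨h, x⟩ := h
        exact ⟨_, le_rfl, h, x, rfl, rfl⟩
      | refl p => exact ⟨_, le_rfl, le_rfl, p.2, rfl, rfl⟩
      | symm p q _ ih =>
        obtain ⟨τ, h₁, h₂, z, hz₁, hz₂⟩ := ih
        exact ⟨τ, h₂, h₁, z, hz₂, hz₁⟩
      | trans p q r _ _ ih ih' =>
        obtain ⟨τ, h₁, h₂, z, hz₁, hz₂⟩ := ih
        obtain ⟨τ', h₁', h₂', z', hz₁', hz₂'⟩ := ih'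
        obtain ⟨w, hw, hw'⟩ := exists_incl_infCone h₂ h₁' z z' (hz₂.trans hz₁'.symm)
        refine ⟨infCone τ τ', (infCone_le_left τ τ').trans h₁, (infCone_le_right τ τ').trans h₂',
          w, ?_, ?_⟩
        · rw [← hz₁, ← hw]; rfl
        · rw [← hz₂', ← hw']; rfl
    exact key ⟨σ, x⟩ ⟨ρ, y⟩ (Quot.eqvGen_exact h)
  · rintro ⟨τ, h₁, h₂, z, rfl, rfl⟩
    rw [chart_incl, chart_incl]

theorem chart_injective (σ : Δ.Cone) : Function.Injective (chart σ) := fun x y h => by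
  obtain ⟨τ, h₁, h₂, z, rfl, rfl⟩ := chart_eq_chart_iff.1 h
  rfl

theorem isOpenMap_chart (σ : Δ.Cone) : IsOpenMap (chart σ) := by
  intro W hW
  have h1 : IsOpen ((Quot.mk (GlueRel Δ)) ⁻¹' (chart σ '' W)) := by
    rw [isOpen_sigma_iff]
    intro ρ
    have h2 : Sigma.mk ρ ⁻¹' (Quot.mk (GlueRel Δ) ⁻¹' (chart σ '' W)) =
        ⋃ (τ : Δ.Cone) (h₁ : τ ≤ σ) (h₂ : τ ≤ ρ), AffineToric.incl (show τ.1 ≤ ρ.1 from h₂) ''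
          (AffineToric.incl (show τ.1 ≤ σ.1 from h₁) ⁻¹' W) := by
      ext y
      simp only [Set.mem_preimage, Set.mem_image, Set.mem_iUnion]
      constructor
      · rintro ⟨x, hx, hxy⟩
        obtain ⟨τ, h₁, h₂, z, rfl, rfl⟩ := chart_eq_chart_iff.1 hxy
        exact ⟨τ, h₁, h₂, z, hx, rfl⟩
      · rintro ⟨τ, h₁, h₂, z, hz, rfl⟩
        refine ⟨_, hz, ?_⟩
        rw [chart_incl]
        exact (chart_incl h₂ z).symm
    rw [h2]
    exact isOpen_iUnion fun τ => isOpen_iUnion fun h₁ => isOpen_iUnion fun h₂ =>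
      isOpenMap_incl h₂ _ (hW.preimage (AffineToric.continuous_incl _))
  exact isQuotientMap_quot_mk.isOpen_preimage.1 h1

theorem isOpenEmbedding_chart (σ : Δ.Cone) : Topology.IsOpenEmbedding (chart σ) :=
  .of_continuous_injective_isOpenMap (continuous_chart σ) (chart_injective σ) (isOpenMap_chart σ)

end Charts

end ToricLC

end

noncomputable section

namespace ToricLC

/-! ### Exponential coordinates on the orbits -/

section Exp

open Filter Topology

/-- The function `z ↦ exp(2πiz)`. -/
def cexp (z : ℂ) : ℂ := Complex.exp (2 * Real.pi * Complex.I * z)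

theorem cexp_add (z w : ℂ) : cexp (z + w) = cexp z * cexp w := by
  rw [cexp, mul_add, Complex.exp_add]; rfl

@[simp] theorem cexp_zero : cexp 0 = 1 := by simp [cexp]

theorem cexp_ne_zero (z : ℂ) : cexp z ≠ 0 := Complex.exp_ne_zero _

theorem cexp_eq_one_iff {z : ℂ} : cexp z = 1 ↔ ∃ k : ℤ, z = k := by
  rw [cexp, Complex.exp_eq_one_iff]
  refine exists_congr fun k => ?_
  have h : (2 * Real.pi * Complex.I : ℂ) ≠ 0 := Complex.two_pi_I_ne_zero
  rw [mul_comm (k : ℂ), mul_right_inj' h]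

theorem cexp_eq_cexp_iff {z w : ℂ} : cexp z = cexp w ↔ ∃ k : ℤ, z - w = k := by
  rw [← cexp_eq_one_iff]
  have h : cexp z = cexp (z - w) * cexp w := by rw [← cexp_add, sub_add_cancel]
  rw [h, mul_eq_right₀ (cexp_ne_zero w)]

theorem cexp_sum {ι : Type*} (s : Finset ι) (f : ι → ℂ) :
    cexp (∑ i ∈ s, f i) = ∏ i ∈ s, cexp (f i) := by
  classical
  induction s using Finset.induction_on with
  | empty => simp
  | insert i s hi ih => rw [Finset.sum_insert hi, Finset.prod_insert hi, cexp_add, ih]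

theorem norm_cexp (z : ℂ) : ‖cexp z‖ = Real.exp (-(2 * Real.pi * z.im)) := by
  rw [cexp, Complex.norm_exp]
  congr 1
  simp

theorem continuous_cexp : Continuous cexp := by
  unfold cexp
  fun_prop

theorem cexp_zsmul (k : ℤ) (z : ℂ) : cexp (k * z) = cexp z ^ k := by
  rw [cexp, cexp, ← Complex.exp_int_mul]
  congr 1
  ring

/-- A right inverse of `z ↦ exp(2πiz)` on the nonzero complex numbers. -/
def clog (z : ℂ) : ℂ := (2 * Real.pi * Complex.I)⁻¹ * Complex.log z

theorem cexp_clog {z : ℂ} (hz : z ≠ 0) : cexp (clog z) = z := by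
  rw [cexp, clog, mul_inv_cancel_left₀ Complex.two_pi_I_ne_zero, Complex.exp_log hz]

@[simp] theorem clog_one : clog 1 = 0 := by simp [clog]

theorem continuousAt_clog_one : ContinuousAt clog 1 :=
  continuousAt_const.mul (continuousAt_clog (by simp))

variable (N : Type) [AddCommGroup N] [Module.Free ℤ N] [Module.Finite ℤ N]

/-- The space `N ⊗ ℂ`, in coordinates with respect to a basis of `N`. -/
abbrev ExpSpace : Type := Module.Free.ChooseBasisIndex ℤ N → ℂ

variable {N}

/-- The pairing of `M` and `N ⊗ ℂ`. -/
def dot (m : N →ₗ[ℤ] ℤ) : ExpSpace N →ₗ[ℂ] ℂ :=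
  ∑ i, (m (Module.Free.chooseBasis ℤ N i) : ℂ) • LinearMap.proj i

theorem dot_apply (m : N →ₗ[ℤ] ℤ) (w : ExpSpace N) :
    dot m w = ∑ i, (m (Module.Free.chooseBasis ℤ N i) : ℂ) * w i := by simp [dot]

theorem dot_add (m m' : N →ₗ[ℤ] ℤ) (w : ExpSpace N) : dot (m + m') w = dot m w + dot m' w := by
  simp [dot_apply, add_mul, Finset.sum_add_distrib]

@[simp] theorem dot_zero_left (w : ExpSpace N) : dot 0 w = 0 := by simp [dot_apply]

theorem continuous_dot (m : N →ₗ[ℤ] ℤ) : Continuous (dot m) :=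
  LinearMap.continuous_of_finiteDimensional _

/-- The inclusion `N → N ⊗ ℂ`. -/
def latticeVec : N →+ ExpSpace N where
  toFun n i := ((Module.Free.chooseBasis ℤ N).repr n i : ℂ)
  map_zero' := by ext i; simp
  map_add' n n' := by ext i; simp

@[simp] theorem dot_latticeVec (m : N →ₗ[ℤ] ℤ) (n : N) : dot m (latticeVec n) = m n := by
  rw [dot_apply]
  conv_rhs => rw [← (Module.Free.chooseBasis ℤ N).sum_repr n, map_sum]
  push_cast
  refine Finset.sum_congr rfl fun i _ => ?_
  rw [map_smul, smul_eq_mul]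
  push_cast
  exact mul_comm _ _

/-- The dual basis of `M`. -/
def dualVec (i : Module.Free.ChooseBasisIndex ℤ N) : N →ₗ[ℤ] ℤ := (Module.Free.chooseBasis ℤ N).coord i

theorem sum_dualVec (m : N →ₗ[ℤ] ℤ) :
    ∑ i, m (Module.Free.chooseBasis ℤ N i) • dualVec i = m := by
  refine (Module.Free.chooseBasis ℤ N).ext fun j => ?_
  simp [dualVec]

/-- The element of `N ⊗ ℂ` corresponding to a homomorphism `M → ℂ`. -/
def ofHom (h : (N →ₗ[ℤ] ℤ) →+ ℂ) : ExpSpace N := fun i => h (dualVec i)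

@[simp] theorem dot_ofHom (h : (N →ₗ[ℤ] ℤ) →+ ℂ) (m : N →ₗ[ℤ] ℤ) : dot m (ofHom h) = h m := by
  rw [dot_apply]
  conv_rhs => rw [← sum_dualVec m, map_sum]
  refine Finset.sum_congr rfl fun i _ => ?_
  rw [map_zsmul, zsmul_eq_mul]
  rfl

/-- The exponential `N ⊗ ℂ → T`. -/
def expTorus (w : ExpSpace N) : Torus N where
  toFun m := Units.mk0 (cexp (dot m.toAdd w)) (cexp_ne_zero _)
  map_one' := by ext; simp
  map_mul' m m' := by ext; simp [dot_add, cexp_add]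

theorem expTorus_apply (w : ExpSpace N) (m : N →ₗ[ℤ] ℤ) :
    (expTorus w (Multiplicative.ofAdd m) : ℂ) = cexp (dot m w) := rfl

theorem torusExp_eq (z : ℂ) (n : N) : torusExp z n = expTorus (z • latticeVec n) :=
  MonoidHom.ext fun m => Units.ext (by
    rw [← ofAdd_toAdd m, expTorus_apply, map_smul, dot_latticeVec]
    change Complex.exp _ = Complex.exp _
    congr 1
    rw [smul_eq_mul, mul_assoc]
    rfl)

theorem expTorus_surjective : Function.Surjective (expTorus (N := N)) := fun t => by
  refine ⟨fun i => clog (t (Multiplicative.ofAdd (dualVec i))), MonoidHom.ext fun m => Units.ext ?_⟩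
  rw [← ofAdd_toAdd m, expTorus_apply, dot_apply]
  conv_rhs => rw [← sum_dualVec m.toAdd]
  rw [cexp_sum, ofAdd_sum, map_prod, Units.coe_prod]
  refine Finset.prod_congr rfl fun i _ => ?_
  rw [cexp_zsmul, cexp_clog (Units.ne_zero _), ofAdd_zsmul, map_zpow, Units.val_zpow_eq_zpow_val]

variable {Δ : Fan N}

/-- The projection `N → N_σ` splits because `N_σ` is free. The transpose of the resulting idempotent
projects `M` onto `σ^⊥`. -/
theorem exists_perp_retraction (σ : Δ.Cone) : ∃ r : N →ₗ[ℤ] N,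
    (∀ n ∈ spanLattice σ.1, r n = 0) ∧ ∀ n, r n - n ∈ spanLattice σ.1 := by
  obtain ⟨s, hs⟩ := Module.projective_lifting_property (spanLattice σ.1).mkQ
    (LinearMap.id (M := QuotLattice σ.1)) (Submodule.mkQ_surjective _)
  refine ⟨s ∘ₗ (spanLattice σ.1).mkQ, fun n hn => ?_, fun n => ?_⟩
  · have : (spanLattice σ.1).mkQ n = 0 := (Submodule.Quotient.mk_eq_zero _).2 hn
    rw [LinearMap.comp_apply, this, map_zero]
  · rw [← Submodule.Quotient.eq]
    exact LinearMap.congr_fun hs _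

/-- A projection `M → σ^⊥ ∩ M`. -/
def perpProj (σ : Δ.Cone) (m : N →ₗ[ℤ] ℤ) : N →ₗ[ℤ] ℤ :=
  m ∘ₗ (exists_perp_retraction σ).choose

theorem isPerp_perpProj (σ : Δ.Cone) (m : N →ₗ[ℤ] ℤ) : IsPerp σ.1 (perpProj σ m) :=
  isPerp_of_spanLattice fun n hn => by
    rw [perpProj, LinearMap.comp_apply, (exists_perp_retraction σ).choose_spec.1 n hn, map_zero]

theorem perpProj_eq_self {σ : Δ.Cone} {m : N →ₗ[ℤ] ℤ} (h : IsPerp σ.1 m) : perpProj σ m = m :=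
  LinearMap.ext fun n => by
    have := h.apply_eq_zero ((exists_perp_retraction σ).choose_spec.2 n)
    rw [map_sub, sub_eq_zero] at this
    exact this

theorem perpProj_add (σ : Δ.Cone) (m m' : N →ₗ[ℤ] ℤ) :
    perpProj σ (m + m') = perpProj σ m + perpProj σ m' := LinearMap.add_comp _ _ _

/-- `σ^⊥ ∩ M` has a finite set of generators, namely the projections of the dual basis. -/
theorem dot_perp {σ : Δ.Cone} {m : N →ₗ[ℤ] ℤ} (h : IsPerp σ.1 m) (w : ExpSpace N) :
    dot m w = ∑ i, (m (Module.Free.chooseBasis ℤ N i) : ℂ) * dot (perpProj σ (dualVec i)) w := by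
  have h1 : m = ∑ i, m (Module.Free.chooseBasis ℤ N i) • perpProj σ (dualVec i) := by
    conv_lhs => rw [← perpProj_eq_self h, ← sum_dualVec m]
    ext n
    simp [perpProj]
  have h2 : ∀ (s : Finset (Module.Free.ChooseBasisIndex ℤ N)) (k : _ → ℤ),
      dot (∑ i ∈ s, k i • perpProj σ (dualVec i)) w =
        ∑ i ∈ s, (k i : ℂ) * dot (perpProj σ (dualVec i)) w := fun s k => by
    simp only [dot_apply, LinearMap.sum_apply, LinearMap.smul_apply, Finset.mul_sum]
    rw [Finset.sum_comm]
    refine Finset.sum_congr rfl fun i _ => ?_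
    push_cast
    rw [Finset.sum_mul]
    exact Finset.sum_congr rfl fun j _ => by rw [zsmul_eq_mul]; push_cast; ring
  conv_lhs => rw [h1]
  exact h2 _ _

/-- The point `exp(2πiw) · x_τ` of `U_τ`. -/
def orbitPt (τ : Δ.Cone) (w : ExpSpace N) : AffineToric τ.1 := (affinePt τ.1).act (expTorus w)

open Classical in
theorem eval_orbitPt (τ : Δ.Cone) (w : ExpSpace N) (m : dualMonoid τ.1) :
    (orbitPt τ w).eval m = if IsPerp τ.1 m.1 then cexp (dot m.1 w) else 0 := by
  change cexp (dot m.1 w) * (if IsPerp τ.1 m.1 then (1 : ℂ) else 0) = _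
  split_ifs <;> simp

/-- The point `exp(2πiw) · x_τ` of the toric variety. -/
def param (τ : Δ.Cone) (w : ExpSpace N) : Variety Δ := chart τ (orbitPt τ w)

theorem param_eq_smul (τ : Δ.Cone) (w : ExpSpace N) : param τ w = expTorus w • pt τ := rfl

@[simp] theorem param_zero (τ : Δ.Cone) : param τ 0 = pt τ := by
  have : expTorus (0 : ExpSpace N) = 1 := MonoidHom.ext fun m => Units.ext (by
    rw [← ofAdd_toAdd m, expTorus_apply]; simp)
  rw [param_eq_smul, this]
  exact one_smul (Torus N) (pt τ)

theorem param_mem_torusOrbit (τ : Δ.Cone) (w : ExpSpace N) : param τ w ∈ torusOrbit τ :=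
  ⟨expTorus w, rfl⟩

theorem exists_param_of_mem_torusOrbit {τ : Δ.Cone} {x : Variety Δ} (hx : x ∈ torusOrbit τ) :
    ∃ w, param τ w = x := by
  obtain ⟨t, rfl⟩ := hx
  obtain ⟨w, rfl⟩ := expTorus_surjective t
  exact ⟨w, rfl⟩

theorem continuous_param (τ : Δ.Cone) : Continuous (param τ) := by
  refine (continuous_chart τ).comp (AffineToric.continuous_iff.2 fun m => ?_)
  simp only [eval_orbitPt]
  split_ifs
  · exact continuous_cexp.comp (continuous_dot _)
  · exact continuous_const

theorem param_eq_chart {τ σ : Δ.Cone} (h : τ ≤ σ) (w : ExpSpace N) :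
    param τ w = chart σ ((orbitPt τ w).incl h) := (chart_incl h _).symm

/-- By `exists_face_of_point` only the exponents of `τ^⊥` survive at the point, for a suitable face
`τ`. Composing its values with the projection `M → τ^⊥` gives an element of the torus, which carries
`x_τ` to the point. -/
theorem exists_param_incl {σ : Δ.Cone} (x : AffineToric σ.1) :
    ∃ (τ : Δ.Cone) (h : τ ≤ σ) (w : ExpSpace N), (orbitPt τ w).incl h = x := by
  obtain ⟨τ, h, z, rfl, hz⟩ := exists_face_of_point x
  have hne : ∀ m : N →ₗ[ℤ] ℤ, z.eval ⟨perpProj τ m, (isPerp_perpProj τ m).mem_dualMonoid⟩ ≠ 0 :=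
    fun m => z.eval_ne_zero_of_perp (isPerp_perpProj τ m) _
  let t : Torus N :=
    { toFun := fun m => Units.mk0 _ (hne m.toAdd)
      map_one' := Units.ext (by
        change z.eval ⟨perpProj τ 0, _⟩ = 1
        rw [← z.eval_zero]
        exact congrArg z.eval (Subtype.ext (LinearMap.zero_comp _)))
      map_mul' := fun m m' => Units.ext (by
        change z.eval ⟨perpProj τ (m.toAdd + m'.toAdd), _⟩ = _ * _
        refine Eq.trans ?_ (z.eval_add _ _)
        exact congrArg z.eval (Subtype.ext (perpProj_add _ _ _))) }
  obtain ⟨w, hw⟩ := expTorus_surjective t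
  refine ⟨τ, h, w, congrArg _ (AffineToric.ext fun m => ?_)⟩
  rw [eval_orbitPt]
  split_ifs with hm
  · rw [← expTorus_apply, hw]
    change z.eval ⟨perpProj τ m.1, _⟩ = _
    exact congrArg z.eval (Subtype.ext (perpProj_eq_self hm))
  · by_contra hcon
    exact hm (hz m (Ne.symm hcon))

theorem exists_param (x : Variety Δ) : ∃ (τ : Δ.Cone) (w : ExpSpace N), param τ w = x := by
  obtain ⟨σ, x⟩ := x
  obtain ⟨τ, h, w, rfl⟩ := exists_param_incl x
  exact ⟨τ, w, param_eq_chart h w⟩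

/-- An integral homomorphism on `τ^⊥` extends to `M` through the projection `perpProj`, and
homomorphisms `M → ℤ` are elements of `N`. -/
theorem exists_lattice_of_int {τ : Δ.Cone} {u : ExpSpace N}
    (h : ∀ m, IsPerp τ.1 m → ∃ k : ℤ, dot m u = k) :
    ∃ n : N, ∀ m, IsPerp τ.1 m → dot m u = m n := by
  choose k hk using fun i => h (perpProj τ (dualVec i)) (isPerp_perpProj τ _)
  refine ⟨∑ i, k i • Module.Free.chooseBasis ℤ N i, fun m hm => ?_⟩
  rw [dot_perp hm, map_sum]
  push_cast
  refine Finset.sum_congr rfl fun i _ => ?_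
  rw [hk, map_smul, smul_eq_mul]
  push_cast
  exact mul_comm _ _

theorem param_eq_param_of_perp {τ : Δ.Cone} {w w' : ExpSpace N}
    (h : ∀ m, IsPerp τ.1 m → cexp (dot m w) = cexp (dot m w')) : param τ w = param τ w' := by
  refine congrArg (chart τ) (AffineToric.ext fun m => ?_)
  rw [eval_orbitPt, eval_orbitPt]
  split_ifs with hm
  · exact h _ hm
  · rfl

/-- Distinct orbits are disjoint: if a point of `O_κ` lies in `U_ρ` with `ρ ≤ κ`, the exponent
cutting out `ρ` does not vanish at it, hence belongs to `κ^⊥`, and this forces `κ = ρ`. -/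
theorem cone_eq_of_param_eq {σ τ : Δ.Cone} {v w : ExpSpace N} (h : param σ v = param τ w) :
    σ = τ := by
  obtain ⟨ρ, h₁, h₂, z, hz₁, hz₂⟩ := chart_eq_chart_iff.1 h
  have key : ∀ (κ : Δ.Cone) (h : ρ ≤ κ) (v : ExpSpace N), z.incl h = orbitPt κ v → κ = ρ := by
    intro κ h v hz
    obtain ⟨m₀, hm₀⟩ := exists_cutsFace h
    have h1 := hm₀.eval_incl_ne_zero h z
    rw [hz, eval_orbitPt] at h1
    split_ifs at h1 with hp
    · exact le_antisymm (hm₀.le_of_perp hp) h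
    · exact (h1 rfl).elim
  rw [key σ h₁ v hz₁, key τ h₂ w hz₂]

theorem cexp_dot_eq_of_param_eq {τ : Δ.Cone} {v w : ExpSpace N} (h : param τ v = param τ w)
    {m : N →ₗ[ℤ] ℤ} (hm : IsPerp τ.1 m) : cexp (dot m v) = cexp (dot m w) := by
  have := congrArg (fun x => x.eval ⟨m, hm.mem_dualMonoid⟩) (chart_injective τ h)
  simpa [eval_orbitPt, hm] using this

theorem exists_lattice_of_param_eq {τ : Δ.Cone} {v w : ExpSpace N} (h : param τ v = param τ w) :
    ∃ n : N, ∀ m, IsPerp τ.1 m → dot m (v - w) = m n :=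
  exists_lattice_of_int fun m hm => by
    rw [map_sub]
    exact cexp_eq_cexp_iff.1 (cexp_dot_eq_of_param_eq h hm)

theorem param_add_latticeVec (τ : Δ.Cone) (w : ExpSpace N) (n : N) :
    param τ (w + latticeVec n) = param τ w :=
  param_eq_param_of_perp fun m _ => by
    rw [map_add, dot_latticeVec, cexp_add, cexp_eq_one_iff.2 ⟨m n, rfl⟩, mul_one]

/-! ### Neighbourhoods of points of the orbits -/

/-- A basic set of exponential coordinates of points of `O_τ` near the point `exp(2πiv) · x_σ`. -/
def nearSet (τ σ : Δ.Cone) (v : ExpSpace N) (E : Finset (dualMonoid σ.1)) (ε : ℝ) :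
    Set (ExpSpace N) :=
  {w | ∀ m ∈ E, (IsPerp σ.1 m.1 → ‖dot m.1 w - dot m.1 v‖ < ε) ∧
    (¬ IsPerp σ.1 m.1 → IsPerp τ.1 m.1 → ε⁻¹ < (dot m.1 w).im)}

theorem nearSet_mono {τ σ : Δ.Cone} {v : ExpSpace N} {E E' : Finset (dualMonoid σ.1)} {ε ε' : ℝ}
    (hE : E' ⊆ E) (hε : 0 < ε) (h : ε ≤ ε') : nearSet τ σ v E ε ⊆ nearSet τ σ v E' ε' :=
  fun _ hw m hm => ⟨fun h1 => ((hw m (hE hm)).1 h1).trans_le h,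
    fun h1 h2 => ((inv_anti₀ hε h).trans_lt ((hw m (hE hm)).2 h1 h2))⟩

theorem convex_nearSet (τ σ : Δ.Cone) (v : ExpSpace N) (E : Finset (dualMonoid σ.1)) (ε : ℝ) :
    Convex ℝ (nearSet τ σ v E ε) := by
  intro w hw w' hw' a b ha hb hab m hm
  have hd : dot m.1 (a • w + b • w') = a • dot m.1 w + b • dot m.1 w' := by
    rw [map_add, LinearMap.map_smul_of_tower, LinearMap.map_smul_of_tower]
  rw [hd]
  constructor
  · intro h
    have := convex_ball (dot m.1 v) ε (mem_ball_iff_norm.2 ((hw m hm).1 h))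
      (mem_ball_iff_norm.2 ((hw' m hm).1 h)) ha hb hab
    exact mem_ball_iff_norm.1 this
  · intro h h'
    have := convex_Ioi (𝕜 := ℝ) ε⁻¹ ((hw m hm).2 h h') ((hw' m hm).2 h h') ha hb hab
    simpa using this

theorem nearSet_nonempty (τ σ : Δ.Cone) (v : ExpSpace N) (E : Finset (dualMonoid σ.1)) {ε : ℝ}
    (hε : 0 < ε) : (nearSet τ σ v E ε).Nonempty := by
  let r : ℝ := ∑ m ∈ E, (ε⁻¹ + |(dot m.1 v).im| + 1)
  have hpos : ∀ m ∈ E, 0 ≤ ε⁻¹ + |(dot m.1 v).im| + 1 := fun m _ => by positivity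
  -- Moving far in the imaginary direction of an interior lattice point of `σ` changes nothing along
  -- `σ^⊥`. Every other exponent of `σ^∨` pairs with that point to at least `1`, so its imaginary
  -- part grows by at least `r`.
  refine ⟨v + (Complex.I * r) • latticeVec (interiorPoint σ), fun m hm => ⟨fun h => ?_, fun h _ => ?_⟩⟩
  · rw [map_add, map_smul, dot_latticeVec, h.apply_eq_zero (interiorPoint_mem σ)]
    simpa using hε
  · have h1 : (1 : ℝ) ≤ m.1 (interiorPoint σ) := by exact_mod_cast apply_interiorPoint_pos m.2 h
    have h2 : ε⁻¹ + |(dot m.1 v).im| + 1 ≤ r := Finset.single_le_sum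
      (f := fun m : dualMonoid σ.1 => ε⁻¹ + |(dot m.1 v).im| + 1) hpos hm
    have h3 : (dot m.1 (v + (Complex.I * r) • latticeVec (interiorPoint σ))).im =
        (dot m.1 v).im + r * (m.1 (interiorPoint σ) : ℝ) := by
      rw [map_add, map_smul, dot_latticeVec]
      simp
    rw [h3]
    have h4 := neg_abs_le (dot m.1 v).im
    have h5 : r ≤ r * (m.1 (interiorPoint σ) : ℝ) :=
      le_mul_of_one_le_right (Finset.sum_nonneg hpos) h1
    linarith

/-- The filter of exponential coordinates of points of `O_τ` tending to `exp(2πiv) · x_σ`. -/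
def near (τ σ : Δ.Cone) (v : ExpSpace N) : Filter (ExpSpace N) :=
  ⨅ q : Finset (dualMonoid σ.1) × Set.Ioi (0 : ℝ), 𝓟 (nearSet τ σ v q.1 q.2)

theorem mem_near_iff {τ σ : Δ.Cone} {v : ExpSpace N} {s : Set (ExpSpace N)} :
    s ∈ near τ σ v ↔ ∃ (E : Finset (dualMonoid σ.1)) (ε : ℝ), 0 < ε ∧ nearSet τ σ v E ε ⊆ s := by
  classical
  have : Nonempty (Finset (dualMonoid σ.1) × Set.Ioi (0 : ℝ)) := ⟨(∅, ⟨1, Set.mem_Ioi.2 one_pos⟩)⟩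
  rw [near, mem_iInf_of_directed]
  · constructor
    · rintro ⟨⟨E, ε⟩, h⟩
      exact ⟨E, ε.1, ε.2, mem_principal.1 h⟩
    · rintro ⟨E, ε, hε, h⟩
      exact ⟨⟨E, ⟨ε, hε⟩⟩, mem_principal.2 h⟩
  · rintro ⟨E, ε⟩ ⟨E', ε'⟩
    have hε : 0 < min ε.1 ε'.1 := lt_min ε.2 ε'.2
    exact ⟨⟨E ∪ E', ⟨min ε.1 ε'.1, hε⟩⟩,
      principal_mono.2 (nearSet_mono Finset.subset_union_left hε (min_le_left _ _)),
      principal_mono.2 (nearSet_mono Finset.subset_union_right hε (min_le_right _ _))⟩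

theorem nearSet_mem_near (τ σ : Δ.Cone) (v : ExpSpace N) (E : Finset (dualMonoid σ.1)) {ε : ℝ}
    (hε : 0 < ε) : nearSet τ σ v E ε ∈ near τ σ v := mem_near_iff.2 ⟨E, ε, hε, subset_rfl⟩

instance (τ σ : Δ.Cone) (v : ExpSpace N) : (near τ σ v).NeBot := by
  refine neBot_iff.2 fun h => ?_
  have : (∅ : Set (ExpSpace N)) ∈ near τ σ v := h ▸ mem_bot
  obtain ⟨E, ε, hε, h⟩ := mem_near_iff.1 this
  obtain ⟨w, hw⟩ := nearSet_nonempty τ σ v E hε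
  exact h hw

theorem tendsto_dot_near {τ σ : Δ.Cone} (v : ExpSpace N) {m : N →ₗ[ℤ] ℤ} (hm : IsPerp σ.1 m) :
    Tendsto (dot m) (near τ σ v) (𝓝 (dot m v)) := by
  rw [Metric.tendsto_nhds]
  intro ε hε
  filter_upwards [nearSet_mem_near τ σ v {⟨m, hm.mem_dualMonoid⟩} hε] with w hw
  rw [dist_eq_norm]
  exact (hw _ (Finset.mem_singleton_self _)).1 hm

theorem tendsto_im_dot_near {τ σ : Δ.Cone} (v : ExpSpace N) {m : N →ₗ[ℤ] ℤ}
    (hm : m ∈ dualMonoid σ.1) (hσ : ¬ IsPerp σ.1 m) (hτ : IsPerp τ.1 m) :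
    Tendsto (fun w => (dot m w).im) (near τ σ v) atTop := by
  rw [tendsto_atTop]
  intro b
  have hε : 0 < (|b| + 1)⁻¹ := by positivity
  filter_upwards [nearSet_mem_near τ σ v {⟨m, hm⟩} hε] with w hw
  have := (hw _ (Finset.mem_singleton_self _)).2 hσ hτ
  rw [inv_inv] at this
  linarith [le_abs_self b]

theorem tendsto_near {τ σ : Δ.Cone} {v : ExpSpace N} {α : Type*} {l : Filter α}
    {f : α → ExpSpace N}
    (h₁ : ∀ m, IsPerp σ.1 m → Tendsto (fun a => dot m (f a)) l (𝓝 (dot m v)))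
    (h₂ : ∀ m ∈ dualMonoid σ.1, ¬ IsPerp σ.1 m → IsPerp τ.1 m →
      Tendsto (fun a => (dot m (f a)).im) l atTop) : Tendsto f l (near τ σ v) := by
  intro s hs
  obtain ⟨E, ε, hε, h⟩ := mem_near_iff.1 hs
  suffices ∀ᶠ a in l, f a ∈ nearSet τ σ v E ε from this.mono fun a ha => h ha
  refine (Filter.eventually_all_finset E).2 fun m _ => ?_
  by_cases hσ : IsPerp σ.1 m.1
  · filter_upwards [Metric.tendsto_nhds.1 (h₁ m.1 hσ) ε hε] with a ha
    exact ⟨fun _ => by rwa [dist_eq_norm] at ha, fun h => (h hσ).elim⟩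
  · by_cases hτ : IsPerp τ.1 m.1
    · filter_upwards [(h₂ m.1 m.2 hσ hτ).eventually_gt_atTop ε⁻¹] with a ha
      exact ⟨fun h => (hσ h).elim, fun _ _ => ha⟩
    · exact Eventually.of_forall fun a => ⟨fun h => (hσ h).elim, fun _ h => (hτ h).elim⟩

theorem nhds_le_near (σ : Δ.Cone) (v : ExpSpace N) : 𝓝 v ≤ near σ σ v :=
  tendsto_near (f := id) (fun m _ => (continuous_dot m).tendsto v) fun _ _ h h' => (h h').elim

/-- The basic sets behave like open sets across strata. Along `σ^⊥`, and along the exponents of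
`τ^⊥`, the coordinates near `w` tend to those of `w`; along the remaining exponents of `ρ^⊥` the
imaginary part tends to infinity. -/
theorem nearSet_mem_near_of_mem {ρ τ σ : Δ.Cone} (h : τ ≤ σ) {v w : ExpSpace N}
    {E : Finset (dualMonoid σ.1)} {ε : ℝ} (hw : w ∈ nearSet τ σ v E ε) :
    nearSet ρ σ v E ε ∈ near ρ τ w := by
  refine (Filter.eventually_all_finset E).2 fun m hm => ?_
  by_cases hσ : IsPerp σ.1 m.1
  · have h1 := (tendsto_dot_near (τ := ρ) w (hσ.mono h)).sub_const (dot m.1 v)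
    filter_upwards [h1.norm.eventually_lt_const ((hw m hm).1 hσ)] with x hx
    exact ⟨fun _ => hx, fun h => (h hσ).elim⟩
  · by_cases hτ : IsPerp τ.1 m.1
    · have h1 := (Complex.continuous_im.tendsto _).comp (tendsto_dot_near (τ := ρ) w hτ)
      filter_upwards [h1.eventually_const_lt ((hw m hm).2 hσ hτ)] with x hx
      exact ⟨fun h => (hσ h).elim, fun _ _ => hx⟩
    · by_cases hρ : IsPerp ρ.1 m.1
      · filter_upwards [(tendsto_im_dot_near (τ := ρ) w (dualMonoid_anti h m.2) hτ
          hρ).eventually_gt_atTop ε⁻¹] with x hx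
        exact ⟨fun h => (hσ h).elim, fun _ _ => hx⟩
      · exact Eventually.of_forall fun a => ⟨fun h => (hσ h).elim, fun _ h => (hρ h).elim⟩

theorem tendsto_add_latticeVec_near (τ σ : Δ.Cone) (v : ExpSpace N) (n : N) :
    Tendsto (· + latticeVec n) (near τ σ v) (near τ σ (v + latticeVec n)) := by
  refine tendsto_near (fun m hm => ?_) fun m hm hσ hτ => ?_
  · simp only [map_add]
    exact (tendsto_dot_near v hm).add_const _
  · simp only [map_add, dot_latticeVec, Complex.add_im, Complex.intCast_im, add_zero]
    exact tendsto_im_dot_near v hm hσ hτ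

theorem tendsto_nsmul_near (τ σ : Δ.Cone) (v : ExpSpace N) {k : ℕ} (hk : 0 < k) :
    Tendsto (k • ·) (near τ σ v) (near τ σ (k • v)) := by
  refine tendsto_near (fun m hm => ?_) fun m hm hσ hτ => ?_
  · simp only [map_nsmul]
    exact (tendsto_dot_near v hm).const_smul k
  · simp only [map_nsmul]
    have : ∀ z : ℂ, (k • z).im = k * z.im := fun z => by simp
    simp only [this]
    exact (tendsto_im_dot_near v hm hσ hτ).const_mul_atTop (by exact_mod_cast hk)

/-- Monomials in `σ^⊥` converge; those in `τ^⊥` only have absolute value `exp(-2π Im)`, which tends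
to `0`; the others vanish identically on `O_τ`. -/
theorem tendsto_orbitPt_near {τ σ : Δ.Cone} (h : τ ≤ σ) (v : ExpSpace N) :
    Tendsto (fun w => (orbitPt τ w).incl h) (near τ σ v) (𝓝 (orbitPt σ v)) := by
  rw [nhds_induced, tendsto_comap_iff, tendsto_pi_nhds]
  intro m
  simp only [Function.comp_def, AffineToric.eval_incl, eval_orbitPt]
  by_cases hσ : IsPerp σ.1 m.1
  · simp only [hσ, hσ.mono h, if_true]
    exact (continuous_cexp.tendsto _).comp (tendsto_dot_near v hσ)
  · by_cases hτ : IsPerp τ.1 m.1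
    · simp only [hσ, hτ, if_true, if_false]
      rw [tendsto_zero_iff_norm_tendsto_zero]
      simp only [norm_cexp]
      refine Real.tendsto_exp_neg_atTop_nhds_zero.comp ?_
      exact (tendsto_im_dot_near v m.2 hσ hτ).const_mul_atTop (by positivity)
    · simp only [hσ, hτ, if_false]
      exact tendsto_const_nhds

theorem tendsto_param_near {τ σ : Δ.Cone} (h : τ ≤ σ) (v : ExpSpace N) :
    Tendsto (param τ) (near τ σ v) (𝓝 (param σ v)) := by
  have := ((continuous_chart σ).tendsto _).comp (tendsto_orbitPt_near h v)
  exact this.congr fun w => (param_eq_chart h w).symm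

/-- A logarithm of the `σ^⊥`-coordinates, continuous at the given point. Each monomial is divided by
its value there, so that the principal branch is only needed near `1`, and the coordinate of `v` is
added back. -/
theorem exists_logCoord (σ : Δ.Cone) (v : ExpSpace N) :
    ∃ ℓ : AffineToric σ.1 → ExpSpace N, Tendsto ℓ (𝓝 (orbitPt σ v)) (𝓝 v) ∧
      ∀ (τ : Δ.Cone) (hle : τ ≤ σ) (w : ExpSpace N) (m : N →ₗ[ℤ] ℤ), IsPerp σ.1 m →
        cexp (dot m (ℓ ((orbitPt τ w).incl hle))) = cexp (dot m w) := by
  have hperp : ∀ m : N →ₗ[ℤ] ℤ, perpProj σ m ∈ dualMonoid σ.1 := fun m =>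
    (isPerp_perpProj σ m).mem_dualMonoid
  refine ⟨fun y i => v i +
    clog (y.eval ⟨perpProj σ (dualVec i), hperp _⟩ * cexp (-dot (perpProj σ (dualVec i)) v)), ?_, ?_⟩
  · rw [tendsto_pi_nhds]
    intro i
    have h0 : (orbitPt σ v).eval ⟨perpProj σ (dualVec i), hperp _⟩ *
        cexp (-dot (perpProj σ (dualVec i)) v) = 1 := by
      rw [eval_orbitPt, if_pos (isPerp_perpProj σ _), ← cexp_add, add_neg_cancel, cexp_zero]
    have h1 : Tendsto (fun y : AffineToric σ.1 => y.eval ⟨perpProj σ (dualVec i), hperp _⟩ *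
        cexp (-dot (perpProj σ (dualVec i)) v)) (𝓝 (orbitPt σ v)) (𝓝 1) := by
      rw [← h0]
      exact ((AffineToric.continuous_eval _).tendsto _).mul_const _
    have h2 := (continuousAt_clog_one.tendsto.comp h1).const_add (v i)
    rwa [clog_one, add_zero] at h2
  · intro τ hle w m hm
    have h2 : ∀ i, ((orbitPt τ w).incl hle).eval ⟨perpProj σ (dualVec i), hperp _⟩ =
        cexp (dot (perpProj σ (dualVec i)) w) := fun i => by
      rw [AffineToric.eval_incl, eval_orbitPt, if_pos ((isPerp_perpProj σ _).mono hle)]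
    simp only [dot_apply m, h2, mul_add, Finset.sum_add_distrib]
    rw [cexp_add, cexp_sum Finset.univ fun i => _ * clog _]
    have h3 : ∀ i, cexp ((m (Module.Free.chooseBasis ℤ N i) : ℂ) *
        clog (cexp (dot (perpProj σ (dualVec i)) w) * cexp (-dot (perpProj σ (dualVec i)) v))) =
        cexp ((m (Module.Free.chooseBasis ℤ N i) : ℂ) * dot (perpProj σ (dualVec i)) (w - v)) := by
      intro i
      rw [cexp_zsmul, cexp_clog (mul_ne_zero (cexp_ne_zero _) (cexp_ne_zero _)), cexp_zsmul,
        ← cexp_add, map_sub, sub_eq_add_neg]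
    rw [Finset.prod_congr rfl fun i _ => h3 i, ← cexp_sum, ← dot_perp hm, ← dot_apply, ← dot_apply,
      ← cexp_add, map_sub, add_sub_cancel]

/-- Exponential coordinates can be corrected to take prescribed values on `σ^⊥`. -/
theorem exists_adjust (σ : Δ.Cone) (a b : ExpSpace N)
    (h : ∀ m, IsPerp σ.1 m → cexp (dot m a) = cexp (dot m b)) :
    ∃ w : ExpSpace N, (∀ m, IsPerp σ.1 m → dot m w = dot m a) ∧
      ∀ m, cexp (dot m w) = cexp (dot m b) := by
  let f : (N →ₗ[ℤ] ℤ) →+ ℂ :=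
    { toFun := fun m => dot (perpProj σ m) a + dot (m - perpProj σ m) b
      map_zero' := by
        have : perpProj σ (0 : N →ₗ[ℤ] ℤ) = 0 := LinearMap.zero_comp _
        simp [this]
      map_add' := fun m m' => by
        rw [perpProj_add, add_sub_add_comm, dot_add, dot_add]
        ring }
  have hf : ∀ m, f m = dot (perpProj σ m) a + dot (m - perpProj σ m) b := fun _ => rfl
  refine ⟨ofHom f, fun m hm => ?_, fun m => ?_⟩
  · rw [dot_ofHom, hf, perpProj_eq_self hm, sub_self, dot_zero_left, add_zero]
  · rw [dot_ofHom, hf, cexp_add, h _ (isPerp_perpProj σ m), ← cexp_add, ← dot_add, add_sub_cancel]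

/-- A neighbourhood of `exp(2πiv) · x_σ` consists of points with exponential coordinates near
`v`. -/
theorem eventually_nhds_param (σ : Δ.Cone) (v : ExpSpace N) (E : Finset (dualMonoid σ.1)) {ε : ℝ}
    (hε : 0 < ε) : ∀ᶠ x in 𝓝 (param σ v), ∃ τ ≤ σ, ∃ w ∈ nearSet τ σ v E ε, param τ w = x := by
  suffices h : ∀ᶠ y in 𝓝 (orbitPt σ v), ∃ τ ≤ σ, ∃ w ∈ nearSet τ σ v E ε, param τ w = chart σ y by
    have := (isOpenMap_chart σ).image_mem_nhds h
    refine mem_of_superset this ?_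
    rintro _ ⟨y, hy, rfl⟩
    exact hy
  obtain ⟨ℓ, hℓ, hcl⟩ := exists_logCoord σ v
  -- The bound `exp(-2πε⁻¹)` is the absolute value of `exp(2πiz)` for `Im z = ε⁻¹`, so smallness of
  -- the monomial means a large imaginary part of any logarithm.
  have hev : ∀ᶠ y in 𝓝 (orbitPt σ v), ∀ m ∈ E,
      (IsPerp σ.1 m.1 → ‖dot m.1 (ℓ y) - dot m.1 v‖ < ε) ∧
      (¬ IsPerp σ.1 m.1 → ‖y.eval m‖ < Real.exp (-(2 * Real.pi * ε⁻¹))) := by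
    refine (Filter.eventually_all_finset E).2 fun m hm => ?_
    by_cases hσ : IsPerp σ.1 m.1
    · have h1 := (((continuous_dot m.1).tendsto v).comp hℓ)
      filter_upwards [Metric.tendsto_nhds.1 h1 ε hε] with y hy
      exact ⟨fun _ => by rwa [dist_eq_norm] at hy, fun h => (h hσ).elim⟩
    · have h1 := ((AffineToric.continuous_eval m).tendsto (orbitPt σ v)).norm
      rw [eval_orbitPt, if_neg hσ, norm_zero] at h1
      filter_upwards [h1.eventually_lt_const (Real.exp_pos _)] with y hy
      exact ⟨fun h => (hσ h).elim, fun _ => hy⟩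
  filter_upwards [hev] with y hy
  obtain ⟨τ, hle, w₀, rfl⟩ := exists_param_incl y
  -- The logarithm `w₀` of the point is arbitrary. It is replaced by one taking the values of the
  -- continuous logarithm on `σ^⊥` and still exponentiating to the same element of the torus.
  obtain ⟨w, hw, hw'⟩ := exists_adjust σ _ w₀ fun m hm => hcl τ hle w₀ m hm
  refine ⟨τ, hle, w, fun m hm => ⟨fun hσ => ?_, fun hσ hτ => ?_⟩, ?_⟩
  · rw [hw _ hσ]
    exact (hy m hm).1 hσ
  · have h1 := (hy m hm).2 hσ
    rw [AffineToric.eval_incl, eval_orbitPt, if_pos hτ, ← hw', norm_cexp, Real.exp_lt_exp] at h1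
    have h2 := Real.pi_pos
    nlinarith
  · rw [chart_incl]
    exact param_eq_param_of_perp fun m _ => hw' m

/-- The neighbourhood filter at a point of `O_σ` is generated stratum by stratum. As the fan is
finite, the conditions for the separate faces merge into one finite set of exponents and one `ε`, to
which `eventually_nhds_param` applies. All later checks of continuity on `X` go through this. -/
theorem eventually_nhds_param_iff {σ : Δ.Cone} {v : ExpSpace N} {P : Variety Δ → Prop} :
    (∀ᶠ x in 𝓝 (param σ v), P x) ↔ ∀ τ ≤ σ, ∀ᶠ w in near τ σ v, P (param τ w) := by
  classical
  constructor
  · exact fun h τ hτ => (tendsto_param_near hτ v).eventually h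
  · intro h
    have := Δ.finite.fintype
    have h' : ∀ τ : Δ.Cone, ∃ (E : Finset (dualMonoid σ.1)) (ε : ℝ), 0 < ε ∧
        (τ ≤ σ → ∀ w ∈ nearSet τ σ v E ε, P (param τ w)) := fun τ => by
      by_cases hτ : τ ≤ σ
      · obtain ⟨E, ε, hε, hw⟩ := mem_near_iff.1 (h τ hτ)
        exact ⟨E, ε, hε, fun _ w hw' => hw hw'⟩
      · exact ⟨∅, 1, one_pos, fun h => (hτ h).elim⟩
    choose E ε hε hP using h'
    obtain ⟨δ, hδ, hδε⟩ : ∃ δ > 0, ∀ τ, δ ≤ ε τ := by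
      rcases isEmpty_or_nonempty Δ.Cone with he | he
      · exact ⟨1, one_pos, fun τ => (he.false τ).elim⟩
      · obtain ⟨τ₀, hτ₀⟩ := Finite.exists_min ε
        exact ⟨ε τ₀, hε τ₀, hτ₀⟩
    filter_upwards [eventually_nhds_param σ v (Finset.univ.biUnion E) hδ]
    rintro _ ⟨τ, hτ, w, hw, rfl⟩
    exact hP τ hτ w (nearSet_mono (Finset.subset_biUnion_of_mem E (Finset.mem_univ τ)) hδ (hδε τ) hw)

end Exp

end ToricLC

end

noncomputable section

namespace ToricLC

/-! ### The étalé space of a sheaf of vector spaces -/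

section Etale

open Filter Topology

variable {Y : TopCat.{0}} {F G : Sh Y}

/-- The étalé space of a sheaf. -/
abbrev Etale (F : Sh Y) : Type := F.presheaf.EtaleSpace

/-- The germ at a point of a section. -/
abbrev germAt (F : Sh Y) {U : Opens Y} (t : F.presheaf.obj (op U)) (x : Y) (hx : x ∈ U) :
    stalk F x := F.presheaf.germ U x hx t

theorem etale_mk_inj {x : Y} {a b : stalk F x} (h : (⟨x, a⟩ : Etale F) = ⟨x, b⟩) : a = b := by
  cases h; rfl

theorem etale_mk_eq_iff {x : Y} {a b : stalk F x} : (⟨x, a⟩ : Etale F) = ⟨x, b⟩ ↔ a = b :=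
  ⟨etale_mk_inj, fun h => by rw [h]⟩

theorem exists_germAt (g : Etale F) :
    ∃ (U : Opens Y) (hU : g.base ∈ U) (t : F.presheaf.obj (op U)),
      g = ⟨g.base, germAt F t g.base hU⟩ := by
  obtain ⟨U, hU, t, ht⟩ := F.presheaf.exists_germ_eq g.germ
  refine ⟨U, hU, t, ?_⟩
  obtain ⟨x, a⟩ := g
  exact etale_mk_eq_iff.2 ht.symm

theorem exists_germAt' {x : Y} (a : stalk F x) :
    ∃ (U : Opens Y) (hU : x ∈ U) (t : F.presheaf.obj (op U)), germAt F t x hU = a :=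
  F.presheaf.exists_germ_eq a

theorem eventually_germAt_eq {U V : Opens Y} {x : Y} (hU : x ∈ U) (hV : x ∈ V)
    {t : F.presheaf.obj (op U)} {t' : F.presheaf.obj (op V)}
    (h : germAt F t x hU = germAt F t' x hV) :
    ∀ᶠ y in 𝓝 x, ∃ (h₁ : y ∈ U) (h₂ : y ∈ V), germAt F t y h₁ = germAt F t' y h₂ := by
  obtain ⟨W, hW, iU, iV, h'⟩ := F.presheaf.germ_eq x hU hV t t' h
  filter_upwards [W.isOpen.mem_nhds hW] with y hy
  refine ⟨iU.le hy, iV.le hy, ?_⟩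
  have h1 := F.presheaf.germ_res_apply iU y hy t
  have h2 := F.presheaf.germ_res_apply iV y hy t'
  exact h1.symm.trans ((congrArg _ h').trans h2)

/-- Sections are open in the étalé space, so convergence to a germ means convergence of base points
together with eventual equality to one representative section. -/
theorem tendsto_etale_iff {α : Type*} {l : Filter α} {g : α → Etale F} {U : Opens Y} {x : Y}
    (hx : x ∈ U) (t : F.presheaf.obj (op U)) :
    Tendsto g l (𝓝 ⟨x, germAt F t x hx⟩) ↔ Tendsto (fun a => (g a).base) l (𝓝 x) ∧
      ∀ᶠ a in l, ∃ h : (g a).base ∈ U, (g a).germ = germAt F t _ h := by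
  constructor
  · intro h
    exact ⟨((TopCat.Presheaf.EtaleSpace.continuous_base F.presheaf).tendsto _).comp h,
      h.eventually (TopCat.Presheaf.EtaleSpace.eventually_nhds ⟨x, germAt F t x hx⟩ hx t rfl)⟩
  · rintro ⟨h₁, h₂⟩
    simp only [TopologicalSpace.nhds_generateFrom, tendsto_iInf, Set.mem_ofPred_eq,
      tendsto_principal]
    rintro _ ⟨hmem, V, f, rfl⟩
    obtain ⟨hV, hVf⟩ := hmem
    filter_upwards [h₂, h₁.eventually (eventually_germAt_eq hx hV hVf)] with a ⟨ha, ha'⟩ ⟨hb, hc, h3⟩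
    exact ⟨hc, ha'.trans h3⟩

/-- The projection to the base is a local homeomorphism, hence injective near the limit. -/
theorem eventually_eq_of_tendsto {α : Type*} {l : Filter α} {g g' : α → Etale F} {e : Etale F}
    (h : Tendsto g l (𝓝 e)) (h' : Tendsto g' l (𝓝 e)) (hb : ∀ a, (g a).base = (g' a).base) :
    ∀ᶠ a in l, g a = g' a := by
  obtain ⟨U, hU, t, ht⟩ := exists_germAt e
  rw [ht] at h h'
  filter_upwards [((tendsto_etale_iff hU t).1 h).2, ((tendsto_etale_iff hU t).1 h').2]
    with a ⟨h1, h2⟩ ⟨h3, h4⟩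
  have hb := hb a
  revert h1 h3
  generalize g a = p at *
  generalize g' a = q at *
  obtain ⟨x, p⟩ := p
  obtain ⟨y, q⟩ := q
  obtain rfl : x = y := hb
  intro h1 h2 h3 h4
  exact etale_mk_eq_iff.2 (h2.trans h4.symm)

theorem tendsto_etale_germ {α : Type*} {l : Filter α} {b : α → Y} {U : Opens Y} {x : Y}
    (hx : x ∈ U) (t : F.presheaf.obj (op U)) (hb : Tendsto b l (𝓝 x)) {s : ∀ a, stalk F (b a)}
    (h : ∀ a, ∀ ha : b a ∈ U, s a = germAt F t _ ha) :
    Tendsto (fun a => (⟨b a, s a⟩ : Etale F)) l (𝓝 ⟨x, germAt F t x hx⟩) :=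
  (tendsto_etale_iff hx t).2 ⟨hb, (hb.eventually (U.isOpen.mem_nhds hx)).mono
    fun a ha => ⟨ha, h a ha⟩⟩

theorem germAt_add {U : Opens Y} (t t' : F.presheaf.obj (op U)) (x : Y) (hx : x ∈ U) :
    germAt F (t + t') x hx = germAt F t x hx + germAt F t' x hx := map_add _ _ _

theorem germAt_smul {U : Opens Y} (c : ℂ) (t : F.presheaf.obj (op U)) (x : Y) (hx : x ∈ U) :
    germAt F (c • t) x hx = c • germAt F t x hx := map_smul _ _ _

theorem germAt_res {U V : Opens Y} (i : U ⟶ V) (t : F.presheaf.obj (op V)) (x : Y) (hx : x ∈ U) :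
    germAt F (F.presheaf.map i.op t) x hx = germAt F t x (i.le hx) :=
  F.presheaf.germ_res_apply i x hx t

theorem tendsto_etale_add {α : Type*} {l : Filter α} {b : α → Y} {x : Y} {s s' : ∀ a, stalk F (b a)}
    {u u' : stalk F x} (h : Tendsto (fun a => (⟨b a, s a⟩ : Etale F)) l (𝓝 ⟨x, u⟩))
    (h' : Tendsto (fun a => (⟨b a, s' a⟩ : Etale F)) l (𝓝 ⟨x, u'⟩)) :
    Tendsto (fun a => (⟨b a, s a + s' a⟩ : Etale F)) l (𝓝 ⟨x, u + u'⟩) := by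
  obtain ⟨U, hU, t, rfl⟩ := exists_germAt' u
  obtain ⟨V, hV, t', rfl⟩ := exists_germAt' u'
  have hUV : x ∈ U ⊓ V := ⟨hU, hV⟩
  have e1 := germAt_res (F := F) (homOfLE inf_le_left : U ⊓ V ⟶ U) t x hUV
  have e2 := germAt_res (F := F) (homOfLE inf_le_right : U ⊓ V ⟶ V) t' x hUV
  rw [← e1] at h ⊢
  rw [← e2] at h' ⊢
  generalize F.presheaf.map _ t = t₁ at *
  generalize F.presheaf.map _ t' = t₂ at *
  rw [← germAt_add]
  rw [tendsto_etale_iff] at h h'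
  rw [tendsto_etale_iff]
  refine ⟨h.1, ?_⟩
  filter_upwards [h.2, h'.2] with a ⟨h1, h2⟩ ⟨h3, h4⟩
  refine ⟨h1, ?_⟩
  rw [germAt_add]
  exact congrArg₂ _ h2 h4

theorem tendsto_etale_smul {α : Type*} {l : Filter α} {b : α → Y} {x : Y} {s : ∀ a, stalk F (b a)}
    {u : stalk F x} (c : ℂ) (h : Tendsto (fun a => (⟨b a, s a⟩ : Etale F)) l (𝓝 ⟨x, u⟩)) :
    Tendsto (fun a => (⟨b a, c • s a⟩ : Etale F)) l (𝓝 ⟨x, c • u⟩) := by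
  obtain ⟨U, hU, t, rfl⟩ := exists_germAt' u
  rw [← germAt_smul]
  rw [tendsto_etale_iff] at h ⊢
  refine ⟨h.1, ?_⟩
  filter_upwards [h.2] with a ⟨h1, h2⟩
  refine ⟨h1, ?_⟩
  rw [germAt_smul]
  exact congrArg _ h2

/-- Sections over `U` are the continuous families of germs. -/
theorem exists_section {U : Opens Y} (g : ∀ x : U, stalk F x.1)
    (hg : Continuous fun x : U => (⟨x.1, g x⟩ : Etale F)) :
    ∃ t : F.presheaf.obj (op U), ∀ x : U, germAt F t x.1 x.2 = g x := by
  have hloc : ∀ x : U, ∃ (V : Opens Y) (hV : x.1 ∈ V) (i : V ⟶ U) (t : F.presheaf.obj (op V)),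
      ∀ (y : Y) (hy : y ∈ V), germAt F t y hy = g ⟨y, i.le hy⟩ := by
    intro x
    obtain ⟨W, hW, t, ht⟩ := exists_germAt' (g x)
    have h1 : Tendsto (fun x : U => (⟨x.1, g x⟩ : Etale F)) (𝓝 x) (𝓝 ⟨x.1, g x⟩) := hg.tendsto x
    rw [← ht] at h1
    have h1 := ((tendsto_etale_iff hW t).1 h1).2
    rw [nhds_subtype_eq_comap, eventually_comap] at h1
    obtain ⟨V, hV, hVo, hxV⟩ := eventually_nhds_iff.1 (h1.and (U.isOpen.mem_nhds x.2))
    have hVW : (⟨V, hVo⟩ : Opens Y) ≤ W := fun y hy =>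
      ((hV y hy).1 ⟨y, (hV y hy).2⟩ rfl).1
    refine ⟨⟨V, hVo⟩, hxV, homOfLE fun y hy => (hV y hy).2, F.presheaf.map (homOfLE hVW).op t,
      fun y hy => ?_⟩
    rw [germAt_res]
    exact ((hV y hy).1 ⟨y, (hV y hy).2⟩ rfl).2.symm
  choose V hV i t ht using hloc
  obtain ⟨s, hs, -⟩ := TopCat.Sheaf.existsUnique_gluing' F V U i
    (fun x hx => Opens.mem_iSup.2 ⟨⟨x, hx⟩, hV _⟩) t (fun x y => by
      refine TopCat.Presheaf.section_ext F _ _ _ fun z hz => ?_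
      refine (germAt_res _ _ _ _).trans (Eq.trans ?_ (germAt_res _ _ _ _).symm)
      exact (ht x z hz.1).trans (ht y z hz.2).symm)
  refine ⟨s, fun x => ?_⟩
  rw [← ht x x.1 (hV x), ← hs x, germAt_res]

theorem section_ext {U : Opens Y} {t t' : F.presheaf.obj (op U)}
    (h : ∀ (x : Y) (hx : x ∈ U), germAt F t x hx = germAt F t' x hx) : t = t' :=
  TopCat.Presheaf.section_ext F _ _ _ h

/-- The map of étalé spaces induced by a morphism of sheaves. -/
def etaleMap (f : F ⟶ G) (g : Etale F) : Etale G := ⟨g.base, stalkMap f g.base g.germ⟩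

theorem stalkMap_germAt (f : F ⟶ G) {U : Opens Y} (t : F.presheaf.obj (op U)) (x : Y)
    (hx : x ∈ U) : stalkMap f x (germAt F t x hx) = germAt G (f.hom.app (op U) t) x hx :=
  TopCat.Presheaf.stalkFunctor_map_germ_apply U x hx f.hom t

theorem continuous_etaleMap (f : F ⟶ G) : Continuous (etaleMap f) := by
  refine continuous_iff_continuousAt.2 fun g => ?_
  obtain ⟨U, hU, t, ht⟩ := exists_germAt g
  have h1 : etaleMap f g = ⟨g.base, germAt G (f.hom.app (op U) t) _ hU⟩ := by
    conv_lhs => rw [ht]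
    rw [← stalkMap_germAt]
    rfl
  rw [ContinuousAt, h1, tendsto_etale_iff]
  have h2 : Tendsto id (𝓝 g) (𝓝 ⟨g.base, germAt F t _ hU⟩) := by rw [← ht]; exact tendsto_id
  rw [tendsto_etale_iff] at h2
  refine ⟨h2.1, ?_⟩
  filter_upwards [h2.2] with a ⟨h3, h4⟩
  refine ⟨h3, ?_⟩
  refine Eq.trans ?_ (stalkMap_germAt f t _ h3)
  exact congrArg _ h4

theorem hom_ext_stalk {f g : F ⟶ G} (h : ∀ x, stalkMap f x = stalkMap g x) : f = g := by
  apply Sheaf.hom_ext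
  ext U t
  obtain ⟨U⟩ := U
  refine section_ext fun x hx => ?_
  have := LinearMap.congr_fun (h x) (germAt F t x hx)
  rwa [stalkMap_germAt, stalkMap_germAt] at this

theorem isIso_of_stalkMap_bijective (f : F ⟶ G) (h : ∀ x, Function.Bijective (stalkMap f x)) :
    IsIso f := by
  have : ∀ x, IsIso ((TopCat.Presheaf.stalkFunctor (ModuleCat.{0} ℂ) x).map f.hom) := fun x =>
    (ConcreteCategory.isIso_iff_bijective _).2 (h x)
  exact TopCat.Presheaf.isIso_of_stalkFunctor_map_iso f

end Etale

end ToricLC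

end

noncomputable section

namespace ToricLC

/-! ### Inverse images and constant sheaves -/

section Pullback

open Filter Topology

variable {Y Y' : TopCat.{0}} (f : Y ⟶ Y')

theorem map_mem {U : Opens Y'} {y : Y} (h : y ∈ (Opens.map f).obj U) : f y ∈ U := h

theorem mem_map {U : Opens Y'} {y : Y} (h : f y ∈ U) : y ∈ (Opens.map f).obj U := h

theorem mem_top (y : Y) : y ∈ (⊤ : Opens Y) := trivial

/-- The map `P_{f(y)} → Q_y` induced by a morphism `P ⟶ f_* Q` of presheaves. -/
def presheafAdjStalk {P : TopCat.Presheaf (ModuleCat.{0} ℂ) Y'}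
    {Q : TopCat.Presheaf (ModuleCat.{0} ℂ) Y}
    (φ : P ⟶ (TopCat.Presheaf.pushforward (ModuleCat.{0} ℂ) f).obj Q) (y : Y) :
    P.stalk (f y) ⟶ Q.stalk y :=
  (TopCat.Presheaf.stalkFunctor (ModuleCat.{0} ℂ) (f y)).map φ ≫
    Q.stalkPushforward (ModuleCat.{0} ℂ) f y

theorem germ_presheafAdjStalk {P : TopCat.Presheaf (ModuleCat.{0} ℂ) Y'}
    {Q : TopCat.Presheaf (ModuleCat.{0} ℂ) Y}
    (φ : P ⟶ (TopCat.Presheaf.pushforward (ModuleCat.{0} ℂ) f).obj Q) (y : Y) (U : Opens Y')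
    (hy : f y ∈ U) : P.germ U (f y) hy ≫ presheafAdjStalk f φ y =
      φ.app (op U) ≫ Q.germ ((Opens.map f).obj U) y hy :=
  (TopCat.Presheaf.stalkFunctor_map_germ_assoc U (f y) hy φ _).trans
    (congrArg (φ.app (op U) ≫ ·)
      (TopCat.Presheaf.stalkPushforward_germ (ModuleCat.{0} ℂ) f Q U y hy))

theorem presheafAdjStalk_comp {P : TopCat.Presheaf (ModuleCat.{0} ℂ) Y'}
    {Q R : TopCat.Presheaf (ModuleCat.{0} ℂ) Y}
    (φ : P ⟶ (TopCat.Presheaf.pushforward (ModuleCat.{0} ℂ) f).obj Q) (g : Q ⟶ R) (y : Y) :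
    presheafAdjStalk f (φ ≫ (TopCat.Presheaf.pushforward (ModuleCat.{0} ℂ) f).map g) y =
      presheafAdjStalk f φ y ≫ (TopCat.Presheaf.stalkFunctor (ModuleCat.{0} ℂ) y).map g := by
  refine TopCat.Presheaf.stalk_hom_ext _ fun U hU => ?_
  refine (germ_presheafAdjStalk f _ y U hU).trans ?_
  refine Eq.trans ?_ (((germ_presheafAdjStalk f φ y U hU).symm =≫
    (TopCat.Presheaf.stalkFunctor (ModuleCat.{0} ℂ) y).map g).trans (Category.assoc _ _ _))
  refine (Category.assoc _ _ _).trans (Eq.trans ?_ (Category.assoc _ _ _).symm)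
  exact congrArg (φ.app (op U) ≫ ·)
    (TopCat.Presheaf.stalkFunctor_map_germ ((Opens.map f).obj U) y hU g).symm

/-- The map `F_{f(y)} → G_y` induced by a morphism `F ⟶ f_* G`. -/
def adjStalk {F : Sh Y'} {G : Sh Y} (φ : F ⟶ (TopCat.Sheaf.pushforward (ModuleCat.{0} ℂ) f).obj G)
    (y : Y) : stalk F (f y) →ₗ[ℂ] stalk G y :=
  (presheafAdjStalk f (P := F.presheaf) (Q := G.presheaf) φ.hom y).hom

theorem adjStalk_germAt {F : Sh Y'} {G : Sh Y}
    (φ : F ⟶ (TopCat.Sheaf.pushforward (ModuleCat.{0} ℂ) f).obj G) (y : Y) {U : Opens Y'}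
    (hy : f y ∈ U) (t : F.presheaf.obj (op U)) :
    adjStalk f φ y (germAt F t (f y) hy) =
      germAt G (U := (Opens.map f).obj U) (φ.hom.app (op U) t) y hy :=
  congrArg (fun q => ModuleCat.Hom.hom q t)
    (germ_presheafAdjStalk f (P := F.presheaf) (Q := G.presheaf) φ.hom y U hy)

theorem adjStalk_comp {F : Sh Y'} {G H : Sh Y}
    (φ : F ⟶ (TopCat.Sheaf.pushforward (ModuleCat.{0} ℂ) f).obj G) (g : G ⟶ H) (y : Y) :
    adjStalk f (φ ≫ (TopCat.Sheaf.pushforward (ModuleCat.{0} ℂ) f).map g) y =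
      stalkMap g y ∘ₗ adjStalk f φ y :=
  congrArg ModuleCat.Hom.hom
    (presheafAdjStalk_comp f (P := F.presheaf) (Q := G.presheaf) (R := H.presheaf) φ.hom g.hom y)

theorem adjStalk_precomp {E F : Sh Y'} {G : Sh Y} (g : E ⟶ F)
    (φ : F ⟶ (TopCat.Sheaf.pushforward (ModuleCat.{0} ℂ) f).obj G) (y : Y) :
    adjStalk f (g ≫ φ) y = adjStalk f φ y ∘ₗ stalkMap g (f y) := by
  refine LinearMap.ext fun a => ?_
  obtain ⟨U, hU, t, rfl⟩ := exists_germAt' a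
  refine (adjStalk_germAt f _ y hU t).trans ?_
  refine Eq.trans ?_ (congrArg (adjStalk f φ y) (stalkMap_germAt g t (f y) hU)).symm
  exact (adjStalk_germAt f φ y hU _).symm

theorem adjStalk_ext {F : Sh Y'} {G : Sh Y}
    {φ ψ : F ⟶ (TopCat.Sheaf.pushforward (ModuleCat.{0} ℂ) f).obj G}
    (h : ∀ y, adjStalk f φ y = adjStalk f ψ y) : φ = ψ := by
  apply Sheaf.hom_ext
  ext U t
  obtain ⟨U⟩ := U
  refine section_ext (F := G) (U := (Opens.map f).obj U) fun y hy => ?_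
  exact (adjStalk_germAt f φ y (map_mem f hy) t).symm.trans
    ((LinearMap.congr_fun (h y) (germAt F t (f y) (map_mem f hy))).trans
      (adjStalk_germAt f ψ y (map_mem f hy) t))

/-- Construct a morphism `F ⟶ f_* G` from its effect on stalks. -/
theorem exists_hom_of_stalks {F : Sh Y'} {G : Sh Y} (ψ : ∀ y, stalk F (f y) →ₗ[ℂ] stalk G y)
    (hψ : ∀ (U : Opens Y') (t : F.presheaf.obj (op U)),
      Continuous fun y : (Opens.map f).obj U =>
        (⟨y.1, ψ y.1 (germAt F t (f y.1) (map_mem f y.2))⟩ : Etale G)) :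
    ∃ φ : F ⟶ (TopCat.Sheaf.pushforward (ModuleCat.{0} ℂ) f).obj G, ∀ y, adjStalk f φ y = ψ y := by
  choose s hs using fun (U : Opens Y') (t : F.presheaf.obj (op U)) =>
    exists_section (F := G) (U := (Opens.map f).obj U)
      (fun y => ψ y.1 (germAt F t (f y.1) (map_mem f y.2))) (hψ U t)
  have hadd : ∀ U t t', s U (t + t') = s U t + s U t' := fun U t t' => section_ext fun y hy => by
    rw [hs U _ ⟨y, hy⟩, germAt_add, germAt_add, hs U t ⟨y, hy⟩, hs U t' ⟨y, hy⟩, map_add]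
  have hsmul : ∀ U (c : ℂ) t, s U (c • t) = c • s U t := fun U c t => section_ext fun y hy => by
    rw [hs U _ ⟨y, hy⟩, germAt_smul, germAt_smul, hs U t ⟨y, hy⟩, map_smul]
  let φ : F ⟶ (TopCat.Sheaf.pushforward (ModuleCat.{0} ℂ) f).obj G :=
    ⟨{ app := fun U => ModuleCat.ofHom
        (X := F.presheaf.obj U) (Y := G.presheaf.obj (op ((Opens.map f).obj U.unop)))
        { toFun := s U.unop, map_add' := hadd _, map_smul' := hsmul _ }
       naturality := fun U V i => by
        ext t
        refine section_ext (F := G) (U := (Opens.map f).obj V.unop) fun y hy => ?_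
        refine (hs V.unop (F.presheaf.map i t) ⟨y, hy⟩).trans ?_
        refine Eq.trans ?_ (germAt_res (F := G) ((Opens.map f).map i.unop) (s U.unop t) y hy).symm
        refine Eq.trans ?_ (hs U.unop t ⟨y, ((Opens.map f).map i.unop).le hy⟩).symm
        exact congrArg (ψ y) (germAt_res (F := F) i.unop t (f y) (map_mem f hy)) }⟩
  refine ⟨φ, fun y => LinearMap.ext fun a => ?_⟩
  obtain ⟨U, hU, t, rfl⟩ := exists_germAt' a
  exact (adjStalk_germAt f φ y hU t).trans (hs U t ⟨y, hU⟩)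

/-- The inverse image of a sheaf. -/
abbrev pull (F : Sh Y') : Sh Y := (TopCat.Sheaf.pullback (ModuleCat.{0} ℂ) f).obj F

/-- The canonical map `F_{f(y)} → (f⁻¹F)_y`. -/
def pullStalk (F : Sh Y') (y : Y) : stalk F (f y) →ₗ[ℂ] stalk (pull f F) y :=
  adjStalk f ((TopCat.Sheaf.pullbackPushforwardAdjunction (ModuleCat.{0} ℂ) f).unit.app F) y

theorem comp_map_eq_of_eq_id {C D : Type*} [Category* C] [Category* D] (R : D ⥤ C) {X : C} {Z : D}
    (a : X ⟶ R.obj Z) (b : Z ⟶ Z) (c : R.obj Z ⟶ R.obj Z) (hb : b = 𝟙 Z) (hc : c = 𝟙 _) :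
    a ≫ R.map b ≫ c = a := by
  rw [hb, hc, CategoryTheory.Functor.map_id, Category.comp_id, Category.comp_id]

/-- The unit of the sheaf adjunction is that of the presheaf adjunction followed by sheafification;
this gives access to the stalks of the inverse image. -/
theorem pullbackConstruction_unit_hom (F : Sh Y') :
    ((Functor.sheafPullbackConstruction.sheafAdjunctionContinuous (Opens.map f)
      (ModuleCat.{0} ℂ) (Opens.grothendieckTopology Y')
      (Opens.grothendieckTopology Y)).unit.app F).hom =
      (TopCat.Presheaf.pullbackPushforwardAdjunction (ModuleCat.{0} ℂ) f).unit.app F.presheaf ≫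
      (TopCat.Presheaf.pushforward (ModuleCat.{0} ℂ) f).map
        (toSheafify (Opens.grothendieckTopology Y)
          ((TopCat.Presheaf.pullback (ModuleCat.{0} ℂ) f).obj F.presheaf)) := by
  have h := Adjunction.map_restrictFullyFaithful_unit_app
      (L := Functor.sheafPullbackConstruction.sheafPullback (Opens.map f) (ModuleCat.{0} ℂ)
        (Opens.grothendieckTopology Y') (Opens.grothendieckTopology Y))
      (R := (Opens.map f).sheafPushforwardContinuous (ModuleCat.{0} ℂ)
        (Opens.grothendieckTopology Y') (Opens.grothendieckTopology Y))
      (((Opens.map f).op.lanAdjunction (ModuleCat.{0} ℂ)).comp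
        (sheafificationAdjunction (Opens.grothendieckTopology Y) (ModuleCat.{0} ℂ)))
      (fullyFaithfulSheafToPresheaf (Opens.grothendieckTopology Y') (ModuleCat.{0} ℂ))
      (Functor.FullyFaithful.id _)
      (Iso.refl _) (Iso.refl _) F
  refine Eq.trans h ((comp_map_eq_of_eq_id
    (sheafToPresheaf (Opens.grothendieckTopology Y) (ModuleCat.{0} ℂ) ⋙
      (Functor.whiskeringLeft _ _ (ModuleCat.{0} ℂ)).obj (Opens.map f).op)
    (Z := (presheafToSheaf (Opens.grothendieckTopology Y) (ModuleCat.{0} ℂ)).obj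
      ((Opens.map f).op.lan.obj F.obj)) _ (𝟙 _) (𝟙 _) rfl rfl).trans ?_)
  exact Adjunction.comp_unit_app ((Opens.map f).op.lanAdjunction (ModuleCat.{0} ℂ))
    (sheafificationAdjunction (Opens.grothendieckTopology Y) (ModuleCat.{0} ℂ)) _

/-- Left adjoints are unique, so the inverse image may be taken to be the sheafified presheaf
inverse image. On its stalks the unit is the isomorphism for presheaves followed by the one for
sheafification. -/
theorem pullStalk_bijective (F : Sh Y') (y : Y) : Function.Bijective (pullStalk f F y) := by
  let adj₁ := TopCat.Sheaf.pullbackPushforwardAdjunction (ModuleCat.{0} ℂ) f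
  let adj₂ := Functor.sheafPullbackConstruction.sheafAdjunctionContinuous (Opens.map f)
    (ModuleCat.{0} ℂ) (Opens.grothendieckTopology Y') (Opens.grothendieckTopology Y)
  have hu := Adjunction.unit_leftAdjointUniq_hom_app adj₁ adj₂ F
  have h1 : stalkMap ((adj₁.leftAdjointUniq adj₂).hom.app F) y ∘ₗ pullStalk f F y =
      adjStalk f (adj₂.unit.app F) y := by
    rw [← hu]
    exact (adjStalk_comp f _ _ y).symm
  have h3 : Function.Bijective (adjStalk f (adj₂.unit.app F) y) := by
    have e : presheafAdjStalk f (P := F.presheaf) (adj₂.unit.app F).hom y =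
        (TopCat.Presheaf.stalkPullbackIso (ModuleCat.{0} ℂ) f F.presheaf y).hom ≫
          (TopCat.Presheaf.stalkFunctor (ModuleCat.{0} ℂ) y).map
          (toSheafify (Opens.grothendieckTopology Y)
            ((TopCat.Presheaf.pullback (ModuleCat.{0} ℂ) f).obj F.presheaf)) := by
      rw [pullbackConstruction_unit_hom]
      exact presheafAdjStalk_comp f _ _ y
    have := TopCat.Presheaf.stalkFunctor_map_unit_toSheafify_isIso y (ModuleCat.{0} ℂ)
      ((TopCat.Presheaf.pullback (ModuleCat.{0} ℂ) f).obj F.presheaf)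
    have : IsIso (presheafAdjStalk f (P := F.presheaf) (adj₂.unit.app F).hom y) := by
      rw [e]; exact IsIso.comp_isIso' inferInstance this
    exact (ConcreteCategory.isIso_iff_bijective _).1 this
  have h4 : Function.Bijective (stalkMap ((adj₁.leftAdjointUniq adj₂).hom.app F) y) := by
    have hi : IsIso ((adj₁.leftAdjointUniq adj₂).hom.app F) := NatIso.hom_app_isIso _ _
    have : IsIso ((TopCat.Sheaf.forget (ModuleCat.{0} ℂ) Y ⋙
        TopCat.Presheaf.stalkFunctor (ModuleCat.{0} ℂ) y).map
          ((adj₁.leftAdjointUniq adj₂).hom.app F)) := Functor.map_isIso _ _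
    exact (ConcreteCategory.isIso_iff_bijective _).1 this
  rw [← h1, LinearMap.coe_comp] at h3
  exact (Function.Bijective.of_comp_iff' h4 _).1 h3

/-- The isomorphism `F_{f(y)} ≅ (f⁻¹F)_y`. -/
def pullStalkEquiv (F : Sh Y') (y : Y) : stalk F (f y) ≃ₗ[ℂ] stalk (pull f F) y :=
  LinearEquiv.ofBijective (pullStalk f F y) (pullStalk_bijective f F y)

theorem pullStalk_germAt (F : Sh Y') {U : Opens Y'}
    (t : F.presheaf.obj (op U)) : ∃ t' : (pull f F).presheaf.obj (op ((Opens.map f).obj U)),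
      ∀ (z : Y) (hz : f z ∈ U), pullStalkEquiv f F z (germAt F t (f z) hz) =
        germAt _ t' z (mem_map f hz) :=
  ⟨_, fun z hz => adjStalk_germAt f _ z hz t⟩

/-- The map from the étalé space of an inverse image. -/
def pullEtale (F : Sh Y') (g : Etale (pull f F)) : Etale F :=
  ⟨f g.base, (pullStalkEquiv f F g.base).symm g.germ⟩

theorem continuous_pullEtale (F : Sh Y') : Continuous (pullEtale f F) := by
  refine continuous_iff_continuousAt.2 fun g => ?_
  obtain ⟨U, hU, t, ht⟩ := exists_germAt' ((pullStalkEquiv f F g.base).symm g.germ)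
  obtain ⟨t', ht'⟩ := pullStalk_germAt f F t
  have h1 : pullEtale f F g = ⟨f g.base, germAt F t _ hU⟩ := etale_mk_eq_iff.2 ht.symm
  have h2 : g = ⟨g.base, germAt _ t' g.base (mem_map f hU)⟩ := by
    obtain ⟨y, a⟩ := g
    refine etale_mk_eq_iff.2 ?_
    rw [← ht' y hU, ht, LinearEquiv.apply_symm_apply]
  rw [ContinuousAt, h1, tendsto_etale_iff]
  have h3 : Tendsto id (𝓝 g) (𝓝 ⟨g.base, germAt _ t' g.base (mem_map f hU)⟩) := by rw [← h2]; exact tendsto_id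
  rw [tendsto_etale_iff (mem_map f hU)] at h3
  refine ⟨(f.hom.continuous.tendsto _).comp h3.1, ?_⟩
  filter_upwards [h3.2] with a ⟨h4, h5⟩
  refine ⟨h4, ?_⟩
  refine (pullStalkEquiv f F a.base).symm_apply_eq.2 ?_
  exact h5.trans (ht' a.base h4).symm

theorem tendsto_pullStalk (F : Sh Y') {α : Type*} {l : Filter α} {b : α → Y} {y : Y}
    (hb : Tendsto b l (𝓝 y)) {s : ∀ a, stalk F (f (b a))} {u : stalk F (f y)}
    (h : Tendsto (fun a => (⟨f (b a), s a⟩ : Etale F)) l (𝓝 ⟨f y, u⟩)) :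
    Tendsto (fun a => (⟨b a, pullStalkEquiv f F (b a) (s a)⟩ : Etale (pull f F))) l
      (𝓝 ⟨y, pullStalkEquiv f F y u⟩) := by
  obtain ⟨U, hU, t, rfl⟩ := exists_germAt' u
  obtain ⟨t', ht'⟩ := pullStalk_germAt f F t
  rw [ht' y hU, tendsto_etale_iff (mem_map f hU)]
  refine ⟨hb, ?_⟩
  filter_upwards [((tendsto_etale_iff hU t).1 h).2] with a ⟨h1, h2⟩
  refine ⟨h1, ?_⟩
  exact (congrArg (pullStalkEquiv f F (b a)) h2).trans (ht' (b a) h1)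

theorem adjStalk_homEquiv {F : Sh Y'} {G : Sh Y} (θ : pull f F ⟶ G) (y : Y)
    (a : stalk F (f y)) :
    adjStalk f ((TopCat.Sheaf.pullbackPushforwardAdjunction (ModuleCat.{0} ℂ) f).homEquiv F G θ) y a =
      stalkMap θ y (pullStalkEquiv f F y a) := by
  rw [Adjunction.homEquiv_unit]
  exact LinearMap.congr_fun (adjStalk_comp f _ θ y) a

/-! ### Constant sheaves -/

/-- The constant sheaf. -/
abbrev constSheaf (Y : TopCat.{0}) (A : ModuleCat.{0} ℂ) : Sh Y :=
  (constantSheaf (Opens.grothendieckTopology Y) (ModuleCat.{0} ℂ)).obj A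

/-- The global sections of a constant sheaf coming from elements of the group. -/
def constSection (Y : TopCat.{0}) (A : ModuleCat.{0} ℂ) :
    A ⟶ (constSheaf Y A).presheaf.obj (op ⊤) :=
  (toSheafify (Opens.grothendieckTopology Y) ((Functor.const (Opens Y)ᵒᵖ).obj A)).app (op ⊤)

theorem constSection_germ_bijective (A : ModuleCat.{0} ℂ) (y : Y) :
    Function.Bijective fun a : A => germAt (constSheaf Y A) (constSection Y A a) y (mem_top _) := by
  let P : TopCat.Presheaf (ModuleCat.{0} ℂ) Y := (Functor.const (Opens Y)ᵒᵖ).obj A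
  have h0 : Function.Bijective fun a : A =>
      (P.germ ⊤ y (mem_top _) : P.obj (op ⊤) ⟶ P.stalk y) a := by
    constructor
    · intro a b h
      obtain ⟨W, hW, iU, iV, h'⟩ := P.germ_eq y (mem_top _) (mem_top _) a b h
      exact h'
    · intro q
      obtain ⟨U, hU, t, ht⟩ := P.exists_germ_eq q
      refine ⟨t, Eq.trans ?_ ht⟩
      exact (P.germ_res_apply (homOfLE le_top) y hU t).symm
  have h1 := TopCat.Presheaf.stalkFunctor_map_unit_toSheafify_isIso y (ModuleCat.{0} ℂ) P
  have h2 := (ConcreteCategory.isIso_iff_bijective _).1 h1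
  have h3 := h2.comp h0
  refine (congrArg Function.Bijective (funext fun a => ?_)).mp h3
  exact (TopCat.Presheaf.stalkFunctor_map_germ_apply (⊤ : Opens Y) y (mem_top _)
    (toSheafify (Opens.grothendieckTopology Y) P) a)

theorem exists_hom_constSheaf (A : ModuleCat.{0} ℂ) (H : Sh Y)
    (s : A ⟶ H.presheaf.obj (op ⊤)) :
    ∃ φ : constSheaf Y A ⟶ H, ∀ (y : Y) (a : A),
      stalkMap φ y (germAt (constSheaf Y A) (constSection Y A a) y (mem_top _)) =
        germAt H (s a) y (mem_top _) := by
  let η : (Functor.const (Opens Y)ᵒᵖ).obj A ⟶ H.presheaf :=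
    { app := fun V => s ≫ H.presheaf.map (homOfLE le_top : V.unop ⟶ ⊤).op
      naturality := fun V W i => by
        refine (Category.id_comp _).trans (Eq.trans ?_ (Category.assoc _ _ _).symm)
        exact congrArg (s ≫ ·) (H.presheaf.map_comp (homOfLE le_top : V.unop ⟶ ⊤).op i) }
  refine ⟨⟨sheafifyLift (Opens.grothendieckTopology Y) η H.property⟩, fun y a => ?_⟩
  refine (stalkMap_germAt _ _ y (mem_top _)).trans ?_
  have h1 := toSheafify_sheafifyLift (Opens.grothendieckTopology Y) η H.property
  have h2 := congrArg (fun q => ModuleCat.Hom.hom (NatTrans.app q (op ⊤)) a) h1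
  refine (congrArg (fun q => germAt H q y (mem_top _)) h2).trans ?_
  exact germAt_res (F := H) (homOfLE le_top : (⊤ : Opens Y) ⟶ ⊤) (s a) y (mem_top _)

theorem stalkMap_bijective {F G : Sh Y} (i : F ≅ G) (y : Y) :
    Function.Bijective (stalkMap i.hom y) :=
  (ConcreteCategory.isIso_iff_bijective _).1 ((TopCat.Sheaf.forget (ModuleCat.{0} ℂ) _ ⋙
    TopCat.Presheaf.stalkFunctor (ModuleCat.{0} ℂ) y).mapIso i).isIso_hom

/-- Local triviality of the inverse image of a sheaf along a map `p : D → Y`, in terms of étalé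
spaces. -/
def IsLocallyTrivial (F : Sh Y) {D : Type} [TopologicalSpace D] (p : D → Y) : Prop :=
  ∀ d₀ : D, ∃ W : Set D, IsOpen W ∧ d₀ ∈ W ∧ ∃ (A : ModuleCat.{0} ℂ)
    (e : ∀ d : W, A ≃ₗ[ℂ] stalk F (p d)),
    ∀ a, Continuous fun d : W => (⟨p d, e d a⟩ : Etale F)

/-- Sheaf-theoretic local constancy is translated into local trivializations of the étalé space, to
which covering space theory applies. Elements of the group give continuous families in the constant
sheaf, and continuity survives the isomorphism and the two inverse images. -/
theorem isLocallyTrivial_of_isLocallyConstant {F : Sh Y} {Z : Set Y}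
    (h : IsLocallyConstantSheaf (restrictTo F Z)) : IsLocallyTrivial F (Subtype.val : Z → Y) := by
  intro z
  obtain ⟨U, hzU, ⟨A, ⟨i⟩⟩⟩ := h z
  let j : TopCat.of Z ⟶ Y := TopCat.ofHom ⟨Subtype.val, continuous_subtype_val⟩
  have hi := stalkMap_bijective i
  let e₀ : ∀ d : (Opens.toTopCat (TopCat.of Z)).obj U, A ≃ₗ[ℂ] stalk (constSheaf _ A) d := fun d =>
    LinearEquiv.ofBijective
      ({ toFun := fun a => germAt (constSheaf _ A) (constSection _ A a) d (mem_top _)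
         map_add' := fun a b => by rw [map_add, germAt_add]
         map_smul' := fun c a => by rw [map_smul, germAt_smul]; rfl } : A →ₗ[ℂ] _)
      (constSection_germ_bijective A d)
  let e₁ : ∀ d : (Opens.toTopCat (TopCat.of Z)).obj U, A ≃ₗ[ℂ] stalk F (j (U.inclusion' d)) :=
    fun d => (e₀ d).trans ((LinearEquiv.ofBijective _ (hi d)).trans
      ((pullStalkEquiv U.inclusion' (restrictTo F Z) d).symm.trans
        (pullStalkEquiv j F (U.inclusion' d)).symm))
  refine ⟨U, U.isOpen, hzU, A, e₁, fun a => ?_⟩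
  have h1 : Continuous fun d : (Opens.toTopCat (TopCat.of Z)).obj U =>
      (⟨d, germAt (constSheaf _ A) (constSection _ A a) d (mem_top _)⟩ : Etale (constSheaf _ A)) :=
    continuous_iff_continuousAt.2 fun d => tendsto_etale_germ (U := ⊤) (mem_top _) _
      tendsto_id fun _ _ => rfl
  exact ((continuous_pullEtale j F).comp (continuous_pullEtale U.inclusion' (restrictTo F Z))).comp
    ((continuous_etaleMap i.hom).comp h1)

theorem isLocallyConstant_of_isLocallyTrivial {F : Sh Y} {Z : Set Y}
    (h : IsLocallyTrivial F (Subtype.val : Z → Y)) : IsLocallyConstantSheaf (restrictTo F Z) := by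
  intro z
  obtain ⟨W, hW, hzW, A, e, he⟩ := h z
  let U : Opens (TopCat.of Z) := ⟨W, hW⟩
  refine ⟨U, hzW, ?_⟩
  let j : TopCat.of Z ⟶ Y := TopCat.ofHom ⟨Subtype.val, continuous_subtype_val⟩
  let H : Sh ((Opens.toTopCat (TopCat.of Z)).obj U) := pull U.inclusion' (restrictTo F Z)
  let e₁ : ∀ d : (Opens.toTopCat (TopCat.of Z)).obj U, A ≃ₗ[ℂ] stalk H d := fun d =>
    (e d).trans ((pullStalkEquiv j F (U.inclusion' d)).trans
      (pullStalkEquiv U.inclusion' (restrictTo F Z) d))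
  have hc : ∀ a : A, Continuous fun d : (Opens.toTopCat (TopCat.of Z)).obj U =>
      (⟨d, e₁ d a⟩ : Etale H) := fun a => continuous_iff_continuousAt.2 fun d =>
    tendsto_pullStalk U.inclusion' (restrictTo F Z) tendsto_id
      (tendsto_pullStalk j F (continuous_subtype_val.tendsto d) ((he a).tendsto d))
  have hs : ∀ a : A, ∃ t : H.presheaf.obj (op ⊤), ∀ d, germAt H t d (mem_top _) = e₁ d a := fun a => by
    obtain ⟨t, ht⟩ := exists_section (F := H) (U := ⊤) (fun x => e₁ x.1 a)
      ((hc a).comp continuous_subtype_val)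
    exact ⟨t, fun d => ht ⟨d, mem_top _⟩⟩
  choose s hs using hs
  obtain ⟨φ, hφ⟩ := exists_hom_constSheaf A H (ModuleCat.ofHom
    { toFun := s
      map_add' := fun a b => section_ext fun x _ => by
        rw [germAt_add, hs, hs, hs, map_add]
      map_smul' := fun c a => section_ext fun x _ => by
        rw [germAt_smul, hs, hs, map_smul]; rfl })
  have : IsIso φ := isIso_of_stalkMap_bijective φ fun d => by
    have h1 : stalkMap φ d ∘ (fun a : A => germAt (constSheaf _ A) (constSection _ A a) d (mem_top _)) =
        e₁ d := funext fun a => (hφ d a).trans (hs a d)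
    refine (Function.Bijective.of_comp_iff _ (constSection_germ_bijective A d)).1 ?_
    rw [h1]
    exact (e₁ d).bijective
  exact Sheaf.isConstant_of_iso _ (asIso φ).symm

end Pullback

end ToricLC

end

noncomputable section

namespace ToricLC

/-! ### Covering spaces from locally trivial sheaves -/

section Covering

open Filter Topology

variable {Y : TopCat.{0}} {F : Sh Y}

/-- The germ of a point of the étalé space, as an element of the stalk at a given base point. -/
def germOver (g : Etale F) (x : Y) (h : g.base = x) : stalk F x := h ▸ g.germ

theorem mk_germOver (g : Etale F) (x : Y) (h : g.base = x) :
    (⟨x, germOver g x h⟩ : Etale F) = g := by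
  subst h; rfl

/-- The inverse image of the étalé space along a map. -/
abbrev EtaleOver (F : Sh Y) {D : Type} (p : D → Y) : Type :=
  {q : D × Etale F // q.2.base = p q.1}

/-- Over a trivializing open set `W` the étalé space is `W × A`, the fibre `A` being given the
discrete topology. -/
theorem isCoveringMap_etaleOver {D : Type} [TopologicalSpace D] {p : D → Y}
    (h : IsLocallyTrivial F p) : IsCoveringMap fun q : EtaleOver F p => q.1.1 := by
  intro d₀
  obtain ⟨W, hW, hd₀, A, e, he⟩ := h d₀
  let _ : TopologicalSpace A := ⊥
  have _ : DiscreteTopology A := ⟨rfl⟩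
  have hc : Continuous fun q : EtaleOver F p => q.1.1 := continuous_fst.comp continuous_subtype_val
  refine IsEvenlyCovered.to_isEvenlyCovered_preimage (I := A) ⟨inferInstance, W, hd₀, hW,
    hW.preimage hc, ?_⟩
  let fwd : ((fun q : EtaleOver F p => q.1.1) ⁻¹' W) → W × A := fun q =>
    (⟨q.1.1.1, q.2⟩, (e ⟨q.1.1.1, q.2⟩).symm (germOver q.1.1.2 _ q.1.2))
  let bwd : W × A → ((fun q : EtaleOver F p => q.1.1) ⁻¹' W) := fun x =>
    ⟨⟨(x.1.1, ⟨p x.1.1, e x.1 x.2⟩), rfl⟩, x.1.2⟩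
  have hfb : ∀ q, (⟨p q.1.1.1, e ⟨q.1.1.1, q.2⟩ (fwd q).2⟩ : Etale F) = q.1.1.2 := fun q => by
    have : e ⟨q.1.1.1, q.2⟩ (fwd q).2 = germOver q.1.1.2 _ q.1.2 :=
      LinearEquiv.apply_symm_apply _ _
    rw [this]
    exact mk_germOver _ _ _
  refine ⟨{ toFun := fwd, invFun := bwd, left_inv := fun q => ?_, right_inv := fun x => ?_,
            continuous_toFun := ?_, continuous_invFun := ?_ }, fun q => rfl⟩
  · exact Subtype.ext (Subtype.ext (Prod.ext rfl (hfb q)))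
  · exact Prod.ext rfl ((e x.1).symm_apply_apply x.2)
  · refine Continuous.prodMk (Continuous.subtype_mk (hc.comp continuous_subtype_val) _) ?_
    -- The fibre being discrete, continuity means local constancy: the constant family through `q₀`
    -- and the tautological one have the same limit and the same base points, hence agree nearby.
    refine continuous_iff_continuousAt.2 fun q₀ => ?_
    rw [ContinuousAt, nhds_discrete A, tendsto_pure]
    have h1 : Tendsto (fun q : ((fun q : EtaleOver F p => q.1.1) ⁻¹' W) =>
        (⟨p q.1.1.1, e ⟨q.1.1.1, q.2⟩ (fwd q₀).2⟩ : Etale F)) (𝓝 q₀) (𝓝 q₀.1.1.2) := by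
      have h2 : Continuous fun q : ((fun q : EtaleOver F p => q.1.1) ⁻¹' W) =>
          (⟨p q.1.1.1, e ⟨q.1.1.1, q.2⟩ (fwd q₀).2⟩ : Etale F) :=
        (he (fwd q₀).2).comp ((hc.comp continuous_subtype_val).subtype_mk fun q => q.2)
      have h3 := h2.tendsto q₀
      rwa [hfb q₀] at h3
    have h2 : Tendsto (fun q : ((fun q : EtaleOver F p => q.1.1) ⁻¹' W) => q.1.1.2) (𝓝 q₀)
        (𝓝 q₀.1.1.2) :=
      (continuous_snd.comp (continuous_subtype_val.comp continuous_subtype_val)).tendsto q₀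
    filter_upwards [eventually_eq_of_tendsto h1 h2 fun q => q.1.2.symm] with q hq
    rw [← hfb q, etale_mk_eq_iff] at hq
    exact ((e ⟨q.1.1.1, q.2⟩).injective hq).symm
  · rw [continuous_prod_of_discrete_right]
    intro a
    exact ((continuous_subtype_val.prodMk (he a)).subtype_mk _).subtype_mk _

/-- The covering `isCoveringMap_etaleOver` of a simply connected base has a section through each of
its points. -/
theorem exists_continuous_lift {D : Type} [TopologicalSpace D] [SimplyConnectedSpace D]
    [LocallyPathConnectedSpace D] {p : D → Y} (h : IsLocallyTrivial F p) (d₀ : D)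
    (b : stalk F (p d₀)) : ∃ s : ∀ d, stalk F (p d),
      (Continuous fun d => (⟨p d, s d⟩ : Etale F)) ∧ s d₀ = b := by
  obtain ⟨S, ⟨hS, hS'⟩, -⟩ := (isCoveringMap_etaleOver h).existsUnique_continuousMap_lifts
    (ContinuousMap.id D) d₀ ⟨(d₀, ⟨p d₀, b⟩), rfl⟩ rfl
  have h1 : ∀ d, (S d).1.1 = d := fun d => congrFun hS' d
  have h2 : ∀ d, (S d).1.2.base = p d := fun d => (S d).2.trans (congrArg p (h1 d))
  refine ⟨fun d => germOver (S d).1.2 _ (h2 d), ?_, ?_⟩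
  · simp only [mk_germOver]
    exact continuous_snd.comp (continuous_subtype_val.comp S.continuous)
  · exact etale_mk_inj ((mk_germOver (S d₀).1.2 _ (h2 d₀)).trans
      (congrArg (fun q : EtaleOver F p => q.1.2) hS))

theorem eqOn_of_continuousOn_lift {D : Type} [TopologicalSpace D] {p : D → Y}
    (h : IsLocallyTrivial F p) {S : Set D} (hS : IsPreconnected S) {s s' : ∀ d, stalk F (p d)}
    (hs : ContinuousOn (fun d => (⟨p d, s d⟩ : Etale F)) S)
    (hs' : ContinuousOn (fun d => (⟨p d, s' d⟩ : Etale F)) S) {d₀ : D} (hd₀ : d₀ ∈ S)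
    (h₀ : s d₀ = s' d₀) {d : D} (hd : d ∈ S) : s d = s' d := by
  have h1 : ∀ {t : ∀ d, stalk F (p d)}, ContinuousOn (fun d => (⟨p d, t d⟩ : Etale F)) S →
      ContinuousOn (fun d => (⟨(d, ⟨p d, t d⟩), rfl⟩ : EtaleOver F p)) S := fun ht =>
    Topology.IsInducing.subtypeVal.continuousOn_iff.2 (continuousOn_id.prodMk ht)
  have h2 := (isCoveringMap_etaleOver h).eqOn_of_comp_eqOn hS (h1 hs) (h1 hs') (fun _ _ => rfl) hd₀
    (by simp only [h₀]) hd
  exact etale_mk_inj (congrArg (fun q : EtaleOver F p => q.1.2) h2)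

theorem etale_add_eq {x y : Y} {a b : stalk F x} {a' b' : stalk F y}
    (h : (⟨x, a⟩ : Etale F) = ⟨y, a'⟩) (h' : (⟨x, b⟩ : Etale F) = ⟨y, b'⟩) :
    (⟨x, a + b⟩ : Etale F) = ⟨y, a' + b'⟩ := by
  cases h
  rw [etale_mk_inj h']

theorem etale_smul_eq {x y : Y} {a : stalk F x} {a' : stalk F y} (c : ℂ)
    (h : (⟨x, a⟩ : Etale F) = ⟨y, a'⟩) : (⟨x, c • a⟩ : Etale F) = ⟨y, c • a'⟩ := by
  cases h
  rfl

/-- The identification of the stalks at equal points. -/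
def stalkCast {x y : Y} (h : x = y) : stalk F x ≃ₗ[ℂ] stalk F y := h ▸ LinearEquiv.refl ℂ _

theorem mk_stalkCast {x y : Y} (h : x = y) (a : stalk F x) :
    (⟨y, stalkCast h a⟩ : Etale F) = ⟨x, a⟩ := by
  subst h; rfl

end Covering

/-! ### Flat structures -/

section Flat

open Filter Topology

variable {N : Type} [AddCommGroup N] [Module.Free ℤ N] [Module.Finite ℤ N] {Δ : Fan N}

/-- A description of a sheaf, locally constant on the orbits, in terms of vector spaces of
multivalued flat sections on the orbits and of maps between them. -/
structure FlatData (F : Sh (X Δ)) (Γ : Δ.Cone → Type) [∀ σ, AddCommGroup (Γ σ)]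
    [∀ σ, Module ℂ (Γ σ)] where
  ev : ∀ (σ : Δ.Cone) (v : ExpSpace N), Γ σ ≃ₗ[ℂ] stalk F (param σ v : X Δ)
  res : ∀ {τ σ : Δ.Cone}, τ ≤ σ → (Γ σ →ₗ[ℂ] Γ τ)
  tendsto : ∀ {τ σ : Δ.Cone} (h : τ ≤ σ) (v : ExpSpace N) (a : Γ σ),
    Tendsto (fun w => (⟨param τ w, ev τ w (res h a)⟩ : Etale F)) (near τ σ v)
      (𝓝 ⟨param σ v, ev σ v a⟩)

namespace FlatData

variable {F : Sh (X Δ)} {Γ : Δ.Cone → Type} [∀ σ, AddCommGroup (Γ σ)] [∀ σ, Module ℂ (Γ σ)]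
  (D : FlatData F Γ)

/-- The value at `exp(2πiv) · x_σ` of a flat section, as a point of the étalé space. -/
def val (σ : Δ.Cone) (v : ExpSpace N) (a : Γ σ) : Etale F := ⟨param σ v, D.ev σ v a⟩

@[simp] theorem base_val (σ : Δ.Cone) (v : ExpSpace N) (a : Γ σ) : (D.val σ v a).base = param σ v :=
  rfl

theorem val_injective {σ : Δ.Cone} {v : ExpSpace N} {a b : Γ σ} (h : D.val σ v a = D.val σ v b) :
    a = b := (D.ev σ v).injective (etale_mk_inj h)

theorem exists_val {σ : Δ.Cone} {v : ExpSpace N} {g : Etale F} (h : g.base = param σ v) :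
    ∃ a, g = D.val σ v a := by
  obtain ⟨x, u⟩ := g
  obtain rfl : x = param σ v := h
  exact ⟨(D.ev σ v).symm u, etale_mk_eq_iff.2 ((D.ev σ v).apply_symm_apply u).symm⟩

theorem tendsto_val {τ σ : Δ.Cone} (h : τ ≤ σ) (v : ExpSpace N) (a : Γ σ) :
    Tendsto (fun w => D.val τ w (D.res h a)) (near τ σ v) (𝓝 (D.val σ v a)) := D.tendsto h v a

@[simp] theorem res_refl (σ : Δ.Cone) (a : Γ σ) : D.res (le_refl σ) a = a := by
  -- The principal filter at `0` refines `near σ σ 0`, so the limit property can be read at the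
  -- point `0` itself.
  have h1 := (D.tendsto_val (le_refl σ) 0 a).mono_left ((pure_le_nhds _).trans (nhds_le_near σ 0))
  have h2 := eventually_eq_of_tendsto h1 (tendsto_pure_nhds (fun v => D.val σ v a) 0) fun _ => rfl
  exact D.val_injective (eventually_pure.1 h2)

theorem continuous_val (σ : Δ.Cone) (a : Γ σ) : Continuous fun v => D.val σ v a :=
  continuous_iff_continuousAt.2 fun v => by
    have := (D.tendsto_val (le_refl σ) v a).mono_left (nhds_le_near σ v)
    simp only [res_refl] at this
    exact this

/-- Continuous lifts to the étalé space over an orbit are flat sections. -/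
theorem exists_eq_val {A : Type*} [TopologicalSpace A] [PreconnectedSpace A] [Nonempty A]
    {σ : Δ.Cone} {g : A → Etale F} (hg : Continuous g) {φ : A → ExpSpace N} (hφ : Continuous φ)
    (hb : ∀ x, (g x).base = param σ (φ x)) : ∃ a, ∀ x, g x = D.val σ (φ x) a := by
  choose a ha using fun x => D.exists_val (hb x)
  have hl : IsLocallyConstant a := (IsLocallyConstant.iff_eventually_eq a).2 fun x₀ => by
    have h1 : Tendsto (fun x => D.val σ (φ x) (a x₀)) (𝓝 x₀) (𝓝 (g x₀)) := by
      rw [ha x₀]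
      exact ((D.continuous_val σ (a x₀)).comp hφ).tendsto x₀
    filter_upwards [eventually_eq_of_tendsto h1 (hg.tendsto x₀) fun x => (hb x).symm] with x hx
    rw [ha x] at hx
    exact (D.val_injective hx).symm
  obtain ⟨x₀⟩ := (inferInstance : Nonempty A)
  exact ⟨a x₀, fun x => by rw [← hl.apply_eq_of_preconnectedSpace x x₀]; exact ha x⟩

/-- The segment from `v` to `v'` maps to a single point of `X`, and a continuous lift of a constant
path over a flat structure is constant. -/
theorem val_eq_of_perp {σ : Δ.Cone} {v v' : ExpSpace N}
    (h : ∀ m, IsPerp σ.1 m → dot m v = dot m v') (a : Γ σ) : D.val σ v a = D.val σ v' a := by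
  obtain ⟨b, hb⟩ := D.exists_eq_val (A := ℝ) (σ := σ) (g := fun _ => D.val σ v a) continuous_const
    (φ := fun t => v + t • (v' - v)) (by fun_prop) fun t => param_eq_param_of_perp fun m hm => by
      rw [map_add, LinearMap.map_smul_of_tower, map_sub, h m hm, sub_self, smul_zero, add_zero]
  have h0 := hb 0
  have h1 := hb 1
  rw [zero_smul, add_zero] at h0
  rw [one_smul, add_sub_cancel] at h1
  rw [D.val_injective h0] at h1 ⊢
  exact h1

theorem exists_monodromy (σ : Δ.Cone) (n : N) (a : Γ σ) :
    ∃ b, ∀ v, D.val σ (v + latticeVec n) a = D.val σ v b :=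
  D.exists_eq_val (A := ExpSpace N) (φ := id)
    ((D.continuous_val σ a).comp (continuous_id.add continuous_const)) continuous_id
    fun v => param_add_latticeVec σ v n

theorem val_add_of_eq {σ : Δ.Cone} {v v' : ExpSpace N} {a b a' b' : Γ σ}
    (h : D.val σ v a = D.val σ v' a') (h' : D.val σ v b = D.val σ v' b') :
    D.val σ v (a + b) = D.val σ v' (a' + b') := by
  unfold val at *
  rw [map_add, map_add]
  exact etale_add_eq h h'

theorem val_smul_of_eq {σ : Δ.Cone} {v v' : ExpSpace N} {a a' : Γ σ} (c : ℂ)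
    (h : D.val σ v a = D.val σ v' a') : D.val σ v (c • a) = D.val σ v' (c • a') := by
  unfold val at *
  rw [map_smul, map_smul]
  exact etale_smul_eq c h

/-- The monodromy operator of `n ∈ N` on flat sections. -/
def monodromy (σ : Δ.Cone) (n : N) : Module.End ℂ (Γ σ) where
  toFun a := (D.exists_monodromy σ n a).choose
  map_add' a b := D.val_injective (v := 0) (by
    rw [← (D.exists_monodromy σ n (a + b)).choose_spec 0]
    exact D.val_add_of_eq ((D.exists_monodromy σ n a).choose_spec 0)
      ((D.exists_monodromy σ n b).choose_spec 0))
  map_smul' c a := D.val_injective (v := 0) (by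
    rw [← (D.exists_monodromy σ n (c • a)).choose_spec 0]
    exact D.val_smul_of_eq c ((D.exists_monodromy σ n a).choose_spec 0))

theorem val_add_latticeVec (σ : Δ.Cone) (n : N) (v : ExpSpace N) (a : Γ σ) :
    D.val σ (v + latticeVec n) a = D.val σ v (D.monodromy σ n a) :=
  (D.exists_monodromy σ n a).choose_spec v

theorem val_eq_monodromy {σ : Δ.Cone} {v v' : ExpSpace N} {n : N}
    (h : ∀ m, IsPerp σ.1 m → dot m (v - v') = m n) (a : Γ σ) :
    D.val σ v a = D.val σ v' (D.monodromy σ n a) := by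
  rw [← val_add_latticeVec]
  exact D.val_eq_of_perp (fun m hm => by
    rw [map_add, dot_latticeVec, ← h m hm, map_sub, add_sub_cancel]) a

theorem monodromy_add (σ : Δ.Cone) (n n' : N) :
    D.monodromy σ (n + n') = D.monodromy σ n * D.monodromy σ n' := LinearMap.ext fun a => by
  refine D.val_injective (v := 0) ?_
  rw [← val_add_latticeVec, Module.End.mul_apply, ← val_add_latticeVec, ← val_add_latticeVec,
    map_add, add_assoc]

theorem monodromy_of_mem_spanLattice {σ : Δ.Cone} {n : N} (hn : n ∈ spanLattice σ.1) :
    D.monodromy σ n = 1 := LinearMap.ext fun a => by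
  refine D.val_injective (v := 0) ?_
  rw [← val_add_latticeVec]
  exact D.val_eq_of_perp (fun m hm => by
    rw [map_add, dot_latticeVec, hm.apply_eq_zero hn, Int.cast_zero, add_zero]) a

theorem eq_of_eventually_val {τ : Δ.Cone} {l : Filter (ExpSpace N)} [l.NeBot] {a b : Γ τ}
    (h : ∀ᶠ w in l, D.val τ w a = D.val τ w b) : a = b := by
  obtain ⟨w, hw⟩ := h.exists
  exact D.val_injective hw

theorem eq_res {τ σ : Δ.Cone} (h : τ ≤ σ) (v : ExpSpace N) {a : Γ σ} {b : Γ τ}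
    (hb : Tendsto (fun w => D.val τ w b) (near τ σ v) (𝓝 (D.val σ v a))) : b = D.res h a :=
  D.eq_of_eventually_val (eventually_eq_of_tendsto hb (D.tendsto_val h v a) fun _ => rfl)

/-- Translation by a lattice vector does not move points of the orbits and carries the logarithms
near `0` to those near the translate; restricting and translating therefore commute. -/
theorem res_monodromy {τ σ : Δ.Cone} (h : τ ≤ σ) (n : N) (a : Γ σ) :
    D.res h (D.monodromy σ n a) = D.monodromy τ n (D.res h a) := by
  refine (D.eq_res h 0 ?_).symm
  have h1 := (D.tendsto_val h (0 + latticeVec n) a).comp (tendsto_add_latticeVec_near τ σ 0 n)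
  simp only [Function.comp_def, val_add_latticeVec] at h1
  exact h1

/-- One section represents the germ on `O_σ`. Near a logarithm `w` in `O_τ` close enough to `O_σ`,
the logarithms in `O_ρ` are also close to `O_σ`, and both restrictions agree there with that
section. -/
theorem res_res {ρ τ σ : Δ.Cone} (h : ρ ≤ τ) (h' : τ ≤ σ) (a : Γ σ) :
    D.res h (D.res h' a) = D.res (h.trans h') a := by
  obtain ⟨U, hU, t, ht⟩ := exists_germAt (D.val σ 0 a)
  have h1 := D.tendsto_val h' 0 a
  have h2 := D.tendsto_val (h.trans h') 0 a
  rw [ht] at h1 h2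
  have h1 := ((tendsto_etale_iff hU t).1 h1).2
  have h2 := ((tendsto_etale_iff hU t).1 h2).2
  obtain ⟨E₁, ε₁, hε₁, h1⟩ := mem_near_iff.1 h1
  obtain ⟨E₂, ε₂, hε₂, h2⟩ := mem_near_iff.1 h2
  classical
  have hε : 0 < min ε₁ ε₂ := lt_min hε₁ hε₂
  obtain ⟨w, hw⟩ := nearSet_nonempty τ σ 0 (E₁ ∪ E₂) hε
  obtain ⟨hwU, hwt⟩ := h1 (nearSet_mono Finset.subset_union_left hε (min_le_left _ _) hw)
  have h3 : nearSet ρ σ 0 (E₁ ∪ E₂) (min ε₁ ε₂) ∈ near ρ τ w := nearSet_mem_near_of_mem h' hw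
  have h4 := D.tendsto_val h w (D.res h' a)
  have h5 : D.val τ w (D.res h' a) = ⟨param τ w, germAt F t _ hwU⟩ := etale_mk_eq_iff.2 hwt
  rw [h5] at h4
  refine D.eq_of_eventually_val (l := near ρ τ w) ?_
  filter_upwards [((tendsto_etale_iff hwU t).1 h4).2, h3] with x ⟨hx, hx'⟩ hx3
  obtain ⟨hx4, hx5⟩ := h2 (nearSet_mono Finset.subset_union_right hε (min_le_right _ _) hx3)
  exact etale_mk_eq_iff.2 (hx'.trans hx5.symm)

end FlatData

end Flat

end ToricLC

end

noncomputable section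

namespace ToricLC

/-! ### Sheaves locally constant on the orbits have flat structures -/

section ExistsFlat

open Filter Topology

theorem IsLocallyTrivial.comp {Y : TopCat.{0}} {F : Sh Y} {D D' : Type} [TopologicalSpace D]
    [TopologicalSpace D'] {p : D → Y} (h : IsLocallyTrivial F p) {q : D' → D} (hq : Continuous q) :
    IsLocallyTrivial F (p ∘ q) := fun d => by
  obtain ⟨W, hW, hd, A, e, he⟩ := h (q d)
  refine ⟨q ⁻¹' W, hW.preimage hq, hd, A, fun x => e ⟨q x.1, x.2⟩, fun a => ?_⟩
  exact (he a).comp ((hq.comp continuous_subtype_val).subtype_mk fun x => x.2)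

variable {N : Type} [AddCommGroup N] [Module.Free ℤ N] [Module.Finite ℤ N] {Δ : Fan N}
  {F : Sh (X Δ)}

theorem isLocallyTrivial_param (hF : isLC Δ F) (σ : Δ.Cone) :
    IsLocallyTrivial F (Y := X Δ) (param σ) :=
  (isLocallyTrivial_of_isLocallyConstant (hF σ)).comp
    (q := fun v => (⟨param σ v, param_mem_torusOrbit σ v⟩ : (torusOrbit σ : Set (X Δ))))
    ((continuous_param σ).subtype_mk _)

/-- The space of multivalued flat sections of a sheaf on an orbit. -/
def flatSections (hF : isLC Δ F) (σ : Δ.Cone) :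
    Submodule ℂ (∀ v : ExpSpace N, stalk F (param σ v : X Δ)) where
  carrier := {s | Continuous fun v => (⟨param σ v, s v⟩ : Etale F)}
  add_mem' h h' := continuous_iff_continuousAt.2 fun v =>
    tendsto_etale_add (h.tendsto v) (h'.tendsto v)
  zero_mem' := by
    obtain ⟨s, hs, -⟩ := exists_continuous_lift (isLocallyTrivial_param hF σ) 0 0
    refine continuous_iff_continuousAt.2 fun v => ?_
    have := tendsto_etale_smul 0 (hs.tendsto v)
    simp only [zero_smul] at this
    exact this
  smul_mem' c _ h := continuous_iff_continuousAt.2 fun v => tendsto_etale_smul c (h.tendsto v)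

theorem flatSections_ext (hF : isLC Δ F) {σ : Δ.Cone} {s s' : flatSections hF σ} {v : ExpSpace N}
    (h : s.1 v = s'.1 v) : s = s' :=
  Subtype.ext (funext fun w => eqOn_of_continuousOn_lift (isLocallyTrivial_param hF σ)
    isPreconnected_univ s.2.continuousOn s'.2.continuousOn (Set.mem_univ v) h (Set.mem_univ w))

/-- Evaluation of flat sections. -/
def flatEval (hF : isLC Δ F) (σ : Δ.Cone) (v : ExpSpace N) :
    flatSections hF σ ≃ₗ[ℂ] stalk F (param σ v : X Δ) :=
  LinearEquiv.ofBijective (LinearMap.proj v ∘ₗ (flatSections hF σ).subtype)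
    ⟨fun _ _ h => flatSections_ext hF h, fun b => by
      obtain ⟨s, hs, hb⟩ := exists_continuous_lift (isLocallyTrivial_param hF σ) v b
      exact ⟨⟨s, hs⟩, hb⟩⟩

/-- `s'` is the limit of `s` from the orbit of `τ` at a point of the orbit of `σ`. -/
def IsCospec (hF : isLC Δ F) {τ σ : Δ.Cone} (s : flatSections hF σ) (v : ExpSpace N)
    (s' : flatSections hF τ) : Prop :=
  Tendsto (fun w => (⟨param τ w, s'.1 w⟩ : Etale F)) (near τ σ v) (𝓝 ⟨param σ v, s.1 v⟩)

theorem IsCospec.unique {hF : isLC Δ F} {τ σ : Δ.Cone} {s : flatSections hF σ} {v : ExpSpace N}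
    {s₁ s₂ : flatSections hF τ} (h₁ : IsCospec hF s v s₁) (h₂ : IsCospec hF s v s₂) : s₁ = s₂ := by
  obtain ⟨w, hw⟩ := (eventually_eq_of_tendsto h₁ h₂ fun _ => rfl).exists
  exact flatSections_ext hF (etale_mk_inj hw)

/-- A section representing the germ at `v` is defined at all points of `O_τ` with logarithms in some
basic set. That set is convex, hence connected, so the section is there a flat section of `N ⊗ ℂ`;
the same basic set serves for all nearby `v'`. -/
theorem exists_isCospec (hF : isLC Δ F) {τ σ : Δ.Cone} (h : τ ≤ σ) (s : flatSections hF σ)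
    (v : ExpSpace N) : ∃ s' : flatSections hF τ, ∀ᶠ v' in 𝓝 v, IsCospec hF s v' s' := by
  classical
  obtain ⟨U, hU, t, ht⟩ := exists_germAt' (s.1 v)
  have h1 : ∀ᶠ w in near τ σ v, param τ w ∈ U :=
    (tendsto_param_near h v).eventually (U.isOpen.mem_nhds hU)
  obtain ⟨E, ε, hε, hE⟩ := mem_near_iff.1 h1
  obtain ⟨w₀, hw₀⟩ := nearSet_nonempty τ σ v E hε
  -- The value `0` off `U` only makes `g` total; on the basic set the points lie in `U`.
  let g : ∀ w, stalk F (param τ w : X Δ) := fun w =>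
    if hw : param τ w ∈ U then germAt F t (param τ w : X Δ) hw else 0
  have hg : ∀ w (hw : param τ w ∈ U), g w = germAt F t (param τ w : X Δ) hw := fun w hw =>
    dif_pos hw
  have hgc : ContinuousOn (fun w => (⟨param τ w, g w⟩ : Etale F)) (nearSet τ σ v E ε) := by
    intro w hw
    have hwU : param τ w ∈ U := hE hw
    rw [ContinuousWithinAt, hg w hwU]
    exact tendsto_etale_germ hwU t
      (((continuous_param τ).tendsto w).mono_left nhdsWithin_le_nhds) fun a ha => hg a ha
  obtain ⟨s', hs', hs'w⟩ := exists_continuous_lift (isLocallyTrivial_param hF τ) w₀ (g w₀)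
  have heq : ∀ w ∈ nearSet τ σ v E ε, s' w = g w := fun w hw =>
    eqOn_of_continuousOn_lift (isLocallyTrivial_param hF τ)
      (convex_nearSet τ σ v E ε).isPreconnected hs'.continuousOn hgc hw₀ hs'w hw
  refine ⟨⟨s', hs'⟩, ?_⟩
  have h2 : Tendsto (fun v' => (⟨param σ v', s.1 v'⟩ : Etale F)) (𝓝 v)
      (𝓝 ⟨param σ v, germAt F t _ hU⟩) := by
    rw [ht]; exact s.2.tendsto v
  filter_upwards [((tendsto_etale_iff hU t).1 h2).2,
    nhds_le_near σ v (nearSet_mem_near σ σ v E hε)] with v' ⟨h3, h4⟩ h5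
  have h6 : nearSet τ σ v E ε ∈ near τ σ v' := nearSet_mem_near_of_mem le_rfl h5
  have h4' : s.1 v' = germAt F t _ h3 := h4
  rw [IsCospec, h4']
  refine (tendsto_etale_iff h3 t).2 ⟨tendsto_param_near h v', ?_⟩
  filter_upwards [h6] with w hw
  exact ⟨hE hw, (heq w hw).trans (hg w (hE hw))⟩

/-- The limit from `O_τ` depends on `v` in a locally constant way, and `N ⊗ ℂ` is connected. -/
theorem exists_isCospec_forall (hF : isLC Δ F) {τ σ : Δ.Cone} (h : τ ≤ σ)
    (s : flatSections hF σ) : ∃ s' : flatSections hF τ, ∀ v, IsCospec hF s v s' := by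
  choose s' hs' using exists_isCospec hF h s
  have hl : IsLocallyConstant s' := (IsLocallyConstant.iff_eventually_eq s').2 fun v => by
    filter_upwards [hs' v] with v' hv'
    exact (hs' v').self_of_nhds.unique hv'
  exact ⟨s' 0, fun v => by
    rw [hl.apply_eq_of_preconnectedSpace 0 v]
    exact (hs' v).self_of_nhds⟩

theorem exists_flatData (hF : isLC Δ F) :
    Nonempty (FlatData F fun σ => flatSections hF σ) := by
  choose c hc using fun {τ σ : Δ.Cone} (h : τ ≤ σ) (s : flatSections hF σ) =>
    exists_isCospec_forall hF h s
  exact ⟨{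
    ev := flatEval hF
    res := fun h =>
      { toFun := c h
        map_add' := fun s s' => (hc h (s + s') 0).unique
          (tendsto_etale_add (hc h s 0) (hc h s' 0))
        map_smul' := fun r s => (hc h (r • s) 0).unique (tendsto_etale_smul r (hc h s 0)) }
    tendsto := fun h v s => hc h s v }⟩

/-- Transport of a flat structure to isomorphic spaces of flat sections. -/
def FlatData.congr {Γ Γ' : Δ.Cone → Type} [∀ σ, AddCommGroup (Γ σ)] [∀ σ, Module ℂ (Γ σ)]
    [∀ σ, AddCommGroup (Γ' σ)] [∀ σ, Module ℂ (Γ' σ)] (D : FlatData F Γ)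
    (e : ∀ σ, Γ' σ ≃ₗ[ℂ] Γ σ) : FlatData F Γ' where
  ev σ v := (e σ).trans (D.ev σ v)
  res {τ σ} h := (e τ).symm.toLinearMap ∘ₗ D.res h ∘ₗ (e σ).toLinearMap
  tendsto {τ σ} h v a := by
    simp only [LinearMap.comp_apply, LinearEquiv.coe_coe, LinearEquiv.trans_apply,
      LinearEquiv.apply_symm_apply]
    exact D.tendsto h v (e σ a)

/-- The stalks at the distinguished points. -/
abbrev ptStalk (F : Sh (X Δ)) (σ : Δ.Cone) : Type := stalk F (pt σ : X Δ)

/-- A flat section is determined by its value at `v = 0`, where `param σ 0` is the distinguished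
point up to a propositional equality; this lets the stalk itself serve as the space of flat
sections. -/
theorem exists_flatData_ptStalk (hF : isLC Δ F) :
    ∃ D : FlatData F (ptStalk F), ∀ σ a, D.val σ 0 a = ⟨pt σ, a⟩ := by
  obtain ⟨D⟩ := exists_flatData hF
  refine ⟨D.congr fun σ => (stalkCast (param_zero σ).symm).trans (D.ev σ 0).symm, fun σ a => ?_⟩
  have : (D.congr fun σ => (stalkCast (param_zero σ).symm).trans (D.ev σ 0).symm).val σ 0 a =
      ⟨param σ 0, stalkCast (param_zero σ).symm a⟩ := by
    refine etale_mk_eq_iff.2 ?_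
    exact (D.ev σ 0).apply_symm_apply _
  rw [this, mk_stalkCast]

end ExistsFlat

/-! ### Morphisms and flat structures -/

section FlatHom

open Filter Topology

/-- A family of maps of stalks `F_{f(y)} → G_y` which is continuous on étalé spaces. -/
def IsEtaleFamily {Y Y' : TopCat.{0}} (f : Y → Y') {F : Sh Y'} {G : Sh Y}
    (ψ : ∀ y, stalk F (f y) →ₗ[ℂ] stalk G y) : Prop :=
  ∀ (U : Opens Y') (t : F.presheaf.obj (op U)) (y : Y) (hy : f y ∈ U),
    ∃ (V : Opens Y) (_ : y ∈ V) (t' : G.presheaf.obj (op V)),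
      ∀ (z : Y) (hz : f z ∈ U) (hz' : z ∈ V), ψ z (germAt F t (f z) hz) = germAt G t' z hz'

theorem IsEtaleFamily.tendsto {Y Y' : TopCat.{0}} {f : Y → Y'} {F : Sh Y'} {G : Sh Y}
    {ψ : ∀ y, stalk F (f y) →ₗ[ℂ] stalk G y} (hψ : IsEtaleFamily f ψ) {α : Type*} {l : Filter α}
    {b : α → Y} {y : Y} (hb : Tendsto b l (𝓝 y)) {s : ∀ a, stalk F (f (b a))} {u : stalk F (f y)}
    (h : Tendsto (fun a => (⟨f (b a), s a⟩ : Etale F)) l (𝓝 ⟨f y, u⟩)) :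
    Tendsto (fun a => (⟨b a, ψ (b a) (s a)⟩ : Etale G)) l (𝓝 ⟨y, ψ y u⟩) := by
  obtain ⟨U, hU, t, rfl⟩ := exists_germAt' u
  obtain ⟨V, hV, t', ht'⟩ := hψ U t y hU
  rw [ht' y hU hV, tendsto_etale_iff]
  refine ⟨hb, ?_⟩
  filter_upwards [((tendsto_etale_iff hU t).1 h).2, hb.eventually (V.isOpen.mem_nhds hV)]
    with a ⟨h1, h2⟩ h3
  refine ⟨h3, ?_⟩
  exact (congrArg (ψ (b a)) h2).trans (ht' (b a) h1 h3)

theorem isEtaleFamily_adjStalk {Y Y' : TopCat.{0}} (f : Y ⟶ Y') {F : Sh Y'} {G : Sh Y}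
    (φ : F ⟶ (TopCat.Sheaf.pushforward (ModuleCat.{0} ℂ) f).obj G) :
    IsEtaleFamily f (adjStalk f φ) := fun U t y hy =>
  ⟨(Opens.map f).obj U, mem_map f hy, φ.hom.app (op U) t, fun z hz _ => adjStalk_germAt f φ z hz t⟩

theorem isEtaleFamily_stalkMap {Y : TopCat.{0}} {F G : Sh Y} (φ : F ⟶ G) :
    IsEtaleFamily (id : Y → Y) (stalkMap φ) := fun U t y hy =>
  ⟨U, hy, φ.hom.app (op U) t, fun z hz _ => stalkMap_germAt φ t z hz⟩

theorem IsEtaleFamily.exists_adjStalk {Y Y' : TopCat.{0}} (f : Y ⟶ Y') {F : Sh Y'} {G : Sh Y}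
    {ψ : ∀ y, stalk F (f y) →ₗ[ℂ] stalk G y} (hψ : IsEtaleFamily f ψ) :
    ∃ φ : F ⟶ (TopCat.Sheaf.pushforward (ModuleCat.{0} ℂ) f).obj G, ∀ y, adjStalk f φ y = ψ y := by
  refine exists_hom_of_stalks f ψ fun U t => continuous_iff_continuousAt.2 fun y => ?_
  refine hψ.tendsto (continuous_subtype_val.tendsto y) ?_
  exact tendsto_etale_germ (map_mem f y.2) t
    ((f.hom.continuous.comp continuous_subtype_val).tendsto y) fun _ _ => rfl

/-- Apply the result on maps `F ⟶ f_* G` to the identity: direct image along it has the same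
sections by definition. -/
theorem IsEtaleFamily.exists_stalkMap {Y : TopCat.{0}} {F G : Sh Y}
    {ψ : ∀ y : Y, stalk F y →ₗ[ℂ] stalk G y} (hψ : IsEtaleFamily (id : Y → Y) ψ) :
    ∃ φ : F ⟶ G, ∀ y, stalkMap φ y = ψ y := by
  have hψ' : IsEtaleFamily (𝟙 Y : Y ⟶ Y) ψ := hψ
  obtain ⟨φ, hφ⟩ := hψ'.exists_adjStalk (𝟙 Y)
  let φ' : F ⟶ G := ⟨{ app := fun U => φ.hom.app U, naturality := fun U V i => φ.hom.naturality i }⟩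
  refine ⟨φ', fun y => LinearMap.ext fun a => ?_⟩
  obtain ⟨U, hU, t, rfl⟩ := exists_germAt' a
  rw [stalkMap_germAt, ← hφ]
  exact (adjStalk_germAt (𝟙 Y) φ y hU t).symm

variable {N : Type} [AddCommGroup N] [Module.Free ℤ N] [Module.Finite ℤ N] {Δ : Fan N}
  {F G : Sh (X Δ)} {Γ Γ' : Δ.Cone → Type} [∀ σ, AddCommGroup (Γ' σ)] [∀ σ, Module ℂ (Γ' σ)]
  [∀ σ, AddCommGroup (Γ σ)] [∀ σ, Module ℂ (Γ σ)]

/-- The family `ψ` of maps of stalks is given by the maps `φ` of spaces of flat sections. -/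
def FlatRel (D : FlatData F Γ) (D' : FlatData G Γ') (f : X Δ → X Δ) (k : ℕ)
    (ψ : ∀ y, stalk F (f y) →ₗ[ℂ] stalk G y) (φ : ∀ σ, Γ σ →ₗ[ℂ] Γ' σ) : Prop :=
  ∀ (σ : Δ.Cone) (v : ExpSpace N) (a : Γ σ) (u : stalk F (f (param σ v))),
    (⟨f (param σ v), u⟩ : Etale F) = D.val σ (k • v) a →
      (⟨param σ v, ψ (param σ v) u⟩ : Etale G) = D'.val σ v (φ σ a)

variable {D : FlatData F Γ} {D' : FlatData G Γ'} {f : X Δ → X Δ} {k : ℕ}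
  {ψ : ∀ y, stalk F (f y) →ₗ[ℂ] stalk G y}

theorem FlatData.exists_germ_eq_val (D : FlatData F Γ) {x : X Δ} {σ : Δ.Cone} {v : ExpSpace N}
    (h : x = param σ v) (a : Γ σ) : ∃ u : stalk F x, (⟨x, u⟩ : Etale F) = D.val σ v a := by
  subst h
  exact ⟨_, rfl⟩

/-- Along `v ↦ k • v`, which lifts `f`, a flat section of `F` pulls back to a continuous family of
germs; applying `ψ` gives a continuous lift over `O_σ` for `G`, which is again flat. -/
theorem exists_flatRel (D : FlatData F Γ) (D' : FlatData G Γ')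
    (hf : ∀ (σ : Δ.Cone) v, f (param σ v) = param σ (k • v)) (hψ : IsEtaleFamily f ψ) :
    ∃ φ : ∀ σ, Γ σ →ₗ[ℂ] Γ' σ, FlatRel D D' f k ψ φ := by
  choose u hu using fun (σ : Δ.Cone) (v : ExpSpace N) (a : Γ σ) => D.exists_germ_eq_val (hf σ v) a
  have h1 : ∀ (σ : Δ.Cone) (a : Γ σ), ∃ b : Γ' σ, ∀ v,
      (⟨param σ v, ψ (param σ v) (u σ v a)⟩ : Etale G) = D'.val σ v b := fun σ a => by
    refine D'.exists_eq_val (A := ExpSpace N) (φ := id) (continuous_iff_continuousAt.2 fun v => ?_)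
      continuous_id fun _ => rfl
    refine hψ.tendsto ((continuous_param σ).tendsto v) ?_
    simp only [hu]
    exact ((D.continuous_val σ a).comp (continuous_const_smul k)).tendsto v
  choose φ hφ using h1
  have hadd : ∀ σ v a b, u σ v (a + b) = u σ v a + u σ v b := fun σ v a b => by
    refine etale_mk_inj ((hu σ v (a + b)).trans (Eq.symm ?_))
    refine (etale_add_eq (hu σ v a) (hu σ v b)).trans ?_
    rw [FlatData.val, map_add]
  have hsmul : ∀ σ v (c : ℂ) a, u σ v (c • a) = c • u σ v a := fun σ v c a => by
    refine etale_mk_inj ((hu σ v (c • a)).trans (Eq.symm ?_))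
    refine (etale_smul_eq c (hu σ v a)).trans ?_
    rw [FlatData.val, map_smul]
  refine ⟨fun σ => { toFun := φ σ, map_add' := fun a b => ?_, map_smul' := fun c a => ?_ }, ?_⟩
  · refine D'.val_injective (v := 0) ?_
    rw [← hφ, hadd, map_add]
    refine (etale_add_eq (hφ σ a 0) (hφ σ b 0)).trans ?_
    rw [FlatData.val, map_add]
  · refine D'.val_injective (v := 0) ?_
    rw [← hφ, hsmul, map_smul]
    refine (etale_smul_eq c (hφ σ a 0)).trans ?_
    rw [FlatData.val, RingHom.id_apply, map_smul]
  · intro σ v a u' hu'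
    rw [etale_mk_inj (hu'.trans (hu σ v a).symm)]
    exact hφ σ a v

namespace FlatRel

variable {φ : ∀ σ, Γ σ →ₗ[ℂ] Γ' σ}

/-- Since `k • (v + n) = k • v + k • n`, a loop downstairs is wrapped `k` times by `f`; hence the
operator of `k • n` on the source side. -/
theorem map_monodromy (h : FlatRel D D' f k ψ φ)
    (hf : ∀ (σ : Δ.Cone) v, f (param σ v) = param σ (k • v)) (σ : Δ.Cone) (n : N) (a : Γ σ) :
    φ σ (D.monodromy σ (k • n) a) = D'.monodromy σ n (φ σ a) := by
  refine D'.val_injective (v := 0) ?_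
  rw [← D'.val_add_latticeVec]
  obtain ⟨u, hu⟩ := D.exists_germ_eq_val (hf σ 0) (D.monodromy σ (k • n) a)
  obtain ⟨u', hu'⟩ := D.exists_germ_eq_val (hf σ (0 + latticeVec n)) a
  rw [← h σ 0 _ u hu, ← h σ _ a u' hu']
  have hp : param σ (0 + latticeVec n) = param σ 0 := param_add_latticeVec σ 0 n
  have h2 : D.val σ (k • (0 + latticeVec n)) a = D.val σ (k • 0) (D.monodromy σ (k • n) a) := by
    rw [smul_add, ← map_nsmul, D.val_add_latticeVec]
  have h3 := hu.trans (h2.symm.trans hu'.symm)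
  revert u'
  rw [hp]
  intro u' _ h3
  rw [etale_mk_inj h3]

theorem map_res (h : FlatRel D D' f k ψ φ) (hψ : IsEtaleFamily f ψ) (hk : 0 < k)
    (hf : ∀ (σ : Δ.Cone) v, f (param σ v) = param σ (k • v)) {τ σ : Δ.Cone} (hle : τ ≤ σ)
    (a : Γ σ) : φ τ (D.res hle a) = D'.res hle (φ σ a) := by
  refine D'.eq_res hle 0 ?_
  choose u hu using fun w => D.exists_germ_eq_val (hf τ w) (D.res hle a)
  obtain ⟨u₀, hu₀⟩ := D.exists_germ_eq_val (hf σ 0) a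
  have h1 : ∀ w, D'.val τ w (φ τ (D.res hle a)) = ⟨param τ w, ψ (param τ w) (u w)⟩ := fun w =>
    (h τ w _ (u w) (hu w)).symm
  simp only [h1, ← h σ 0 a u₀ hu₀]
  refine hψ.tendsto (tendsto_param_near hle 0) ?_
  simp only [hu, hu₀]
  exact (D.tendsto_val hle (k • 0) a).comp (tendsto_nsmul_near τ σ 0 hk)

end FlatRel

/-- Maps of spaces of flat sections compatible with monodromy and restrictions define maps of
stalks. -/
theorem exists_isEtaleFamily (D : FlatData F Γ) (D' : FlatData G Γ') (hk : 0 < k)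
    (hf : ∀ (σ : Δ.Cone) v, f (param σ v) = param σ (k • v)) (hfc : Continuous f)
    (φ : ∀ σ, Γ σ →ₗ[ℂ] Γ' σ)
    (hT : ∀ σ n a, φ σ (D.monodromy σ (k • n) a) = D'.monodromy σ n (φ σ a))
    (hres : ∀ {τ σ : Δ.Cone} (h : τ ≤ σ) a, φ τ (D.res h a) = D'.res h (φ σ a)) :
    ∃ ψ : ∀ y, stalk F (f y) →ₗ[ℂ] stalk G y, IsEtaleFamily f ψ ∧ FlatRel D D' f k ψ φ := by
  -- The map on the stalk at `y` is defined through an arbitrary logarithm of `y`; compatibility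
  -- with monodromy will show that the choice is immaterial.
  choose σ v hσv using fun y : X Δ => exists_param (Δ := Δ) y
  have e1 : ∀ y, f y = param (σ y) (k • v y) := fun y => by rw [← hf, hσv]
  let ψ : ∀ y, stalk F (f y) →ₗ[ℂ] stalk G y := fun y =>
    (stalkCast (hσv y)).toLinearMap ∘ₗ (D'.ev (σ y) (v y)).toLinearMap ∘ₗ φ (σ y) ∘ₗ
      (D.ev (σ y) (k • v y)).symm.toLinearMap ∘ₗ (stalkCast (e1 y)).toLinearMap
  have h1 : ∀ y (u : stalk F (f y)) a, (⟨f y, u⟩ : Etale F) = D.val (σ y) (k • v y) a →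
      (⟨y, ψ y u⟩ : Etale G) = D'.val (σ y) (v y) (φ (σ y) a) := by
    intro y u a h
    have h2 : stalkCast (e1 y) u = D.ev (σ y) (k • v y) a :=
      etale_mk_inj ((mk_stalkCast (e1 y) u).trans h)
    have h3 : ψ y u = stalkCast (hσv y) (D'.ev (σ y) (v y) (φ (σ y) a)) := by
      simp only [ψ, LinearMap.comp_apply, LinearEquiv.coe_coe, h2, LinearEquiv.symm_apply_apply]
    rw [h3, mk_stalkCast]
    rfl
  have hrel : FlatRel D D' f k ψ φ := by
    intro ρ w a u hu
    obtain ⟨n, hn⟩ : ∃ n : N, ∀ m, IsPerp ρ.1 m → dot m (w - v (param ρ w)) = m n := by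
      have h2 := hσv (param ρ w)
      have h3 := cone_eq_of_param_eq h2
      rw [h3] at h2
      exact exists_lattice_of_param_eq h2.symm
    have h3 : σ (param ρ w) = ρ := cone_eq_of_param_eq (hσv (param ρ w))
    have h4 := h1 (param ρ w) u
    -- The chosen cone equals `ρ` only propositionally. Generalizing it and the chosen logarithm
    -- allows the substitution.
    generalize hy : v (param ρ w) = v' at *
    generalize σ (param ρ w) = ρ' at *
    subst h3
    rw [D'.val_eq_monodromy hn, ← hT]
    refine h4 _ ?_
    rw [hu]
    refine D.val_eq_monodromy (fun m hm => ?_) a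
    rw [← smul_sub, map_nsmul, map_nsmul, hn m hm, nsmul_eq_mul, nsmul_eq_mul]
    push_cast
    rfl
  refine ⟨ψ, ?_, hrel⟩
  intro U t y hy
  obtain ⟨ρ, w, rfl⟩ := exists_param y
  obtain ⟨a, ha⟩ := D.exists_val (g := ⟨f (param ρ w), germAt F t _ hy⟩) (hf ρ w)
  obtain ⟨V, hV, t', ht'⟩ := exists_germAt (D'.val ρ w (φ ρ a))
  -- Continuity is tested separately on each stratum `τ ≤ ρ`: both germs are there the values of the
  -- restricted flat sections, which `φ` exchanges.
  have hev : ∀ᶠ z in 𝓝 (param ρ w), ∃ (hz : f z ∈ U) (hz' : z ∈ V),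
      ψ z (germAt F t (f z) hz) = germAt G t' z hz' := by
    rw [eventually_nhds_param_iff]
    intro τ hτ
    have h2 := D'.tendsto_val hτ w (φ ρ a)
    rw [ht'] at h2
    have h3 := (D.tendsto_val hτ (k • w) a).comp (tendsto_nsmul_near τ ρ w hk)
    rw [← ha] at h3
    have h4 : ∀ᶠ x in near τ ρ w, f (param τ x) ∈ U :=
      ((hfc.tendsto _).comp (tendsto_param_near hτ w)).eventually (U.isOpen.mem_nhds hy)
    filter_upwards [((tendsto_etale_iff hV t').1 h2).2, ((tendsto_etale_iff hy t).1 h3).2, h4]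
      with x ⟨hx1, hx2⟩ ⟨hx3, hx4⟩ hx5
    refine ⟨hx5, hx1, etale_mk_inj ?_⟩
    rw [hrel τ x (D.res hτ a) (germAt F t _ hx5) ?_, hres]
    · exact etale_mk_eq_iff.2 hx2
    · refine Eq.trans ?_ (etale_mk_eq_iff.2 hx4).symm
      have : ∀ (p q : X Δ) (hp : p ∈ U) (hq : q ∈ U), p = q →
          (⟨p, germAt F t p hp⟩ : Etale F) = ⟨q, germAt F t q hq⟩ := by
        rintro p q hp hq rfl
        rfl
      exact this _ _ _ _ (hf τ x)
  obtain ⟨W, hW, hWo, hyW⟩ := eventually_nhds_iff.1 hev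
  have hWV : (⟨W, hWo⟩ : Opens (X Δ)) ≤ V := fun z hz => (hW z hz).2.1
  refine ⟨⟨W, hWo⟩, hyW, G.presheaf.map (homOfLE hWV).op t', fun z hz hz' => ?_⟩
  rw [germAt_res]
  exact (hW z hz').2.2

end FlatHom

end ToricLC

end

noncomputable section

namespace ToricLC

/-! ### Coordinates on the orbits -/

section OrbitCoord

open Filter Topology

variable {N : Type} [AddCommGroup N] [Module.Free ℤ N] [Module.Finite ℤ N] {Δ : Fan N}

/-- The coordinates are the invertible monomials obtained by projecting the dual basis to `σ^⊥`.
They are redundant but determine the point, and they are continuous because the chart is an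
embedding. -/
theorem exists_orbitCoord (σ : Δ.Cone) :
    ∃ c : torusOrbit σ → ExpSpace N, Continuous c ∧ ∀ (x : torusOrbit σ) (w : ExpSpace N),
      param σ w = x.1 → ∀ i, c x i = cexp (dot (perpProj σ (dualVec i)) w) := by
  have he := (isOpenEmbedding_chart σ).toIsEmbedding
  have hr : ∀ x : torusOrbit σ, x.1 ∈ Set.range (chart σ) := fun x => by
    obtain ⟨w, hw⟩ := exists_param_of_mem_torusOrbit x.2
    exact ⟨orbitPt σ w, hw⟩
  refine ⟨fun x i => (he.toHomeomorph.symm ⟨x.1, hr x⟩).eval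
    ⟨perpProj σ (dualVec i), (isPerp_perpProj σ _).mem_dualMonoid⟩, ?_, ?_⟩
  · refine continuous_pi fun i => (AffineToric.continuous_eval _).comp
      (he.toHomeomorph.symm.continuous.comp (continuous_subtype_val.subtype_mk _))
  · intro x w hw i
    have : he.toHomeomorph.symm ⟨x.1, hr x⟩ = orbitPt σ w := by
      rw [Homeomorph.symm_apply_eq]
      exact Subtype.ext hw.symm
    simp only [this, eval_orbitPt, isPerp_perpProj, if_true]

theorem param_eq_of_coord {σ : Δ.Cone} {u w : ExpSpace N}
    (h : ∀ i, cexp (u i) = cexp (dot (perpProj σ (dualVec i)) w)) : param σ u = param σ w :=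
  param_eq_param_of_perp fun m hm => by
    rw [dot_perp hm w, dot_apply, cexp_sum, cexp_sum]
    exact Finset.prod_congr rfl fun i _ => by rw [cexp_zsmul, cexp_zsmul, h]

/-- An integer of absolute value less than `1` is `0`. This is how a change of logarithm which is
small along `σ^⊥` is seen to act trivially on what comes from `O_σ`. -/
theorem mem_spanLattice_of_norm_lt {σ : Δ.Cone} {n : N}
    (h : ∀ i, ‖((perpProj σ (dualVec i) n : ℤ) : ℂ)‖ < 1) : n ∈ spanLattice σ.1 := by
  refine mem_spanLattice_iff.2 fun m hm => ?_
  have h1 := dot_perp hm (latticeVec n)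
  have h0 : ∀ i, perpProj σ (dualVec i) n = 0 := fun i => by
    have := h i
    rw [Complex.norm_intCast, ← Int.cast_abs] at this
    exact Int.abs_lt_one_iff.1 (by exact_mod_cast this)
  simp only [dot_latticeVec, h0, Int.cast_zero, mul_zero, Finset.sum_const_zero] at h1
  exact_mod_cast h1

/-- Each orbit coordinate is lifted separately through the covering `exp : ℂ → ℂ \ {0}`. -/
theorem exists_lift_path {σ : Δ.Cone} (γ : Path (pt σ : X Δ) (pt σ))
    (hγ : ∀ t, γ t ∈ torusOrbit σ) : ∃ φ : unitInterval → ExpSpace N, Continuous φ ∧ φ 0 = 0 ∧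
      ∀ t, param σ (φ t) = γ t := by
  obtain ⟨c, hc, hcw⟩ := exists_orbitCoord σ
  choose w hw using fun t => exists_param_of_mem_torusOrbit (hγ t)
  let p : unitInterval → torusOrbit σ := fun t => ⟨γ t, hγ t⟩
  have hp : Continuous p := γ.continuous.subtype_mk _
  have hne : ∀ t i, c (p t) i ≠ 0 := fun t i => by
    rw [hcw _ (w t) (hw t)]
    exact cexp_ne_zero _
  have hlift : ∀ i, ∃ g : C(unitInterval, ℂ), g 0 = 0 ∧ ∀ t, Complex.exp (g t) = c (p t) i := by
    intro i
    let q : C(unitInterval, {z : ℂ // z ≠ 0}) := ⟨fun t => ⟨c (p t) i, hne t i⟩,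
      ((continuous_apply i).comp (hc.comp hp)).subtype_mk _⟩
    have h0 : q 0 = ⟨Complex.exp 0, Complex.exp_ne_zero 0⟩ := Subtype.ext (by
      change c (p 0) i = _
      rw [hcw (p 0) 0 ((param_zero σ).trans γ.source.symm) i]
      simp)
    obtain ⟨g, hg, hg0⟩ := Complex.isCoveringMap_exp.exists_path_lifts q 0 h0
    exact ⟨g, hg0, fun t => congrArg Subtype.val (congrFun hg t)⟩
  choose g hg0 hg using hlift
  refine ⟨fun t i => (2 * Real.pi * Complex.I)⁻¹ * g i t, ?_, ?_, fun t => ?_⟩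
  · exact continuous_pi fun i => continuous_const.mul (g i).continuous
  · ext i
    simp [hg0]
  · refine (param_eq_of_coord fun i => ?_).trans (hw t)
    rw [← hcw (p t) (w t) (hw t) i, ← hg, cexp, mul_inv_cancel_left₀ Complex.two_pi_I_ne_zero]

end OrbitCoord

/-! ### Monodromy and continuation along exit paths -/

section Monodromy

open Filter Topology

variable {N : Type} [AddCommGroup N] [Module.Free ℤ N] [Module.Finite ℤ N] {Δ : Fan N}
  {F : Sh (X Δ)} {Γ : Δ.Cone → Type} [∀ σ, AddCommGroup (Γ σ)] [∀ σ, Module ℂ (Γ σ)]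

theorem FlatData.isLC (D : FlatData F Γ) : isLC Δ F := fun σ => by
  refine isLocallyConstant_of_isLocallyTrivial fun z => ?_
  obtain ⟨c, hc, hcw⟩ := exists_orbitCoord σ
  obtain ⟨v, hv⟩ := exists_param_of_mem_torusOrbit z.2
  -- Where the ratios to the coordinates of `z` avoid the cut, the principal logarithm gives a
  -- continuous choice of logarithms of points, and flat sections evaluated on it trivialize the
  -- sheaf.
  let W : Set (torusOrbit σ) := {x | ∀ i, c x i / c z i ∈ Complex.slitPlane}
  have hne : ∀ (x : torusOrbit σ) i, c x i ≠ 0 := fun x i => by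
    obtain ⟨w, hw⟩ := exists_param_of_mem_torusOrbit x.2
    rw [hcw _ w hw]
    exact cexp_ne_zero _
  have hci : ∀ i, Continuous fun x => c x i / c z i := fun i =>
    ((continuous_apply i).comp hc).div_const _
  have hW : IsOpen W := by
    simp only [W, Set.ofPred_forall]
    exact isOpen_iInter_of_finite fun i => Complex.isOpen_slitPlane.preimage (hci i)
  let u : W → ExpSpace N := fun x i => dot (perpProj σ (dualVec i)) v + clog (c x.1 i / c z i)
  have hu : Continuous u := continuous_pi fun i => continuous_const.add (continuous_const.mul
    (((hci i).comp continuous_subtype_val).clog fun x => x.2 i))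
  have hux : ∀ x : W, param σ (u x) = x.1.1 := fun x => by
    obtain ⟨w, hw⟩ := exists_param_of_mem_torusOrbit x.1.2
    refine (param_eq_of_coord fun i => ?_).trans hw
    rw [← hcw _ w hw i, cexp_add, cexp_clog (div_ne_zero (hne _ i) (hne _ i)), ← hcw z v hv i,
      mul_div_cancel₀ _ (hne _ i)]
  refine ⟨W, hW, fun i => ?_, ModuleCat.of ℂ (Γ σ),
    fun x => (D.ev σ (u x)).trans (stalkCast (hux x)), fun a => ?_⟩
  · rw [div_self (hne _ i)]
    exact Complex.one_mem_slitPlane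
  · refine ((D.continuous_val σ a).comp hu).congr fun x => ?_
    exact (mk_stalkCast (hux x) _).symm

/-- Two logarithms of one point of `O_τ` which are close along `σ^⊥` differ, as far as `τ^⊥` sees,
by a lattice vector in `Span σ`; its monodromy is trivial on `Γ σ`, hence on restrictions from it.
-/
theorem FlatData.val_res_eq (D : FlatData F Γ) {τ σ : Δ.Cone} (h : τ ≤ σ) {w w' : ExpSpace N}
    (hp : param τ w = param τ w') (hw : ∀ i, ‖dot (perpProj σ (dualVec i)) (w - w')‖ < 1)
    (a : Γ σ) : D.val τ w (D.res h a) = D.val τ w' (D.res h a) := by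
  obtain ⟨n, hn⟩ := exists_lattice_of_param_eq hp
  have h1 : n ∈ spanLattice σ.1 := mem_spanLattice_of_norm_lt fun i => by
    rw [← hn _ ((isPerp_perpProj σ _).mono h)]
    exact hw i
  rw [D.val_eq_monodromy hn, ← D.res_monodromy, D.monodromy_of_mem_spanLattice h1,
    Module.End.one_apply]

/-- The logarithms `w x` are not assumed continuous; they are only normalized to vanish on `σ^⊥`.
Their jumps are invisible to sections restricted from `σ`, by `val_res_eq`. The cone `κ` is `σ` at
the start of an exit path and `τ` afterwards. -/
theorem FlatData.tendsto_val_exit (D : FlatData F Γ) {τ κ σ : Δ.Cone} (hτ : τ ≤ κ) (hκ : κ ≤ σ)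
    {v : ExpSpace N} (hv : ∀ m, IsPerp σ.1 m → dot m v = 0) {α : Type*} {l : Filter α}
    {w : α → ExpSpace N} (hw : ∀ᶠ x in l, ∀ m, IsPerp σ.1 m → dot m (w x) = 0)
    (hp : Tendsto (fun x => param τ (w x)) l (𝓝 (param κ v))) (a : Γ σ) :
    Tendsto (fun x => D.val τ (w x) (D.res (hτ.trans hκ) a)) l (𝓝 (D.val κ v (D.res hκ a))) := by
  classical
  obtain ⟨U, hU, t, ht⟩ := exists_germAt (D.val κ v (D.res hκ a))
  have h1 := D.tendsto_val hτ v (D.res hκ a)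
  rw [ht] at h1
  rw [ht, tendsto_etale_iff hU t]
  refine ⟨hp, ?_⟩
  obtain ⟨E, ε, hε, hE⟩ := mem_near_iff.1 ((tendsto_etale_iff hU t).1 h1).2
  -- The exponents added span `σ^⊥`; with `ε ≤ 1` they provide the bound required by `val_res_eq`.
  let E' : Finset (dualMonoid κ.1) := E ∪ Finset.univ.image fun i =>
    ⟨perpProj σ (dualVec i), ((isPerp_perpProj σ (dualVec i)).mono hκ).mem_dualMonoid⟩
  have hε' : 0 < min ε 1 := lt_min hε one_pos
  filter_upwards [hp.eventually (eventually_nhds_param κ v E' hε'), hw] with x hx hwx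
  obtain ⟨ρ, hρ, w', hw', hpw⟩ := hx
  obtain rfl := cone_eq_of_param_eq hpw
  have h2 := hE (nearSet_mono Finset.subset_union_left hε' (min_le_left _ _) hw')
  have h3 : D.val ρ (w x) (D.res (hτ.trans hκ) a) = D.val ρ w' (D.res (hτ.trans hκ) a) := by
    refine D.val_res_eq _ hpw.symm (fun i => ?_) a
    have hi := isPerp_perpProj σ (dualVec i)
    have h4 := (hw' ⟨perpProj σ (dualVec i), (hi.mono hκ).mem_dualMonoid⟩
      (Finset.mem_union_right _ (Finset.mem_image_of_mem _ (Finset.mem_univ i)))).1 (hi.mono hκ)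
    rw [map_sub, hwx _ hi, zero_sub, norm_neg]
    rw [hv _ hi, sub_zero] at h4
    exact h4.trans_le (min_le_right _ _)
  obtain ⟨h5, h6⟩ := h2
  rw [D.res_res] at h6
  have h7 : D.val ρ (w x) (D.res (hτ.trans hκ) a) = ⟨param ρ w', germAt F t _ h5⟩ :=
    h3.trans (etale_mk_eq_iff.2 h6)
  rw [h7]
  exact ⟨h5, rfl⟩

theorem orbitLoop_mem (σ : Δ.Cone) (n : N) (t : unitInterval) :
    (orbitLoop σ n) t ∈ torusOrbit σ := ⟨_, rfl⟩

variable (D : FlatData F (ptStalk F))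

/-- A continuous lift of the loop is the value of one flat section along `φ`; its endpoint `φ 1` is
a logarithm of `x_σ` that pairs with `σ^⊥` as `n` does. -/
theorem FlatData.transports_iff
    (hD : ∀ σ a, D.val σ 0 a = ⟨pt σ, a⟩) {σ : Δ.Cone} {γ : Path (pt σ : X Δ) (pt σ)}
    {φ : unitInterval → ExpSpace N} (hφ : Continuous φ) (hφ0 : φ 0 = 0)
    (hγ : ∀ t, param σ (φ t) = γ t) {n : N} (hn : ∀ m, IsPerp σ.1 m → dot m (φ 1) = m n)
    (a b : ptStalk F σ) : Transports F γ a b ↔ D.monodromy σ n a = b := by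
  have h1 : ∀ a, D.val σ (φ 1) a = ⟨pt σ, D.monodromy σ n a⟩ := fun a => by
    rw [← hD]
    exact D.val_eq_monodromy (fun m hm => by rw [sub_zero, hn m hm]) a
  constructor
  · rintro ⟨s, hs, hs0, hs1⟩
    obtain ⟨c, hc⟩ := D.exists_eq_val s.continuous hφ fun t => (hs t).trans (hγ t).symm
    have h0 : c = a := by
      have := (hc 0).symm.trans hs0
      rw [hφ0, hD] at this
      exact etale_mk_inj this
    have h2 := (hc 1).symm.trans hs1
    rw [h0, h1] at h2
    exact etale_mk_inj h2
  · rintro rfl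
    exact ⟨⟨fun t => D.val σ (φ t) a, (D.continuous_val σ a).comp hφ⟩, hγ,
      by simp only [ContinuousMap.coe_mk, hφ0, hD], h1 a⟩

theorem FlatData.exists_transports_iff
    (hD : ∀ σ a, D.val σ 0 a = ⟨pt σ, a⟩) {σ : Δ.Cone} {γ : Path (pt σ : X Δ) (pt σ)}
    (hγ : ∀ t, γ t ∈ torusOrbit σ) :
    ∃ n : N, ∀ a b : ptStalk F σ, Transports F γ a b ↔ D.monodromy σ n a = b := by
  obtain ⟨φ, hφ, hφ0, hγφ⟩ := exists_lift_path γ hγ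
  obtain ⟨n, hn⟩ := exists_lattice_of_param_eq (τ := σ) (v := φ 1) (w := 0)
    (by rw [hγφ, param_zero, γ.target])
  simp only [sub_zero] at hn
  exact ⟨n, D.transports_iff hD hφ hφ0 hγφ hn⟩

theorem FlatData.transports_orbitLoop_iff
    (hD : ∀ σ a, D.val σ 0 a = ⟨pt σ, a⟩) {σ : Δ.Cone} {n : N} (a b : ptStalk F σ) :
    Transports F (orbitLoop σ n : Path (pt σ : X Δ) (pt σ)) a b ↔ D.monodromy σ n a = b :=
  D.transports_iff hD (φ := fun t => ((t : ℝ) : ℂ) • latticeVec n) (by fun_prop) (by simp)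
    (fun t => by rw [param_eq_smul, ← torusExp_eq]; rfl) (fun m _ => by simp) a b

theorem FlatData.isMonodromy_orbitLoop_iff
    (hD : ∀ σ a, D.val σ 0 a = ⟨pt σ, a⟩) {σ : Δ.Cone} {n : N}
    {μ : Module.End ℂ (ptStalk F σ)} :
    IsMonodromy F (orbitLoop σ n : Path (pt σ : X Δ) (pt σ)) μ ↔ μ = D.monodromy σ n := by
  simp only [IsMonodromy, D.transports_orbitLoop_iff hD]
  exact ⟨fun h => LinearMap.ext fun a => (h a).symm, fun h a => by rw [h]⟩

theorem FlatData.isLCu_iff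
    (hD : ∀ σ a, D.val σ 0 a = ⟨pt σ, a⟩) :
    isLCu Δ F ↔ ∀ σ n, IsLocallyNilpotent (D.monodromy σ n - 1) := by
  constructor
  · intro h σ n
    obtain ⟨μ, hμ, hn⟩ := h.2 σ (orbitLoop σ n) (orbitLoop_mem σ n)
    rwa [(D.isMonodromy_orbitLoop_iff hD).1 hμ] at hn
  · refine fun h => ⟨D.isLC, fun σ γ hγ => ?_⟩
    obtain ⟨n, hn⟩ := D.exists_transports_iff hD hγ
    exact ⟨D.monodromy σ n, fun a => (hn a _).2 rfl, h σ n⟩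

theorem FlatData.monodromyInvariants_eq
    (hD : ∀ σ a, D.val σ 0 a = ⟨pt σ, a⟩) (σ : Δ.Cone) :
    monodromyInvariants F (torusOrbit σ : Set (X Δ)) (pt σ : X Δ) =
      ⨅ n : N, LinearMap.ker (D.monodromy σ n - 1) := by
  apply le_antisymm
  · refine le_iInf fun n => ?_
    exact iInf_le_of_le (orbitLoop σ n) (iInf_le_of_le (orbitLoop_mem σ n)
      (iInf_le_of_le _ (iInf_le_of_le ((D.isMonodromy_orbitLoop_iff hD).2 rfl) le_rfl)))
  · refine le_iInf fun γ => le_iInf fun hγ => le_iInf fun μ => le_iInf fun hμ => ?_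
    obtain ⟨n, hn⟩ := D.exists_transports_iff hD hγ
    have : μ = D.monodromy σ n := LinearMap.ext fun a => ((hn a _).1 (hμ a)).symm
    rw [this]
    exact iInf_le _ n

/-- The lift follows the restricted flat section of `a` along logarithms that vanish on `σ^⊥`, and
starts at `a` itself; `tendsto_val_exit` makes it continuous both at time `0` and later. -/
theorem FlatData.transports_exitPath
    (hD : ∀ σ a, D.val σ 0 a = ⟨pt σ, a⟩) {τ σ : Δ.Cone} (h : τ ≤ σ) (γ : Path (pt σ : X Δ) (pt τ))
    (hγ : IsExitPath γ) (a : ptStalk F σ) : Transports F γ a (D.res h a) := by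
  classical
  -- The torus element stabilizes `x_σ`, so its logarithms are integral on `σ^⊥` and one of them can
  -- be chosen to vanish there.
  have h1 : ∀ s : unitInterval, 0 < s → ∃ w : ExpSpace N, param τ w = γ s ∧
      ∀ m, IsPerp σ.1 m → dot m w = 0 := fun s hs => by
    obtain ⟨t, ht, hts⟩ := hγ s hs
    obtain ⟨u, rfl⟩ := expTorus_surjective t
    have hu : param σ u = param σ 0 := (MulAction.mem_stabilizer_iff.1 ht).trans (param_zero σ).symm
    obtain ⟨w, hw, hw'⟩ := exists_adjust σ 0 u fun m hm => (cexp_dot_eq_of_param_eq hu hm).symm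
    exact ⟨w, (param_eq_param_of_perp fun m _ => hw' m).trans hts.symm,
      fun m hm => by rw [hw m hm, map_zero]⟩
  choose! w hw hw0 using h1
  let s : unitInterval → Etale F := fun x => if x = 0 then ⟨pt σ, a⟩ else D.val τ (w x) (D.res h a)
  have hpos : ∀ x : unitInterval, x ≠ 0 → 0 < x := fun x hx => unitInterval.pos_iff_ne_zero.2 hx
  have hs : ∀ x, x ≠ 0 → s x = D.val τ (w x) (D.res h a) := fun x hx => if_neg hx
  have hsc : Continuous s := continuous_iff_continuousAt.2 fun x => by
    by_cases hx : x = 0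
    · subst hx
      rw [continuousAt_iff_punctured_nhds]
      have h2 : s 0 = D.val σ 0 (D.res le_rfl a) := by rw [D.res_refl, hD]; exact if_pos rfl
      rw [h2]
      have hne : ∀ᶠ y : unitInterval in 𝓝[≠] 0, y ≠ 0 := eventually_mem_nhdsWithin
      refine (D.tendsto_val_exit h le_rfl (v := 0) (w := w) (fun m _ => map_zero _)
        (hne.mono fun y hy => hw0 y (hpos y hy)) ?_ a).congr' ?_
      · rw [param_zero]
        have h3 : Tendsto γ (𝓝[≠] 0) (𝓝 (γ 0)) := γ.continuous.continuousAt.tendsto.mono_left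
          nhdsWithin_le_nhds
        rw [γ.source] at h3
        exact h3.congr' (hne.mono fun y hy => (hw y (hpos y hy)).symm)
      · exact hne.mono fun y hy => (hs y hy).symm
    · have hne : ∀ᶠ y : unitInterval in 𝓝 x, y ≠ 0 := isOpen_ne.mem_nhds hx
      have h4 := D.tendsto_val_exit le_rfl h (v := w x) (w := w) (l := 𝓝 x) (hw0 x (hpos x hx))
        (hne.mono fun y hy => hw0 y (hpos y hy)) (by
          rw [hw x (hpos x hx)]
          exact (γ.continuous.tendsto x).congr' (hne.mono fun y hy => (hw y (hpos y hy)).symm)) a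
      rw [ContinuousAt, hs x hx]
      exact h4.congr' (hne.mono fun y hy => (hs y hy).symm)
  refine ⟨⟨s, hsc⟩, fun x => ?_, if_pos rfl, ?_⟩
  · by_cases hx : x = 0
    · subst hx
      simp [s]
    · simp only [ContinuousMap.coe_mk, hs x hx, FlatData.base_val, hw x (hpos x hx)]
  · refine (hs 1 one_ne_zero).trans ?_
    rw [← hD]
    refine D.val_res_eq h ?_ (fun i => ?_) a
    · rw [hw 1 (hpos 1 one_ne_zero), param_zero]
      exact γ.target
    · rw [sub_zero, hw0 1 (hpos 1 one_ne_zero) _ (isPerp_perpProj σ _), norm_zero]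
      exact one_pos

end Monodromy

end ToricLC

end

noncomputable section

namespace ToricLC

/-! ### Power series in locally nilpotent operators -/

section PowerSeriesCalculus

theorem one_add_X_mul_deriv_log :
    (1 + PowerSeries.X : PowerSeries ℂ) * PowerSeries.derivative ℂ (PowerSeries.log ℂ) = 1 := by
  ext n
  rw [PowerSeries.deriv_log, add_mul, one_mul, map_add]
  cases n with
  | zero => simp
  | succ n => simp [PowerSeries.coeff_succ_X_mul, pow_succ, PowerSeries.coeff_one]

/-- Both sides have derivative `1`, by the chain rule and `(1 + X) log' = 1`, and zero constant
term. -/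
theorem log_subst_exp_sub_one :
    (PowerSeries.log ℂ).subst (PowerSeries.exp ℂ - 1) = (PowerSeries.X : PowerSeries ℂ) := by
  have hs : PowerSeries.HasSubst (PowerSeries.exp ℂ - 1) := PowerSeries.HasSubst.exp_sub_one
  refine PowerSeries.derivative.ext ?_ ?_
  · rw [PowerSeries.derivative_subst hs, map_sub, PowerSeries.derivative_exp, PowerSeries.derivative_X,
      Derivation.map_one_eq_zero, sub_zero]
    have := congrArg (PowerSeries.substAlgHom hs) one_add_X_mul_deriv_log
    rw [map_mul, map_add, map_one, PowerSeries.substAlgHom_X, PowerSeries.coe_substAlgHom] at this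
    rw [add_sub_cancel] at this
    rw [mul_comm]
    exact this
  · rw [PowerSeries.constantCoeff_X]
    exact PowerSeries.constantCoeff_subst_eq_zero
      (show PowerSeries.constantCoeff (PowerSeries.exp ℂ - 1) = 0 by simp) _ (by simp)

/-- With `h` the composite and `l` the derivative of the logarithm, `h' = h l` and `l' = -l²`, so `h
l` has zero derivative and equals `1`; comparing with `(1 + X) l = 1` gives `h = 1 + X`. -/
theorem exp_subst_log :
    (PowerSeries.exp ℂ).subst (PowerSeries.log ℂ) = (1 + PowerSeries.X : PowerSeries ℂ) := by
  have hs : PowerSeries.HasSubst (PowerSeries.log ℂ) := PowerSeries.HasSubst.log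
  set h : PowerSeries ℂ := (PowerSeries.exp ℂ).subst (PowerSeries.log ℂ) with hh
  set l : PowerSeries ℂ := PowerSeries.derivative ℂ (PowerSeries.log ℂ) with hl
  have h1 : PowerSeries.derivative ℂ h = h * l := by
    rw [hh, PowerSeries.derivative_subst hs, PowerSeries.derivative_exp]
  have h2 : (1 + PowerSeries.X) * l = 1 := one_add_X_mul_deriv_log
  have h3 : PowerSeries.derivative ℂ l = - l ^ 2 := by
    have := congrArg (PowerSeries.derivative ℂ) h2
    rw [Derivation.leibniz, map_add, Derivation.map_one_eq_zero,
      PowerSeries.derivative_X, zero_add, smul_eq_mul, smul_eq_mul, mul_one] at this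
    linear_combination l * this - (PowerSeries.derivative ℂ l) * h2
  have h4 : h * l = 1 := by
    refine PowerSeries.derivative.ext ?_ ?_
    · rw [Derivation.leibniz, h1, h3, Derivation.map_one_eq_zero, smul_eq_mul, smul_eq_mul]
      ring
    · have h5 : PowerSeries.constantCoeff h = 1 := by
        have h6 : (PowerSeries.exp ℂ - 1).subst (PowerSeries.log ℂ) = h - 1 := by
          rw [PowerSeries.subst_sub hs, hh]
          congr 1
          rw [← PowerSeries.coe_substAlgHom hs, map_one]
        have h7 := PowerSeries.constantCoeff_subst_eq_zero (a := PowerSeries.log ℂ)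
          PowerSeries.constantCoeff_log (PowerSeries.exp ℂ - 1) (by simp)
        rw [h6] at h7
        exact sub_eq_zero.1 ((map_sub _ _ _).symm.trans (h7.trans rfl)) |>.trans (map_one _)
      rw [map_mul, h5, hl, PowerSeries.deriv_log]
      simp [← PowerSeries.coeff_zero_eq_constantCoeff_apply]
  linear_combination (1 + PowerSeries.X) * h4 - h * h2

variable {V : Type*} [AddCommGroup V] [Module ℂ V]

theorem IsLocallyNilpotent.of_le {f : Module.End ℂ V} {a : V} {j k : ℕ} (h : (f ^ j) a = 0)
    (hjk : j ≤ k) : (f ^ k) a = 0 := by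
  obtain ⟨i, rfl⟩ := Nat.exists_eq_add_of_le' hjk
  rw [pow_add, Module.End.mul_apply, h, map_zero]

/-- A power series applied to a locally nilpotent operator and a vector. -/
def psApply (f : Module.End ℂ V) (p : PowerSeries ℂ) (a : V) : V :=
  ∑ᶠ k : ℕ, PowerSeries.coeff k p • (f ^ k) a

theorem psApply_eq_sum {f : Module.End ℂ V} {a : V} {K : ℕ} (h : (f ^ K) a = 0)
    (p : PowerSeries ℂ) :
    psApply f p a = ∑ k ∈ Finset.range K, PowerSeries.coeff k p • (f ^ k) a := by
  refine finsum_eq_sum_of_support_subset _ fun k hk => ?_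
  rw [Finset.coe_range, Set.mem_Iio]
  by_contra hlt
  exact hk (by simp only [IsLocallyNilpotent.of_le h (not_lt.1 hlt), smul_zero])

theorem psApply_eq {f : Module.End ℂ V} {a : V} {K : ℕ} (h : (f ^ K) a = 0) (p : PowerSeries ℂ) :
    psApply f p a = Polynomial.aeval f (p.trunc K) a := by
  rw [psApply_eq_sum h, Polynomial.aeval_def, PowerSeries.eval₂_trunc_eq_sum_range, LinearMap.sum_apply]
  exact Finset.sum_congr rfl fun k _ => by simp [Module.algebraMap_end_eq_smul_id]

/-- Coefficients in degrees `≥ K` do not matter on a vector killed by `f ^ K`; identities between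
power series thus reduce to identities between polynomials. -/
theorem aeval_trunc_coe {f : Module.End ℂ V} {a : V} {K : ℕ} (h : (f ^ K) a = 0)
    (P : Polynomial ℂ) :
    Polynomial.aeval f ((P : PowerSeries ℂ).trunc K) a = Polynomial.aeval f P a := by
  rw [← psApply_eq h, psApply_eq (IsLocallyNilpotent.of_le h (le_max_left K (P.natDegree + 1)))]
  congr 2
  exact PowerSeries.trunc_coe_eq_self ((Nat.lt_succ_self _).trans_le (le_max_right _ _))

/-- Power series in a locally nilpotent operator. -/
def psEval (f : Module.End ℂ V) (hf : IsLocallyNilpotent f) :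
    PowerSeries ℂ →ₐ[ℂ] Module.End ℂ V where
  toFun p :=
    { toFun := psApply f p
      map_add' := fun a b => by
        obtain ⟨j, hj⟩ := hf a
        obtain ⟨k, hk⟩ := hf b
        have hj' := IsLocallyNilpotent.of_le hj (le_max_left j k)
        have hk' := IsLocallyNilpotent.of_le hk (le_max_right j k)
        rw [psApply_eq hj', psApply_eq hk', psApply_eq (K := max j k) (by
          rw [map_add, hj', hk', add_zero]), map_add]
      map_smul' := fun c a => by
        obtain ⟨j, hj⟩ := hf a
        rw [psApply_eq hj, psApply_eq (K := j) (by rw [map_smul, hj, smul_zero]), map_smul,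
          RingHom.id_apply] }
  map_one' := LinearMap.ext fun a => by
    obtain ⟨j, hj⟩ := hf a
    change psApply f 1 a = a
    rw [psApply_eq hj, ← Polynomial.coe_one, aeval_trunc_coe hj, map_one, Module.End.one_apply]
  map_zero' := LinearMap.ext fun a => by
    obtain ⟨j, hj⟩ := hf a
    change psApply f 0 a = 0
    rw [psApply_eq hj, ← Polynomial.coe_zero, aeval_trunc_coe hj, map_zero, LinearMap.zero_apply]
  map_add' p q := LinearMap.ext fun a => by
    obtain ⟨j, hj⟩ := hf a
    change psApply f (p + q) a = psApply f p a + psApply f q a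
    rw [psApply_eq hj, psApply_eq hj, psApply_eq hj, map_add, map_add, LinearMap.add_apply]
  map_mul' p q := LinearMap.ext fun a => by
    obtain ⟨j, hj⟩ := hf a
    change psApply f (p * q) a = psApply f p (psApply f q a)
    have hj' : (f ^ j) (Polynomial.aeval f (q.trunc j) a) = 0 := by
      rw [← Module.End.mul_apply, ← Polynomial.aeval_X_pow (R := ℂ) f, ← map_mul, mul_comm, map_mul,
        Module.End.mul_apply, Polynomial.aeval_X_pow, hj, map_zero]
    rw [psApply_eq hj, psApply_eq hj q, psApply_eq hj', ← Module.End.mul_apply, ← map_mul,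
      ← aeval_trunc_coe hj (p.trunc j * q.trunc j), Polynomial.coe_mul,
      PowerSeries.trunc_trunc_mul_trunc]
  commutes' c := LinearMap.ext fun a => by
    obtain ⟨j, hj⟩ := hf a
    change psApply f (algebraMap ℂ (PowerSeries ℂ) c) a = _
    have : algebraMap ℂ (PowerSeries ℂ) c = ((Polynomial.C c : Polynomial ℂ) : PowerSeries ℂ) := by
      rw [Polynomial.coe_C]; rfl
    rw [psApply_eq hj, this, aeval_trunc_coe hj, Polynomial.aeval_C]

theorem psEval_apply {f : Module.End ℂ V} (hf : IsLocallyNilpotent f) {a : V} {K : ℕ}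
    (h : (f ^ K) a = 0) (p : PowerSeries ℂ) :
    psEval f hf p a = Polynomial.aeval f (p.trunc K) a := psApply_eq h p

theorem psEval_eq_sum {f : Module.End ℂ V} (hf : IsLocallyNilpotent f) {a : V} {K : ℕ}
    (h : (f ^ K) a = 0) (p : PowerSeries ℂ) :
    psEval f hf p a = ∑ k ∈ Finset.range K, PowerSeries.coeff k p • (f ^ k) a := psApply_eq_sum h p

theorem psEval_coe {f : Module.End ℂ V} (hf : IsLocallyNilpotent f) (P : Polynomial ℂ) :
    psEval f hf P = Polynomial.aeval f P := LinearMap.ext fun a => by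
  obtain ⟨j, hj⟩ := hf a
  rw [psEval_apply hf hj, aeval_trunc_coe hj]

@[simp] theorem psEval_X {f : Module.End ℂ V} (hf : IsLocallyNilpotent f) :
    psEval f hf PowerSeries.X = f := by
  rw [← Polynomial.coe_X, psEval_coe, Polynomial.aeval_X]

theorem psEval_X_mul_pow_apply {f : Module.End ℂ V} (hf : IsLocallyNilpotent f)
    {q : PowerSeries ℂ} (hq : PowerSeries.constantCoeff q = 0) {a : V} {K : ℕ}
    (h : (f ^ K) a = 0) (r : PowerSeries ℂ) : psEval f hf (q ^ K * r) a = 0 := by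
  obtain ⟨q', rfl⟩ := PowerSeries.X_dvd_iff.2 hq
  rw [mul_pow, mul_assoc, mul_comm, map_mul, Module.End.mul_apply, map_pow, psEval_X, h, map_zero]

theorem isLocallyNilpotent_psEval {f : Module.End ℂ V} (hf : IsLocallyNilpotent f)
    {q : PowerSeries ℂ} (hq : PowerSeries.constantCoeff q = 0) :
    IsLocallyNilpotent (psEval f hf q) := fun a => by
  obtain ⟨K, hK⟩ := hf a
  refine ⟨K, ?_⟩
  rw [← map_pow, ← mul_one (q ^ K)]
  exact psEval_X_mul_pow_apply hf hq hK 1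

/-- Split `p` into a polynomial of degree less than `K` and a multiple of `X ^ K`. As `q` has no
constant term, the substituted second part kills any vector killed by `f ^ K`, and for polynomials
substitution is evaluation. -/
theorem psEval_subst {f : Module.End ℂ V} (hf : IsLocallyNilpotent f) {q : PowerSeries ℂ}
    (hq : PowerSeries.constantCoeff q = 0) (p : PowerSeries ℂ) :
    psEval f hf (p.subst q) = psEval (psEval f hf q) (isLocallyNilpotent_psEval hf hq) p :=
  LinearMap.ext fun a => by
    obtain ⟨K, hK⟩ := hf a
    have hs : PowerSeries.HasSubst q := PowerSeries.HasSubst.of_constantCoeff_zero' hq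
    have hK' : ((psEval f hf q) ^ K) a = 0 := by
      rw [← map_pow, ← mul_one (q ^ K)]
      exact psEval_X_mul_pow_apply hf hq hK 1
    rw [psEval_apply _ hK']
    conv_lhs => rw [PowerSeries.eq_X_pow_mul_shift_add_trunc K p]
    rw [← PowerSeries.coe_substAlgHom hs, map_add, map_mul, map_pow, PowerSeries.substAlgHom_X,
      map_add, LinearMap.add_apply, psEval_X_mul_pow_apply hf hq hK, zero_add,
      PowerSeries.substAlgHom_coe, ← Polynomial.aeval_algHom_apply]

theorem psEval_intertwine {W : Type*} [AddCommGroup W] [Module ℂ W] {f : Module.End ℂ V}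
    {g : Module.End ℂ W} (hf : IsLocallyNilpotent f) (hg : IsLocallyNilpotent g) (φ : V →ₗ[ℂ] W)
    (h : ∀ a, φ (f a) = g (φ a)) (p : PowerSeries ℂ) (a : V) :
    φ (psEval f hf p a) = psEval g hg p (φ a) := by
  have hpow : ∀ (k : ℕ) a, φ ((f ^ k) a) = (g ^ k) (φ a) := fun k => by
    induction k with
    | zero => intro a; rfl
    | succ k ih => intro a; rw [pow_succ, pow_succ, Module.End.mul_apply, Module.End.mul_apply, ih, h]
  obtain ⟨K, hK⟩ := hf a
  rw [psEval_eq_sum hf hK, psEval_eq_sum hg (K := K) (by rw [← hpow, hK, map_zero]), map_sum]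
  exact Finset.sum_congr rfl fun k _ => by rw [map_smul, hpow]

/-- The exponential of a locally nilpotent operator. -/
def opExp (f : Module.End ℂ V) (hf : IsLocallyNilpotent f) : Module.End ℂ V :=
  psEval f hf (PowerSeries.exp ℂ)

/-- The logarithm of a locally unipotent operator. -/
def opLog (T : Module.End ℂ V) (hT : IsLocallyNilpotent (T - 1)) : Module.End ℂ V :=
  psEval (T - 1) hT (PowerSeries.log ℂ)

theorem opExp_sub_one (f : Module.End ℂ V) (hf : IsLocallyNilpotent f) :
    opExp f hf - 1 = psEval f hf (PowerSeries.exp ℂ - 1) := by rw [map_sub, map_one]; rfl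

theorem isLocallyNilpotent_opExp_sub_one (f : Module.End ℂ V) (hf : IsLocallyNilpotent f) :
    IsLocallyNilpotent (opExp f hf - 1) := by
  rw [opExp_sub_one]
  exact isLocallyNilpotent_psEval hf (by simp)

theorem isLocallyNilpotent_opLog (T : Module.End ℂ V) (hT : IsLocallyNilpotent (T - 1)) :
    IsLocallyNilpotent (opLog T hT) := isLocallyNilpotent_psEval hT (by simp)

theorem opExp_opLog (T : Module.End ℂ V) (hT : IsLocallyNilpotent (T - 1))
    (h : IsLocallyNilpotent (opLog T hT)) : opExp (opLog T hT) h = T := by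
  rw [opExp]
  have := psEval_subst hT (q := PowerSeries.log ℂ) (by simp) (PowerSeries.exp ℂ)
  rw [exp_subst_log, map_add, map_one, psEval_X, add_sub_cancel] at this
  exact this.symm

theorem opLog_opExp (f : Module.End ℂ V) (hf : IsLocallyNilpotent f)
    (h : IsLocallyNilpotent (opExp f hf - 1)) : opLog (opExp f hf) h = f := by
  have := psEval_subst hf (q := PowerSeries.exp ℂ - 1) (by simp) (PowerSeries.log ℂ)
  rw [log_subst_exp_sub_one, psEval_X] at this
  rw [opLog]
  simp only [opExp_sub_one]
  exact this.symm

theorem unipotentLog_eq (T : Module.End ℂ V) (hT : IsLocallyNilpotent (T - 1)) (a : V) :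
    unipotentLog T a = opLog T hT a := by
  obtain ⟨K, hK⟩ := hT a
  have h1 : opLog T hT a =
      ∑ k ∈ Finset.range (K + 1), PowerSeries.coeff k (PowerSeries.log ℂ) • ((T - 1) ^ k) a := by
    exact psEval_eq_sum hT (IsLocallyNilpotent.of_le hK (Nat.le_succ K)) _
  have h2 : unipotentLog T a =
      ∑ k ∈ Finset.range K, ((-1 : ℂ) ^ k / ((k : ℂ) + 1)) • ((T - 1) ^ (k + 1)) a := by
    refine finsum_eq_sum_of_support_subset _ fun k hk => ?_
    rw [Finset.coe_range, Set.mem_Iio]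
    by_contra hlt
    exact hk (by
      simp only [IsLocallyNilpotent.of_le hK ((not_lt.1 hlt).trans (Nat.le_succ k)), smul_zero])
  rw [h1, h2, Finset.sum_range_succ']
  simp only [PowerSeries.coeff_log, if_true, zero_smul, add_zero, Nat.succ_ne_zero, if_false]
  refine Finset.sum_congr rfl fun k _ => ?_
  congr 1
  simp [pow_succ]

theorem pow_add_apply_eq_zero {f g : Module.End ℂ V} (h : Commute f g) {a : V} {K : ℕ}
    (hf : (f ^ K) a = 0) (hg : (g ^ K) a = 0) {i j : ℕ} (hij : 2 * K ≤ i + j) :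
    (f ^ i * g ^ j) a = 0 := by
  rcases le_or_gt K j with hj | hj
  · rw [Module.End.mul_apply, IsLocallyNilpotent.of_le hg hj, map_zero]
  · rw [(h.pow_pow i j).eq, Module.End.mul_apply,
      IsLocallyNilpotent.of_le hf (by lia : K ≤ i), map_zero]

theorem IsLocallyNilpotent.add {f g : Module.End ℂ V} (hf : IsLocallyNilpotent f)
    (hg : IsLocallyNilpotent g) (h : Commute f g) : IsLocallyNilpotent (f + g) := fun a => by
  obtain ⟨j, hj⟩ := hf a
  obtain ⟨k, hk⟩ := hg a
  refine ⟨2 * max j k, ?_⟩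
  rw [h.add_pow, LinearMap.sum_apply]
  refine Finset.sum_eq_zero fun i hi => ?_
  rw [(Nat.cast_commute _ _).eq.symm, Module.End.mul_apply,
    pow_add_apply_eq_zero h (IsLocallyNilpotent.of_le hj (le_max_left j k))
      (IsLocallyNilpotent.of_le hk (le_max_right j k)) (by
        rw [Finset.mem_range] at hi; lia), map_zero]

theorem IsLocallyNilpotent.smul {f : Module.End ℂ V} (hf : IsLocallyNilpotent f) (c : ℂ) :
    IsLocallyNilpotent (c • f) := fun a => by
  obtain ⟨j, hj⟩ := hf a
  exact ⟨j, by rw [smul_pow, LinearMap.smul_apply, hj, smul_zero]⟩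

theorem opExp_apply {f : Module.End ℂ V} (hf : IsLocallyNilpotent f) {a : V} {K : ℕ}
    (h : (f ^ K) a = 0) :
    opExp f hf a = ∑ k ∈ Finset.range K, ((k.factorial : ℂ)⁻¹) • (f ^ k) a := by
  rw [opExp, psEval_eq_sum hf h]
  exact Finset.sum_congr rfl fun k _ => by simp

theorem opExp_add {f g : Module.End ℂ V} (hf : IsLocallyNilpotent f) (hg : IsLocallyNilpotent g)
    (h : Commute f g) (hfg : IsLocallyNilpotent (f + g)) :
    opExp (f + g) hfg = opExp f hf * opExp g hg := LinearMap.ext fun a => by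
  obtain ⟨j, hj⟩ := hf a
  obtain ⟨k, hk⟩ := hg a
  obtain ⟨l, hl⟩ := hfg a
  obtain ⟨K, hK⟩ : ∃ K, j ≤ K ∧ k ≤ K ∧ l ≤ K :=
    ⟨max j (max k l), by simp⟩
  have hj' := IsLocallyNilpotent.of_le hj hK.1
  have hk' := IsLocallyNilpotent.of_le hk hK.2.1
  have hl' := IsLocallyNilpotent.of_le hl (hK.2.2.trans (by lia : K ≤ 2 * K))
  let G : ℕ × ℕ → V := fun p =>
    ((p.1.factorial : ℂ)⁻¹ * (p.2.factorial : ℂ)⁻¹) • (f ^ p.1 * g ^ p.2) a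
  have hbig : ∀ {i : ℕ}, K ≤ i → (f ^ i) (opExp g hg a) = 0 := fun {i} hi => by
    rw [opExp_apply hg hk', map_sum]
    refine Finset.sum_eq_zero fun m _ => ?_
    rw [map_smul, ← Module.End.mul_apply, (h.pow_pow i m).eq, Module.End.mul_apply,
      IsLocallyNilpotent.of_le hj' hi, map_zero, smul_zero]
  have hR : (opExp f hf * opExp g hg) a =
      ∑ p ∈ Finset.range (2 * K) ×ˢ Finset.range (2 * K), G p := by
    rw [Module.End.mul_apply, opExp_apply hf (hbig (by lia : K ≤ 2 * K)),
      opExp_apply hg (IsLocallyNilpotent.of_le hk' (by lia : K ≤ 2 * K)), Finset.sum_product]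
    refine Finset.sum_congr rfl fun i _ => ?_
    rw [map_sum, Finset.smul_sum]
    refine Finset.sum_congr rfl fun m _ => ?_
    rw [map_smul, smul_smul]
    rfl
  -- The binomial theorem gives the terms with `i + j < 2K`. The terms of the full square outside
  -- this triangle vanish on `a`, because one of the exponents is then at least `K`.
  have hL : opExp (f + g) hfg a = ∑ p ∈ (Finset.range (2 * K) ×ˢ Finset.range (2 * K)).filter
      (fun p => p.1 + p.2 < 2 * K), G p := by
    rw [opExp_apply hfg hl', ← Finset.sum_fiberwise_of_maps_to (g := fun p : ℕ × ℕ => p.1 + p.2)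
      (t := Finset.range (2 * K)) (fun p hp => by
        rw [Finset.mem_filter] at hp
        exact Finset.mem_range.2 hp.2)]
    refine Finset.sum_congr rfl fun i hi => ?_
    rw [Finset.mem_range] at hi
    have hfil : Finset.filter (fun p : ℕ × ℕ => p.1 + p.2 = i)
        ((Finset.range (2 * K) ×ˢ Finset.range (2 * K)).filter (fun p => p.1 + p.2 < 2 * K)) =
        Finset.HasAntidiagonal.antidiagonal i := by
      ext p
      simp only [Finset.mem_filter, Finset.mem_product, Finset.mem_range,
        Finset.HasAntidiagonal.mem_antidiagonal]
      lia
    rw [hfil, h.add_pow', LinearMap.sum_apply, Finset.smul_sum]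
    refine Finset.sum_congr rfl fun p hp => ?_
    rw [LinearMap.smul_apply, ← Nat.cast_smul_eq_nsmul ℂ, smul_smul]
    congr 1
    rw [Finset.HasAntidiagonal.mem_antidiagonal] at hp
    have hc := Nat.add_choose_mul_factorial_mul_factorial p.1 p.2
    rw [hp, ← Nat.choose_symm_of_eq_add hp.symm] at hc
    have hc' : ((i.choose p.1 : ℕ) : ℂ) * (p.1.factorial : ℂ) * (p.2.factorial : ℂ) =
      (i.factorial : ℂ) := by exact_mod_cast hc
    have h1 : (p.1.factorial : ℂ) ≠ 0 := by exact_mod_cast p.1.factorial_ne_zero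
    have h2 : (p.2.factorial : ℂ) ≠ 0 := by exact_mod_cast p.2.factorial_ne_zero
    have h3 : (i.factorial : ℂ) ≠ 0 := by exact_mod_cast i.factorial_ne_zero
    field_simp
    linear_combination hc'
  rw [hL, hR]
  refine Finset.sum_filter_of_ne fun p _ hp => ?_
  by_contra hlt
  exact hp (by simp only [G, pow_add_apply_eq_zero h hj' hk' (not_lt.1 hlt), smul_zero])

theorem opExp_injective {f g : Module.End ℂ V} (hf : IsLocallyNilpotent f)
    (hg : IsLocallyNilpotent g) (h : opExp f hf = opExp g hg) : f = g := by
  rw [← opLog_opExp f hf (isLocallyNilpotent_opExp_sub_one f hf),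
    ← opLog_opExp g hg (isLocallyNilpotent_opExp_sub_one g hg)]
  simp only [h]

theorem opLog_commute {S T : Module.End ℂ V} (hS : IsLocallyNilpotent (S - 1))
    (hT : IsLocallyNilpotent (T - 1)) (h : Commute S T) : Commute (opLog S hS) (opLog T hT) := by
  have h1 : ∀ a, S (opLog T hT a) = opLog T hT (S a) := fun a =>
    psEval_intertwine hT hT S (fun b => by
      have := LinearMap.congr_fun h.eq b
      simp only [LinearMap.sub_apply, map_sub, Module.End.one_apply]
      exact congrArg (· - S b) this) _ a
  refine LinearMap.ext fun a => ?_
  exact (psEval_intertwine hS hS (opLog T hT) (fun b => by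
    simp only [LinearMap.sub_apply, map_sub, Module.End.one_apply, h1]) _ a).symm

theorem opLog_mul {S T : Module.End ℂ V} (hS : IsLocallyNilpotent (S - 1))
    (hT : IsLocallyNilpotent (T - 1)) (h : Commute S T) (hST : IsLocallyNilpotent (S * T - 1)) :
    opLog (S * T) hST = opLog S hS + opLog T hT := by
  have hc := opLog_commute hS hT h
  have h1 := isLocallyNilpotent_opLog S hS
  have h2 := isLocallyNilpotent_opLog T hT
  refine opExp_injective (isLocallyNilpotent_opLog _ hST) (h1.add h2 hc) ?_
  rw [opExp_opLog, opExp_add h1 h2 hc, opExp_opLog, opExp_opLog]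

/-- This matches monodromy invariants with the socle of the module of logarithms. -/
theorem opLog_apply_eq_zero_iff {T : Module.End ℂ V} (hT : IsLocallyNilpotent (T - 1)) (a : V) :
    opLog T hT a = 0 ↔ T a = a := by
  constructor
  · intro h
    have h1 := LinearMap.congr_fun (opExp_opLog T hT (isLocallyNilpotent_opLog T hT)) a
    rw [← h1, opExp_apply _ (K := 1) (by rw [pow_one, h])]
    simp
  · intro h
    rw [opLog, psEval_eq_sum hT (K := 1) (by rw [pow_one, LinearMap.sub_apply, h]; simp)]
    simp

end PowerSeriesCalculus

end ToricLC

end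

noncomputable section

namespace ToricLC

/-! ### Modules over the rings `𝓣_σ` -/

section TRingModules

variable {N : Type} [AddCommGroup N] {σ τ : PointedCone ℝ (ℝ ⊗[ℤ] N)}

theorem TRing.of_add (n n' : N) : TRing.of σ (n + n') = TRing.of σ n + TRing.of σ n' := by
  rw [TRing.of, Submodule.Quotient.mk_add, TensorProduct.tmul_add, map_add]
  rfl

theorem TRing.of_eq_zero {n : N} (hn : n ∈ spanLattice σ) : TRing.of σ n = 0 := by
  rw [TRing.of, (Submodule.Quotient.mk_eq_zero _).2 hn, TensorProduct.tmul_zero, map_zero]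

theorem TRing.map_of (h : τ ≤ σ) (n : N) : TRing.map h (TRing.of τ n) = TRing.of σ n := by
  rw [TRing.map, TRing.of, SymmetricAlgebra.lift_ι_apply, LinearMap.comp_apply,
    LinearMap.baseChange_tmul]
  rfl

theorem TRing.ι_mem_span (x : ℂ ⊗[ℤ] QuotLattice σ) :
    SymmetricAlgebra.ι ℂ _ x ∈ Submodule.span ℂ (Set.range (TRing.of σ)) := by
  induction x using TensorProduct.induction_on with
  | zero => rw [map_zero]; exact zero_mem _
  | tmul c q =>
    obtain ⟨n, rfl⟩ := Submodule.Quotient.mk_surjective _ q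
    have : c ⊗ₜ[ℤ] (Submodule.Quotient.mk n : QuotLattice σ) = c • ((1 : ℂ) ⊗ₜ Submodule.Quotient.mk n) := by
      rw [TensorProduct.smul_tmul', smul_eq_mul, mul_one]
    rw [this, map_smul]
    exact Submodule.smul_mem _ _ (Submodule.subset_span ⟨n, rfl⟩)
  | add x y hx hy => rw [map_add]; exact add_mem hx hy

theorem TRing.induction_of {motive : TRing σ → Prop} (a : TRing σ)
    (scalar : ∀ c : ℂ, motive (algebraMap ℂ _ c)) (of : ∀ n, motive (TRing.of σ n))
    (add : ∀ a b, motive a → motive b → motive (a + b))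
    (mul : ∀ a b, motive a → motive b → motive (a * b)) : motive a := by
  induction a using SymmetricAlgebra.induction with
  | algebraMap c => exact scalar c
  | mul a b ha hb => exact mul a b ha hb
  | add a b ha hb => exact add a b ha hb
  | ι x =>
    refine Submodule.span_induction (p := fun y _ => motive y) ?_ ?_ ?_ ?_ (TRing.ι_mem_span x)
    · rintro _ ⟨n, rfl⟩
      exact of n
    · rw [← map_zero (algebraMap ℂ (TRing σ))]
      exact scalar 0
    · exact fun a b _ _ ha hb => add a b ha hb
    · intro c a _ ha
      rw [Algebra.smul_def]
      exact mul _ _ (scalar c) ha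

theorem TRing.maxIdeal_eq_span : TRing.maxIdeal σ = Ideal.span (Set.range (TRing.of σ)) := by
  apply le_antisymm
  · refine Ideal.span_le.2 ?_
    rintro _ ⟨x, rfl⟩
    refine Submodule.span_induction (p := fun y _ => y ∈ Ideal.span (Set.range (TRing.of σ)))
      ?_ ?_ ?_ ?_ (TRing.ι_mem_span x)
    · exact fun y hy => Ideal.subset_span hy
    · exact zero_mem _
    · exact fun a b _ _ ha hb => add_mem ha hb
    · exact fun c a _ ha => Submodule.smul_of_tower_mem _ c ha
  · refine Ideal.span_mono ?_
    rintro _ ⟨n, rfl⟩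
    exact ⟨_, rfl⟩

theorem TRing.of_mem_maxIdeal (n : N) : TRing.of σ n ∈ TRing.maxIdeal σ :=
  Ideal.subset_span ⟨_, rfl⟩

/-- The additive map `N → 𝓣_σ`. -/
def TRing.ofAddHom (σ : PointedCone ℝ (ℝ ⊗[ℤ] N)) : N →+ TRing σ :=
  AddMonoidHom.mk' (TRing.of σ) TRing.of_add

theorem TRing.maxIdeal_eq_span_basis {ι : Type*} (b : Module.Basis ι ℤ N) :
    TRing.maxIdeal σ = Ideal.span (Set.range fun i => TRing.of σ (b i)) := by
  rw [TRing.maxIdeal_eq_span]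
  apply le_antisymm
  · refine Ideal.span_le.2 ?_
    rintro _ ⟨n, rfl⟩
    rw [← b.linearCombination_repr n, Finsupp.linearCombination_apply, Finsupp.sum]
    change TRing.ofAddHom σ _ ∈ _
    rw [map_sum]
    refine sum_mem fun i _ => ?_
    rw [map_zsmul]
    exact zsmul_mem (Ideal.subset_span (Set.mem_range_self i)) _
  · refine Ideal.span_mono ?_
    rintro _ ⟨n, rfl⟩
    exact ⟨_, rfl⟩

/-- The universal property of the symmetric algebra requires a commutative target; the subalgebra
generated by the commuting operators provides one. -/
theorem exists_TRing_action {V : Type*} [AddCommGroup V] [Module ℂ V] (L : N →+ Module.End ℂ V)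
    (hcomm : ∀ n n', Commute (L n) (L n')) (hker : ∀ n ∈ spanLattice σ, L n = 0) :
    ∃ ρ : TRing σ →ₐ[ℂ] Module.End ℂ V, ∀ n, ρ (TRing.of σ n) = L n := by
  let A := Algebra.adjoin ℂ (Set.range L)
  have : IsMulCommutative A := Algebra.isMulCommutative_adjoin ℂ (by
    rintro _ ⟨n, rfl⟩ _ ⟨n', rfl⟩
    exact hcomm n n')
  let : CommRing A := { A.toRing with mul_comm := this.is_comm.comm }
  have hmem : ∀ n, L n ∈ A := fun n => Algebra.subset_adjoin ⟨n, rfl⟩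
  let L₁ : N →ₗ[ℤ] A := AddMonoidHom.toIntLinearMap
    { toFun := fun n => ⟨L n, hmem n⟩
      map_zero' := Subtype.ext (map_zero L)
      map_add' := fun n n' => Subtype.ext (map_add L n n') }
  let L₂ : QuotLattice σ →ₗ[ℤ] A := (spanLattice σ).liftQ L₁ fun n hn =>
    LinearMap.mem_ker.2 (Subtype.ext (hker n hn))
  let L₃ : ℂ ⊗[ℤ] QuotLattice σ →ₗ[ℂ] A := TensorProduct.AlgebraTensorModule.lift
    (LinearMap.toSpanSingleton ℂ _ L₂)
  refine ⟨A.val.comp (SymmetricAlgebra.lift L₃), fun n => ?_⟩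
  rw [AlgHom.comp_apply, TRing.of, SymmetricAlgebra.lift_ι_apply]
  have : L₃ ((1 : ℂ) ⊗ₜ Submodule.Quotient.mk n) = ⟨L n, hmem n⟩ := by
    simp only [L₃, TensorProduct.AlgebraTensorModule.lift_tmul, LinearMap.toSpanSingleton_apply,
      one_smul]
    rfl
  rw [this]
  rfl

variable {V : Type*} [AddCommGroup V] [Module ℂ V] [Module (TRing σ) V] [IsScalarTower ℂ (TRing σ) V]

/-- The action of an element of `𝓣_σ`. -/
def TRing.act (V : Type*) [AddCommGroup V] [Module ℂ V] [Module (TRing σ) V]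
    [IsScalarTower ℂ (TRing σ) V] (a : TRing σ) : Module.End ℂ V :=
  Algebra.lsmul ℂ ℂ V a

@[simp] theorem TRing.act_apply (a : TRing σ) (m : V) : TRing.act V a m = a • m := rfl

theorem TRing.act_pow_apply (a : TRing σ) (k : ℕ) (m : V) :
    (TRing.act V a ^ k) m = a ^ k • m := by
  rw [TRing.act, ← map_pow]
  rfl

/-- The maximal ideal is generated by finitely many classes of lattice vectors. If each has a power
killing `m`, the ideal lies in the radical of the annihilator of `m`, and being finitely generated
it has a power inside the annihilator. -/
theorem supported_iff [Module.Free ℤ N] [Module.Finite ℤ N] :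
    (∀ m : V, ∃ k : ℕ, ∀ a ∈ TRing.maxIdeal σ ^ k, a • m = 0) ↔
      ∀ n, IsLocallyNilpotent (TRing.act V (TRing.of σ n)) := by
  constructor
  · intro h n m
    obtain ⟨k, hk⟩ := h m
    exact ⟨k, by
      rw [TRing.act_pow_apply]
      exact hk _ (Ideal.pow_mem_pow (TRing.of_mem_maxIdeal n) k)⟩
  · intro h m
    have h1 : TRing.maxIdeal σ ≤ (Ideal.torsionOf (TRing σ) V m).radical := by
      rw [TRing.maxIdeal_eq_span, Ideal.span_le]
      rintro _ ⟨n, rfl⟩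
      obtain ⟨k, hk⟩ := h n m
      rw [TRing.act_pow_apply] at hk
      exact ⟨k, hk⟩
    have h2 : (TRing.maxIdeal σ).FG := by
      rw [TRing.maxIdeal_eq_span_basis (Module.Free.chooseBasis ℤ N)]
      exact Submodule.fg_span (Set.finite_range _)
    obtain ⟨k, hk⟩ := Ideal.exists_pow_le_of_le_radical_of_fg h1 h2
    exact ⟨k, fun a ha => hk ha⟩

theorem maxIdeal_smul_eq_zero_iff {m : V} :
    (∀ a ∈ TRing.maxIdeal σ, a • m = 0) ↔ ∀ n, TRing.of σ n • m = 0 := by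
  constructor
  · exact fun h n => h _ (TRing.of_mem_maxIdeal n)
  · intro h
    have : TRing.maxIdeal σ ≤ Ideal.torsionOf (TRing σ) V m := by
      rw [TRing.maxIdeal_eq_span, Ideal.span_le]
      rintro _ ⟨n, rfl⟩
      exact h n
    exact fun a ha => this ha

/-- A linear map commuting with the action of `N` is `𝓣_σ`-linear. -/
theorem map_smul_of_map_of {W : Type*} [AddCommGroup W] [Module ℂ W] [Module (TRing τ) W]
    [IsScalarTower ℂ (TRing τ) W] (r : TRing τ →ₐ[ℂ] TRing σ)
    (hr : ∀ n, r (TRing.of τ n) = TRing.of σ n) (φ : V →ₗ[ℂ] W)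
    (h : ∀ n m, φ (TRing.of σ n • m) = TRing.of τ n • φ m) (a : TRing τ) (m : V) :
    φ (r a • m) = a • φ m := by
  induction a using TRing.induction_of generalizing m with
  | scalar c => rw [AlgHom.commutes, algebraMap_smul, algebraMap_smul, map_smul]
  | of n => rw [hr, h]
  | add a b ha hb => rw [map_add, add_smul, add_smul, map_add, ha, hb]
  | mul a b ha hb => rw [map_mul, mul_smul, mul_smul, ha, hb]

end TRingModules

/-! ### Co-`𝓣`-modules and their morphisms in terms of the operators of lattice vectors -/

section CoTModOps

variable {N : Type} [AddCommGroup N] {Δ : Fan N}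

/-- A co-`𝓣`-module given by the operators of the elements of `N`. -/
def CoTMod.ofOps (Γ : Δ.Cone → Type) [∀ σ, AddCommGroup (Γ σ)] [∀ σ, Module ℂ (Γ σ)]
    (L : ∀ σ, N →+ Module.End ℂ (Γ σ)) (hcomm : ∀ σ n n', Commute (L σ n) (L σ n'))
    (hker : ∀ σ : Δ.Cone, ∀ n ∈ spanLattice σ.1, L σ n = 0)
    (res : ∀ {τ σ : Δ.Cone}, τ ≤ σ → (Γ σ →ₗ[ℂ] Γ τ))
    (hres : ∀ {τ σ : Δ.Cone} (h : τ ≤ σ) n a, res h (L σ n a) = L τ n (res h a))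
    (res_refl : ∀ σ a, res (le_refl σ) a = a)
    (res_res : ∀ {ρ τ σ : Δ.Cone} (h : ρ ≤ τ) (h' : τ ≤ σ) a,
      res h (res h' a) = res (h.trans h') a) : CoTMod Δ :=
  letI : ∀ σ : Δ.Cone, Module (TRing σ.1) (Γ σ) := fun σ =>
    Module.compHom (Γ σ) (exists_TRing_action (L σ) (hcomm σ) (hker σ)).choose.toRingHom
  haveI : ∀ σ : Δ.Cone, IsScalarTower ℂ (TRing σ.1) (Γ σ) := fun σ => ⟨fun c a m => by
    change (exists_TRing_action (L σ) (hcomm σ) (hker σ)).choose (c • a) m =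
      c • (exists_TRing_action (L σ) (hcomm σ) (hker σ)).choose a m
    rw [_root_.map_smul]
    rfl⟩
  have hof : ∀ (σ : Δ.Cone) n (m : Γ σ), TRing.of σ.1 n • m = L σ n m := fun σ n m =>
    LinearMap.congr_fun ((exists_TRing_action (L σ) (hcomm σ) (hker σ)).choose_spec n) m
  { obj := Γ
    map := res
    map_smul := fun h a m => map_smul_of_map_of (TRing.map h) (TRing.map_of h) (res h)
      (fun n m => by rw [hof, hof, hres]) a m
    map_refl := res_refl
    map_trans := res_res }

theorem CoTMod.ofOps_smul (Γ : Δ.Cone → Type) [∀ σ, AddCommGroup (Γ σ)] [∀ σ, Module ℂ (Γ σ)]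
    (L : ∀ σ, N →+ Module.End ℂ (Γ σ)) (hcomm : ∀ σ n n', Commute (L σ n) (L σ n'))
    (hker : ∀ σ : Δ.Cone, ∀ n ∈ spanLattice σ.1, L σ n = 0)
    (res : ∀ {τ σ : Δ.Cone}, τ ≤ σ → (Γ σ →ₗ[ℂ] Γ τ))
    (hres : ∀ {τ σ : Δ.Cone} (h : τ ≤ σ) n a, res h (L σ n a) = L τ n (res h a))
    (res_refl : ∀ σ a, res (le_refl σ) a = a)
    (res_res : ∀ {ρ τ σ : Δ.Cone} (h : ρ ≤ τ) (h' : τ ≤ σ) a,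
      res h (res h' a) = res (h.trans h') a) (σ : Δ.Cone) (n : N)
    (m : (CoTMod.ofOps Γ L hcomm hker res hres res_refl res_res).obj σ) :
    TRing.of σ.1 n • m = L σ n m :=
  LinearMap.congr_fun ((exists_TRing_action (L σ) (hcomm σ) (hker σ)).choose_spec n) m

/-- A morphism of co-`𝓣`-modules given by linear maps commuting with the operators of `N`. -/
def CoTMod.homOfOps {P Q : CoTMod Δ} (φ : ∀ σ, P.obj σ →ₗ[ℂ] Q.obj σ)
    (h : ∀ (σ : Δ.Cone) n m, φ σ (TRing.of σ.1 n • m) = TRing.of σ.1 n • φ σ m)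
    (hm : ∀ {τ σ : Δ.Cone} (h : τ ≤ σ) m, φ τ (P.map h m) = Q.map h (φ σ m)) : P ⟶ Q :=
  CoTMod.Hom.mk (P := P) (Q := Q) (fun σ =>
    { toFun := φ σ
      map_add' := map_add (φ σ)
      map_smul' := map_smul_of_map_of (AlgHom.id ℂ (TRing σ.1)) (fun _ => rfl) (φ σ) (h σ) }) hm

/-- Isomorphisms of co-`𝓣`-modules given by linear isomorphisms. -/
def CoTMod.isoOfOps {P Q : CoTMod Δ} (φ : ∀ σ, P.obj σ ≃ₗ[ℂ] Q.obj σ)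
    (h : ∀ (σ : Δ.Cone) n m, φ σ (TRing.of σ.1 n • m) = TRing.of σ.1 n • φ σ m)
    (hm : ∀ {τ σ : Δ.Cone} (h : τ ≤ σ) m, φ τ (P.map h m) = Q.map h (φ σ m)) : P ≅ Q where
  hom := CoTMod.homOfOps (fun σ => (φ σ).toLinearMap) h hm
  inv := CoTMod.homOfOps (fun σ => (φ σ).symm.toLinearMap)
    (fun σ n m => (φ σ).injective (by simp [h]))
    (fun {τ σ} hle m => (φ τ).injective (by simp [hm]))
  hom_inv_id := CoTMod.hom_ext fun σ => LinearMap.ext fun m => (φ σ).symm_apply_apply m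
  inv_hom_id := CoTMod.hom_ext fun σ => LinearMap.ext fun m => (φ σ).apply_symm_apply m

end CoTModOps

end ToricLC

end

noncomputable section

namespace ToricLC

/-! ### The co-module of logarithms of monodromy -/

section LogModule

open Filter Topology

variable {N : Type} [AddCommGroup N] [Module.Free ℤ N] [Module.Finite ℤ N] {Δ : Fan N}
  {F G : Sh (X Δ)} {Γ Γ' : Δ.Cone → Type} [∀ σ, AddCommGroup (Γ' σ)] [∀ σ, Module ℂ (Γ' σ)]
  [∀ σ, AddCommGroup (Γ σ)] [∀ σ, Module ℂ (Γ σ)]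

/-- The monodromy of a flat structure is locally unipotent. -/
def FlatData.IsUnipotent (D : FlatData F Γ) : Prop :=
  ∀ σ n, IsLocallyNilpotent (D.monodromy σ n - 1)

theorem FlatData.monodromy_commute (D : FlatData F Γ) (σ : Δ.Cone) (n n' : N) :
    Commute (D.monodromy σ n) (D.monodromy σ n') := by
  rw [Commute, SemiconjBy, ← D.monodromy_add, ← D.monodromy_add, add_comm]

/-- The operators `(2πi)⁻¹ log T_n`. -/
def FlatData.logAction (D : FlatData F Γ) (hD : D.IsUnipotent) (σ : Δ.Cone) :
    N →+ Module.End ℂ (Γ σ) :=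
  AddMonoidHom.mk' (fun n => (2 * Real.pi * Complex.I : ℂ)⁻¹ • opLog (D.monodromy σ n) (hD σ n))
    fun n n' => by
      have h : IsLocallyNilpotent (D.monodromy σ n * D.monodromy σ n' - 1) := by
        rw [← D.monodromy_add]; exact hD σ _
      have h2 := opLog_mul (hD σ n) (hD σ n') (D.monodromy_commute σ n n') h
      rw [← smul_add, ← h2]
      simp only [D.monodromy_add]

theorem FlatData.logAction_apply (D : FlatData F Γ) (hD : D.IsUnipotent) (σ : Δ.Cone) (n : N) :
    D.logAction hD σ n =
      (2 * Real.pi * Complex.I : ℂ)⁻¹ • opLog (D.monodromy σ n) (hD σ n) := rfl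

theorem FlatData.opLog_monodromy (D : FlatData F Γ) (hD : D.IsUnipotent) (σ : Δ.Cone) (n : N) :
    opLog (D.monodromy σ n) (hD σ n) = (2 * Real.pi * Complex.I : ℂ) • D.logAction hD σ n := by
  rw [logAction_apply, smul_smul, mul_inv_cancel₀ Complex.two_pi_I_ne_zero, one_smul]

theorem FlatData.isLocallyNilpotent_logAction (D : FlatData F Γ) (hD : D.IsUnipotent)
    (σ : Δ.Cone) (n : N) : IsLocallyNilpotent (D.logAction hD σ n) :=
  (isLocallyNilpotent_opLog _ (hD σ n)).smul _

theorem FlatData.logAction_eq_zero_iff (D : FlatData F Γ) (hD : D.IsUnipotent)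
    (σ : Δ.Cone) (n : N) (a : Γ σ) : D.logAction hD σ n a = 0 ↔ D.monodromy σ n a = a := by
  rw [logAction_apply, LinearMap.smul_apply,
    smul_eq_zero_iff_right (inv_ne_zero Complex.two_pi_I_ne_zero), opLog_apply_eq_zero_iff]

/-- Linear maps intertwine monodromy up to the `k`-th power map of the torus if and only if they
intertwine its logarithm up to the factor `k`. -/
theorem FlatData.map_logAction (D : FlatData F Γ) (hD : D.IsUnipotent) (D' : FlatData G Γ')
    (hD' : D'.IsUnipotent) {σ τ : Δ.Cone} (n n' : N) (φ : Γ σ →ₗ[ℂ] Γ' τ)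
    (h : ∀ a, φ (D.monodromy σ n a) = D'.monodromy τ n' (φ a)) (a : Γ σ) :
    φ (D.logAction hD σ n a) = D'.logAction hD' τ n' (φ a) := by
  rw [logAction_apply, logAction_apply, LinearMap.smul_apply, LinearMap.smul_apply, map_smul]
  congr 1
  exact psEval_intertwine _ _ φ (fun b => by
    simp only [LinearMap.sub_apply, map_sub, Module.End.one_apply, h]) _ a

theorem FlatData.map_monodromy_of_logAction (D : FlatData F Γ) (hD : D.IsUnipotent)
    (D' : FlatData G Γ') (hD' : D'.IsUnipotent) {σ τ : Δ.Cone} (n n' : N) (φ : Γ σ →ₗ[ℂ] Γ' τ)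
    (h : ∀ a, φ (D.logAction hD σ n a) = D'.logAction hD' τ n' (φ a)) (a : Γ σ) :
    φ (D.monodromy σ n a) = D'.monodromy τ n' (φ a) := by
  rw [← opExp_opLog _ (hD σ n) (isLocallyNilpotent_opLog _ _),
    ← opExp_opLog _ (hD' τ n') (isLocallyNilpotent_opLog _ _)]
  exact psEval_intertwine _ _ φ (fun b => by
    rw [D.opLog_monodromy hD, D'.opLog_monodromy hD', LinearMap.smul_apply, LinearMap.smul_apply,
      map_smul, h]) _ a

/-- The co-`𝓣`-module of a flat structure. -/
def FlatData.coTMod (D : FlatData F Γ) (hD : D.IsUnipotent) : CoTMod Δ :=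
  CoTMod.ofOps Γ (D.logAction hD)
    (fun σ n n' => ((opLog_commute (hD σ n) (hD σ n') (D.monodromy_commute σ n n')).smul_left
      _).smul_right _)
    (fun σ n hn => LinearMap.ext fun a => (D.logAction_eq_zero_iff hD σ n a).2 (by
      rw [D.monodromy_of_mem_spanLattice hn]; rfl))
    D.res
    (fun h n a => D.map_logAction hD D hD n n (D.res h) (D.res_monodromy h n) a)
    D.res_refl D.res_res

theorem FlatData.coTMod_smul (D : FlatData F Γ) (hD : D.IsUnipotent) (σ : Δ.Cone) (n : N)
    (m : (D.coTMod hD).obj σ) : TRing.of σ.1 n • m = D.logAction hD σ n m :=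
  CoTMod.ofOps_smul Γ (D.logAction hD) _ _ D.res
    (fun h n a => D.map_logAction hD D hD n n (D.res h) (D.res_monodromy h n) a)
    D.res_refl D.res_res σ n m

theorem FlatData.isSupportedAtOrigin_coTMod (D : FlatData F Γ) (hD : D.IsUnipotent) :
    isSupportedAtOrigin Δ (D.coTMod hD) := fun σ => by
  refine supported_iff.2 fun n => ?_
  have : TRing.act ((D.coTMod hD).obj σ) (TRing.of σ.1 n) = D.logAction hD σ n :=
    LinearMap.ext fun m => D.coTMod_smul hD σ n m
  rw [this]
  exact D.isLocallyNilpotent_logAction hD σ n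

/-- Every flat section takes a value at `v = 0`, and the values of `ψ` there determine the image. -/
theorem FlatRel.unique {D : FlatData F Γ} {D' : FlatData G Γ'} {f : X Δ → X Δ} {k : ℕ}
    {ψ : ∀ y, stalk F (f y) →ₗ[ℂ] stalk G y} (hf : ∀ (σ : Δ.Cone) v, f (param σ v) = param σ (k • v))
    {φ φ' : ∀ σ, Γ σ →ₗ[ℂ] Γ' σ} (h : FlatRel D D' f k ψ φ) (h' : FlatRel D D' f k ψ φ') :
    φ = φ' := funext fun σ => LinearMap.ext fun a => by
  obtain ⟨u, hu⟩ := D.exists_germ_eq_val (hf σ 0) a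
  exact D'.val_injective ((h σ 0 a u hu).symm.trans (h' σ 0 a u hu))

theorem id_param (σ : Δ.Cone) (v : ExpSpace N) :
    (id : X Δ → X Δ) (param σ v) = param σ (1 • v) := by rw [one_smul]; rfl

theorem flatRel_stalkMap {D : FlatData F (ptStalk F)} {D' : FlatData G (ptStalk G)}
    (hD : ∀ σ a, D.val σ 0 a = ⟨pt σ, a⟩) (hD' : ∀ σ a, D'.val σ 0 a = ⟨pt σ, a⟩) (f : F ⟶ G) :
    FlatRel D D' id 1 (stalkMap f) fun σ => stalkMap f (pt σ : X Δ) := by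
  obtain ⟨φ, hφ⟩ := exists_flatRel D D' id_param (isEtaleFamily_stalkMap f)
  have : φ = fun σ => stalkMap f (pt σ : X Δ) := funext fun σ => LinearMap.ext fun a => by
    obtain ⟨u, hu⟩ := D.exists_germ_eq_val (id_param σ 0) a
    have h1 := hφ σ 0 a u hu
    rw [smul_zero, hD] at hu
    rw [hD'] at h1
    have h2 := congrArg (etaleMap f) hu
    exact etale_mk_inj (h1.symm.trans h2)
  exact this ▸ hφ

theorem stalkMap_id {Y : TopCat.{0}} (F : Sh Y) (y : Y) : stalkMap (𝟙 F) y = LinearMap.id :=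
  congrArg ModuleCat.Hom.hom
    ((TopCat.Presheaf.stalkFunctor (ModuleCat.{0} ℂ) y).map_id F.presheaf)

theorem stalkMap_comp {Y : TopCat.{0}} {F G H : Sh Y} (f : F ⟶ G) (g : G ⟶ H) (y : Y) :
    stalkMap (f ≫ g) y = stalkMap g y ∘ₗ stalkMap f y :=
  congrArg ModuleCat.Hom.hom
    ((TopCat.Presheaf.stalkFunctor (ModuleCat.{0} ℂ) y).map_comp f.hom g.hom)

/-- A flat structure normalized at the distinguished points. -/
def flatOf (hF : isLC Δ F) : FlatData F (ptStalk F) := (exists_flatData_ptStalk hF).choose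

theorem flatOf_val (hF : isLC Δ F) (σ : Δ.Cone) (a : ptStalk F σ) :
    (flatOf hF).val σ 0 a = ⟨pt σ, a⟩ := (exists_flatData_ptStalk hF).choose_spec σ a

theorem flatOf_isUnipotent (hF : isLCu Δ F) : (flatOf hF.1).IsUnipotent :=
  ((flatOf hF.1).isLCu_iff (flatOf_val hF.1)).1 hF

variable (Δ) in
/-- The functor of logarithms of monodromy. -/
def logFunctor : LCu Δ ⥤ CoTMod Δ where
  obj F := (flatOf F.property.1).coTMod (flatOf_isUnipotent F.property)
  map {F G} f := CoTMod.homOfOps (P := (flatOf F.property.1).coTMod (flatOf_isUnipotent F.property))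
    (Q := (flatOf G.property.1).coTMod (flatOf_isUnipotent G.property))
    (fun σ => stalkMap f.hom (pt σ : X Δ))
    (fun σ n m => ((congrArg _ (FlatData.coTMod_smul _ _ σ n m)).trans
      (FlatData.map_logAction (flatOf F.property.1) _ (flatOf G.property.1) _ n n
        (stalkMap f.hom (pt σ : X Δ)) (fun a => by
          have := (flatRel_stalkMap (flatOf_val F.property.1) (flatOf_val G.property.1)
            f.hom).map_monodromy id_param σ n a
          rwa [one_smul] at this) m)).trans (FlatData.coTMod_smul _ _ σ n _).symm)
    (fun h m => (flatRel_stalkMap (flatOf_val F.property.1) (flatOf_val G.property.1)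
        f.hom).map_res (isEtaleFamily_stalkMap f.hom) one_pos id_param h m)
  map_id F := CoTMod.hom_ext fun σ => LinearMap.ext fun m =>
    LinearMap.congr_fun (stalkMap_id F.obj (pt σ : X Δ)) m
  map_comp f g := CoTMod.hom_ext fun σ => LinearMap.ext fun m =>
    LinearMap.congr_fun (stalkMap_comp f.hom g.hom (pt σ : X Δ)) m

theorem logFunctor_smul (F : LCu Δ) (σ : Δ.Cone) (n : N) (m : ((logFunctor Δ).obj F).obj σ) :
    TRing.of σ.1 n • m =
      (flatOf F.property.1).logAction (flatOf_isUnipotent F.property) σ n m :=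
  FlatData.coTMod_smul _ _ _ _ _

/-- Along an orbit a morphism acts on flat sections, and these are known from their values at the
distinguished point. -/
theorem hom_ext_of_pt {F G : Sh (X Δ)} (hF : isLC Δ F) (hG : isLC Δ G) {f g : F ⟶ G}
    (h : ∀ σ : Δ.Cone, stalkMap f (pt σ : X Δ) = stalkMap g (pt σ : X Δ)) : f = g := by
  refine hom_ext_stalk fun y => LinearMap.ext fun u => ?_
  obtain ⟨σ, v, rfl⟩ := exists_param y
  obtain ⟨a, ha⟩ := (flatOf hF).exists_val (σ := σ) (v := 1 • v) (g := ⟨(param σ v : X Δ), u⟩)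
    (id_param σ v)
  have h1 := flatRel_stalkMap (flatOf_val hF) (flatOf_val hG) f σ v a u ha
  have h2 := flatRel_stalkMap (flatOf_val hF) (flatOf_val hG) g σ v a u ha
  simp only [h] at h1
  exact etale_mk_inj (h1.trans h2.symm)

instance : (logFunctor Δ).Faithful where
  map_injective {F G f g} h := by
    apply ObjectProperty.hom_ext
    refine hom_ext_of_pt F.property.1 G.property.1 fun σ => LinearMap.ext fun a => ?_
    exact LinearMap.congr_fun (congrArg (fun φ => CoTMod.Hom.app φ σ) h) a

/-- A map commuting with the logarithms of monodromy commutes with their exponentials. It is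
therefore compatible with monodromy and restrictions, and `exists_isEtaleFamily` extends it to all
stalks. -/
instance : (logFunctor Δ).Full where
  map_surjective {F G} g := by
    let D := flatOf F.property.1
    let D' := flatOf G.property.1
    let φ : ∀ σ, ptStalk F.obj σ →ₗ[ℂ] ptStalk G.obj σ := fun σ =>
      (CoTMod.Hom.app g σ).restrictScalars ℂ
    have hT : ∀ σ n a, φ σ (D.monodromy σ (1 • n) a) = D'.monodromy σ n (φ σ a) := fun σ n a => by
      rw [one_smul]
      refine D.map_monodromy_of_logAction (flatOf_isUnipotent F.property) D'
        (flatOf_isUnipotent G.property) n n (φ σ) (fun b => ?_) a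
      exact ((congrArg (CoTMod.Hom.app g σ) (logFunctor_smul F σ n b)).symm.trans
        ((CoTMod.Hom.app g σ).map_smul (TRing.of σ.1 n) b)).trans (logFunctor_smul G σ n _)
    obtain ⟨ψ, hψ, hrel⟩ := exists_isEtaleFamily D D' one_pos id_param continuous_id φ hT
      (fun h a => CoTMod.Hom.comm g h a)
    obtain ⟨f, hf⟩ := hψ.exists_stalkMap
    obtain rfl : stalkMap f = ψ := funext hf
    refine ⟨⟨f⟩, CoTMod.hom_ext fun σ => LinearMap.ext fun a => ?_⟩
    have := hrel.unique id_param (flatRel_stalkMap (flatOf_val F.property.1)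
      (flatOf_val G.property.1) f)
    exact (LinearMap.congr_fun (congrFun this σ) a).symm

theorem isSupportedAtOrigin_logFunctor (F : LCu Δ) :
    isSupportedAtOrigin Δ ((logFunctor Δ).obj F) := FlatData.isSupportedAtOrigin_coTMod _ _

/-- Invariants of all loops in the orbit are the vectors fixed by every `T_n`, that is, killed by
every `log T_n`; since these classes generate the maximal ideal, they form the socle. -/
theorem isLCcf_iff (F : LCu Δ) : isLCcf Δ F.obj ↔ isCofinite Δ ((logFunctor Δ).obj F) := by
  have h : ∀ σ : Δ.Cone, FiniteDimensional ℂ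
      (monodromyInvariants F.obj (torusOrbit σ : Set (X Δ)) (pt σ : X Δ)) ↔
      FiniteDimensional ℂ (((logFunctor Δ).obj F).socle σ) := fun σ => by
    have h1 : @Eq (Submodule ℂ (ptStalk F.obj σ)) (((logFunctor Δ).obj F).socle σ)
        (monodromyInvariants F.obj (torusOrbit σ : Set (X Δ)) (pt σ : X Δ)) := by
      rw [(flatOf F.property.1).monodromyInvariants_eq (flatOf_val F.property.1)]
      refine Submodule.ext (M := ptStalk F.obj σ) fun m =>
        Iff.trans ?_ (Submodule.mem_iInf (R := ℂ) (M := ptStalk F.obj σ) _).symm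
      refine (maxIdeal_smul_eq_zero_iff (V := ((logFunctor Δ).obj F).obj σ)).trans
        (forall_congr' fun n => ?_)
      refine (Iff.of_eq (congrArg (· = 0) (logFunctor_smul F σ n m))).trans
        (((flatOf F.property.1).logAction_eq_zero_iff (flatOf_isUnipotent F.property) σ n m).trans ?_)
      exact sub_eq_zero.symm
    exact Iff.of_eq (congrArg (fun S : Submodule ℂ (ptStalk F.obj σ) => FiniteDimensional ℂ S)
      h1.symm)
  constructor
  · exact fun hF => ⟨isSupportedAtOrigin_logFunctor F, fun σ => (h σ).1 (hF.2 σ)⟩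
  · exact fun hF => ⟨F.property, fun σ => (h σ).2 (hF.2 σ)⟩

/-- The comparison of two flat structures on a sheaf. -/
theorem FlatData.exists_equiv (D : FlatData F Γ) (D' : FlatData F Γ') :
    ∃ e : ∀ σ, Γ σ ≃ₗ[ℂ] Γ' σ, (∀ σ n a, e σ (D.monodromy σ n a) = D'.monodromy σ n (e σ a)) ∧
      ∀ {τ σ : Δ.Cone} (h : τ ≤ σ) a, e τ (D.res h a) = D'.res h (e σ a) := by
  have hid : IsEtaleFamily (id : X Δ → X Δ) (F := F) (G := F) (fun _ => LinearMap.id) :=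
    fun U t y hy => ⟨U, hy, t, fun _ _ _ => rfl⟩
  obtain ⟨φ, hφ⟩ := exists_flatRel D D' id_param hid
  obtain ⟨φ', hφ'⟩ := exists_flatRel D' D id_param hid
  have h1 : ∀ σ a, D.val σ 0 a = D'.val σ 0 (φ σ a) := fun σ a => by
    have := hφ σ 0 a (D.ev σ 0 a) (by rw [smul_zero]; rfl)
    exact this
  have h2 : ∀ σ a, D'.val σ 0 a = D.val σ 0 (φ' σ a) := fun σ a => by
    have := hφ' σ 0 a (D'.ev σ 0 a) (by rw [smul_zero]; rfl)
    exact this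
  refine ⟨fun σ => LinearEquiv.ofLinearMap (φ σ) (φ' σ)
    (LinearMap.ext fun a => D'.val_injective (v := 0) ((h1 σ _).symm.trans (h2 σ a).symm))
    (LinearMap.ext fun a => D.val_injective (v := 0) ((h2 σ _).symm.trans (h1 σ a).symm)),
    fun σ n a => ?_, fun h a => hφ.map_res hid one_pos id_param h a⟩
  have := hφ.map_monodromy id_param σ n a
  rwa [one_smul] at this

theorem FlatData.isLCu (D : FlatData F Γ) (hD : D.IsUnipotent) : isLCu Δ F := by
  obtain ⟨e, he, -⟩ := D.exists_equiv (flatOf D.isLC)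
  refine ((flatOf D.isLC).isLCu_iff (flatOf_val D.isLC)).2 fun σ n b => ?_
  obtain ⟨a, rfl⟩ := (e σ).surjective b
  obtain ⟨k, hk⟩ := hD σ n a
  refine ⟨k, ?_⟩
  have : ∀ (k : ℕ) a, (((flatOf D.isLC).monodromy σ n - 1) ^ k) (e σ a) =
      e σ (((D.monodromy σ n - 1) ^ k) a) := fun k => by
    induction k with
    | zero => intro a; rfl
    | succ k ih =>
      intro a
      rw [pow_succ, pow_succ, Module.End.mul_apply, Module.End.mul_apply, ← ih]
      congr 1
      simp only [LinearMap.sub_apply, map_sub, Module.End.one_apply, he]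
  rw [this, hk, map_zero]

/-- The sheaf of a flat structure corresponds to its co-`𝓣`-module. -/
theorem FlatData.exists_iso (D : FlatData F Γ) (hD : D.IsUnipotent) :
    Nonempty ((logFunctor Δ).obj ⟨F, D.isLCu hD⟩ ≅ D.coTMod hD) := by
  obtain ⟨e, he, he'⟩ := D.exists_equiv (flatOf D.isLC)
  refine ⟨(CoTMod.isoOfOps (P := D.coTMod hD) (Q := (logFunctor Δ).obj ⟨F, D.isLCu hD⟩) e
    (fun σ n m => ?_) he').symm⟩
  rw [FlatData.coTMod_smul, logFunctor_smul]
  exact FlatData.map_logAction _ _ _ _ n n (e σ).toLinearMap (he σ n) m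

end LogModule

end ToricLC

end

noncomputable section

namespace ToricLC

/-! ### Sheaves of families of vectors subject to a local condition -/

section LinearPredicate

variable {Y : TopCat.{0}}

/-- A local linear condition on families of elements of vector spaces `T x`. -/
structure LinearPredicate (T : Y → Type) [∀ x, AddCommGroup (T x)] [∀ x, Module ℂ (T x)] where
  sections : ∀ U : Opens Y, Submodule ℂ (∀ x : U, T x)
  res : ∀ {U V : Opens Y} (i : U ⟶ V) (s : ∀ x : V, T x), s ∈ sections V →
    (fun x : U => s (i x)) ∈ sections U
  locality : ∀ {U : Opens Y} (s : ∀ x : U, T x),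
    (∀ x : U, ∃ (V : Opens Y) (_ : x.1 ∈ V) (i : V ⟶ U), (fun x : V => s (i x)) ∈ sections V) →
      s ∈ sections U

namespace LinearPredicate

variable {T : Y → Type} [∀ x, AddCommGroup (T x)] [∀ x, Module ℂ (T x)] (P : LinearPredicate T)

/-- The presheaf of families satisfying the condition. -/
def presheaf : TopCat.Presheaf (ModuleCat.{0} ℂ) Y where
  obj U := ModuleCat.of ℂ (P.sections U.unop)
  map {U V} i := ModuleCat.ofHom
    { toFun := fun s => ⟨fun x => s.1 (i.unop x), P.res i.unop s.1 s.2⟩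
      map_add' := fun _ _ => rfl
      map_smul' := fun _ _ => rfl }

/-- The underlying predicate. -/
def toLocalPredicate : TopCat.LocalPredicate T where
  pred {U} s := s ∈ P.sections U
  res i s h := P.res i s h
  locality s h := P.locality s h

theorem isSheaf : P.presheaf.IsSheaf := by
  rw [TopCat.Presheaf.isSheaf_iff_isSheaf_comp (forget (ModuleCat.{0} ℂ))]
  exact TopCat.Presheaf.isSheaf_of_iso
    (NatIso.ofComponents (fun U => Iso.refl _) (fun _ => rfl))
    (TopCat.subpresheafToTypes.isSheaf P.toLocalPredicate)

/-- The sheaf of families satisfying the condition. -/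
def sheaf : Sh Y := ⟨P.presheaf, P.isSheaf⟩

/-- Evaluation of families at a point. -/
def evalCocone (x : Y) : Cocone ((OpenNhds.inclusion x).op ⋙ P.presheaf) where
  pt := ModuleCat.of ℂ (T x)
  ι :=
    { app := fun U => ModuleCat.ofHom
        { toFun := fun s => s.1 ⟨x, U.unop.2⟩
          map_add' := fun _ _ => rfl
          map_smul' := fun _ _ => rfl }
      naturality := fun _ _ _ => rfl }

/-- Evaluation of germs of families. -/
def stalkEval (x : Y) : stalk P.sheaf x →ₗ[ℂ] T x :=
  (colimit.desc ((OpenNhds.inclusion x).op ⋙ P.presheaf) (P.evalCocone x)).hom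

/-- A family satisfying the condition as a section. -/
def ofFamily {U : Opens Y} (s : ∀ x : U, T x) (hs : s ∈ P.sections U) : P.sheaf.presheaf.obj (op U) :=
  (⟨s, hs⟩ : P.sections U)

theorem exists_mk {U : Opens Y} (t : P.sheaf.presheaf.obj (op U)) :
    ∃ (s : ∀ x : U, T x) (hs : s ∈ P.sections U), t = P.ofFamily s hs := ⟨t.1, t.2, rfl⟩

theorem stalkEval_germ {U : Opens Y} (s : ∀ x : U, T x) (hs : s ∈ P.sections U) (x : Y)
    (hx : x ∈ U) : P.stalkEval x (germAt P.sheaf (P.ofFamily s hs) x hx) = s ⟨x, hx⟩ :=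
  congrArg (fun q : P.presheaf.obj (op U) ⟶ ModuleCat.of ℂ (T x) =>
    ModuleCat.Hom.hom q (⟨s, hs⟩ : P.sections U))
    (colimit.ι_desc (P.evalCocone x) (op (⟨U, hx⟩ : OpenNhds x)))

end LinearPredicate

end LinearPredicate

/-! ### The sheaf with given monodromy and restriction maps -/

section Construction

open Filter Topology

variable {N : Type} [AddCommGroup N] [Module.Free ℤ N] [Module.Finite ℤ N] {Δ : Fan N}

theorem near_eq_of_perp {τ σ : Δ.Cone} {v v' : ExpSpace N}
    (h : ∀ m, IsPerp σ.1 m → dot m v = dot m v') : near τ σ v ≤ near τ σ v' :=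
  tendsto_near (f := id) (fun m hm => by rw [← h m hm]; exact tendsto_dot_near v hm)
    fun _ hm hσ hτ => tendsto_im_dot_near v hm hσ hτ

/-- Representations of the fundamental groups of the orbits and maps between them. -/
structure MonodromyData (Γ : Δ.Cone → Type) [∀ σ, AddCommGroup (Γ σ)] [∀ σ, Module ℂ (Γ σ)] where
  op : ∀ σ : Δ.Cone, N → Module.End ℂ (Γ σ)
  op_add : ∀ σ n n', op σ (n + n') = op σ n * op σ n'
  op_span : ∀ (σ : Δ.Cone) n, n ∈ spanLattice σ.1 → op σ n = 1
  res : ∀ {τ σ : Δ.Cone}, τ ≤ σ → (Γ σ →ₗ[ℂ] Γ τ)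
  res_op : ∀ {τ σ : Δ.Cone} (h : τ ≤ σ) n a, res h (op σ n a) = op τ n (res h a)
  res_refl : ∀ σ a, res (le_refl σ) a = a
  res_res : ∀ {ρ τ σ : Δ.Cone} (h : ρ ≤ τ) (h' : τ ≤ σ) a, res h (res h' a) = res (h.trans h') a

namespace MonodromyData

variable {Γ : Δ.Cone → Type} [∀ σ, AddCommGroup (Γ σ)] [∀ σ, Module ℂ (Γ σ)]
  (R : MonodromyData Γ)

theorem op_eq {σ : Δ.Cone} {n n' : N} (h : ∀ m, IsPerp σ.1 m → m n = m n') :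
    R.op σ n = R.op σ n' := by
  have h1 : n - n' ∈ spanLattice σ.1 := mem_spanLattice_iff.2 fun m hm => by
    rw [map_sub, h m hm, sub_self]
  rw [← sub_add_cancel n n', R.op_add, R.op_span σ _ h1, one_mul]

/-- The fibre at `x`: equivariant families indexed by the logarithms of `x`. -/
def Fibre (x : Variety Δ) :
    Submodule ℂ (∀ (σ : Δ.Cone) (_ : {v : ExpSpace N // param σ v = x}), Γ σ) where
  carrier := {f | ∀ (σ : Δ.Cone) (v w : ExpSpace N) (hv : param σ v = x) (hw : param σ w = x) (n : N),
    (∀ m, IsPerp σ.1 m → dot m (w - v) = m n) → f σ ⟨v, hv⟩ = R.op σ n (f σ ⟨w, hw⟩)}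
  add_mem' hf hg σ v w hv hw n hn := by
    simp only [Pi.add_apply, map_add, hf σ v w hv hw n hn, hg σ v w hv hw n hn]
  zero_mem' σ v w hv hw n hn := by simp only [Pi.zero_apply, map_zero]
  smul_mem' c f hf σ v w hv hw n hn := by
    simp only [Pi.smul_apply, map_smul, hf σ v w hv hw n hn]

variable {R}

theorem Fibre.ext {x : Variety Δ} {f g : R.Fibre x} {σ : Δ.Cone} {v : ExpSpace N}
    (hv : param σ v = x) (h : f.1 σ ⟨v, hv⟩ = g.1 σ ⟨v, hv⟩) : f = g := by
  refine Subtype.ext (funext fun τ => funext fun ⟨w, hw⟩ => ?_)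
  obtain rfl := cone_eq_of_param_eq (hw.trans hv.symm)
  obtain ⟨n, hn⟩ := exists_lattice_of_param_eq (hv.trans hw.symm)
  rw [f.2 τ w v hw hv n hn, g.2 τ w v hw hv n hn, h]

variable (R)

/-- The value at one logarithm prescribes the others by equivariance, and two lattice vectors with
the same pairing on `σ^⊥` act alike. The values are compared by `HEq` because another logarithm's
cone equals `σ` only propositionally. -/
theorem exists_fibre (σ : Δ.Cone) (v : ExpSpace N) {x : Variety Δ} (hx : param σ v = x) (a : Γ σ) :
    ∃ f : R.Fibre x, f.1 σ ⟨v, hx⟩ = a := by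
  subst hx
  have h1 : ∀ (σ' : Δ.Cone) (v' : ExpSpace N), param σ' v' = param σ v → ∃ b : Γ σ', ∀ n,
      (∀ m, IsPerp σ.1 m → dot m (v - v') = m n) → HEq b (R.op σ n a) := fun σ' v' h' => by
    obtain rfl := cone_eq_of_param_eq h'
    obtain ⟨n, hn⟩ := exists_lattice_of_param_eq h'.symm
    refine ⟨R.op σ' n a, fun n' hn' => heq_of_eq ?_⟩
    rw [R.op_eq fun m hm => by exact_mod_cast (hn m hm).symm.trans (hn' m hm)]
  choose f hf using h1
  refine ⟨⟨fun σ' v' => f σ' v'.1 v'.2, fun σ' w w' hw hw' n hn => ?_⟩, ?_⟩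
  · obtain rfl := cone_eq_of_param_eq hw
    obtain ⟨k, hk⟩ := exists_lattice_of_param_eq hw'.symm
    simp only
    rw [eq_of_heq (hf σ' w' hw' k hk), ← Module.End.mul_apply, ← R.op_add]
    refine eq_of_heq (hf σ' w hw _ fun m hm => ?_)
    rw [map_add, Int.cast_add, ← hk m hm, ← hn m hm, ← map_add]
    congr 1
    abel
  · have := eq_of_heq (hf σ v rfl 0 fun m _ => by simp)
    simp only
    rw [this, R.op_span σ 0 (zero_mem _), Module.End.one_apply]

/-- Flat families. -/
def flatPredicate : LinearPredicate (Y := X Δ) (fun x => R.Fibre x) where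
  sections U :=
    { carrier := {s | ∀ (σ : Δ.Cone) (v : ExpSpace N) (hv : param σ v ∈ U) (τ : Δ.Cone) (h : τ ≤ σ),
        ∀ᶠ w in near τ σ v, ∀ hw : param τ w ∈ U,
          (s ⟨param τ w, hw⟩).1 τ ⟨w, rfl⟩ = R.res h ((s ⟨param σ v, hv⟩).1 σ ⟨v, rfl⟩)}
      add_mem' := fun {s s'} hs hs' σ v hv τ h => by
        filter_upwards [hs σ v hv τ h, hs' σ v hv τ h] with w h1 h2 hw
        simp only [Pi.add_apply, Submodule.coe_add, map_add, h1 hw, h2 hw]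
      zero_mem' := fun σ v hv τ h => Eventually.of_forall fun w hw => by
        simp only [Pi.zero_apply, Submodule.coe_zero, map_zero]
      smul_mem' := fun c s hs σ v hv τ h => by
        filter_upwards [hs σ v hv τ h] with w h1 hw
        simp only [Pi.smul_apply, Submodule.coe_smul, map_smul, h1 hw] }
  res {U V} i s hs σ v hv τ h := by
    filter_upwards [hs σ v (i.le hv) τ h] with w hw hwU
    exact hw (i.le hwU)
  locality {U} s hs σ v hv τ h := by
    obtain ⟨V, hV, i, hi⟩ := hs ⟨param σ v, hv⟩
    filter_upwards [hi σ v hV τ h, (tendsto_param_near h v).eventually (V.isOpen.mem_nhds hV)]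
      with w hw hwV hwU
    exact hw hwV

/-- The sheaf with given monodromy and restriction maps. -/
abbrev sheaf : Sh (X Δ) := R.flatPredicate.sheaf

/-- If a flat family vanishes at a point, flatness makes it vanish at all nearby points of every
stratum, hence on a neighbourhood. -/
theorem stalkEval_injective (x : X Δ) : Function.Injective (R.flatPredicate.stalkEval x) := by
  refine (injective_iff_map_eq_zero _).2 fun u hu => ?_
  obtain ⟨U, hU, t, rfl⟩ := exists_germAt' u
  obtain ⟨s, hs, rfl⟩ := R.flatPredicate.exists_mk t
  rw [LinearPredicate.stalkEval_germ] at hu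
  obtain ⟨σ, v, rfl⟩ := exists_param x
  have h1 : ∀ᶠ y in 𝓝 (param σ v), ∀ hy : y ∈ U, s ⟨y, hy⟩ = 0 := by
    rw [eventually_nhds_param_iff]
    intro τ hτ
    filter_upwards [hs σ v hU τ hτ] with w hw hwU
    refine Fibre.ext rfl ?_
    rw [hw hwU, hu]
    simp only [Submodule.coe_zero, Pi.zero_apply, map_zero]
  obtain ⟨W, hW, hWo, hxW⟩ := eventually_nhds_iff.1 h1
  let V : Opens (X Δ) := U ⊓ ⟨W, hWo⟩
  have hVU : V ≤ U := inf_le_left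
  have h2 : (R.flatPredicate.sheaf.presheaf.map (homOfLE hVU).op) (R.flatPredicate.ofFamily s hs) = 0 :=
    Subtype.ext (funext fun y => hW y.1 y.2.2 y.2.1)
  have h3 := germAt_res (F := R.flatPredicate.sheaf) (homOfLE hVU) (R.flatPredicate.ofFamily s hs)
    (param σ v : X Δ) ⟨hU, hxW⟩
  rw [← h3, h2]
  exact map_zero (R.flatPredicate.sheaf.presheaf.germ V (param σ v : X Δ) _).hom

/-- Over the points having a logarithm in the basic set of `v`, the section takes the value `R.res _
a` at such a logarithm. Two such logarithms of one point differ by a lattice vector of `Span σ`, up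
to what `τ^⊥` does not see, and that vector acts trivially on restrictions of `a`; so there is no
ambiguity. -/
theorem exists_local_section (σ : Δ.Cone) (v : ExpSpace N) (a : Γ σ) :
    ∃ (U : Opens (X Δ)) (_ : param σ v ∈ U) (s : ∀ x : U, R.Fibre x.1)
      (_ : s ∈ R.flatPredicate.sections U), ∀ (τ : Δ.Cone) (h : τ ≤ σ), ∀ᶠ w in near τ σ v,
        ∃ hw : param τ w ∈ U, (s ⟨param τ w, hw⟩).1 τ ⟨w, rfl⟩ = R.res h a := by
  classical
  let E : Finset (dualMonoid σ.1) := Finset.univ.image fun i =>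
    ⟨perpProj σ (dualVec i), (isPerp_perpProj σ (dualVec i)).mem_dualMonoid⟩
  -- Two logarithms each within `1/2` of `v` along `σ^⊥` differ there by less than `1`, as
  -- `mem_spanLattice_of_norm_lt` requires.
  have hε : (0 : ℝ) < 1 / 2 := by norm_num
  let U : Opens (X Δ) := ⟨{x | ∃ τ, ∃ (_ : τ ≤ σ), ∃ w ∈ nearSet τ σ v E (1 / 2), param τ w = x}, by
    rw [isOpen_iff_mem_nhds]
    rintro _ ⟨τ, hτ, w, hw, rfl⟩
    refine (eventually_nhds_param_iff (P := fun x => ∃ τ, ∃ (_ : τ ≤ σ),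
      ∃ w ∈ nearSet τ σ v E (1 / 2), param τ w = x)).2 fun ρ hρ => ?_
    filter_upwards [nearSet_mem_near_of_mem (ρ := ρ) hτ hw] with z hz
    exact ⟨ρ, hρ.trans hτ, z, hz, rfl⟩⟩
  choose τ hτ w hw hx using fun x : U => x.2
  choose s hs using fun x : U => R.exists_fibre (τ x) (w x) (hx x) (R.res (hτ x) a)
  have key : ∀ (ρ : Δ.Cone) (hρ : ρ ≤ σ) (z : ExpSpace N) (_ : z ∈ nearSet ρ σ v E (1 / 2))
      (hzU : param ρ z ∈ U), (s ⟨param ρ z, hzU⟩).1 ρ ⟨z, rfl⟩ = R.res hρ a := by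
    -- The logarithm picked by `choose` and the given `z` describe the same point; stating the claim
    -- for an arbitrary point `x` allows it to be identified with `param ρ z`.
    suffices H : ∀ (x : Variety Δ) (f : R.Fibre x) (ρ' : Δ.Cone) (z' : ExpSpace N)
        (h1 : param ρ' z' = x) (h4 : ρ' ≤ σ), z' ∈ nearSet ρ' σ v E (1 / 2) →
        f.1 ρ' ⟨z', h1⟩ = R.res h4 a → ∀ (ρ : Δ.Cone) (hρ : ρ ≤ σ) (z : ExpSpace N),
        z ∈ nearSet ρ σ v E (1 / 2) → ∀ hz : param ρ z = x, f.1 ρ ⟨z, hz⟩ = R.res hρ a from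
      fun ρ hρ z hz hzU => H _ (s ⟨param ρ z, hzU⟩) _ _ (hx _) (hτ _) (hw _) (hs _) ρ hρ z hz rfl
    rintro _ f ρ' z' h1 h4 h3 h2 ρ hρ z hz rfl
    obtain rfl := cone_eq_of_param_eq h1
    obtain ⟨n, hn⟩ := exists_lattice_of_param_eq h1
    have h6 : n ∈ spanLattice σ.1 := mem_spanLattice_of_norm_lt fun i => by
      have hi := isPerp_perpProj σ (dualVec i)
      have hiE : (⟨perpProj σ (dualVec i), hi.mem_dualMonoid⟩ : dualMonoid σ.1) ∈ E :=
        Finset.mem_image_of_mem _ (Finset.mem_univ i)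
      rw [← hn _ (hi.mono hρ), map_sub, ← sub_sub_sub_cancel_right _ _ (dot _ v)]
      refine (norm_sub_le _ _).trans_lt ?_
      have h7 := (hz _ hiE).1 hi
      have h8 := (h3 _ hiE).1 hi
      linarith
    rw [f.2 ρ' z z' rfl h1 n hn, h2, ← R.res_op, R.op_span σ n h6, Module.End.one_apply]
  refine ⟨U, ⟨σ, le_rfl, v, fun m _ => ⟨fun _ => by simp, fun h h' => (h h').elim⟩, rfl⟩,
    s, ?_, fun ρ hρ => ?_⟩
  · intro κ z hzU ρ hρ
    obtain ⟨κ', hκ', z', hz', hzz⟩ := hzU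
    obtain rfl := cone_eq_of_param_eq hzz
    obtain ⟨n, hn⟩ := exists_lattice_of_param_eq hzz
    -- The logarithm `z` is arbitrary and need not lie in the basic set. Its translate by `n` agrees
    -- along `κ'^⊥` with `z'`, which does lie there, so logarithms near `z` can be compared with
    -- `key` after the same translation.
    have h1 : nearSet ρ σ v E (1 / 2) ∈ near ρ κ' (z + latticeVec n) :=
      near_eq_of_perp (fun m hm => by
        rw [map_add, dot_latticeVec, ← hn m hm, map_sub, add_sub_cancel])
        (nearSet_mem_near_of_mem (ρ := ρ) hκ' hz')
    filter_upwards [tendsto_add_latticeVec_near ρ κ' z n h1] with y hy hyU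
    have hyU' : param ρ (y + latticeVec n) ∈ U := ⟨ρ, hρ.trans hκ', _, hy, rfl⟩
    have h2 := key ρ (hρ.trans hκ') _ hy hyU'
    have h3 := key κ' hκ' z' hz' ⟨κ', hκ', z', hz', rfl⟩
    have h4 : (s ⟨param ρ y, hyU⟩).1 ρ ⟨y + latticeVec n, param_add_latticeVec ρ y n⟩ =
        R.res (hρ.trans hκ') a := by
      refine Eq.trans ?_ h2
      have : ∀ (x x' : Variety Δ) (hx : x ∈ U) (hx' : x' ∈ U) (e : x = x') (u : ExpSpace N)
          (hu : param ρ u = x) (hu' : param ρ u = x'),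
          (s ⟨x, hx⟩).1 ρ ⟨u, hu⟩ = (s ⟨x', hx'⟩).1 ρ ⟨u, hu'⟩ := by
        rintro x _ hx hx' rfl u hu hu'
        rfl
      exact this _ _ _ _ (param_add_latticeVec ρ y n).symm _ _ _
    have h5 : (s ⟨param κ' z, ⟨κ', hκ', z', hz', hzz⟩⟩).1 κ' ⟨z', hzz⟩ = R.res hκ' a := by
      refine Eq.trans ?_ h3
      have : ∀ (x x' : Variety Δ) (hx : x ∈ U) (hx' : x' ∈ U) (e : x = x') (u : ExpSpace N)
          (hu : param κ' u = x) (hu' : param κ' u = x'),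
          (s ⟨x, hx⟩).1 κ' ⟨u, hu⟩ = (s ⟨x', hx'⟩).1 κ' ⟨u, hu'⟩ := by
        rintro x _ hx hx' rfl u hu hu'
        rfl
      exact this _ _ _ _ hzz.symm _ _ _
    rw [(s ⟨param ρ y, hyU⟩).2 ρ y (y + latticeVec n) rfl (param_add_latticeVec ρ y n) n
      (fun m _ => by rw [add_sub_cancel_left, dot_latticeVec]), h4,
      (s ⟨param κ' z, ⟨κ', hκ', z', hz', hzz⟩⟩).2 κ' z z' rfl hzz n hn, h5, R.res_op,
      R.res_res]
  · filter_upwards [nearSet_mem_near ρ σ v E hε] with z hz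
    exact ⟨⟨ρ, hρ, z, hz, rfl⟩, key ρ hρ z hz _⟩

/-- The value at `(σ, v)` of a germ. -/
def value (σ : Δ.Cone) (v : ExpSpace N) : stalk R.sheaf (param σ v : X Δ) →ₗ[ℂ] Γ σ where
  toFun u := (R.flatPredicate.stalkEval (param σ v : X Δ) u).1 σ ⟨v, rfl⟩
  map_add' u u' := by rw [map_add]; rfl
  map_smul' c u := by rw [map_smul]; rfl

theorem value_bijective (σ : Δ.Cone) (v : ExpSpace N) : Function.Bijective (R.value σ v) := by
  refine ⟨fun u u' h => R.stalkEval_injective _ (Fibre.ext rfl h), fun a => ?_⟩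
  obtain ⟨U, hU, s, hs, h⟩ := R.exists_local_section σ v a
  -- A condition holding eventually along `near σ σ v` holds at `v` itself, since that filter is
  -- coarser than the principal one.
  obtain ⟨h1, h2⟩ := eventually_pure.1 ((h σ le_rfl).filter_mono ((pure_le_nhds v).trans
    (nhds_le_near σ v)))
  rw [R.res_refl] at h2
  refine ⟨germAt R.sheaf (R.flatPredicate.ofFamily s hs) _ hU, ?_⟩
  exact (congrArg (fun f : R.Fibre (param σ v) => f.1 σ ⟨v, rfl⟩)
    (R.flatPredicate.stalkEval_germ s hs (param σ v : X Δ) hU)).trans h2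

/-- The flat structure of the sheaf. -/
def flatData : FlatData R.sheaf Γ where
  ev σ v := (LinearEquiv.ofBijective (R.value σ v) (R.value_bijective σ v)).symm
  res := R.res
  tendsto {τ σ} h v a := by
    obtain ⟨U, hU, s, hs, hsa⟩ := R.exists_local_section σ v a
    have hval : ∀ (τ : Δ.Cone) (w : ExpSpace N) (hw : param τ w ∈ U) (b : Γ τ),
        (s ⟨param τ w, hw⟩).1 τ ⟨w, rfl⟩ = b →
        (LinearEquiv.ofBijective (R.value τ w) (R.value_bijective τ w)).symm b =
          germAt R.sheaf (R.flatPredicate.ofFamily s hs) (param τ w : X Δ) hw := by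
      intro τ w hw b hb
      rw [LinearEquiv.symm_apply_eq]
      exact (((congrArg (fun f : R.Fibre (param τ w) => f.1 τ ⟨w, rfl⟩)
        (R.flatPredicate.stalkEval_germ s hs (param τ w : X Δ) hw))).trans hb).symm
    obtain ⟨h1, h2⟩ := eventually_pure.1 ((hsa σ le_rfl).filter_mono ((pure_le_nhds v).trans
      (nhds_le_near σ v)))
    rw [R.res_refl] at h2
    rw [hval σ v hU a h2, tendsto_etale_iff]
    refine ⟨tendsto_param_near h v, ?_⟩
    filter_upwards [hsa τ h] with w ⟨hw, hw'⟩
    exact ⟨hw, hval τ w hw _ hw'⟩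

/-- The flat continuation of a germ to `v + n` and its value at `v` are two entries of one
equivariant family in the fibre, related by `R.op σ n`. -/
theorem monodromy_flatData (σ : Δ.Cone) (n : N) : R.flatData.monodromy σ n = R.op σ n :=
  LinearMap.ext fun a => by
    have h1 := R.flatData.val_add_latticeVec σ n 0 a
    have h2 : ∀ (x : X Δ) (u : stalk R.sheaf x) (v : ExpSpace N) (hx : param σ v = x) (b : Γ σ),
        (⟨x, u⟩ : Etale R.sheaf) = R.flatData.val σ v b →
        (R.flatPredicate.stalkEval x u).1 σ ⟨v, hx⟩ = b := by
      rintro _ u v rfl b hb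
      rw [etale_mk_inj hb]
      exact (LinearEquiv.ofBijective (R.value σ v) (R.value_bijective σ v)).apply_symm_apply b
    have h3 := h2 (param σ 0) (R.flatData.ev σ 0 (R.flatData.monodromy σ n a)) 0 rfl _ rfl
    have h4 := h2 (param σ 0) (R.flatData.ev σ 0 (R.flatData.monodromy σ n a)) (0 + latticeVec n)
      (param_add_latticeVec σ 0 n) a h1.symm
    refine h3.symm.trans (Eq.trans (Subtype.property (R.flatPredicate.stalkEval _ _) σ 0
      (0 + latticeVec n) rfl (param_add_latticeVec σ 0 n) n
      fun m _ => by rw [add_sub_cancel_left, dot_latticeVec]) (congrArg (R.op σ n) h4))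

end MonodromyData

/-! ### Every co-module supported at the origin comes from a sheaf -/

/-- The exponentials of the action of `N`. -/
def expMonodromy (M : CoTMod Δ) (hM : isSupportedAtOrigin Δ M) : MonodromyData M.obj where
  op σ n := opExp ((2 * Real.pi * Complex.I : ℂ) • TRing.act (M.obj σ) (TRing.of σ.1 n))
    ((supported_iff.1 (hM σ) n).smul _)
  op_add σ n n' := by
    have h1 := (supported_iff.1 (hM σ) n).smul (2 * Real.pi * Complex.I : ℂ)
    have h2 := (supported_iff.1 (hM σ) n').smul (2 * Real.pi * Complex.I : ℂ)
    have hc : Commute (TRing.act (M.obj σ) (TRing.of σ.1 n)) (TRing.act (M.obj σ) (TRing.of σ.1 n')) :=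
      LinearMap.ext fun m => smul_comm _ _ m
    have hc' := (hc.smul_left (2 * Real.pi * Complex.I : ℂ)).smul_right (2 * Real.pi * Complex.I : ℂ)
    rw [← opExp_add h1 h2 hc' (h1.add h2 hc')]
    congr 1
    rw [← smul_add]
    congr 1
    exact LinearMap.ext fun m => by
      rw [LinearMap.add_apply, TRing.act_apply, TRing.act_apply, TRing.act_apply, TRing.of_add,
        add_smul]
  op_span σ n hn := LinearMap.ext fun m => by
    rw [opExp_apply _ (K := 1) (by
      rw [pow_one, LinearMap.smul_apply, TRing.act_apply, TRing.of_eq_zero hn, zero_smul,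
        smul_zero])]
    simp
  res := M.map
  res_op {τ σ} h n a := psEval_intertwine _ _ (M.map h) (fun b => by
    rw [LinearMap.smul_apply, LinearMap.smul_apply, map_smul, TRing.act_apply, TRing.act_apply,
      ← TRing.map_of h, M.map_smul]) _ a
  res_refl := M.map_refl
  res_res := M.map_trans

/-- Exponentiate the action of `2πi n`, form the sheaf with this monodromy, and recover the action
from `opLog_opExp`. -/
theorem exists_logFunctor_iso (M : CoTMod Δ) (hM : isSupportedAtOrigin Δ M) :
    ∃ F : LCu Δ, Nonempty ((logFunctor Δ).obj F ≅ M) := by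
  let R := expMonodromy M hM
  have hD : R.flatData.IsUnipotent := fun σ n => by
    rw [R.monodromy_flatData]
    exact isLocallyNilpotent_opExp_sub_one _ _
  refine ⟨⟨R.sheaf, R.flatData.isLCu hD⟩, ?_⟩
  obtain ⟨e⟩ := R.flatData.exists_iso hD
  refine ⟨e ≪≫ CoTMod.isoOfOps (fun σ => LinearEquiv.refl ℂ (M.obj σ)) (fun σ n m => ?_)
    fun _ _ => rfl⟩
  refine (R.flatData.coTMod_smul hD σ n m).trans ?_
  rw [FlatData.logAction_apply]
  simp only [R.monodromy_flatData]
  refine (congrArg (fun g : Module.End ℂ (M.obj σ) => ((2 * Real.pi * Complex.I : ℂ)⁻¹ • g) m)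
    (opLog_opExp _ ((supported_iff.1 (hM σ) n).smul (2 * Real.pi * Complex.I : ℂ)) (isLocallyNilpotent_opExp_sub_one _ _))).trans ?_
  refine Eq.trans (congrArg (fun g : Module.End ℂ (M.obj σ) => g m) (smul_smul _ _ _)) ?_
  rw [inv_mul_cancel₀ Complex.two_pi_I_ne_zero, one_smul]
  rfl

end Construction

end ToricLC

end

noncomputable section

namespace ToricLC

/-! ### The equivalences for unipotent and co-finite sheaves -/

section Equivalences

variable {N : Type} [AddCommGroup N] [Module.Free ℤ N] [Module.Finite ℤ N] (Δ : Fan N)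

/-- `logFunctor` takes logarithms of monodromy. -/
def logMonodromy {C : Type u} [Category.{v} C] (L : C ⥤ LCu Δ) :
    LogMonodromy (L ⋙ (isLCu Δ).ι) (L ⋙ logFunctor Δ) where
  iso A σ := LinearEquiv.refl ℂ (ptStalk (L.obj A).obj σ)
  naturality _ _ _ := rfl
  log A σ n μ hμ m := by
    have h1 := ((flatOf (L.obj A).property.1).isMonodromy_orbitLoop_iff
      (flatOf_val (L.obj A).property.1)).1 hμ
    refine (logFunctor_smul (L.obj A) σ n m).trans ?_
    rw [FlatData.logAction_apply, h1]
    exact congrArg ((2 * Real.pi * Complex.I : ℂ)⁻¹ • ·)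
      (unipotentLog_eq _ (flatOf_isUnipotent (L.obj A).property σ n) m).symm
  cospecialization A τ σ h γ hγ m :=
    (flatOf (L.obj A).property.1).transports_exitPath (flatOf_val (L.obj A).property.1) h γ hγ m

/-- The functor `LC_u(X) ⥤ co-𝓣-Mod_n`. -/
abbrev logFunctorN : LCu Δ ⥤ CoTModN Δ :=
  (isSupportedAtOrigin Δ).lift (logFunctor Δ) isSupportedAtOrigin_logFunctor

/-- The functor `LC_cf(X) ⥤ co-𝓣-Mod_cf`. -/
abbrev logFunctorCf : LCcf Δ ⥤ CoTModCf Δ :=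
  (isCofinite Δ).lift (LCcfToLCu Δ ⋙ logFunctor Δ) fun F =>
    (isLCcf_iff ((LCcfToLCu Δ).obj F)).1 F.property

instance : (logFunctorN Δ).EssSurj where
  mem_essImage M := by
    obtain ⟨F, ⟨e⟩⟩ := exists_logFunctor_iso M.obj M.property
    exact ⟨F, ⟨(isSupportedAtOrigin Δ).isoMk e⟩⟩

theorem isCofinite_of_iso {P Q : CoTMod Δ} (e : P ≅ Q) (h : isCofinite Δ P) : isCofinite Δ Q := by
  have h1 : ∀ (σ : Δ.Cone) (m : Q.obj σ),
      CoTMod.Hom.app e.hom σ (CoTMod.Hom.app e.inv σ m) = m := fun σ m =>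
    LinearMap.congr_fun (congrArg (fun f => CoTMod.Hom.app f σ) e.inv_hom_id) m
  have h2 : ∀ σ, Function.Injective (CoTMod.Hom.app e.inv σ) := fun σ =>
    Function.LeftInverse.injective (h1 σ)
  refine ⟨fun σ m => ?_, fun σ => ?_⟩
  · obtain ⟨k, hk⟩ := h.1 σ (CoTMod.Hom.app e.inv σ m)
    refine ⟨k, fun a ha => h2 σ ?_⟩
    rw [_root_.map_smul, hk a ha, map_zero]
  · have := h.2 σ
    exact FiniteDimensional.of_injective
      (((CoTMod.Hom.app e.inv σ).restrictScalars ℂ).restrict (p := Q.socle σ) (q := P.socle σ)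
        fun m hm a ha => by
          rw [LinearMap.coe_restrictScalars, ← _root_.map_smul, hm a ha, map_zero])
      fun x y hxy => Subtype.ext (h2 σ (congrArg Subtype.val hxy))

instance : (logFunctorCf Δ).EssSurj where
  mem_essImage M := by
    obtain ⟨F, ⟨e⟩⟩ := exists_logFunctor_iso M.obj M.property.1
    exact ⟨⟨F.obj, (isLCcf_iff F).2 (isCofinite_of_iso Δ e.symm M.property)⟩,
      ⟨(isCofinite Δ).isoMk e⟩⟩

instance : (logFunctorN Δ).IsEquivalence where
instance : (logFunctorCf Δ).IsEquivalence where

end Equivalences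

end ToricLC

end

noncomputable section

namespace ToricLC

/-! ### Artinian modules from locally nilpotent elements -/

section Artinian

variable {R : Type*} [CommRing R]

/-- The elements of the form `f ^ k • y`, `y ∈ P`, killed by `f`. -/
def divisibleTorsion {M : Type*} [AddCommGroup M] [Module R M] (f : R) (k : ℕ)
    (P : Submodule R M) : Submodule R (Submodule.torsionBy R M f) :=
  (P.map (f ^ k • LinearMap.id)).comap (Submodule.subtype _)

theorem mem_divisibleTorsion {M : Type*} [AddCommGroup M] [Module R M] {f : R} {k : ℕ}
    {P : Submodule R M} {x : Submodule.torsionBy R M f} :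
    x ∈ divisibleTorsion f k P ↔ ∃ y ∈ P, f ^ k • y = x.1 := by
  simp [divisibleTorsion, Submodule.mem_map]

theorem divisibleTorsion_mono {M : Type*} [AddCommGroup M] [Module R M] {f : R} {k l : ℕ}
    {P Q : Submodule R M} (hPQ : P ≤ Q) (hkl : k ≤ l) :
    divisibleTorsion f l P ≤ divisibleTorsion f k Q := fun x hx => by
  obtain ⟨y, hy, hyx⟩ := mem_divisibleTorsion.1 hx
  refine mem_divisibleTorsion.2 ⟨f ^ (l - k) • y, hPQ (P.smul_mem _ hy), ?_⟩
  rw [smul_smul, ← pow_add, Nat.add_sub_cancel' hkl, hyx]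

/-- Induction on the power of `f` killing `x ∈ Q`: when `f ^ (k + 1)` kills it, `f ^ k • x` is also
`f ^ k • y` for some `y ∈ P`, and `x - y` is killed by a smaller power. -/
theorem le_of_divisibleTorsion_le {M : Type*} [AddCommGroup M] [Module R M] {f : R}
    (hf : ∀ m : M, ∃ k : ℕ, f ^ k • m = 0) {P Q : Submodule R M} (hPQ : P ≤ Q)
    (h : ∀ k, divisibleTorsion f k Q ≤ divisibleTorsion f k P) : Q ≤ P := by
  have key : ∀ (k : ℕ) (x : M), x ∈ Q → f ^ k • x = 0 → x ∈ P := fun k => by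
    induction k with
    | zero => intro x _ hx; rw [pow_zero, one_smul] at hx; rw [hx]; exact P.zero_mem
    | succ k ih =>
      intro x hxQ hx
      have h1 : f ^ k • x ∈ Submodule.torsionBy R M f := by
        rw [Submodule.mem_torsionBy_iff, smul_smul, ← pow_succ', hx]
      obtain ⟨y, hy, hyx⟩ := mem_divisibleTorsion.1
        (h k (mem_divisibleTorsion.2 ⟨x, hxQ, rfl⟩ : (⟨_, h1⟩ : Submodule.torsionBy R M f) ∈ _))
      have h2 := ih (x - y) (Q.sub_mem hxQ (hPQ hy)) (by rw [smul_sub, hyx, sub_self])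
      exact sub_add_cancel x y ▸ P.add_mem h2 hy
  intro x hx
  obtain ⟨k, hk⟩ := hf x
  exact key k x hx hk

/-- A module is artinian if multiplication by `f` is locally nilpotent on it and its kernel is
artinian. -/
theorem isArtinian_of_torsionBy {M : Type*} [AddCommGroup M] [Module R M] {f : R}
    (hf : ∀ m : M, ∃ k : ℕ, f ^ k • m = 0) [IsArtinian R (Submodule.torsionBy R M f)] :
    IsArtinian R M := by
  rw [← monotone_stabilizes_iff_artinian]
  intro P'
  let P : ℕ → Submodule R M := fun i => OrderDual.ofDual (P' i)
  have hP : ∀ {i j : ℕ}, i ≤ j → P j ≤ P i := fun h => P'.monotone h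
  have h1 : ∀ k, ∃ n, ∀ i, n ≤ i →
      divisibleTorsion f k (P i) = divisibleTorsion f k (P n) := fun k => by
    obtain ⟨n, hn⟩ := IsArtinian.monotone_stabilizes
      (⟨fun i => OrderDual.toDual (divisibleTorsion f k (P i)),
        fun i j h => divisibleTorsion_mono (hP h) le_rfl⟩ :
        ℕ →o (Submodule R (Submodule.torsionBy R M f))ᵒᵈ)
    exact ⟨n, fun i hi => (hn i hi).symm⟩
  -- For each `k` the chain of `divisibleTorsion f k (P i)` stabilizes, but at a step depending on
  -- `k`. The diagonal chain controls all `k ≥ d` at once, leaving only the finitely many `k < d`.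
  obtain ⟨d, hd⟩ := IsArtinian.monotone_stabilizes
      (⟨fun i => OrderDual.toDual (divisibleTorsion f i (P i)),
        fun i j h => divisibleTorsion_mono (hP h) h⟩ :
        ℕ →o (Submodule R (Submodule.torsionBy R M f))ᵒᵈ)
  have hd' : ∀ i, d ≤ i → divisibleTorsion f i (P i) =
    divisibleTorsion f d (P d) := fun i hi => (hd i hi).symm
  choose n hn using h1
  let b := max d ((Finset.range d).sup n)
  refine ⟨b, fun i hi => (le_antisymm ?_ (hP hi) : P b = P i)⟩
  refine le_of_divisibleTorsion_le hf (hP hi) fun k => ?_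
  rcases lt_or_ge k d with hk | hk
  · have h2 : n k ≤ b := (Finset.le_sup (f := n) (Finset.mem_range.2 hk)).trans (le_max_right _ _)
    rw [hn k b h2, hn k i (h2.trans hi)]
  · have hb : d ≤ b := le_max_left _ _
    refine (divisibleTorsion_mono (hP hb) hk).trans ?_
    have h3 := hd' (max i k) (hk.trans (le_max_right _ _))
    rw [← h3]
    exact divisibleTorsion_mono (hP (le_max_left _ _)) (le_max_right _ _)

/-- Apply `isArtinian_of_torsionBy` to one element at a time, passing to its kernel; what is left at
the end is the common kernel. -/
theorem isArtinian_of_torsionBySet {M : Type*} [AddCommGroup M] [Module R M] (l : List R)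
    (hl : ∀ f ∈ l, ∀ m : M, ∃ k : ℕ, f ^ k • m = 0)
    (h : IsArtinian R (Submodule.torsionBySet R M {f | f ∈ l})) : IsArtinian R M := by
  induction l generalizing M with
  | nil =>
    refine isArtinian_of_injective (P := Submodule.torsionBySet R M {f | f ∈ ([] : List R)})
      (LinearMap.codRestrict _ LinearMap.id fun m => ?_) fun x y hxy => Subtype.ext_iff.1 hxy
    rw [Submodule.mem_torsionBySet_iff]
    rintro ⟨f, hf⟩
    simp at hf
  | cons f l ih =>
    have : IsArtinian R (Submodule.torsionBy R M f) := by
      refine ih (fun g hg m => ?_) ?_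
      · obtain ⟨k, hk⟩ := hl g (List.mem_cons_of_mem _ hg) m.1
        exact ⟨k, Subtype.ext hk⟩
      · refine isArtinian_of_injective
          (P := Submodule.torsionBySet R M {g | g ∈ (f :: l)})
          (LinearMap.codRestrict _ ((Submodule.subtype _).comp (Submodule.subtype _))
            fun m => ?_) fun x y hxy => by
              have := congrArg Subtype.val hxy
              exact Subtype.ext (Subtype.ext this)
        rw [Submodule.mem_torsionBySet_iff]
        rintro ⟨g, hg⟩
        rcases List.mem_cons.1 hg with rfl | hg
        · exact (Submodule.mem_torsionBy_iff _ _).1 m.1.2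
        · exact congrArg Subtype.val ((Submodule.mem_torsionBySet_iff _ _).1 m.2 ⟨g, hg⟩)
    exact isArtinian_of_torsionBy (hl f List.mem_cons_self)

end Artinian

/-! ### Co-finiteness as the descending chain condition -/

section Cofinite

variable {N : Type} [AddCommGroup N] {σ : PointedCone ℝ (ℝ ⊗[ℤ] N)}
  {V : Type*} [AddCommGroup V] [Module ℂ V] [Module (TRing σ) V] [IsScalarTower ℂ (TRing σ) V]

/-- A basis of `N` gives generators of `𝔪_σ` that act locally nilpotently. Their common kernel lies
in `S`, and a finite-dimensional space is artinian over any algebra acting on it. -/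
theorem isArtinian_of_finiteDimensional_socle [Module.Free ℤ N] [Module.Finite ℤ N]
    (h : ∀ m : V, ∃ k : ℕ, ∀ a ∈ TRing.maxIdeal σ ^ k, a • m = 0) (S : Submodule ℂ V)
    (hS : ∀ m, m ∈ S ↔ ∀ a ∈ TRing.maxIdeal σ, a • m = 0) [FiniteDimensional ℂ S] :
    IsArtinian (TRing σ) V := by
  let b := Module.Free.chooseBasis ℤ N
  let l : List (TRing σ) := (Finset.univ.toList).map fun i => TRing.of σ (b i)
  refine isArtinian_of_torsionBySet l (fun f hf m => ?_) ?_
  · obtain ⟨i, -, rfl⟩ := List.mem_map.1 hf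
    obtain ⟨k, hk⟩ := h m
    exact ⟨k, hk _ (Ideal.pow_mem_pow (TRing.of_mem_maxIdeal _) k)⟩
  · have h1 : ∀ m ∈ Submodule.torsionBySet (TRing σ) V {f | f ∈ l}, m ∈ S := fun m hm => by
      rw [hS]
      have h2 : TRing.maxIdeal σ ≤ Ideal.torsionOf (TRing σ) V m := by
        rw [TRing.maxIdeal_eq_span_basis b, Ideal.span_le]
        rintro _ ⟨i, rfl⟩
        exact (Submodule.mem_torsionBySet_iff _ _).1 hm
          ⟨_, List.mem_map.2 ⟨i, Finset.mem_toList.2 (Finset.mem_univ i), rfl⟩⟩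
      exact fun a ha => h2 ha
    refine isArtinian_of_tower ℂ ?_
    exact isArtinian_of_injective (P := S)
      (LinearMap.codRestrict S
        ((Submodule.subtype (Submodule.torsionBySet (TRing σ) V {f | f ∈ l})).restrictScalars ℂ)
        fun m => h1 m.1 m.2) fun x y hxy => by
          have := congrArg Subtype.val hxy
          exact Subtype.ext this

/-- On `S` the ring acts through scalars, so subspaces of `S` are submodules of `V` and satisfy the
descending chain condition. -/
theorem finiteDimensional_socle_of_isArtinian [IsArtinian (TRing σ) V] (S : Submodule ℂ V)
    (hS : ∀ m, m ∈ S ↔ ∀ a ∈ TRing.maxIdeal σ, a • m = 0) : FiniteDimensional ℂ S := by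
  have h1 : ∀ (W : Submodule ℂ V), W ≤ S → ∀ (a : TRing σ) m, m ∈ W → a • m ∈ W := by
    intro W hW a
    induction a using TRing.induction_of with
    | scalar c => intro m hm; rw [algebraMap_smul]; exact W.smul_mem c hm
    | of n =>
      intro m hm
      rw [(hS m).1 (hW hm) _ (TRing.of_mem_maxIdeal n)]
      exact W.zero_mem
    | add a b ha hb => intro m hm; rw [add_smul]; exact W.add_mem (ha m hm) (hb m hm)
    | mul a b ha hb => intro m hm; rw [mul_smul]; exact ha _ (hb m hm)
  let e : Submodule ℂ S → Submodule (TRing σ) V := fun W =>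
    { carrier := W.map S.subtype
      add_mem' := fun h h' => Submodule.add_mem _ h h'
      zero_mem' := Submodule.zero_mem _
      smul_mem' := fun a m hm => h1 _ (Submodule.map_subtype_le S W) a m hm }
  have he : StrictMono e := fun W W' h =>
    (Submodule.map_strictMono_of_injective S.injective_subtype h :
      W.map S.subtype < W'.map S.subtype)
  have : IsArtinian ℂ S := ⟨Subrelation.wf (fun {A B} hAB => he hAB)
    (InvImage.wf e (IsWellFounded.wf (r := (· < ·))))⟩
  exact (IsSemisimpleModule.finite_tfae.out 2 0).1 this

end Cofinite

section CoTModArtinian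

variable {N : Type} [AddCommGroup N] [Module.Free ℤ N] [Module.Finite ℤ N] {Δ : Fan N}

/-- The socle of a quotient is not controlled directly by that of the module, whereas artinian
modules are visibly stable under quotients. This is what makes the co-finite categories abelian. -/
theorem isCofinite_iff {P : CoTMod Δ} : isCofinite Δ P ↔
    isSupportedAtOrigin Δ P ∧ ∀ σ : Δ.Cone, IsArtinian (TRing σ.1) (P.obj σ) :=
  ⟨fun h => ⟨h.1, fun σ =>
    have := h.2 σ
    isArtinian_of_finiteDimensional_socle (h.1 σ) (P.socle σ) fun _ => Iff.rfl⟩,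
  fun h => ⟨h.1, fun σ =>
    have := h.2 σ
    finiteDimensional_socle_of_isArtinian (P.socle σ) fun _ => Iff.rfl⟩⟩

end CoTModArtinian

end ToricLC

end

noncomputable section

namespace ToricLC

/-! ### A criterion for abelian categories -/

section Criterion

variable {C : Type u} [Category.{v} C] [Preadditive C] {I : Type}

/-- A family of functors to vector spaces through which a preadditive category has concretely
given kernels, cokernels and direct sums. -/
structure IsConcretelyAbelian (V : I → C ⥤ ModuleCat.{0} ℂ) : Prop where
  additive : ∀ i, (V i).Additive
  isIso : ∀ {A B : C} (f : A ⟶ B), (∀ i, Function.Bijective ((V i).map f)) → IsIso f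
  faithful : ∀ {A B : C} {f g : A ⟶ B}, (∀ i x, (V i).map f x = (V i).map g x) → f = g
  zero : ∃ Z : C, IsZero Z
  prod : ∀ A B : C, ∃ b : BinaryBicone A B, b.fst ≫ b.inl + b.snd ≫ b.inr = 𝟙 b.pt
  ker : ∀ {A B : C} (f : A ⟶ B), ∃ (K : C) (k : K ⟶ A), k ≫ f = 0 ∧
    (∀ i, Function.Injective ((V i).map k)) ∧
    (∀ i x, (V i).map f x = 0 → ∃ y, (V i).map k y = x) ∧
    ∀ {T : C} (g : T ⟶ A), g ≫ f = 0 → ∃ l : T ⟶ K, l ≫ k = g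
  coker : ∀ {A B : C} (f : A ⟶ B), ∃ (Q : C) (q : B ⟶ Q), f ≫ q = 0 ∧
    (∀ i, Function.Surjective ((V i).map q)) ∧
    (∀ i x, (V i).map q x = 0 → ∃ y, (V i).map f y = x) ∧
    ∀ {T : C} (g : B ⟶ T), f ≫ g = 0 → ∃ l : Q ⟶ T, q ≫ l = g

namespace IsConcretelyAbelian

variable {V : I → C ⥤ ModuleCat.{0} ℂ}

theorem exists_isLimit (h : IsConcretelyAbelian V) {A B : C} (f : A ⟶ B) :
    ∃ c : KernelFork f, Nonempty (IsLimit c) ∧ ∀ i, Nonempty (IsLimit ((V i).mapCone c)) := by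
  have := h.additive
  obtain ⟨K, k, hk, hinj, hex, hl⟩ := h.ker f
  choose l hl using fun (T : C) (g : T ⟶ A) (hg : g ≫ f = 0) => hl g hg
  refine ⟨KernelFork.ofι k hk, ⟨KernelFork.IsLimit.ofι k hk (fun g hg => l _ g hg)
    (fun g hg => hl _ g hg) fun g hg m hm => h.faithful fun i x => hinj i ?_⟩, fun i => ?_⟩
  · have := congrArg (fun q => (V i).map q x) (hm.trans (hl _ g hg).symm)
    simpa using this
  · let S : ShortComplex (ModuleCat.{0} ℂ) := ⟨(V i).map k, (V i).map f, by
      rw [← Functor.map_comp, hk, Functor.map_zero]⟩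
    have h1 : S.Exact := S.moduleCat_exact_iff.2 (hex i)
    have h2 : Mono S.f := (ModuleCat.mono_iff_injective _).2 (hinj i)
    exact ⟨(isLimitMapConeForkEquiv' (V i) hk).symm h1.fIsKernel⟩

theorem exists_isColimit (h : IsConcretelyAbelian V) {A B : C} (f : A ⟶ B) :
    ∃ c : CokernelCofork f, Nonempty (IsColimit c) ∧
      ∀ i, Nonempty (IsColimit ((V i).mapCocone c)) := by
  have := h.additive
  obtain ⟨K, k, hk, hsurj, hex, hl⟩ := h.coker f
  choose l hl using fun (T : C) (g : B ⟶ T) (hg : f ≫ g = 0) => hl g hg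
  refine ⟨CokernelCofork.ofπ k hk, ⟨CokernelCofork.IsColimit.ofπ k hk (fun g hg => l _ g hg)
    (fun g hg => hl _ g hg) fun g hg m hm => h.faithful fun i x => ?_⟩, fun i => ?_⟩
  · obtain ⟨y, rfl⟩ := hsurj i x
    have := congrArg (fun q => (V i).map q y) (hm.trans (hl _ g hg).symm)
    simpa using this
  · let S : ShortComplex (ModuleCat.{0} ℂ) := ⟨(V i).map f, (V i).map k, by
      rw [← Functor.map_comp, hk, Functor.map_zero]⟩
    have h1 : S.Exact := S.moduleCat_exact_iff.2 (hex i)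
    have h2 : Epi S.g := (ModuleCat.epi_iff_surjective _).2 (hsurj i)
    exact ⟨(isColimitMapCoconeCoforkEquiv' (V i) hk).symm h1.gIsCokernel⟩

theorem hasKernels (h : IsConcretelyAbelian V) : HasKernels C where
  has_limit f := by
    obtain ⟨c, ⟨hc⟩, -⟩ := h.exists_isLimit f
    exact ⟨⟨⟨c, hc⟩⟩⟩

theorem hasCokernels (h : IsConcretelyAbelian V) : HasCokernels C where
  has_colimit f := by
    obtain ⟨c, ⟨hc⟩, -⟩ := h.exists_isColimit f
    exact ⟨⟨⟨c, hc⟩⟩⟩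

theorem preservesKernel (h : IsConcretelyAbelian V) (i : I) {A B : C} (f : A ⟶ B) :
    PreservesLimit (parallelPair f 0) (V i) := by
  obtain ⟨c, ⟨hc⟩, hc'⟩ := h.exists_isLimit f
  exact preservesLimit_of_preserves_limit_cone hc (hc' i).some

theorem preservesCokernel (h : IsConcretelyAbelian V) (i : I) {A B : C} (f : A ⟶ B) :
    PreservesColimit (parallelPair f 0) (V i) := by
  obtain ⟨c, ⟨hc⟩, hc'⟩ := h.exists_isColimit f
  exact preservesColimit_of_preserves_colimit_cocone hc (hc' i).some

theorem hasFiniteProducts (h : IsConcretelyAbelian V) : HasFiniteProducts C := by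
  have h1 : HasBinaryBiproducts C := ⟨fun A B => by
    obtain ⟨b, hb⟩ := h.prod A B
    exact hasBinaryBiproduct_of_total b hb⟩
  have h2 : HasTerminal C := by
    obtain ⟨Z, hZ⟩ := h.zero
    exact hZ.isTerminal.hasTerminal
  exact hasFiniteProducts_of_has_binary_and_terminal

/-- The functors preserve the kernels and cokernels involved, so they send the comparison map to the
one for vector spaces, which is invertible; jointly they detect isomorphisms. -/
theorem isIso_coimageImageComparison (h : IsConcretelyAbelian V) {A B : C} (f : A ⟶ B) :
    letI := h.hasKernels
    letI := h.hasCokernels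
    IsIso (Abelian.coimageImageComparison f) := by
  have := h.hasKernels
  have := h.hasCokernels
  have := h.additive
  refine h.isIso _ fun i => ?_
  have := h.preservesKernel i f
  have := h.preservesCokernel i f
  have := h.preservesKernel i (cokernel.π f)
  have := h.preservesCokernel i (kernel.ι f)
  have h1 : IsIso ((V i).map (Abelian.coimageImageComparison f)) := by
    have h2 := (Arrow.isIso_iff_isIso_of_isIso
      (Abelian.PreservesCoimageImageComparison.iso (V i) f).hom).2
    exact h2 inferInstance
  exact (ConcreteCategory.isIso_iff_bijective _).1 h1

/-- The abelian structure. -/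
@[reducible] def abelian (h : IsConcretelyAbelian V) : Abelian C :=
  letI := h.hasKernels
  letI := h.hasCokernels
  letI := h.hasFiniteProducts
  letI : ∀ {A B : C} (f : A ⟶ B), IsIso (Abelian.coimageImageComparison f) :=
    fun f => h.isIso_coimageImageComparison f
  Abelian.ofCoimageImageComparisonIsIso

theorem isAbelianCat (h : IsConcretelyAbelian V) : IsAbelianCat C where
  normalMono := h.abelian.toIsNormalMonoCategory
  normalEpi := h.abelian.toIsNormalEpiCategory
  finiteProducts := h.hasFiniteProducts
  kernels := h.hasKernels
  cokernels := h.hasCokernels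

theorem isExactFunctor (h : IsConcretelyAbelian V) (i : I) : IsExactFunctor (V i) := by
  let := h.abelian
  have := h.additive i
  have h1 := fun {A B : C} (f : A ⟶ B) => h.preservesKernel i f
  have h2 := fun {A B : C} (f : A ⟶ B) => h.preservesCokernel i f
  exact ⟨(V i).preservesFiniteLimits_of_preservesKernels,
    (V i).preservesFiniteColimits_of_preservesCokernels⟩

theorem jointlyReflectIsomorphisms (h : IsConcretelyAbelian V) : JointlyReflectIsomorphisms V where
  isIso f _ := h.isIso f fun _ => (ConcreteCategory.isIso_iff_bijective _).1 inferInstance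

/-- Closure conditions on a full subcategory. -/
theorem fullSubcategory (h : IsConcretelyAbelian V) (P : ObjectProperty C)
    (hsub : ∀ {K A : C} (k : K ⟶ A), (∀ i, Function.Injective ((V i).map k)) → P A → P K)
    (hquot : ∀ {B Q : C} (q : B ⟶ Q), (∀ i, Function.Surjective ((V i).map q)) → P B → P Q)
    (hzero : ∀ Z : C, IsZero Z → P Z)
    (hprod : ∀ {A B : C} (b : BinaryBicone A B), b.fst ≫ b.inl + b.snd ≫ b.inr = 𝟙 b.pt →
      P A → P B → P b.pt) :
    IsConcretelyAbelian fun i => P.ι ⋙ V i where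
  additive i := by
    have := h.additive i
    infer_instance
  isIso f hf := by
    have : IsIso f.hom := h.isIso f.hom hf
    have : IsIso (P.ι.map f) := this
    exact isIso_of_reflects_iso f P.ι
  faithful hfg := P.hom_ext (h.faithful hfg)
  zero := by
    obtain ⟨Z, hZ⟩ := h.zero
    refine ⟨⟨Z, hzero Z hZ⟩, (IsZero.iff_id_eq_zero _).2 (P.hom_ext ((IsZero.iff_id_eq_zero _).1 hZ))⟩
  prod A B := by
    obtain ⟨b, hb⟩ := h.prod A.obj B.obj
    refine ⟨{ pt := ⟨b.pt, hprod b hb A.property B.property⟩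
              fst := P.homMk b.fst
              snd := P.homMk b.snd
              inl := P.homMk b.inl
              inr := P.homMk b.inr
              inl_fst := P.hom_ext b.inl_fst
              inl_snd := P.hom_ext b.inl_snd
              inr_fst := P.hom_ext b.inr_fst
              inr_snd := P.hom_ext b.inr_snd }, P.hom_ext hb⟩
  ker f := by
    obtain ⟨K, k, hk, hinj, hex, hl⟩ := h.ker f.hom
    refine ⟨⟨K, hsub k hinj (ObjectProperty.FullSubcategory.property _)⟩, P.homMk k, P.hom_ext hk,
      hinj, hex, fun g hg => ?_⟩
    obtain ⟨l, hl⟩ := hl g.hom (congrArg (·.hom) hg)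
    exact ⟨P.homMk l, P.hom_ext hl⟩
  coker f := by
    obtain ⟨K, k, hk, hsurj, hex, hl⟩ := h.coker f.hom
    refine ⟨⟨K, hquot k hsurj (ObjectProperty.FullSubcategory.property _)⟩, P.homMk k, P.hom_ext hk,
      hsurj, hex, fun g hg => ?_⟩
    obtain ⟨l, hl⟩ := hl g.hom (congrArg (·.hom) hg)
    exact ⟨P.homMk l, P.hom_ext hl⟩

end IsConcretelyAbelian

/-- A functor to a category with finite limits and colimits is exact if its composites with a
conservative family of exact functors are exact. -/
theorem IsExactFunctor.of_jointlyReflect {C D : Type*} [Category* C] [Category* D] {I : Type*}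
    {E : I → Type*} [∀ i, Category* (E i)] {W : ∀ i, D ⥤ E i}
    (hW : JointlyReflectIsomorphisms W) [HasFiniteLimits D] [HasFiniteColimits D]
    (hW' : ∀ i, IsExactFunctor (W i)) (G : C ⥤ D) (hG : ∀ i, IsExactFunctor (G ⋙ W i)) :
    IsExactFunctor G where
  limits := ⟨fun J _ _ => ⟨fun {K} => ⟨fun {c} hc => ⟨by
    have := fun i => (hW' i).limits
    have := fun i => (hG i).limits
    exact hW.jointlyReflectsLimit fun i => isLimitOfPreserves (G ⋙ W i) hc⟩⟩⟩⟩
  colimits := ⟨fun J _ _ => ⟨fun {K} => ⟨fun {c} hc => ⟨by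
    have := fun i => (hW' i).colimits
    have := fun i => (hG i).colimits
    exact hW.jointlyReflectsColimit fun i => isColimitOfPreserves (G ⋙ W i) hc⟩⟩⟩⟩

theorem IsExactFunctor.of_iso {C D : Type*} [Category* C] [Category* D] {G H : C ⥤ D}
    (hG : IsExactFunctor G) (e : G ≅ H) : IsExactFunctor H where
  limits := have := hG.limits; preservesFiniteLimits_of_natIso e
  colimits := have := hG.colimits; preservesFiniteColimits_of_natIso e

theorem IsExactFunctor.comp {C D E : Type*} [Category* C] [Category* D] [Category* E] {G : C ⥤ D}
    {H : D ⥤ E} (hG : IsExactFunctor G) (hH : IsExactFunctor H) : IsExactFunctor (G ⋙ H) where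
  limits := have := hG.limits; have := hH.limits; comp_preservesFiniteLimits G H
  colimits := have := hG.colimits; have := hH.colimits; comp_preservesFiniteColimits G H

theorem IsExactFunctor.of_isEquivalence {C D : Type*} [Category* C] [Category* D] (G : C ⥤ D)
    [G.IsEquivalence] : IsExactFunctor G := ⟨inferInstance, inferInstance⟩

/-- Being abelian is invariant under equivalence. -/
theorem IsAbelianCat.of_isEquivalence {C D : Type*} [Category* C] [Category* D] [Preadditive C]
    [Preadditive D] (hD : IsAbelianCat D) (G : C ⥤ D) [G.IsEquivalence] : IsAbelianCat C := by
  let := hD.abelian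
  have : HasFiniteProducts C := ⟨fun n => Adjunction.hasLimitsOfShape_of_equivalence G⟩
  let := abelianOfEquivalence G
  exact ⟨inferInstance, inferInstance, inferInstance, inferInstance, inferInstance⟩

end Criterion

end ToricLC

end

noncomputable section

namespace ToricLC

/-! ### Categories of co-modules are abelian -/

section CoTModAbelian

variable {N : Type} [AddCommGroup N] {Δ : Fan N}

variable (Δ) in
/-- The functor `M ↦ M_σ`. -/
def CoTMod.eval (σ : Δ.Cone) : CoTMod Δ ⥤ ModuleCat.{0} ℂ where
  obj M := ModuleCat.of ℂ (M.obj σ)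
  map f := ModuleCat.ofHom ((CoTMod.Hom.app f σ).restrictScalars ℂ)

theorem CoTMod.isIso_of_bijective {P Q : CoTMod Δ} (f : P ⟶ Q)
    (hf : ∀ σ, Function.Bijective (CoTMod.Hom.app f σ)) : IsIso f := by
  let e : ∀ σ, P.obj σ ≃ₗ[TRing σ.1] Q.obj σ := fun σ => LinearEquiv.ofBijective _ (hf σ)
  refine ⟨⟨CoTMod.Hom.mk (P := Q) (Q := P) (fun σ => (e σ).symm.toLinearMap) fun {τ σ} h m => ?_,
    CoTMod.hom_ext fun σ => LinearMap.ext fun m => (e σ).symm_apply_apply m,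
    CoTMod.hom_ext fun σ => LinearMap.ext fun m => (e σ).apply_symm_apply m⟩⟩
  obtain ⟨m, rfl⟩ := (e σ).surjective m
  refine (e τ).injective ?_
  rw [LinearEquiv.coe_coe, LinearEquiv.apply_symm_apply, LinearEquiv.coe_coe,
    LinearEquiv.symm_apply_apply]
  exact (CoTMod.Hom.comm f h m).symm

/-- A sub-co-module. -/
def CoTMod.sub (P : CoTMod Δ) (S : ∀ σ, Submodule (TRing σ.1) (P.obj σ))
    (hS : ∀ {τ σ : Δ.Cone} (h : τ ≤ σ) m, m ∈ S σ → P.map h m ∈ S τ) : CoTMod Δ where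
  obj σ := S σ
  map {τ σ} h := (P.map h).restrict (p := (S σ).restrictScalars ℂ) (q := (S τ).restrictScalars ℂ)
    fun m hm => hS h m hm
  map_smul h a m := Subtype.ext (P.map_smul h a m.1)
  map_refl σ m := Subtype.ext (P.map_refl σ m.1)
  map_trans h hτ m := Subtype.ext (P.map_trans h hτ m.1)

/-- A quotient co-module. -/
def CoTMod.quot (P : CoTMod Δ) (S : ∀ σ, Submodule (TRing σ.1) (P.obj σ))
    (hS : ∀ {τ σ : Δ.Cone} (h : τ ≤ σ) m, m ∈ S σ → P.map h m ∈ S τ) : CoTMod Δ where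
  obj σ := P.obj σ ⧸ S σ
  map {τ σ} h := ((S σ).restrictScalars ℂ).mapQ ((S τ).restrictScalars ℂ) (P.map h)
    fun m hm => hS h m hm
  map_smul h a m := by
    obtain ⟨m, rfl⟩ := Submodule.Quotient.mk_surjective _ m
    exact congrArg (Submodule.Quotient.mk (p := S _)) (P.map_smul h a m)
  map_refl σ m := by
    obtain ⟨m, rfl⟩ := Submodule.Quotient.mk_surjective _ m
    exact congrArg (Submodule.Quotient.mk (p := S _)) (P.map_refl σ m)
  map_trans h hτ m := by
    obtain ⟨m, rfl⟩ := Submodule.Quotient.mk_surjective _ m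
    exact congrArg (Submodule.Quotient.mk (p := S _)) (P.map_trans h hτ m)

/-- The direct sum of two co-modules. -/
def CoTMod.prod (P Q : CoTMod Δ) : CoTMod Δ where
  obj σ := P.obj σ × Q.obj σ
  map h := (P.map h).prodMap (Q.map h)
  map_smul h a m := Prod.ext (P.map_smul h a m.1) (Q.map_smul h a m.2)
  map_refl σ m := Prod.ext (P.map_refl σ m.1) (Q.map_refl σ m.2)
  map_trans h hτ m := Prod.ext (P.map_trans h hτ m.1) (Q.map_trans h hτ m.2)

variable (Δ) in
theorem isConcretelyAbelian_coTMod : IsConcretelyAbelian (CoTMod.eval Δ) where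
  additive σ := ⟨rfl⟩
  isIso f hf := CoTMod.isIso_of_bijective f hf
  faithful h := CoTMod.hom_ext fun σ => LinearMap.ext fun m => h σ m
  zero := ⟨{ obj := fun _ => PUnit
             map := fun _ => 0
             map_smul := fun _ _ _ => rfl
             map_refl := fun _ _ => rfl
             map_trans := fun _ _ _ => rfl },
    (IsZero.iff_id_eq_zero _).2 (CoTMod.hom_ext fun σ => LinearMap.ext fun m => rfl)⟩
  prod A B := ⟨
    { pt := A.prod B
      fst := CoTMod.Hom.mk (P := A.prod B) (Q := A) (fun σ => LinearMap.fst _ _ _) fun _ _ => rfl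
      snd := CoTMod.Hom.mk (P := A.prod B) (Q := B) (fun σ => LinearMap.snd _ _ _) fun _ _ => rfl
      inl := CoTMod.Hom.mk (P := A) (Q := A.prod B) (fun σ => LinearMap.inl _ _ _) fun h _ =>
        Prod.ext rfl (map_zero (B.map h)).symm
      inr := CoTMod.Hom.mk (P := B) (Q := A.prod B) (fun σ => LinearMap.inr _ _ _) fun h _ =>
        Prod.ext (map_zero (A.map h)).symm rfl
      inl_fst := rfl
      inl_snd := rfl
      inr_fst := rfl
      inr_snd := rfl },
    CoTMod.hom_ext fun σ => LinearMap.ext fun m => Prod.ext (add_zero _) (zero_add _)⟩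
  ker {A B} f := by
    let S : ∀ σ, Submodule (TRing σ.1) (A.obj σ) := fun σ => LinearMap.ker (CoTMod.Hom.app f σ)
    have hS : ∀ {τ σ : Δ.Cone} (h : τ ≤ σ) m, m ∈ S σ → A.map h m ∈ S τ := fun h m hm => by
      rw [LinearMap.mem_ker] at hm ⊢
      rw [CoTMod.Hom.comm, hm, map_zero]
    refine ⟨A.sub S hS, CoTMod.Hom.mk (P := A.sub S hS) (Q := A) (fun σ => (S σ).subtype)
      fun _ _ => rfl, CoTMod.hom_ext fun σ => LinearMap.ext fun m => m.2,
      fun σ => (S σ).injective_subtype, fun σ x hx => ⟨(⟨x, hx⟩ : S σ), rfl⟩, fun {T} g hg => ?_⟩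
    have hg' : ∀ σ m, CoTMod.Hom.app g σ m ∈ S σ := fun σ m =>
      LinearMap.congr_fun (congrArg (fun φ => CoTMod.Hom.app φ σ) hg) m
    exact ⟨CoTMod.Hom.mk (P := T) (Q := A.sub S hS)
      (fun σ => (CoTMod.Hom.app g σ).codRestrict (S σ) (hg' σ))
      fun h m => Subtype.ext (CoTMod.Hom.comm g h m), rfl⟩
  coker {A B} f := by
    let S : ∀ σ, Submodule (TRing σ.1) (B.obj σ) := fun σ => LinearMap.range (CoTMod.Hom.app f σ)
    have hS : ∀ {τ σ : Δ.Cone} (h : τ ≤ σ) m, m ∈ S σ → B.map h m ∈ S τ := by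
      rintro τ σ h _ ⟨m, rfl⟩
      exact ⟨A.map h m, CoTMod.Hom.comm f h m⟩
    refine ⟨B.quot S hS, CoTMod.Hom.mk (P := B) (Q := B.quot S hS) (fun σ => (S σ).mkQ)
      fun _ _ => rfl, CoTMod.hom_ext fun σ => LinearMap.ext fun m =>
        (Submodule.Quotient.mk_eq_zero _).2 ⟨m, rfl⟩,
      fun σ => (S σ).mkQ_surjective, fun σ x hx => (Submodule.Quotient.mk_eq_zero _).1 hx,
      fun {T} g hg => ?_⟩
    have hg' : ∀ σ, S σ ≤ LinearMap.ker (CoTMod.Hom.app g σ) := by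
      rintro σ _ ⟨m, rfl⟩
      exact LinearMap.congr_fun (congrArg (fun φ => CoTMod.Hom.app φ σ) hg) m
    refine ⟨CoTMod.Hom.mk (P := B.quot S hS) (Q := T)
      (fun σ => (S σ).liftQ (CoTMod.Hom.app g σ) (hg' σ)) fun h m => ?_, rfl⟩
    obtain ⟨m, rfl⟩ := Submodule.Quotient.mk_surjective _ m
    exact CoTMod.Hom.comm g h m

theorem isSupportedAtOrigin_of_injective {K A : CoTMod Δ} (k : K ⟶ A)
    (hk : ∀ σ, Function.Injective (CoTMod.Hom.app k σ)) (hA : isSupportedAtOrigin Δ A) :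
    isSupportedAtOrigin Δ K := fun σ m => by
  obtain ⟨n, hn⟩ := hA σ (CoTMod.Hom.app k σ m)
  refine ⟨n, fun a ha => hk σ ?_⟩
  rw [_root_.map_smul, hn a ha, map_zero]

theorem isSupportedAtOrigin_of_surjective {B Q : CoTMod Δ} (q : B ⟶ Q)
    (hq : ∀ σ, Function.Surjective (CoTMod.Hom.app q σ)) (hB : isSupportedAtOrigin Δ B) :
    isSupportedAtOrigin Δ Q := fun σ m => by
  obtain ⟨m, rfl⟩ := hq σ m
  obtain ⟨n, hn⟩ := hB σ m
  exact ⟨n, fun a ha => by rw [← _root_.map_smul, hn a ha, map_zero]⟩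

theorem isSupportedAtOrigin_of_isZero (Z : CoTMod Δ) (hZ : IsZero Z) :
    isSupportedAtOrigin Δ Z := fun σ _ => ⟨0, fun _ _ =>
  LinearMap.congr_fun (congrArg (fun φ => CoTMod.Hom.app φ σ) ((IsZero.iff_id_eq_zero _).1 hZ)) _⟩

theorem CoTMod.bicone_injective {A B : CoTMod Δ} (b : BinaryBicone A B)
    (hb : b.fst ≫ b.inl + b.snd ≫ b.inr = 𝟙 b.pt) (σ : Δ.Cone) {m m' : b.pt.obj σ}
    (h1 : CoTMod.Hom.app b.fst σ m = CoTMod.Hom.app b.fst σ m')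
    (h2 : CoTMod.Hom.app b.snd σ m = CoTMod.Hom.app b.snd σ m') : m = m' := by
  have h3 : ∀ x : b.pt.obj σ, CoTMod.Hom.app b.inl σ (CoTMod.Hom.app b.fst σ x) +
      CoTMod.Hom.app b.inr σ (CoTMod.Hom.app b.snd σ x) = x := fun x =>
    LinearMap.congr_fun (congrArg (fun φ => CoTMod.Hom.app φ σ) hb) x
  rw [← h3 m, ← h3 m', h1, h2]

theorem isSupportedAtOrigin_bicone {A B : CoTMod Δ} (b : BinaryBicone A B)
    (hb : b.fst ≫ b.inl + b.snd ≫ b.inr = 𝟙 b.pt) (hA : isSupportedAtOrigin Δ A)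
    (hB : isSupportedAtOrigin Δ B) : isSupportedAtOrigin Δ b.pt := fun σ m => by
  obtain ⟨n, hn⟩ := hA σ (CoTMod.Hom.app b.fst σ m)
  obtain ⟨n', hn'⟩ := hB σ (CoTMod.Hom.app b.snd σ m)
  refine ⟨max n n', fun a ha => CoTMod.bicone_injective b hb σ ?_ ?_⟩
  · rw [_root_.map_smul, map_zero, hn a (Ideal.pow_le_pow_right (le_max_left _ _) ha)]
  · rw [_root_.map_smul, map_zero, hn' a (Ideal.pow_le_pow_right (le_max_right _ _) ha)]

variable (Δ) in
theorem isConcretelyAbelian_coTModN :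
    IsConcretelyAbelian fun σ => (isSupportedAtOrigin Δ).ι ⋙ CoTMod.eval Δ σ :=
  (isConcretelyAbelian_coTMod Δ).fullSubcategory _
    (fun k hk => isSupportedAtOrigin_of_injective k hk)
    (fun q hq => isSupportedAtOrigin_of_surjective q hq) isSupportedAtOrigin_of_isZero
    (fun b hb => isSupportedAtOrigin_bicone b hb)

section Cf

variable [Module.Free ℤ N] [Module.Finite ℤ N]

theorem isCofinite_of_injective {K A : CoTMod Δ} (k : K ⟶ A)
    (hk : ∀ σ, Function.Injective (CoTMod.Hom.app k σ)) (hA : isCofinite Δ A) : isCofinite Δ K := by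
  rw [isCofinite_iff] at hA ⊢
  exact ⟨isSupportedAtOrigin_of_injective k hk hA.1, fun σ =>
    have := hA.2 σ
    isArtinian_of_injective _ (hk σ)⟩

theorem isCofinite_of_surjective {B Q : CoTMod Δ} (q : B ⟶ Q)
    (hq : ∀ σ, Function.Surjective (CoTMod.Hom.app q σ)) (hB : isCofinite Δ B) :
    isCofinite Δ Q := by
  rw [isCofinite_iff] at hB ⊢
  exact ⟨isSupportedAtOrigin_of_surjective q hq hB.1, fun σ =>
    have := hB.2 σ
    isArtinian_of_surjective _ _ (hq σ)⟩

theorem isCofinite_of_isZero (Z : CoTMod Δ) (hZ : IsZero Z) : isCofinite Δ Z :=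
  isCofinite_iff.2 ⟨isSupportedAtOrigin_of_isZero Z hZ, fun σ =>
    have : Subsingleton (Z.obj σ) := ⟨fun x y => by
      have h := fun m => LinearMap.congr_fun
        (congrArg (fun φ => CoTMod.Hom.app φ σ) ((IsZero.iff_id_eq_zero _).1 hZ)) m
      exact (h x).trans (h y).symm⟩
    isArtinian_of_finite⟩

theorem isCofinite_bicone {A B : CoTMod Δ} (b : BinaryBicone A B)
    (hb : b.fst ≫ b.inl + b.snd ≫ b.inr = 𝟙 b.pt) (hA : isCofinite Δ A)
    (hB : isCofinite Δ B) : isCofinite Δ b.pt := by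
  rw [isCofinite_iff] at hA hB ⊢
  refine ⟨isSupportedAtOrigin_bicone b hb hA.1 hB.1, fun σ => ?_⟩
  have := hA.2 σ
  have := hB.2 σ
  exact isArtinian_of_injective ((CoTMod.Hom.app b.fst σ).prod (CoTMod.Hom.app b.snd σ))
    fun x y h => CoTMod.bicone_injective b hb σ (Prod.ext_iff.1 h).1 (Prod.ext_iff.1 h).2

variable (Δ) in
theorem isConcretelyAbelian_coTModCf :
    IsConcretelyAbelian fun σ => (isCofinite Δ).ι ⋙ CoTMod.eval Δ σ :=
  (isConcretelyAbelian_coTMod Δ).fullSubcategory _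
    (fun k hk => isCofinite_of_injective k hk)
    (fun q hq => isCofinite_of_surjective q hq) isCofinite_of_isZero
    (fun b hb => isCofinite_bicone b hb)

end Cf

end CoTModAbelian

/-! ### Graded co-modules -/

section Projections

variable {M M' : Type*} [AddCommGroup M'] [Module ℂ M'] [AddCommGroup M] [Module ℂ M]

/-- The projections to the components of a grading. -/
structure IsGradingProj (A : ℤ → Submodule ℂ M) (p : ℤ → Module.End ℂ M) : Prop where
  mem : ∀ k m, p k m ∈ A k
  self : ∀ k, ∀ m ∈ A k, p k m = m
  ne : ∀ j k, j ≠ k → ∀ m ∈ A j, p k m = 0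
  sum : ∀ m, ∃ s : Finset ℤ, ∑ k ∈ s, p k m = m

theorem IsGradingProj.isInternal {A : ℤ → Submodule ℂ M} {p : ℤ → Module.End ℂ M}
    (h : IsGradingProj A p) : DirectSum.IsInternal A := by
  rw [DirectSum.isInternal_submodule_iff_iSupIndep_and_iSup_eq_top]
  constructor
  · rw [iSupIndep_def]
    refine fun k => Submodule.disjoint_def.2 fun m hm hm' => ?_
    rw [← h.self k m hm]
    have : ⨆ (j : ℤ) (_ : j ≠ k), A j ≤ LinearMap.ker (p k) :=
      iSup_le fun j => iSup_le fun hj m hm => h.ne j k hj m hm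
    exact this hm'
  · refine eq_top_iff.2 fun m _ => ?_
    obtain ⟨s, hs⟩ := h.sum m
    rw [← hs]
    exact Submodule.sum_mem _ fun k _ => Submodule.mem_iSup_of_mem k (h.mem k m)

/-- Gradings are handled through their projections from here on: morphisms of degree zero commute
with them, and subobjects and quotients are graded once they are stable under them. -/
theorem exists_isGradingProj {A : ℤ → Submodule ℂ M} (h : DirectSum.IsInternal A) :
    ∃ p, IsGradingProj A p := by
  classical
  let e := LinearEquiv.ofBijective (DirectSum.coeLinearMap A) h
  have he : ∀ k (m : A k), e.symm m.1 = DirectSum.lof ℂ ℤ (fun i => A i) k m := fun k m => by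
    rw [LinearEquiv.symm_apply_eq]
    exact (DirectSum.coeLinearMap_lof A k m).symm
  refine ⟨fun k => (A k).subtype ∘ₗ DirectSum.component ℂ ℤ (fun i => A i) k ∘ₗ e.symm.toLinearMap,
    fun k m => Subtype.property _, fun k m hm => ?_, fun j k hjk m hm => ?_, fun m => ?_⟩
  · have := he k ⟨m, hm⟩
    simp only [LinearMap.comp_apply, LinearEquiv.coe_coe, this, DirectSum.component.lof_self]
    rfl
  · have := he j ⟨m, hm⟩
    simp only [LinearMap.comp_apply, LinearEquiv.coe_coe, this, DirectSum.component.of,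
      dif_neg hjk, map_zero]
  · obtain ⟨x, rfl⟩ := e.surjective m
    refine ⟨x.support, ?_⟩
    simp only [LinearMap.comp_apply, LinearEquiv.coe_coe, LinearEquiv.symm_apply_apply]
    exact (DirectSum.coeLinearMap_eq_dfinsuppSum A x).symm

theorem IsGradingProj.comm {A : ℤ → Submodule ℂ M} {p : ℤ → Module.End ℂ M}
    (h : IsGradingProj A p) {A' : ℤ → Submodule ℂ M'} {p' : ℤ → Module.End ℂ M'}
    (h' : IsGradingProj A' p') (φ : M →ₗ[ℂ] M') (hφ : ∀ k, ∀ m ∈ A k, φ m ∈ A' k) (k : ℤ) (m : M) :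
    φ (p k m) = p' k (φ m) := by
  obtain ⟨s, hs⟩ := h.sum m
  rw [← hs, map_sum, map_sum, map_sum, map_sum]
  refine Finset.sum_congr rfl fun j _ => ?_
  by_cases hjk : j = k
  · subst hjk
    rw [h.self j _ (h.mem j m), h'.self j _ (hφ j _ (h.mem j m))]
  · rw [h.ne j k hjk _ (h.mem j m), h'.ne j k hjk _ (hφ j _ (h.mem j m)), map_zero]

theorem IsGradingProj.mem_iff {A : ℤ → Submodule ℂ M} {p : ℤ → Module.End ℂ M}
    (h : IsGradingProj A p) {k : ℤ} {m : M} : m ∈ A k ↔ p k m = m :=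
  ⟨h.self k m, fun hm => hm ▸ h.mem k m⟩

end Projections

end ToricLC

end

noncomputable section

namespace ToricLC

section Projections

variable {M M' : Type*} [AddCommGroup M] [Module ℂ M] [AddCommGroup M'] [Module ℂ M']

theorem IsGradingProj.isInternal_comap {A : ℤ → Submodule ℂ M} {p : ℤ → Module.End ℂ M}
    (h : IsGradingProj A p) (k : M' →ₗ[ℂ] M) (hk : Function.Injective k)
    (hp : ∀ j y, ∃ y', k y' = p j (k y)) : DirectSum.IsInternal fun j => (A j).comap k := by
  -- The image of `k` is stable under the projections; a linear left inverse brings them back to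
  -- `M'`. Its values off the image do not matter.
  obtain ⟨r, hr⟩ := k.exists_leftInverse_of_injective (LinearMap.ker_eq_bot.2 hk)
  have hr' : ∀ y, r (k y) = y := fun y => LinearMap.congr_fun hr y
  have h1 : ∀ j y, k (r (p j (k y))) = p j (k y) := fun j y => by
    obtain ⟨y', hy'⟩ := hp j y
    rw [← hy', hr']
  refine IsGradingProj.isInternal (p := fun j => r ∘ₗ p j ∘ₗ k) ⟨fun j y => ?_, fun j y hy => ?_,
    fun i j hij y hy => ?_, fun y => ?_⟩
  · rw [Submodule.mem_comap, LinearMap.comp_apply, LinearMap.comp_apply, h1]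
    exact h.mem j _
  · rw [LinearMap.comp_apply, LinearMap.comp_apply, h.self j _ hy, hr']
  · rw [LinearMap.comp_apply, LinearMap.comp_apply, h.ne i j hij _ hy, map_zero]
  · obtain ⟨s, hs⟩ := h.sum (k y)
    refine ⟨s, hk ?_⟩
    simp only [map_sum, LinearMap.comp_apply, h1, hs]

theorem IsGradingProj.isInternal_map {A : ℤ → Submodule ℂ M} {p : ℤ → Module.End ℂ M}
    (h : IsGradingProj A p) (q : M →ₗ[ℂ] M') (hq : Function.Surjective q)
    (hp : ∀ j y, q y = 0 → q (p j y) = 0) : DirectSum.IsInternal fun j => (A j).map q := by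
  -- The projections preserve the kernel of `q`, so `q ∘ p j ∘ s` does not depend on the linear
  -- section `s`.
  obtain ⟨s, hs⟩ := q.exists_rightInverse_of_surjective (LinearMap.range_eq_top.2 hq)
  have hs' : ∀ y, q (s y) = y := fun y => LinearMap.congr_fun hs y
  have h1 : ∀ j y, q (p j (s (q y))) = q (p j y) := fun j y => by
    have := hp j (s (q y) - y) (by rw [map_sub, hs', sub_self])
    rwa [map_sub, map_sub, sub_eq_zero] at this
  refine IsGradingProj.isInternal (p := fun j => q ∘ₗ p j ∘ₗ s) ⟨fun j y => ?_, ?_, ?_, fun y => ?_⟩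
  · exact ⟨_, h.mem j _, rfl⟩
  · rintro j _ ⟨y, hy, rfl⟩
    rw [LinearMap.comp_apply, LinearMap.comp_apply, h1, h.self j y hy]
  · rintro i j hij _ ⟨y, hy, rfl⟩
    rw [LinearMap.comp_apply, LinearMap.comp_apply, h1, h.ne i j hij y hy, map_zero]
  · obtain ⟨y, rfl⟩ := hq y
    obtain ⟨t, ht⟩ := h.sum y
    refine ⟨t, ?_⟩
    simp only [LinearMap.comp_apply, h1]
    rw [← map_sum, ht]

theorem IsGradingProj.sum_of_subset {A : ℤ → Submodule ℂ M} {p : ℤ → Module.End ℂ M}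
    (h : IsGradingProj A p) {s t : Finset ℤ} {m : M} (hm : ∑ k ∈ s, p k m = m) (hst : s ⊆ t) :
    ∑ k ∈ t, p k m = m := by
  rw [← Finset.sum_subset hst, hm]
  intro j _ hj
  rw [← hm, map_sum]
  exact Finset.sum_eq_zero fun i hi => h.ne i j (fun e => hj (e ▸ hi)) _ (h.mem i m)

theorem IsGradingProj.isInternal_prod {A : ℤ → Submodule ℂ M} {p : ℤ → Module.End ℂ M}
    (hp : IsGradingProj A p) {B : ℤ → Submodule ℂ M'} {q : ℤ → Module.End ℂ M'}
    (hq : IsGradingProj B q) : DirectSum.IsInternal fun j => (A j).prod (B j) := by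
  refine IsGradingProj.isInternal (p := fun j => (p j).prodMap (q j))
    ⟨fun j m => ⟨hp.mem j _, hq.mem j _⟩, fun j m hm => Prod.ext (hp.self j _ hm.1)
      (hq.self j _ hm.2), fun i j hij m hm => Prod.ext (hp.ne i j hij _ hm.1)
      (hq.ne i j hij _ hm.2), fun m => ?_⟩
  obtain ⟨s, hs⟩ := hp.sum m.1
  obtain ⟨t, ht⟩ := hq.sum m.2
  refine ⟨s ∪ t, Prod.ext ?_ ?_⟩
  · rw [Prod.fst_sum]
    exact hp.sum_of_subset hs Finset.subset_union_left
  · rw [Prod.snd_sum]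
    exact hq.sum_of_subset ht Finset.subset_union_right

end Projections

/-! ### Kernels, cokernels and sums of graded co-modules -/

section Graded

variable {N : Type} [AddCommGroup N] {Δ : Fan N}

theorem GrCoTMod.exists_proj (P : GrCoTMod Δ) (σ : Δ.Cone) : ∃ p, IsGradingProj (P.gr σ) p :=
  exists_isGradingProj (P.isInternal σ)

theorem GrCoTMod.Hom.proj_comm {P Q : GrCoTMod Δ} (f : P ⟶ Q) {σ : Δ.Cone}
    {p : ℤ → Module.End ℂ (P.toCoTMod.obj σ)} (hp : IsGradingProj (P.gr σ) p)
    {q : ℤ → Module.End ℂ (Q.toCoTMod.obj σ)} (hq : IsGradingProj (Q.gr σ) q) (k : ℤ)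
    (m : P.toCoTMod.obj σ) : CoTMod.Hom.app (GrCoTMod.Hom.hom f) σ (p k m) =
      q k (CoTMod.Hom.app (GrCoTMod.Hom.hom f) σ m) :=
  hp.comm hq ((CoTMod.Hom.app (GrCoTMod.Hom.hom f) σ).restrictScalars ℂ)
    (fun k m hm => GrCoTMod.Hom.mem f σ k m hm) k m

/-- A morphism which reflects membership in the graded pieces. -/
theorem GrCoTMod.Hom.mem_of_injective {P Q : GrCoTMod Δ} (f : P ⟶ Q) {σ : Δ.Cone}
    (hf : Function.Injective (CoTMod.Hom.app (GrCoTMod.Hom.hom f) σ)) {k : ℤ}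
    {m : P.toCoTMod.obj σ} (hm : CoTMod.Hom.app (GrCoTMod.Hom.hom f) σ m ∈ Q.gr σ k) :
    m ∈ P.gr σ k := by
  obtain ⟨p, hp⟩ := P.exists_proj σ
  obtain ⟨q, hq⟩ := Q.exists_proj σ
  refine hp.mem_iff.2 (hf ?_)
  rw [f.proj_comm hp hq, hq.self k _ hm]

/-- The grading induced on a subobject. -/
def GrCoTMod.comap (P : GrCoTMod Δ) {K : CoTMod Δ} (k : K ⟶ P.toCoTMod)
    (h : ∀ σ, DirectSum.IsInternal fun j =>
      (P.gr σ j).comap ((CoTMod.Hom.app k σ).restrictScalars ℂ)) : GrCoTMod Δ where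
  toCoTMod := K
  gr σ j := (P.gr σ j).comap ((CoTMod.Hom.app k σ).restrictScalars ℂ)
  isInternal := h
  smul_mem σ d j a m ha hm := by
    have := P.smul_mem σ d j a _ ha hm
    rw [LinearMap.coe_restrictScalars, ← _root_.map_smul] at this
    exact this
  map_mem {τ σ} h j m hm := by
    have := P.map_mem h j _ hm
    rw [LinearMap.coe_restrictScalars, ← CoTMod.Hom.comm] at this
    exact this

/-- The grading induced on a quotient. -/
def GrCoTMod.mapGr (P : GrCoTMod Δ) {Q : CoTMod Δ} (q : P.toCoTMod ⟶ Q)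
    (h : ∀ σ, DirectSum.IsInternal fun j =>
      (P.gr σ j).map ((CoTMod.Hom.app q σ).restrictScalars ℂ)) : GrCoTMod Δ where
  toCoTMod := Q
  gr σ j := (P.gr σ j).map ((CoTMod.Hom.app q σ).restrictScalars ℂ)
  isInternal := h
  smul_mem := by
    rintro σ d j a _ ha ⟨m, hm, rfl⟩
    exact ⟨a • m, P.smul_mem σ d j a m ha hm, (CoTMod.Hom.app q σ).map_smul a m⟩
  map_mem := by
    rintro τ σ h j _ ⟨m, hm, rfl⟩
    exact ⟨P.toCoTMod.map h m, P.map_mem h j m hm, CoTMod.Hom.comm q h m⟩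

/-- The direct sum of graded co-modules. -/
def GrCoTMod.prod (P Q : GrCoTMod Δ) : GrCoTMod Δ where
  toCoTMod := P.toCoTMod.prod Q.toCoTMod
  gr σ j := (P.gr σ j).prod (Q.gr σ j)
  isInternal σ := by
    obtain ⟨p, hp⟩ := P.exists_proj σ
    obtain ⟨q, hq⟩ := Q.exists_proj σ
    exact hp.isInternal_prod hq
  smul_mem σ d j a m ha hm := ⟨P.smul_mem σ d j a _ ha hm.1, Q.smul_mem σ d j a _ ha hm.2⟩
  map_mem h j m hm := ⟨P.map_mem h j _ hm.1, Q.map_mem h j _ hm.2⟩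

variable (Δ) in
-- Kernels and cokernels are those of the underlying co-modules. A map of degree zero commutes with
-- the grading projections, so kernel and image are stable under them and inherit gradings.
theorem isConcretelyAbelian_grCoTMod :
    IsConcretelyAbelian fun σ => GrCoTMod.forget Δ ⋙ CoTMod.eval Δ σ where
  additive σ := ⟨rfl⟩
  isIso {A B} f hf := by
    have : IsIso (GrCoTMod.Hom.hom f) := CoTMod.isIso_of_bijective _ hf
    have h1 : ∀ σ m, CoTMod.Hom.app (GrCoTMod.Hom.hom f) σ
        (CoTMod.Hom.app (inv (GrCoTMod.Hom.hom f)) σ m) = m := fun σ m =>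
      LinearMap.congr_fun (congrArg (fun φ => CoTMod.Hom.app φ σ)
        (IsIso.inv_hom_id (GrCoTMod.Hom.hom f))) m
    exact ⟨GrCoTMod.Hom.mk (P := B) (Q := A) (inv (GrCoTMod.Hom.hom f)) fun σ k m hm =>
      GrCoTMod.Hom.mem_of_injective f (hf σ).1 (by rwa [h1]),
      GrCoTMod.Hom.ext (IsIso.hom_inv_id _), GrCoTMod.Hom.ext (IsIso.inv_hom_id _)⟩
  faithful h := GrCoTMod.Hom.ext ((isConcretelyAbelian_coTMod Δ).faithful h)
  zero := by
    obtain ⟨Z, hZ⟩ := (isConcretelyAbelian_coTMod Δ).zero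
    have h1 : ∀ σ (m : Z.obj σ), m = 0 := fun σ m => LinearMap.congr_fun
      (congrArg (fun φ => CoTMod.Hom.app φ σ) ((IsZero.iff_id_eq_zero _).1 hZ)) m
    refine ⟨{ toCoTMod := Z
              gr := fun _ _ => ⊥
              isInternal := fun σ => IsGradingProj.isInternal (p := fun _ => 0)
                ⟨fun _ _ => zero_mem _, fun _ m _ => (h1 σ m).symm, fun _ _ _ _ _ => rfl,
                  fun m => ⟨∅, (h1 σ m).symm⟩⟩
              smul_mem := fun σ _ _ _ _ _ _ => (Submodule.mem_bot ℂ).2 (h1 σ _)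
              map_mem := fun _ _ _ _ => (Submodule.mem_bot ℂ).2 (h1 _ _) },
      (IsZero.iff_id_eq_zero _).2 (GrCoTMod.Hom.ext ((IsZero.iff_id_eq_zero _).1 hZ))⟩
  prod A B := ⟨
    { pt := A.prod B
      fst := GrCoTMod.Hom.mk (P := A.prod B) (Q := A)
        (CoTMod.Hom.mk (P := A.toCoTMod.prod B.toCoTMod) (Q := A.toCoTMod)
          (fun σ => LinearMap.fst _ _ _) fun _ _ => rfl) fun _ _ _ hm => hm.1
      snd := GrCoTMod.Hom.mk (P := A.prod B) (Q := B)
        (CoTMod.Hom.mk (P := A.toCoTMod.prod B.toCoTMod) (Q := B.toCoTMod)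
          (fun σ => LinearMap.snd _ _ _) fun _ _ => rfl) fun _ _ _ hm => hm.2
      inl := GrCoTMod.Hom.mk (P := A) (Q := A.prod B)
        (CoTMod.Hom.mk (P := A.toCoTMod) (Q := A.toCoTMod.prod B.toCoTMod)
          (fun σ => LinearMap.inl _ _ _) fun h _ => Prod.ext rfl (map_zero (B.toCoTMod.map h)).symm)
        fun _ _ _ hm => ⟨hm, zero_mem _⟩
      inr := GrCoTMod.Hom.mk (P := B) (Q := A.prod B)
        (CoTMod.Hom.mk (P := B.toCoTMod) (Q := A.toCoTMod.prod B.toCoTMod)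
          (fun σ => LinearMap.inr _ _ _) fun h _ => Prod.ext (map_zero (A.toCoTMod.map h)).symm rfl)
        fun _ _ _ hm => ⟨zero_mem _, hm⟩
      inl_fst := rfl
      inl_snd := rfl
      inr_fst := rfl
      inr_snd := rfl },
    GrCoTMod.Hom.ext (CoTMod.hom_ext fun σ => LinearMap.ext fun m =>
      Prod.ext (add_zero _) (zero_add _))⟩
  ker {A B} f := by
    obtain ⟨K, k, hk, hinj, hex, hl⟩ := (isConcretelyAbelian_coTMod Δ).ker (GrCoTMod.Hom.hom f)
    have hInt : ∀ σ, DirectSum.IsInternal fun j =>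
        (A.gr σ j).comap ((CoTMod.Hom.app k σ).restrictScalars ℂ) := fun σ => by
      obtain ⟨p, hp⟩ := A.exists_proj σ
      obtain ⟨q, hq⟩ := B.exists_proj σ
      refine hp.isInternal_comap _ (hinj σ) fun j y => hex σ _ ?_
      refine (f.proj_comm hp hq j _).trans ?_
      have h1 : CoTMod.Hom.app (GrCoTMod.Hom.hom f) σ (CoTMod.Hom.app k σ y) = 0 :=
        LinearMap.congr_fun (congrArg (fun φ => CoTMod.Hom.app φ σ) hk) y
      exact (congrArg (q j) h1).trans (map_zero _)
    refine ⟨A.comap k hInt, GrCoTMod.Hom.mk (P := A.comap k hInt) (Q := A) k fun _ _ _ hm => hm,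
      GrCoTMod.Hom.ext hk, hinj, hex, fun {T} g hg => ?_⟩
    obtain ⟨l, hl⟩ := hl (GrCoTMod.Hom.hom g) (congrArg GrCoTMod.Hom.hom hg)
    refine ⟨GrCoTMod.Hom.mk (P := T) (Q := A.comap k hInt) l fun σ j m hm => ?_,
      GrCoTMod.Hom.ext hl⟩
    have h1 : CoTMod.Hom.app k σ (CoTMod.Hom.app l σ m) =
        CoTMod.Hom.app (GrCoTMod.Hom.hom g) σ m :=
      LinearMap.congr_fun (congrArg (fun φ => CoTMod.Hom.app φ σ) hl) m
    exact (congrArg (· ∈ A.gr σ j) h1).mpr (GrCoTMod.Hom.mem g σ j m hm)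
  coker {A B} f := by
    obtain ⟨K, k, hk, hsurj, hex, hl⟩ := (isConcretelyAbelian_coTMod Δ).coker (GrCoTMod.Hom.hom f)
    have hk' : ∀ σ y, CoTMod.Hom.app k σ (CoTMod.Hom.app (GrCoTMod.Hom.hom f) σ y) = 0 :=
      fun σ y => LinearMap.congr_fun (congrArg (fun φ => CoTMod.Hom.app φ σ) hk) y
    have hInt : ∀ σ, DirectSum.IsInternal fun j =>
        (B.gr σ j).map ((CoTMod.Hom.app k σ).restrictScalars ℂ) := fun σ => by
      obtain ⟨p, hp⟩ := A.exists_proj σ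
      obtain ⟨q, hq⟩ := B.exists_proj σ
      refine hq.isInternal_map _ (hsurj σ) fun j y hy => ?_
      obtain ⟨x, rfl⟩ := hex σ y hy
      exact (congrArg (CoTMod.Hom.app k σ) (f.proj_comm hp hq j x).symm).trans (hk' σ _)
    refine ⟨B.mapGr k hInt, GrCoTMod.Hom.mk (P := B) (Q := B.mapGr k hInt) k
      fun σ j m hm => ⟨m, hm, rfl⟩, GrCoTMod.Hom.ext hk, hsurj, hex, fun {T} g hg => ?_⟩
    obtain ⟨l, hl⟩ := hl (GrCoTMod.Hom.hom g) (congrArg GrCoTMod.Hom.hom hg)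
    refine ⟨GrCoTMod.Hom.mk (P := B.mapGr k hInt) (Q := T) l ?_, GrCoTMod.Hom.ext hl⟩
    rintro σ j _ ⟨m, hm, rfl⟩
    have h1 : CoTMod.Hom.app l σ (CoTMod.Hom.app k σ m) =
        CoTMod.Hom.app (GrCoTMod.Hom.hom g) σ m :=
      LinearMap.congr_fun (congrArg (fun φ => CoTMod.Hom.app φ σ) hl) m
    exact (congrArg (· ∈ T.gr σ j) h1).mpr (GrCoTMod.Hom.mem g σ j m hm)

variable [Module.Free ℤ N] [Module.Finite ℤ N]

variable (Δ) in
theorem isConcretelyAbelian_grCoTModCf :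
    IsConcretelyAbelian fun σ => GrCoTModCfToCoTMod Δ ⋙ CoTMod.eval Δ σ :=
  (isConcretelyAbelian_grCoTMod Δ).fullSubcategory (isGrCofinite Δ)
    (fun k hk => isCofinite_of_injective (GrCoTMod.Hom.hom k) hk)
    (fun q hq => isCofinite_of_surjective (GrCoTMod.Hom.hom q) hq)
    (fun _ hZ => isCofinite_of_isZero _ ((IsZero.iff_id_eq_zero _).2
      (congrArg GrCoTMod.Hom.hom ((IsZero.iff_id_eq_zero _).1 hZ))))
    (fun b hb hA hB => isCofinite_bicone
      { pt := b.pt.toCoTMod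
        fst := GrCoTMod.Hom.hom b.fst
        snd := GrCoTMod.Hom.hom b.snd
        inl := GrCoTMod.Hom.hom b.inl
        inr := GrCoTMod.Hom.hom b.inr
        inl_fst := congrArg GrCoTMod.Hom.hom b.inl_fst
        inl_snd := congrArg GrCoTMod.Hom.hom b.inl_snd
        inr_fst := congrArg GrCoTMod.Hom.hom b.inr_fst
        inr_snd := congrArg GrCoTMod.Hom.hom b.inr_snd } (congrArg GrCoTMod.Hom.hom hb) hA hB)

end Graded

end ToricLC

end

noncomputable section

namespace ToricLC

/-! ### Exactness of the functors to sheaves -/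

section Exactness

variable {N : Type} [AddCommGroup N] [Module.Free ℤ N] [Module.Finite ℤ N] (Δ : Fan N)

/-- The stalk of a sheaf at a point given in logarithmic coordinates. -/
def paramStalk (p : Δ.Cone × ExpSpace N) : Sh (X Δ) ⥤ ModuleCat.{0} ℂ :=
  TopCat.Sheaf.forget (ModuleCat.{0} ℂ) (X Δ) ⋙
    TopCat.Presheaf.stalkFunctor (ModuleCat.{0} ℂ) (param p.1 p.2 : X Δ)

theorem isExactFunctor_paramStalk (p : Δ.Cone × ExpSpace N) : IsExactFunctor (paramStalk Δ p) := by
  unfold paramStalk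
  exact ⟨inferInstance, inferInstance⟩

theorem jointlyReflectIsomorphisms_paramStalk :
    JointlyReflectIsomorphisms (paramStalk Δ) where
  isIso {F G} f _ := isIso_of_stalkMap_bijective f fun y => by
    obtain ⟨σ, v, rfl⟩ := exists_param y
    have h : IsIso ((paramStalk Δ (σ, v)).map f) := inferInstance
    exact (ConcreteCategory.isIso_iff_bijective _).1 h

/-- The stalks along an orbit are all isomorphic. -/
def paramStalkIso (p : Δ.Cone × ExpSpace N) :
    logFunctor Δ ⋙ CoTMod.eval Δ p.1 ≅ (isLCu Δ).ι ⋙ paramStalk Δ p :=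
  NatIso.ofComponents (fun F => ((flatOf F.property.1).ev p.1 p.2).toModuleIso) fun {F G} f => by
    ext a
    have h := flatRel_stalkMap (flatOf_val F.property.1) (flatOf_val G.property.1) f.hom p.1 p.2 a
      ((flatOf F.property.1).ev p.1 p.2 a) (by rw [one_smul]; rfl)
    exact (etale_mk_inj h).symm

/-- Exactness of a functor to sheaves is tested on stalks, and flat sections identify every stalk
along `O_σ` naturally with the component at `σ` of the co-module. -/
theorem isExactFunctor_to_sheaf {C : Type u} [Category.{v} C] (L : C ⥤ LCu Δ)
    (h : ∀ σ, IsExactFunctor (L ⋙ logFunctor Δ ⋙ CoTMod.eval Δ σ)) :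
    IsExactFunctor (L ⋙ (isLCu Δ).ι) :=
  IsExactFunctor.of_jointlyReflect (jointlyReflectIsomorphisms_paramStalk Δ)
    (isExactFunctor_paramStalk Δ) _ fun p =>
      (h p.1).of_iso (Functor.isoWhiskerLeft L (paramStalkIso Δ p))

theorem isAbelianCat_LCu : IsAbelianCat (LCu Δ) :=
  (isConcretelyAbelian_coTModN Δ).isAbelianCat.of_isEquivalence (logFunctorN Δ)

theorem isAbelianCat_LCcf : IsAbelianCat (LCcf Δ) :=
  (isConcretelyAbelian_coTModCf Δ).isAbelianCat.of_isEquivalence (logFunctorCf Δ)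

theorem isExactFunctor_LCu : IsExactFunctor (isLCu Δ).ι :=
  isExactFunctor_to_sheaf Δ (𝟭 _) fun σ => (IsExactFunctor.of_isEquivalence (logFunctorN Δ)).comp
    ((isConcretelyAbelian_coTModN Δ).isExactFunctor σ)

theorem isExactFunctor_LCcf : IsExactFunctor (isLCcf Δ).ι :=
  isExactFunctor_to_sheaf Δ (LCcfToLCu Δ) fun σ =>
    (IsExactFunctor.of_isEquivalence (logFunctorCf Δ)).comp
      ((isConcretelyAbelian_coTModCf Δ).isExactFunctor σ)

theorem isExactFunctor_to_coTMod {C : Type u} [Category.{v} C] (G : C ⥤ CoTMod Δ)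
    (h : ∀ σ, IsExactFunctor (G ⋙ CoTMod.eval Δ σ)) : IsExactFunctor G := by
  let := (isConcretelyAbelian_coTMod Δ).abelian
  exact IsExactFunctor.of_jointlyReflect (isConcretelyAbelian_coTMod Δ).jointlyReflectIsomorphisms
    (isConcretelyAbelian_coTMod Δ).isExactFunctor G h

end Exactness

end ToricLC

end

noncomputable section

namespace ToricLC

/-! ### The action of Frobenius on stalks -/

section FrobStalk

variable {N : Type} [AddCommGroup N] [Module.Free ℤ N] [Module.Finite ℤ N] {Δ : Fan N}
  {F G : Sh (X Δ)}

/-- Squaring every monomial doubles logarithms; this puts the lift of Frobenius under the general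
results on `FlatRel`, with `k = 2`. -/
theorem frobHom_param (σ : Δ.Cone) (v : ExpSpace N) :
    (frobHom Δ : X Δ → X Δ) (param σ v) = param σ (2 • v) :=
  congrArg (chart σ) (AffineToric.ext fun m => by
    change (orbitPt σ v).eval m ^ 2 = (orbitPt σ (2 • v)).eval m
    classical
    rw [eval_orbitPt, eval_orbitPt, two_nsmul, map_add, cexp_add]
    split_ifs
    · exact sq _
    · exact zero_pow two_ne_zero)

/-- The map `F_σ = F_{𝓕(x_σ)} → G_σ` induced by a morphism `F ⟶ 𝓕_* G`. -/
def frobStalk (η : F ⟶ (TopCat.Sheaf.pushforward (ModuleCat.{0} ℂ) (frobHom Δ)).obj G)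
    (σ : Δ.Cone) : ptStalk F σ →ₗ[ℂ] ptStalk G σ :=
  adjStalk (frobHom Δ) η (pt σ) ∘ₗ
    (stalkCast (F := F) (x := (pt σ : X Δ)) (y := frobHom Δ (pt σ)) (frob_pt σ).symm).toLinearMap

theorem stalkSpecializes_eq_stalkCast {Y : TopCat.{0}} {F : Sh Y} {x y : Y} (h : x = y)
    (a : stalk F y) : (F.presheaf.stalkSpecializes (specializes_of_eq h)).hom a =
      stalkCast h.symm a := by
  subst h
  exact congrArg (fun q => ModuleCat.Hom.hom q a) (F.presheaf.stalkSpecializes_refl x)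

/-- The adjoint of `θ`. -/
abbrev adjTheta (θ : (frobPullback Δ).obj F ⟶ G) :
    F ⟶ (TopCat.Sheaf.pushforward (ModuleCat.{0} ℂ) (frobHom Δ)).obj G :=
  (TopCat.Sheaf.pullbackPushforwardAdjunction (ModuleCat.{0} ℂ) (frobHom Δ)).homEquiv F G θ

theorem stalkTheta_eq (θ : (frobPullback Δ).obj F ⟶ F) (σ : Δ.Cone) :
    stalkTheta θ σ = frobStalk (adjTheta θ) σ :=
  LinearMap.ext fun a => congrArg (adjStalk (frobHom Δ) (adjTheta θ) (pt σ))
    (stalkSpecializes_eq_stalkCast (F := F) (x := frobHom Δ (pt σ)) (y := (pt σ : X Δ))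
      (frob_pt σ) a)

theorem flatRel_frobStalk {D : FlatData F (ptStalk F)} {D' : FlatData G (ptStalk G)}
    (hD : ∀ σ a, D.val σ 0 a = ⟨pt σ, a⟩) (hD' : ∀ σ a, D'.val σ 0 a = ⟨pt σ, a⟩)
    (η : F ⟶ (TopCat.Sheaf.pushforward (ModuleCat.{0} ℂ) (frobHom Δ)).obj G) :
    FlatRel D D' (frobHom Δ) 2 (adjStalk (frobHom Δ) η) (frobStalk η) := by
  obtain ⟨φ, hφ⟩ := exists_flatRel D D' frobHom_param (isEtaleFamily_adjStalk (frobHom Δ) η)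
  have : φ = frobStalk η := funext fun σ => LinearMap.ext fun a => by
    obtain ⟨u, hu⟩ := D.exists_germ_eq_val (frobHom_param σ 0) a
    have h1 := hφ σ 0 a u hu
    rw [smul_zero, hD] at hu
    rw [hD'] at h1
    have h2 : ∀ (x : X Δ) (hx : x = pt σ) (u : stalk F (frobHom Δ x)),
        (⟨frobHom Δ x, u⟩ : Etale F) = ⟨pt σ, a⟩ →
        (⟨x, adjStalk (frobHom Δ) η x u⟩ : Etale G) = ⟨pt σ, frobStalk η σ a⟩ := by
      rintro _ rfl u hu
      rw [← mk_stalkCast (F := F) (x := (pt σ : X Δ)) (y := frobHom Δ (pt σ)) (frob_pt σ).symm a]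
        at hu
      rw [etale_mk_inj hu]
      rfl
    exact etale_mk_inj (h1.symm.trans (h2 _ (param_zero σ) u hu))
  exact this ▸ hφ

theorem FlatRel.ext {Γ Γ' : Δ.Cone → Type} [∀ σ, AddCommGroup (Γ σ)] [∀ σ, Module ℂ (Γ σ)]
    [∀ σ, AddCommGroup (Γ' σ)] [∀ σ, Module ℂ (Γ' σ)] {D : FlatData F Γ} {D' : FlatData G Γ'}
    {f : X Δ → X Δ} {k : ℕ} {ψ ψ' : ∀ y, stalk F (f y) →ₗ[ℂ] stalk G y}
    (hf : ∀ (σ : Δ.Cone) v, f (param σ v) = param σ (k • v)) {φ : ∀ σ, Γ σ →ₗ[ℂ] Γ' σ}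
    (h : FlatRel D D' f k ψ φ) (h' : FlatRel D D' f k ψ' φ) (y : X Δ) : ψ y = ψ' y := by
  obtain ⟨σ, v, rfl⟩ := exists_param y
  refine LinearMap.ext fun u => ?_
  obtain ⟨a, ha⟩ := D.exists_val (σ := σ) (v := k • v) (g := ⟨f (param σ v), u⟩) (hf σ v)
  exact etale_mk_inj ((h σ v a u ha).trans (h' σ v a u ha).symm)

theorem FlatRel.bijective {Γ Γ' : Δ.Cone → Type} [∀ σ, AddCommGroup (Γ σ)] [∀ σ, Module ℂ (Γ σ)]
    [∀ σ, AddCommGroup (Γ' σ)] [∀ σ, Module ℂ (Γ' σ)] {D : FlatData F Γ} {D' : FlatData G Γ'}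
    {f : X Δ → X Δ} {k : ℕ} {ψ : ∀ y, stalk F (f y) →ₗ[ℂ] stalk G y}
    (hf : ∀ (σ : Δ.Cone) v, f (param σ v) = param σ (k • v)) {φ : ∀ σ, Γ σ →ₗ[ℂ] Γ' σ}
    (h : FlatRel D D' f k ψ φ) (hφ : ∀ σ, Function.Bijective (φ σ)) (y : X Δ) :
    Function.Bijective (ψ y) := by
  obtain ⟨σ, v, rfl⟩ := exists_param y
  constructor
  · intro u u' huu
    obtain ⟨a, ha⟩ := D.exists_val (σ := σ) (v := k • v) (g := ⟨f (param σ v), u⟩) (hf σ v)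
    obtain ⟨a', ha'⟩ := D.exists_val (σ := σ) (v := k • v) (g := ⟨f (param σ v), u'⟩) (hf σ v)
    have h1 := h σ v a u ha
    rw [huu, h σ v a' u' ha'] at h1
    rw [(hφ σ).1 (D'.val_injective h1)] at ha'
    exact etale_mk_inj (ha.trans ha'.symm)
  · intro w
    obtain ⟨b, hb⟩ := D'.exists_val (σ := σ) (v := v) (g := ⟨param σ v, w⟩) rfl
    obtain ⟨a, rfl⟩ := (hφ σ).2 b
    obtain ⟨u, hu⟩ := D.exists_germ_eq_val (hf σ v) a
    exact ⟨u, etale_mk_inj ((h σ v a u hu).trans hb.symm)⟩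

theorem frobStalk_ext (hF : isLC Δ F) (hG : isLC Δ G)
    {η η' : F ⟶ (TopCat.Sheaf.pushforward (ModuleCat.{0} ℂ) (frobHom Δ)).obj G}
    (h : ∀ σ, frobStalk η σ = frobStalk η' σ) : η = η' := by
  refine adjStalk_ext (frobHom Δ) fun y => ?_
  have h1 := flatRel_frobStalk (flatOf_val hF) (flatOf_val hG) η
  rw [funext h] at h1
  exact h1.ext frobHom_param (flatRel_frobStalk (flatOf_val hF) (flatOf_val hG) η') y

theorem frobStalk_comp {H : Sh (X Δ)}
    (η : F ⟶ (TopCat.Sheaf.pushforward (ModuleCat.{0} ℂ) (frobHom Δ)).obj G) (g : G ⟶ H)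
    (σ : Δ.Cone) :
    frobStalk (η ≫ (TopCat.Sheaf.pushforward (ModuleCat.{0} ℂ) (frobHom Δ)).map g) σ =
      stalkMap g (pt σ : X Δ) ∘ₗ frobStalk η σ := by
  rw [frobStalk, adjStalk_comp]
  rfl

theorem frobStalk_precomp {E : Sh (X Δ)} (g : E ⟶ F)
    (η : F ⟶ (TopCat.Sheaf.pushforward (ModuleCat.{0} ℂ) (frobHom Δ)).obj G) (σ : Δ.Cone) :
    frobStalk (g ≫ η) σ = frobStalk η σ ∘ₗ stalkMap g (pt σ : X Δ) := by
  have h : ∀ {x y : X Δ} (h : x = y) (a : stalk E x),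
      stalkMap g y (stalkCast h a) = stalkCast h (stalkMap g x a) := by
    rintro x _ rfl a
    rfl
  rw [frobStalk, adjStalk_precomp]
  exact LinearMap.ext fun a => congrArg (adjStalk (frobHom Δ) η (pt σ)) (h _ a)

/-- Passing to adjoints turns both composites into morphisms `F ⟶ 𝓕_* G`, which are determined by
their action on the stalks at the distinguished points. -/
theorem comm_theta_iff (hF : isLC Δ F) (hG : isLC Δ G) (θ : (frobPullback Δ).obj F ⟶ F)
    (θ' : (frobPullback Δ).obj G ⟶ G) (f : F ⟶ G) :
    (frobPullback Δ).map f ≫ θ' = θ ≫ f ↔ ∀ σ a,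
      stalkMap f (pt σ : X Δ) (stalkTheta θ σ a) = stalkTheta θ' σ (stalkMap f (pt σ : X Δ) a) := by
  let adj := TopCat.Sheaf.pullbackPushforwardAdjunction (ModuleCat.{0} ℂ) (frobHom Δ)
  rw [← (adj.homEquiv _ _).apply_eq_iff_eq, adj.homEquiv_naturality_left,
    adj.homEquiv_naturality_right]
  have h1 : ∀ σ a, frobStalk (f ≫ adjTheta θ') σ a =
      stalkTheta θ' σ (stalkMap f (pt σ : X Δ) a) := fun σ a => by
    rw [frobStalk_precomp, stalkTheta_eq]
    rfl
  have h2 : ∀ σ a, frobStalk (adjTheta θ ≫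
      (TopCat.Sheaf.pushforward (ModuleCat.{0} ℂ) (frobHom Δ)).map f) σ a =
      stalkMap f (pt σ : X Δ) (stalkTheta θ σ a) := fun σ a => by
    rw [frobStalk_comp, stalkTheta_eq]
    rfl
  constructor
  · intro h σ a
    rw [← h1, ← h2]
    exact congrArg (fun η => frobStalk η σ a) h.symm
  · intro h
    refine frobStalk_ext hF hG fun σ => LinearMap.ext fun a => ?_
    exact (h1 σ a).trans ((h σ a).symm.trans (h2 σ a).symm)

/-- Frobenius wraps every loop twice: `θ_σ T_n² = T_n θ_σ`. -/
theorem stalkTheta_monodromy (hF : isLC Δ F) (θ : (frobPullback Δ).obj F ⟶ F) (σ : Δ.Cone) (n : N)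
    (a : ptStalk F σ) : stalkTheta θ σ ((flatOf hF).monodromy σ (2 • n) a) =
      (flatOf hF).monodromy σ n (stalkTheta θ σ a) := by
  rw [stalkTheta_eq]
  exact (flatRel_frobStalk (flatOf_val hF) (flatOf_val hF) (adjTheta θ)).map_monodromy
    frobHom_param σ n a

theorem stalkTheta_res (hF : isLC Δ F) (θ : (frobPullback Δ).obj F ⟶ F) {τ σ : Δ.Cone}
    (h : τ ≤ σ) (a : ptStalk F σ) : stalkTheta θ τ ((flatOf hF).res h a) =
      (flatOf hF).res h (stalkTheta θ σ a) := by
  rw [stalkTheta_eq, stalkTheta_eq]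
  exact (flatRel_frobStalk (flatOf_val hF) (flatOf_val hF) (adjTheta θ)).map_res
    (isEtaleFamily_adjStalk _ _) two_pos frobHom_param h a

/-- Existence of `θ` with given action on stalks. -/
theorem exists_theta (hF : isLC Δ F) (φ : ∀ σ, Module.End ℂ (ptStalk F σ))
    (hT : ∀ σ n a, φ σ ((flatOf hF).monodromy σ (2 • n) a) = (flatOf hF).monodromy σ n (φ σ a))
    (hres : ∀ {τ σ : Δ.Cone} (h : τ ≤ σ) a, φ τ ((flatOf hF).res h a) =
      (flatOf hF).res h (φ σ a)) :
    ∃ θ : (frobPullback Δ).obj F ⟶ F, (∀ σ, stalkTheta θ σ = φ σ) ∧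
      ((∀ σ, Function.Bijective (φ σ)) → IsIso θ) := by
  obtain ⟨ψ, hψ, hrel⟩ := exists_isEtaleFamily (flatOf hF) (flatOf hF) two_pos frobHom_param
    (frobHom Δ).hom.continuous φ hT hres
  obtain ⟨η, hη⟩ := hψ.exists_adjStalk (frobHom Δ)
  obtain rfl : adjStalk (frobHom Δ) η = ψ := funext hη
  obtain ⟨θ, rfl⟩ := ((TopCat.Sheaf.pullbackPushforwardAdjunction (ModuleCat.{0} ℂ)
    (frobHom Δ)).homEquiv F F).surjective η
  refine ⟨θ, fun σ => ?_, fun hφ => isIso_of_stalkMap_bijective θ fun y => ?_⟩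
  · rw [stalkTheta_eq]
    exact congrFun ((flatRel_frobStalk (flatOf_val hF) (flatOf_val hF) _).unique frobHom_param
      hrel) σ
  · have h1 := hrel.bijective frobHom_param hφ y
    -- The adjoint of `θ` and `θ` itself differ on stalks by the isomorphism with the stalk of the
    -- inverse image, so bijectivity passes from one to the other.
    have h2 : stalkMap θ y ∘ (pullStalkEquiv (frobHom Δ) F y) = adjStalk (frobHom Δ)
        (adjTheta θ) y := funext fun a => (adjStalk_homEquiv (frobHom Δ) θ y a).symm
    rw [← h2] at h1
    exact (Function.Bijective.of_comp_iff _ (pullStalkEquiv (frobHom Δ) F y).bijective).1 h1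

end FrobStalk

end ToricLC

end

noncomputable section

namespace ToricLC

/-! ### Gradings and semisimple operators -/

section Scaling

variable {M : Type*} [AddCommGroup M] [Module ℂ M]

theorem sqrtTwoPow_ne_zero (n : ℤ) : sqrtTwoPow n ≠ 0 := zpow_ne_zero _ (by simp)

theorem sqrtTwoPow_two : sqrtTwoPow 2 = 2 := by
  rw [sqrtTwoPow, zpow_ofNat, ← Complex.ofReal_pow, Real.sq_sqrt zero_le_two]
  norm_num

theorem sqrtTwoPow_injective : Function.Injective sqrtTwoPow := by
  have h : Function.Injective fun n : ℤ => Real.sqrt 2 ^ n :=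
    zpow_right_injective₀ (by positivity) (fun h => by
      have := Real.sq_sqrt (zero_le_two (α := ℝ))
      rw [h] at this
      norm_num at this)
  intro m n hmn
  refine h ?_
  have h1 : ((Real.sqrt 2 ^ m : ℝ) : ℂ) = ((Real.sqrt 2 ^ n : ℝ) : ℂ) := by
    rw [Complex.ofReal_zpow, Complex.ofReal_zpow]
    exact hmn
  exact_mod_cast h1

/-- Multiplication by `c k` on the component of degree `k`. -/
theorem exists_scaling {A : ℤ → Submodule ℂ M} (hA : DirectSum.IsInternal A) (c : ℤ → ℂ) :
    ∃ f : Module.End ℂ M, ∀ k, ∀ m ∈ A k, f m = c k • m := by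
  classical
  let e := LinearEquiv.ofBijective (DirectSum.coeLinearMap A) hA
  refine ⟨DirectSum.toModule ℂ ℤ M (fun k => c k • (A k).subtype) ∘ₗ e.symm.toLinearMap,
    fun k m hm => ?_⟩
  have he : e.symm m = DirectSum.lof ℂ ℤ (fun i => A i) k ⟨m, hm⟩ := by
    rw [LinearEquiv.symm_apply_eq]
    exact (DirectSum.coeLinearMap_lof A k ⟨m, hm⟩).symm
  rw [LinearMap.comp_apply, LinearEquiv.coe_coe, he, DirectSum.toModule_lof]
  rfl

theorem linearMap_ext_of_isInternal {M' : Type*} [AddCommGroup M'] [Module ℂ M']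
    {A : ℤ → Submodule ℂ M} (hA : DirectSum.IsInternal A) {f g : M →ₗ[ℂ] M'}
    (h : ∀ k, ∀ m ∈ A k, f m = g m) : f = g := by
  have h1 : (⊤ : Submodule ℂ M) ≤ LinearMap.eqLocus f g := by
    rw [← ((DirectSum.isInternal_submodule_iff_iSupIndep_and_iSup_eq_top _).1 hA).2]
    exact iSup_le fun k m hm => h k m hm
  exact LinearMap.ext fun m => h1 trivial

theorem exists_bijective_scaling {A : ℤ → Submodule ℂ M} (hA : DirectSum.IsInternal A) :
    ∃ f : Module.End ℂ M, (∀ k, ∀ m ∈ A k, f m = sqrtTwoPow (-k) • m) ∧ Function.Bijective f := by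
  obtain ⟨f, hf⟩ := exists_scaling hA fun k => sqrtTwoPow (-k)
  obtain ⟨g, hg⟩ := exists_scaling hA fun k => sqrtTwoPow k
  have h1 : f ∘ₗ g = LinearMap.id := linearMap_ext_of_isInternal hA fun k m hm => by
    rw [LinearMap.comp_apply, hg k m hm, map_smul, hf k m hm, smul_smul, ← sqrtTwoPow_add,
      add_neg_cancel, sqrtTwoPow_zero, one_smul, LinearMap.id_apply]
  have h2 : g ∘ₗ f = LinearMap.id := linearMap_ext_of_isInternal hA fun k m hm => by
    rw [LinearMap.comp_apply, hf k m hm, map_smul, hg k m hm, smul_smul, ← sqrtTwoPow_add,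
      neg_add_cancel, sqrtTwoPow_zero, one_smul, LinearMap.id_apply]
  exact ⟨f, hf, Function.bijective_iff_has_inverse.2 ⟨g, LinearMap.congr_fun h2,
    LinearMap.congr_fun h1⟩⟩

/-- The grading by the eigenspaces of a semisimple operator. -/
theorem isInternal_eigenspace (f : Module.End ℂ M) (hf : ⨆ n : ℤ, f.eigenspace (sqrtTwoPow n) = ⊤) :
    DirectSum.IsInternal fun k : ℤ => f.eigenspace (sqrtTwoPow (-k)) := by
  refine (DirectSum.isInternal_submodule_iff_iSupIndep_and_iSup_eq_top _).2 ⟨?_, ?_⟩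
  · exact f.eigenspaces_iSupIndep.comp (sqrtTwoPow_injective.comp neg_injective)
  · rw [← hf]
    exact (Equiv.neg ℤ).iSup_comp (g := fun n => f.eigenspace (sqrtTwoPow n))

end Scaling

/-! ### The grading of the co-module of an `F`-sheaf -/

section GradedFunctor

variable {N : Type} [AddCommGroup N]

theorem TRing.smul_mem_of_sym {σ : PointedCone ℝ (ℝ ⊗[ℤ] N)} {V : Type*} [AddCommGroup V]
    [Module ℂ V] [Module (TRing σ) V] [IsScalarTower ℂ (TRing σ) V] (A : ℤ → Submodule ℂ V)
    (h : ∀ n k, ∀ m ∈ A k, TRing.of σ n • m ∈ A (k + 2)) (d : ℕ) (k : ℤ) (a : TRing σ) (m : V)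
    (ha : a ∈ TRing.sym σ d) (hm : m ∈ A k) : a • m ∈ A (k + 2 * d) := by
  have h1 : ∀ (x : ℂ ⊗[ℤ] QuotLattice σ) (k : ℤ), ∀ m ∈ A k,
      SymmetricAlgebra.ι ℂ _ x • m ∈ A (k + 2) := fun x k m hm => by
    refine Submodule.span_induction (p := fun y _ => y • m ∈ A (k + 2)) ?_ ?_ ?_ ?_
      (TRing.ι_mem_span x)
    · rintro y ⟨n, rfl⟩
      exact h n k m hm
    · rw [zero_smul]
      exact zero_mem _
    · intro y z _ _ hy hz
      rw [add_smul]
      exact add_mem hy hz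
    · intro c y _ hy
      rw [smul_assoc]
      exact Submodule.smul_mem _ c hy
  induction d generalizing a with
  | zero =>
    rw [TRing.sym, pow_zero] at ha
    obtain ⟨c, rfl⟩ := Submodule.mem_one.1 ha
    rw [algebraMap_smul]
    simpa using Submodule.smul_mem _ c hm
  | succ d ih =>
    rw [TRing.sym, pow_succ'] at ha
    induction ha using Submodule.mul_induction_on' with
    | mem_mul_mem x hx y hy =>
      obtain ⟨x, rfl⟩ := hx
      rw [mul_smul]
      have := h1 x _ _ (ih y hy)
      rwa [show k + 2 * (d : ℤ) + 2 = k + 2 * ((d + 1 : ℕ) : ℤ) by push_cast; ring] at this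
    | add x _ y _ hx hy => rw [add_smul]; exact add_mem hx hy

variable {Δ : Fan N}

/-- The grading of a co-module by the eigenspaces of compatible operators. -/
def CoTMod.gradedOf (P : CoTMod Δ) (φ : ∀ σ, Module.End ℂ (P.obj σ))
    (hφ : ∀ σ, ⨆ n : ℤ, (φ σ).eigenspace (sqrtTwoPow n) = ⊤)
    (hof : ∀ σ n m, (2 : ℂ) • φ σ (TRing.of σ.1 n • m) = TRing.of σ.1 n • φ σ m)
    (hmap : ∀ {τ σ : Δ.Cone} (h : τ ≤ σ) (m : P.obj σ), φ τ (P.map h m) = P.map h (φ σ m)) :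
    GrCoTMod Δ where
  toCoTMod := P
  gr σ k := (φ σ).eigenspace (sqrtTwoPow (-k))
  isInternal σ := isInternal_eigenspace (φ σ) (hφ σ)
  smul_mem σ := TRing.smul_mem_of_sym _ fun n k m hm => by
    rw [Module.End.mem_eigenspace_iff] at hm ⊢
    have h := hof σ n m
    rw [hm, smul_comm, show -k = 2 + -(k + 2) by ring, sqrtTwoPow_add, sqrtTwoPow_two,
      mul_smul] at h
    exact smul_right_injective _ two_ne_zero h
  map_mem {τ σ} h k m hm := by
    rw [Module.End.mem_eigenspace_iff] at hm ⊢
    rw [hmap h m, hm, _root_.map_smul]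

/-- The operators which act by `2 ^ (-k / 2)` in degree `k`. -/
theorem GrCoTMod.exists_scaling (P : GrCoTMod Δ) :
    ∃ φ : ∀ σ, Module.End ℂ (P.toCoTMod.obj σ), (∀ σ, Function.Bijective (φ σ)) ∧
      (∀ σ k, ∀ m ∈ P.gr σ k, φ σ m = sqrtTwoPow (-k) • m) ∧
      (∀ σ, ⨆ n : ℤ, (φ σ).eigenspace (sqrtTwoPow n) = ⊤) ∧
      (∀ σ n m, (2 : ℂ) • φ σ (TRing.of σ.1 n • m) = TRing.of σ.1 n • φ σ m) ∧
      ∀ {τ σ : Δ.Cone} (h : τ ≤ σ) (m : P.toCoTMod.obj σ),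
        φ τ (P.toCoTMod.map h m) = P.toCoTMod.map h (φ σ m) := by
  choose φ hφ hb using fun σ => exists_bijective_scaling (P.isInternal σ)
  refine ⟨φ, hb, hφ, fun σ => ?_, fun σ n m => ?_, fun {τ σ} h m => ?_⟩
  · rw [← top_le_iff,
      ← ((DirectSum.isInternal_submodule_iff_iSupIndep_and_iSup_eq_top _).1 (P.isInternal σ)).2]
    exact iSup_le fun k => le_iSup_of_le (-k) fun m hm =>
      Module.End.mem_eigenspace_iff.2 (hφ σ k m hm)
  · have h := linearMap_ext_of_isInternal (P.isInternal σ)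
      (f := (2 : ℂ) • (φ σ ∘ₗ Algebra.lsmul ℂ ℂ (P.toCoTMod.obj σ) (TRing.of σ.1 n)))
      (g := (Algebra.lsmul ℂ ℂ (P.toCoTMod.obj σ) (TRing.of σ.1 n)) ∘ₗ φ σ) fun k m hm => by
        have h1 := P.smul_mem σ 1 k (TRing.of σ.1 n) m
          (by rw [TRing.sym, pow_one]; exact ⟨_, rfl⟩) hm
        simp only [LinearMap.smul_apply, LinearMap.comp_apply, Algebra.lsmul_coe, hφ σ k m hm,
          hφ σ _ _ h1]
        rw [smul_comm (TRing.of σ.1 n), smul_smul, ← sqrtTwoPow_two, ← sqrtTwoPow_add]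
        congr 2
        push_cast
        ring
    exact LinearMap.congr_fun h m
  · have h := linearMap_ext_of_isInternal (P.isInternal σ)
      (f := φ τ ∘ₗ P.toCoTMod.map h) (g := P.toCoTMod.map h ∘ₗ φ σ) fun k m hm => by
        rw [LinearMap.comp_apply, LinearMap.comp_apply, hφ σ k m hm, hφ τ k _ (P.map_mem h k m hm),
          map_smul]
    exact LinearMap.congr_fun h m

variable [Module.Free ℤ N] [Module.Finite ℤ N]

/-- The logarithm of `T_n²` is twice that of `T_n`. It follows that lattice vectors raise the degree
by `2` in the grading by eigenspaces of `θ_σ`. -/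
theorem stalkTheta_logAction {F : Sh (X Δ)} (hF : isLCu Δ F) (θ : (frobPullback Δ).obj F ⟶ F)
    (σ : Δ.Cone) (n : N) (a : ptStalk F σ) :
    (2 : ℂ) • stalkTheta θ σ ((flatOf hF.1).logAction (flatOf_isUnipotent hF) σ n a) =
      (flatOf hF.1).logAction (flatOf_isUnipotent hF) σ n (stalkTheta θ σ a) := by
  have h := (flatOf hF.1).map_logAction (flatOf_isUnipotent hF) (flatOf hF.1)
    (flatOf_isUnipotent hF) (2 • n) n (stalkTheta θ σ) (stalkTheta_monodromy hF.1 θ σ n) a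
  rw [map_nsmul, LinearMap.smul_apply, map_nsmul] at h
  rw [← h, ofNat_smul_eq_nsmul]

/-- The sheaf underlying an `F`-sheaf. -/
abbrev LCF.toLCu (A : LCF Δ) : LCu Δ := ⟨A.obj.a, A.property.1.1⟩

/-- The graded co-module of an `F`-sheaf. -/
def gradedLog (A : LCF Δ) : GrCoTMod Δ :=
  CoTMod.gradedOf ((logFunctor Δ).obj A.toLCu) (fun σ => stalkTheta A.obj.str σ) A.property.2.2
    (fun σ n m => ((congrArg (fun x => (2 : ℂ) • stalkTheta A.obj.str σ x)
      (logFunctor_smul A.toLCu σ n m)).trans (stalkTheta_logAction A.property.1.1 A.obj.str σ n m)).trans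
        (logFunctor_smul A.toLCu σ n (stalkTheta A.obj.str σ m)).symm)
    (fun h m => stalkTheta_res A.property.1.1.1 A.obj.str h m)

end GradedFunctor

end ToricLC

end

noncomputable section

namespace ToricLC

/-! ### The equivalence for `F`-sheaves -/

section GradedLog

variable {N : Type} [AddCommGroup N] {Δ : Fan N}

/-- Transport of a grading along an isomorphism of co-modules. -/
theorem GrCoTMod.exists_of_iso (P : GrCoTMod Δ) {K : CoTMod Δ} (e : K ≅ P.toCoTMod) :
    ∃ h : ∀ σ, DirectSum.IsInternal fun j =>
      (P.gr σ j).comap ((CoTMod.Hom.app e.hom σ).restrictScalars ℂ),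
        Nonempty (P.comap e.hom h ≅ P) := by
  have h1 : ∀ σ m, CoTMod.Hom.app e.inv σ (CoTMod.Hom.app e.hom σ m) = m := fun σ m =>
    LinearMap.congr_fun (congrArg (fun φ => CoTMod.Hom.app φ σ) e.hom_inv_id) m
  have h2 : ∀ σ m, CoTMod.Hom.app e.hom σ (CoTMod.Hom.app e.inv σ m) = m := fun σ m =>
    LinearMap.congr_fun (congrArg (fun φ => CoTMod.Hom.app φ σ) e.inv_hom_id) m
  have h : ∀ σ, DirectSum.IsInternal fun j =>
      (P.gr σ j).comap ((CoTMod.Hom.app e.hom σ).restrictScalars ℂ) := fun σ => by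
    obtain ⟨p, hp⟩ := exists_isGradingProj (P.isInternal σ)
    exact hp.isInternal_comap _ (Function.LeftInverse.injective (h1 σ)) fun j y => ⟨_, h2 σ _⟩
  refine ⟨h, ⟨{
    hom := GrCoTMod.Hom.mk (P := P.comap e.hom h) (Q := P) e.hom fun _ _ _ hm => hm
    inv := GrCoTMod.Hom.mk (P := P) (Q := P.comap e.hom h) e.inv fun σ k m hm => ?_
    hom_inv_id := GrCoTMod.Hom.ext e.hom_inv_id
    inv_hom_id := GrCoTMod.Hom.ext e.inv_hom_id }⟩⟩
  change CoTMod.Hom.app e.hom σ (CoTMod.Hom.app e.inv σ m) ∈ P.gr σ k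
  rwa [h2]

variable [Module.Free ℤ N] [Module.Finite ℤ N]

theorem mem_gradedLog (A : LCF Δ) (σ : Δ.Cone) (k : ℤ) (m : ptStalk A.obj.a σ) :
    m ∈ (gradedLog A).gr σ k ↔ stalkTheta A.obj.str σ m = sqrtTwoPow (-k) • m :=
  Module.End.mem_eigenspace_iff (f := stalkTheta A.obj.str σ)

theorem LCF.stalkMap_stalkTheta {A B : LCF Δ} (f : A ⟶ B) (σ : Δ.Cone) (a : ptStalk A.obj.a σ) :
    stalkMap f.hom.f (pt σ : X Δ) (stalkTheta A.obj.str σ a) =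
      stalkTheta B.obj.str σ (stalkMap f.hom.f (pt σ : X Δ) a) :=
  (comm_theta_iff A.property.1.1.1 B.property.1.1.1 A.obj.str B.obj.str f.hom.f).1 f.hom.h σ a

/-- The morphism of graded co-modules induced by a morphism of `F`-sheaves. -/
def gradedLogMap {A B : LCF Δ} (f : A ⟶ B) : gradedLog A ⟶ gradedLog B :=
  GrCoTMod.Hom.mk (P := gradedLog A) (Q := gradedLog B)
    ((logFunctor Δ).map (X := A.toLCu) (Y := B.toLCu) ⟨f.hom.f⟩) fun σ k m hm =>
      (mem_gradedLog B σ k _).2 ((LCF.stalkMap_stalkTheta f σ m).symm.trans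
        ((congrArg (stalkMap f.hom.f (pt σ : X Δ)) ((mem_gradedLog A σ k m).1 hm)).trans
          (map_smul (stalkMap f.hom.f (pt σ : X Δ)) (sqrtTwoPow (-k)) _)))

variable (Δ) in
/-- The functor forgetting `θ`. -/
abbrev LCFToLCu : LCF Δ ⥤ LCu Δ := LCFToLCcf Δ ⋙ LCcfToLCu Δ

variable (Δ) in
/-- The functor which sends an `F`-sheaf to its graded co-module. -/
def gradedLogFunctor : LCF Δ ⥤ GrCoTModCf Δ :=
  (isGrCofinite Δ).lift
    { obj := gradedLog
      map := gradedLogMap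
      map_id := fun A => GrCoTMod.Hom.ext ((LCFToLCu Δ ⋙ logFunctor Δ).map_id A)
      map_comp := fun f g => GrCoTMod.Hom.ext ((LCFToLCu Δ ⋙ logFunctor Δ).map_comp f g) }
    fun A => (isLCcf_iff A.toLCu).1 A.property.1

instance : (gradedLogFunctor Δ).Faithful where
  map_injective {A B f g} h := by
    have h1 : (logFunctor Δ).map (X := A.toLCu) (Y := B.toLCu) ⟨f.hom.f⟩ =
        (logFunctor Δ).map (X := A.toLCu) (Y := B.toLCu) ⟨g.hom.f⟩ :=
      congrArg (fun φ => GrCoTMod.Hom.hom φ.hom) h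
    apply ObjectProperty.hom_ext
    apply Endofunctor.Algebra.ext
    exact congrArg (fun φ : A.toLCu ⟶ B.toLCu => φ.hom) ((logFunctor Δ).map_injective h1)

/-- In each degree `θ` is a scalar, the same for source and target, so a map preserving degrees
commutes with it. -/
instance : (gradedLogFunctor Δ).Full where
  map_surjective {A B} g := by
    obtain ⟨f, hf⟩ := (logFunctor Δ).map_surjective (X := A.toLCu) (Y := B.toLCu)
      (GrCoTMod.Hom.hom g.hom)
    have hcomm := (comm_theta_iff A.property.1.1.1 B.property.1.1.1 A.obj.str B.obj.str f.hom).2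
      fun σ a => by
        have h := linearMap_ext_of_isInternal
          (isInternal_eigenspace (stalkTheta A.obj.str σ) (A.property.2.2 σ))
          (f := stalkMap f.hom (pt σ : X Δ) ∘ₗ stalkTheta A.obj.str σ)
          (g := stalkTheta B.obj.str σ ∘ₗ stalkMap f.hom (pt σ : X Δ)) fun k m hm => by
            have h1 := GrCoTMod.Hom.mem g.hom σ k m hm
            rw [← hf] at h1
            have h2 := (mem_gradedLog B σ k _).1 h1
            rw [LinearMap.comp_apply, LinearMap.comp_apply, Module.End.mem_eigenspace_iff.1 hm,
              map_smul]
            exact h2.symm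
        exact LinearMap.congr_fun h a
    exact ⟨⟨Endofunctor.Algebra.Hom.mk f.hom hcomm⟩,
      ObjectProperty.hom_ext _ (GrCoTMod.Hom.ext hf)⟩

/-- The operator `2^(-k/2)` in degree `k` has the commutation relations of `θ` and is realized by
`exists_theta`; its eigenspaces contain the given graded pieces, and a bijection of degree zero
between graded co-modules is an isomorphism. The underlying co-module is required to be equal, so
that the operators act on the stalks of `F` themselves. -/
theorem exists_gradedLog_iso (F : LCu Δ) (hF : isLCcf Δ F.obj) (P : GrCoTMod Δ)
    (hP : P.toCoTMod = (logFunctor Δ).obj F) : ∃ A : LCF Δ, Nonempty (gradedLog A ≅ P) := by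
  obtain ⟨K, gr, hInt, hsm, hmap⟩ := P
  obtain rfl : K = (logFunctor Δ).obj F := hP
  let P : GrCoTMod Δ := ⟨(logFunctor Δ).obj F, gr, hInt, hsm, hmap⟩
  obtain ⟨φ, hb, hφ, htop, hof, hres⟩ := P.exists_scaling
  obtain ⟨θ, hθ, hiso⟩ := exists_theta F.property.1 (fun σ => φ σ) (fun σ n a => by
    -- The relation `2 φ L_n = L_n φ`, which says that `n` has degree `2`, exponentiates to the
    -- relation with the doubled loop.
    refine (flatOf F.property.1).map_monodromy_of_logAction (flatOf_isUnipotent F.property)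
      (flatOf F.property.1) (flatOf_isUnipotent F.property) (2 • n) n (φ σ) (fun b => ?_) a
    refine Eq.trans ?_ (((hof σ n b).trans (logFunctor_smul F σ n (φ σ b))))
    have h1 : (flatOf F.property.1).logAction (flatOf_isUnipotent F.property) σ (2 • n) b =
        (2 : ℂ) • (flatOf F.property.1).logAction (flatOf_isUnipotent F.property) σ n b := by
      rw [map_nsmul, LinearMap.smul_apply]
      exact (ofNat_smul_eq_nsmul ℂ 2 _).symm
    exact (congrArg (φ σ) (h1.trans (congrArg ((2 : ℂ) • ·) (logFunctor_smul F σ n b).symm))).trans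
      (map_smul (φ σ) _ _)) (fun h a => hres h a)
  let A : LCF Δ := ⟨⟨F.obj, θ⟩, hF, hiso hb, fun σ => by rw [hθ]; exact htop σ⟩
  have hgr : ∀ σ k, ∀ m ∈ gr σ k, m ∈ (gradedLog A).gr σ k := fun σ k m hm =>
    (mem_gradedLog A σ k m).2 ((LinearMap.congr_fun (hθ σ) m).trans (hφ σ k m hm))
  let f : P ⟶ gradedLog A := GrCoTMod.Hom.mk (P := P) (Q := gradedLog A) (𝟙 _) hgr
  have : IsIso f := (isConcretelyAbelian_grCoTMod Δ).isIso f fun σ => Function.bijective_id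
  exact ⟨A, ⟨(asIso f).symm⟩⟩

instance : (gradedLogFunctor Δ).EssSurj where
  mem_essImage P := by
    obtain ⟨F, ⟨e⟩⟩ := exists_logFunctor_iso P.obj.toCoTMod P.property.1
    -- The grading is moved to the co-module of an actual sheaf, which gives the equality needed by
    -- `exists_gradedLog_iso`.
    obtain ⟨h, ⟨e'⟩⟩ := P.obj.exists_of_iso e
    have hF : isLCcf Δ F.obj := (isLCcf_iff F).2 (isCofinite_of_iso Δ e.symm P.property)
    obtain ⟨A, ⟨e''⟩⟩ := exists_gradedLog_iso F hF (P.obj.comap e.hom h) rfl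
    exact ⟨A, ⟨(isGrCofinite Δ).isoMk (e'' ≪≫ e')⟩⟩

instance : (gradedLogFunctor Δ).IsEquivalence where

/-- The twist corresponds to the shift of the grading. -/
theorem twist_gradedLogFunctor (n : ℤ) :
    Nonempty (twist Δ n ⋙ gradedLogFunctor Δ ≅ gradedLogFunctor Δ ⋙ grShift Δ n) := by
  have key : ∀ (A : LCF Δ) (σ : Δ.Cone) (k : ℤ) (m : ptStalk A.obj.a σ),
      m ∈ (gradedLog ((twist Δ n).obj A)).gr σ k ↔ m ∈ (gradedLog A).gr σ (k + n) :=
    fun A σ k m => by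
    refine (mem_gradedLog ((twist Δ n).obj A) σ k m).trans
      (Iff.trans ?_ (mem_gradedLog A σ (k + n) m).symm)
    have h1 : stalkTheta ((twist Δ n).obj A).obj.str σ m =
        sqrtTwoPow n • stalkTheta A.obj.str σ m :=
      LinearMap.congr_fun (stalkTheta_scale (sqrtTwoPow n) A.obj.str σ) m
    have h2 : sqrtTwoPow (-k) • m = sqrtTwoPow n • (sqrtTwoPow (-(k + n)) • m) := by
      rw [smul_smul, ← sqrtTwoPow_add]
      congr 2
      ring
    constructor
    · intro h
      exact smul_right_injective _ (sqrtTwoPow_ne_zero n) (h1.symm.trans (h.trans h2))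
    · intro h
      exact h1.trans ((congrArg (sqrtTwoPow n • ·) h).trans h2.symm)
  refine ⟨NatIso.ofComponents (fun A => (isGrCofinite Δ).isoMk
    { hom := GrCoTMod.Hom.mk (P := gradedLog ((twist Δ n).obj A))
        (Q := GrCoTMod.shiftObj n (gradedLog A)) (𝟙 ((logFunctor Δ).obj A.toLCu))
        fun σ k m hm => (key A σ k m).1 hm
      inv := GrCoTMod.Hom.mk (Q := gradedLog ((twist Δ n).obj A))
        (P := GrCoTMod.shiftObj n (gradedLog A)) (𝟙 ((logFunctor Δ).obj A.toLCu))
        fun σ k m hm => (key A σ k m).2 hm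
      hom_inv_id := rfl
      inv_hom_id := rfl }) ?_⟩
  intro A B f
  apply ObjectProperty.hom_ext
  rfl

variable (Δ)

theorem isAbelianCat_LCF : IsAbelianCat (LCF Δ) :=
  (isConcretelyAbelian_grCoTModCf Δ).isAbelianCat.of_isEquivalence (gradedLogFunctor Δ)

/-- An equivalence preserves binary products, and between abelian categories this implies
additivity. -/
theorem additive_gradedLogFunctor : (gradedLogFunctor Δ).Additive := by
  let := (isAbelianCat_LCF Δ).abelian
  let := (isConcretelyAbelian_grCoTModCf Δ).isAbelianCat.abelian
  exact Functor.additive_of_preserves_binary_products _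

theorem isExactFunctor_LCF : IsExactFunctor (LCFToSh Δ) :=
  isExactFunctor_to_sheaf Δ (LCFToLCu Δ) fun σ =>
    (IsExactFunctor.of_isEquivalence (gradedLogFunctor Δ)).comp
      ((isConcretelyAbelian_grCoTModCf Δ).isExactFunctor σ)

theorem isExactFunctor_coTModN : IsExactFunctor (isSupportedAtOrigin Δ).ι :=
  isExactFunctor_to_coTMod Δ _ fun σ => (isConcretelyAbelian_coTModN Δ).isExactFunctor σ

theorem isExactFunctor_coTModCf : IsExactFunctor (isCofinite Δ).ι :=
  isExactFunctor_to_coTMod Δ _ fun σ => (isConcretelyAbelian_coTModCf Δ).isExactFunctor σ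

theorem isExactFunctor_grCoTModCf : IsExactFunctor (GrCoTModCfToCoTMod Δ) :=
  isExactFunctor_to_coTMod Δ _ fun σ => (isConcretelyAbelian_grCoTModCf Δ).isExactFunctor σ

/-- `gradedLogFunctor` takes logarithms of monodromy and eigenspaces of `θ`. -/
theorem exists_logMonodromy_gradedLogFunctor :
    ∃ L : LogMonodromy (LCFToSh Δ) (gradedLogFunctor Δ ⋙ GrCoTModCfToCoTMod Δ),
      ∀ (A : LCF Δ) (σ : Δ.Cone) (k : ℤ) (m : ((gradedLogFunctor Δ).obj A).obj.toCoTMod.obj σ),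
        m ∈ ((gradedLogFunctor Δ).obj A).obj.gr σ k ↔
          stalkTheta A.obj.str σ (L.iso A σ m) = sqrtTwoPow (-k) • L.iso A σ m :=
  ⟨logMonodromy Δ (LCFToLCu Δ), fun A σ k m => mem_gradedLog A σ k m⟩

end GradedLog

end ToricLC

end

noncomputable section

namespace ToricLC

/-! ### Functors induced on bounded derived categories -/

section BoundedMap

universe w₃

variable {A : Type*} [Category* A] [Abelian A] [HasDerivedCategory.{w₁} A]
  {B : Type*} [Category* B] [Abelian B] [HasDerivedCategory.{w₂} B]
  {C : Type*} [Category* C] [Abelian C] [HasDerivedCategory.{w₃} C]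

/-- Isomorphic functors induce isomorphic functors on derived categories. -/
def mapDerivedCategoryIso {F G : A ⥤ B} [F.Additive] [PreservesFiniteLimits F]
    [PreservesFiniteColimits F] [G.Additive] [PreservesFiniteLimits G] [PreservesFiniteColimits G]
    (e : F ≅ G) : F.mapDerivedCategory ≅ G.mapDerivedCategory :=
  Localization.liftNatIso DerivedCategory.Q
    (HomologicalComplex.quasiIso A (ComplexShape.up ℤ))
    (F.mapHomologicalComplex _ ⋙ DerivedCategory.Q) (G.mapHomologicalComplex _ ⋙ DerivedCategory.Q)
    _ _ (Functor.isoWhiskerRight (NatIso.mapHomologicalComplex e _) _)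

/-- The functor induced by the identity. -/
def mapDerivedCategoryId : (𝟭 A).mapDerivedCategory ≅ 𝟭 (DerivedCategory A) :=
  Localization.liftNatIso DerivedCategory.Q
    (HomologicalComplex.quasiIso A (ComplexShape.up ℤ))
    ((𝟭 A).mapHomologicalComplex _ ⋙ DerivedCategory.Q) DerivedCategory.Q
    _ _ (Functor.isoWhiskerRight (Functor.mapHomologicalComplexIdIso A _) _)

/-- The functor induced by a composite of functors. -/
def mapDerivedCategoryComp (F : A ⥤ B) (G : B ⥤ C) [F.Additive] [PreservesFiniteLimits F]
    [PreservesFiniteColimits F] [G.Additive] [PreservesFiniteLimits G] [PreservesFiniteColimits G]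
    [PreservesFiniteLimits (F ⋙ G)] [PreservesFiniteColimits (F ⋙ G)] :
    F.mapDerivedCategory ⋙ G.mapDerivedCategory ≅ (F ⋙ G).mapDerivedCategory :=
  Localization.liftNatIso DerivedCategory.Q
    (HomologicalComplex.quasiIso A (ComplexShape.up ℤ))
    ((F.mapHomologicalComplex _ ⋙ DerivedCategory.Q) ⋙ G.mapDerivedCategory)
    ((F ⋙ G).mapHomologicalComplex _ ⋙ DerivedCategory.Q) _ _
    (Functor.isoWhiskerLeft (F.mapHomologicalComplex _) G.mapDerivedCategoryFactors ≪≫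
      Functor.isoWhiskerRight (Functor.mapHomologicalComplexCompIso (Iso.refl (F ⋙ G)) _) _)

/-- Isomorphic functors induce isomorphic functors on bounded derived categories. -/
def boundedMapIso {F G : A ⥤ B} [F.Additive] [PreservesFiniteLimits F]
    [PreservesFiniteColimits F] [G.Additive] [PreservesFiniteLimits G] [PreservesFiniteColimits G]
    (e : F ≅ G) : boundedMap F ≅ boundedMap G :=
  (ObjectProperty.fullyFaithfulι _).whiskeringRight _ |>.preimageIso
    (Functor.isoWhiskerLeft DerivedCategory.Bounded.ι (mapDerivedCategoryIso e))

/-- The functor induced by the identity. -/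
def boundedMapId : boundedMap (𝟭 A) ≅ 𝟭 (DerivedCategory.Bounded A) :=
  (ObjectProperty.fullyFaithfulι _).whiskeringRight _ |>.preimageIso
    (Functor.isoWhiskerLeft DerivedCategory.Bounded.ι mapDerivedCategoryId)

/-- The functor induced by a composite of functors. -/
def boundedMapComp (F : A ⥤ B) (G : B ⥤ C) [F.Additive] [PreservesFiniteLimits F]
    [PreservesFiniteColimits F] [G.Additive] [PreservesFiniteLimits G] [PreservesFiniteColimits G]
    [PreservesFiniteLimits (F ⋙ G)] [PreservesFiniteColimits (F ⋙ G)] :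
    boundedMap F ⋙ boundedMap G ≅ boundedMap (F ⋙ G) :=
  (ObjectProperty.fullyFaithfulι _).whiskeringRight _ |>.preimageIso
    (Functor.isoWhiskerLeft DerivedCategory.Bounded.ι (mapDerivedCategoryComp F G))

instance isTriangulated_boundedMap (F : A ⥤ B) [F.Additive] [PreservesFiniteLimits F]
    [PreservesFiniteColimits F] : (boundedMap F).IsTriangulated :=
  ObjectProperty.isTriangulated_lift _ (DerivedCategory.Bounded.ι ⋙ F.mapDerivedCategory)
    fun K => bounded_mapDerivedCategory F K.obj K.property

/-- `D^b` respects identities, composites and isomorphisms of exact functors, so a quasi-inverse of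
the functor induces a quasi-inverse. -/
theorem isEquivalence_boundedMap (e : A ≌ B) [e.functor.Additive] :
    (boundedMap e.functor).IsEquivalence :=
  (CategoryTheory.Equivalence.mk (boundedMap e.functor) (boundedMap e.inverse)
    (boundedMapId.symm ≪≫ boundedMapIso e.unitIso ≪≫
      (boundedMapComp e.functor e.inverse).symm)
    (boundedMapComp e.inverse e.functor ≪≫ boundedMapIso e.counitIso ≪≫
      boundedMapId)).isEquivalence_functor

end BoundedMap

end ToricLC

end
theorem mainTheorem9 {N : Type} [AddCommGroup N] [Module.Free ℤ N] [Module.Finite ℤ N]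
    (Δ : ToricLC.Fan N) :
    -- all the categories involved are abelian, with exact inclusion and forgetful functors
    (ToricLC.IsAbelianCat (ToricLC.LCu Δ) ∧
      ToricLC.IsExactFunctor (ToricLC.isLCu Δ).ι ∧
      ToricLC.IsAbelianCat (ToricLC.LCcf Δ) ∧
      ToricLC.IsExactFunctor (ToricLC.isLCcf Δ).ι ∧
      ToricLC.IsAbelianCat (ToricLC.CoTModN Δ) ∧
      ToricLC.IsExactFunctor (ToricLC.isSupportedAtOrigin Δ).ι ∧
      ToricLC.IsAbelianCat (ToricLC.CoTModCf Δ) ∧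
      ToricLC.IsExactFunctor (ToricLC.isCofinite Δ).ι ∧
      ToricLC.IsExactFunctor (ToricLC.LCFToSh Δ) ∧
      ToricLC.IsExactFunctor (ToricLC.GrCoTModCfToCoTMod Δ)) ∧
    ∃ (hF : ToricLC.IsAbelianCat (ToricLC.LCF Δ))
      (hT : ToricLC.IsAbelianCat (ToricLC.GrCoTModCf Δ))
      (Eu : ToricLC.LCu Δ ≌ ToricLC.CoTModN Δ)
      (Ecf : ToricLC.LCcf Δ ≌ ToricLC.CoTModCf Δ)
      (EF : ToricLC.LCF Δ ≌ ToricLC.GrCoTModCf Δ),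
      -- `Eu` and `Ecf` are given by logarithms of monodromy, and `Ecf` is the restriction of `Eu`
      Nonempty (ToricLC.LogMonodromy (ToricLC.isLCu Δ).ι
        (Eu.functor ⋙ (ToricLC.isSupportedAtOrigin Δ).ι)) ∧
      Nonempty (ToricLC.LogMonodromy (ToricLC.isLCcf Δ).ι
        (Ecf.functor ⋙ (ToricLC.isCofinite Δ).ι)) ∧
      Nonempty (ToricLC.LCcfToLCu Δ ⋙ Eu.functor ≅ Ecf.functor ⋙ ToricLC.CoTModCfToN Δ) ∧
      -- `EF` is given by logarithms of monodromy, graded by the eigenspaces of `θ`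
      (∃ L : ToricLC.LogMonodromy (ToricLC.LCFToSh Δ)
          (EF.functor ⋙ ToricLC.GrCoTModCfToCoTMod Δ),
        ∀ (A : ToricLC.LCF Δ) (σ : Δ.Cone) (k : ℤ)
          (m : (EF.functor.obj A).obj.toCoTMod.obj σ),
          m ∈ (EF.functor.obj A).obj.gr σ k ↔
            ToricLC.stalkTheta A.obj.str σ (L.iso A σ m) =
              ToricLC.sqrtTwoPow (-k) • L.iso A σ m) ∧
      -- compatibility with the forgetful functors
      Nonempty (ToricLC.LCFToLCcf Δ ⋙ Ecf.functor ≅ EF.functor ⋙ ToricLC.GrCoTModCfToCf Δ) ∧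
      -- the twist corresponds to the grading shift
      (∀ n : ℤ, Nonempty (ToricLC.twist Δ n ⋙ EF.functor ≅ EF.functor ⋙ ToricLC.grShift Δ n)) ∧
      -- `EF` induces a triangulated equivalence of bounded derived categories, under which
      -- the twist again corresponds to the grading shift
      letI := hF.abelian
      letI := hT.abelian
      ∃ _ : EF.functor.Additive,
        ∀ [HasDerivedCategory.{w₁} (ToricLC.LCF Δ)] [HasDerivedCategory.{w₂} (ToricLC.GrCoTModCf Δ)],
          (ToricLC.boundedMap EF.functor).IsEquivalence ∧
          (ToricLC.boundedMap EF.functor).IsTriangulated ∧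
          ∀ n : ℤ, Nonempty
            (ToricLC.boundedMap (ToricLC.twist Δ n) ⋙ ToricLC.boundedMap EF.functor ≅
              ToricLC.boundedMap EF.functor ⋙ ToricLC.boundedMap (ToricLC.grShift Δ n)) := by
  -- Identity isomorphisms give the compatibilities with restriction and forgetting, since all three
  -- equivalences have the values of `logFunctor` as underlying co-modules.
  refine ⟨⟨ToricLC.isAbelianCat_LCu Δ, ToricLC.isExactFunctor_LCu Δ, ToricLC.isAbelianCat_LCcf Δ,
    ToricLC.isExactFunctor_LCcf Δ, (ToricLC.isConcretelyAbelian_coTModN Δ).isAbelianCat,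
    ToricLC.isExactFunctor_coTModN Δ, (ToricLC.isConcretelyAbelian_coTModCf Δ).isAbelianCat,
    ToricLC.isExactFunctor_coTModCf Δ, ToricLC.isExactFunctor_LCF Δ,
    ToricLC.isExactFunctor_grCoTModCf Δ⟩, ToricLC.isAbelianCat_LCF Δ,
    (ToricLC.isConcretelyAbelian_grCoTModCf Δ).isAbelianCat, (ToricLC.logFunctorN Δ).asEquivalence,
    (ToricLC.logFunctorCf Δ).asEquivalence, (ToricLC.gradedLogFunctor Δ).asEquivalence,
    ⟨ToricLC.logMonodromy Δ (𝟭 _)⟩, ⟨ToricLC.logMonodromy Δ (ToricLC.LCcfToLCu Δ)⟩, ⟨Iso.refl _⟩,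
    ToricLC.exists_logMonodromy_gradedLogFunctor Δ, ⟨Iso.refl _⟩, ToricLC.twist_gradedLogFunctor, ?_⟩
  -- These structures extend the given preadditive ones, so the additivity of `twist` and `grShift`
  -- remains available; the derived categories are formed with them.
  let := (ToricLC.isAbelianCat_LCF Δ).abelian
  let := (ToricLC.isConcretelyAbelian_grCoTModCf Δ).isAbelianCat.abelian
  have := ToricLC.additive_gradedLogFunctor Δ
  have hadd : (ToricLC.gradedLogFunctor Δ).asEquivalence.functor.Additive := this
  refine ⟨hadd, ⟨ToricLC.isEquivalence_boundedMap _, inferInstance, fun n => ?_⟩⟩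
  obtain ⟨e⟩ := ToricLC.twist_gradedLogFunctor (Δ := Δ) n
  exact ⟨ToricLC.boundedMapComp (ToricLC.twist Δ n) (ToricLC.gradedLogFunctor Δ) ≪≫
    ToricLC.boundedMapIso e ≪≫
    (ToricLC.boundedMapComp (ToricLC.gradedLogFunctor Δ) (ToricLC.grShift Δ n)).symm⟩
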